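/- **Proposition 3.2 (Consistency of $\mathrm s_T$).** Let $k\ge 1$ be an integer, $\varrho>0$ and $0<\alpha\le\beta$. There is a real number $C>0$ depending only on $k$, $\varrho$, $\alpha$ and $\beta$ such that the following holds. Let $\Omega\subset\mathbb R^2$ be a bounded connected polygonal domain and $\mathbb A$ a symmetric fourth-order tensor field ($\mathbb A_{ijkl}=\mathbb A_{jikl}=\mathbb A_{klij}$), constant on each polygon of a finite polygonal partition $P_\Omega$ of $\Omega$, with $\alpha|M|^2\le \mathbb A M:M\le\beta|M|^2$ for all $M\in\mathbb R^{2\times2}_{\rm sym}$. Here a polygon is a bounded connected nonempty open set whose boundary is a finite union of nondegenerate segments and which lies locally on exactly one side of each straight portion of its boundary. Let $(\mathcal T_h,\mathcal F_h)$ be a polygonal mesh of $\Omega$: $\mathcal T_h$ is a finite set of disjoint polygons with $\overline\Omega=\bigcup_{T\in\mathcal T_h}\overline T$; $\mathcal F_h$ is a finite set of disjoint open segments of nonzero length in $\overline\Omega$ with $\bigcup_{T}\partial T=\bigcup_{F}\overline F$, each $F\in\mathcal F_h$ being contained in $\partial T_1\cap\partial T_2$ for two distinct $T_1,T_2\in\mathcal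 T_h$, or in $\partial T\cap\partial\Omega$ for some $T\in\mathcal T_h$. Assume that every $T\in\mathcal T_h$ is contained in a unique polygon of $P_\Omega$, and that there is a conforming triangulation $\mathfrak T_h$ of $\Omega$ such that every $T\in\mathcal T_h$ is decomposed into triangles of $\mathfrak T_h$, every $F\in\mathcal F_h$ is decomposed into edges of $\mathfrak T_h$, $\varrho h_S\le r_S$ for all $S\in\mathfrak T_h$ (with $h_S$ the diameter and $r_S$ the inradius of $S$), and $\varrho h_T\le h_S$ whenever $S\subset T\in\mathcal T_h$ (with $h_T$ the diameter of $T$). For $T\in\mathcal T_h$ let $\mathcal F_T$ be the set of faces contained in $\partial T$, $\bm n_{TF}$ the unit normal to $F$ pointing out of $T$, $\mathbb A_T=\mathbb A_{|T}$, and $\mathcal A_T^+$ the largest eigenvalue of $\mathbb A_T$ on $\mathbb R^{2\times2}_{\rm sym}$. For $X$ an element or a face, let $\mathbb P^l(X)$ be the space of restrictions to $X$ of bivariate polynomials of total degree at most $l$, $(\cdot,\cdot)_X$ the $L^2(X)$ product, and $\pi_X^l$ the $L^2$-orthogonal projector on $\mathbb P^l(X)$ (acting component-wise, and then written $\bm\pi_X^l$,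 on vectors). For $v\in H^2(T)$ let $$\underline{\mathrm I}_T^k v=\big(\pi_T^k v,(\bm\pi_F^k(\nabla v)_{|F})_{F\in\mathcal F_T},(\pi_F^k v_{|F})_{F\in\mathcal F_T}\big)\in\underline{\mathrm U}_T^k=\mathbb P^k(T)\times\prod_{F\in\mathcal F_T}\mathbb P^k(F)^2\times\prod_{F\in\mathcal F_T}\mathbb P^k(F),$$ the restrictions to $F$ being traces. For $\underline{\mathrm v}_T=(v_T,(\bm v_{\nabla,F})_F,(v_F)_F)\in\underline{\mathrm U}_T^k$ let $p_T^{k+2}\underline{\mathrm v}_T\in\mathbb P^{k+2}(T)$ be the polynomial with $\pi_T^1p_T^{k+2}\underline{\mathrm v}_T=\pi_T^1v_T$ and, for all $w\in\mathbb P^{k+2}(T)$, with $\bm M_w=-\mathbb A_T\nabla^2w$, $$(\mathbb A_T\nabla^2p_T^{k+2}\underline{\mathrm v}_T,\nabla^2w)_T=-(v_T,\operatorname{div}\mathbf{div}\,\bm M_w)_T-\sum_{F\in\mathcal F_T}(\bm v_{\nabla,F},\bm M_w\bm n_{TF})_F+\sum_{F\in\mathcal F_T}(v_F,\mathbf{div}\,\bm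 M_w\cdot\bm n_{TF})_F.$$ Finally let $$\begin{aligned}\mathrm s_T(\underline{\mathrm u}_T,\underline{\mathrm v}_T)=&\ \tfrac{\mathcal A_T^+}{h_T^4}\big(\pi_T^k(p_T^{k+2}\underline{\mathrm u}_T-u_T),\pi_T^k(p_T^{k+2}\underline{\mathrm v}_T-v_T)\big)_T\\&+\tfrac{\mathcal A_T^+}{h_T}\sum_{F\in\mathcal F_T}\big(\bm\pi_F^k(\nabla p_T^{k+2}\underline{\mathrm u}_T-\bm u_{\nabla,F}),\bm\pi_F^k(\nabla p_T^{k+2}\underline{\mathrm v}_T-\bm v_{\nabla,F})\big)_F\\&+\tfrac{\mathcal A_T^+}{h_T^3}\sum_{F\in\mathcal F_T}\big(\pi_F^k(p_T^{k+2}\underline{\mathrm u}_T-u_F),\pi_F^k(p_T^{k+2}\underline{\mathrm v}_T-v_F)\big)_F.\end{aligned}$$ Then, for all $T\in\mathcal T_h$ and all $v\in H^{k+3}(T)$, $$\mathrm s_T(\underline{\mathrm I}_T^kv,\underline{\mathrm I}_T^kv)^{1/2}\le C\,h_T^{k+1}\,|v|_{H^{k+3}(T)},\qquad |v|_{H^m(T)}=\sum_{|\bm\alpha|=m}\|\partial^{\bm\alpha}v\|_{L^2(T)}.$$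 -/

import Mathlib

open MeasureTheory Set
open scoped ContDiff

namespace HHO

noncomputable section

/-- The Euclidean plane. -/
abbrev Plane : Type := EuclideanSpace ℝ (Fin 2)

/-! ### Polygons and meshes -/

/-- `n` is the unit normal to the boundary of `T` at the boundary point `x`, pointing out of `T`:
near `x`, the set `T` is the open half-plane through `x` opposite to `n`. -/
def IsOutwardNormalAt (T : Set Plane) (x n : Plane) : Prop :=
  ‖n‖ = 1 ∧ ∃ ε > 0, ∀ y ∈ Metric.ball x ε, (y ∈ T ↔ inner ℝ n (y - x) < 0)

/-- The outward unit normal of `T` at `x` (arbitrary at points where there is none, such as the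
vertices of a polygon). On a straight face of a polygon it is constant. -/
def outwardNormal (T : Set Plane) (x : Plane) : Plane :=
  Classical.epsilon fun n => IsOutwardNormalAt T x n

/-- Open polygon: a bounded, connected, nonempty open set whose boundary is a finite union of
nondegenerate segments, and which lies locally on exactly one side of every straight portion of its
boundary (no cracks). Holes are allowed. -/
structure IsPolygon (T : Set Plane) : Prop where
  isOpen : IsOpen T
  isConnected : IsConnected T
  isBounded : Bornology.IsBounded T
  frontier_eq : ∃ E : Finset (Plane × Plane), (∀ e ∈ E, e.1 ≠ e.2) ∧
    frontier T = ⋃ e ∈ E, segment ℝ e.1 e.2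
  one_sided : ∀ a b : Plane, a ≠ b → openSegment ℝ a b ⊆ frontier T →
    ∃ n : Plane, ∀ x ∈ openSegment ℝ a b, IsOutwardNormalAt T x n

/-- A finite collection of disjoint polygons whose closures cover the closure of `Ω`. -/
structure IsPolygonalPartition (Ω : Set Plane) (P : Finset (Set Plane)) : Prop where
  isPolygon : ∀ T ∈ P, IsPolygon T
  disjoint : ∀ T₁ ∈ P, ∀ T₂ ∈ P, T₁ ≠ T₂ → Disjoint T₁ T₂
  closure_eq : closure Ω = ⋃ T ∈ P, closure T

/-- A polygonal mesh of `Ω`: a set of elements and a set of faces. -/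
structure PolyMesh (Ω : Set Plane) where
  /-- the mesh elements (open polygons) -/
  elems : Finset (Set Plane)
  /-- the mesh faces (open segments) -/
  faces : Finset (Set Plane)
  elems_partition : IsPolygonalPartition Ω elems
  faces_segment : ∀ F ∈ faces, ∃ a b : Plane, a ≠ b ∧ F = openSegment ℝ a b
  faces_subset : ∀ F ∈ faces, F ⊆ closure Ω
  faces_disjoint : ∀ F₁ ∈ faces, ∀ F₂ ∈ faces, F₁ ≠ F₂ → Disjoint F₁ F₂
  /-- each face is an interface or a boundary face -/
  faces_cases : ∀ F ∈ faces,
    (∃ T₁ ∈ elems, ∃ T₂ ∈ elems, T₁ ≠ T₂ ∧ F ⊆ frontier T₁ ∩ frontier T₂) ∨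
      (∃ T ∈ elems, F ⊆ frontier T ∩ frontier Ω)
  /-- the faces partition the mesh skeleton -/
  skeleton : ⋃ T ∈ elems, frontier T = ⋃ F ∈ faces, closure F

open Classical in
/-- The set `𝓕_T` of the faces that lie on the boundary of `T`. -/
def PolyMesh.facesOf {Ω : Set Plane} (𝓜 : PolyMesh Ω) (T : Set Plane) : Finset (Set Plane) :=
  𝓜.faces.filter fun F => F ⊆ frontier T

/-- Inradius of a bounded set of the plane: the largest radius of a disc contained in it. -/
def inradius (S : Set Plane) : ℝ :=
  sSup {r : ℝ | ∃ x : Plane, Metric.closedBall x r ⊆ S}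

/-- The closed triangles of a simplicial complex of the plane, given by their vertices. -/
def triangles (K : Geometry.SimplicialComplex ℝ Plane) : Set (Finset Plane) :=
  {s | s ∈ K.faces ∧ s.card = 3}

/-- The conforming triangulation `K` of `Ω` is a matching simplicial submesh of the mesh `𝓜`:
elements are decomposed into triangles of `K`, faces into edges of `K`. -/
structure IsMatchingSubmesh {Ω : Set Plane} (𝓜 : PolyMesh Ω)
    (K : Geometry.SimplicialComplex ℝ Plane) : Prop where
  finite : K.faces.Finite
  space_eq : K.space = closure Ω
  elems_decomposed : ∀ T ∈ 𝓜.elems, closure T =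
    ⋃ s ∈ {s | s ∈ triangles K ∧ interior (convexHull ℝ (s : Set Plane)) ⊆ T},
      convexHull ℝ (s : Set Plane)
  faces_decomposed : ∀ F ∈ 𝓜.faces, closure F =
    ⋃ e ∈ {e | e ∈ K.faces ∧ e.card = 2 ∧ convexHull ℝ (e : Set Plane) ⊆ closure F},
      convexHull ℝ (e : Set Plane)

/-- Regularity with parameter `ϱ`: every triangle `S` of the submesh satisfies `ϱ h_S ≤ r_S`, and
`ϱ h_T ≤ h_S` whenever `S` is contained in the mesh element `T`. -/
structure IsRegular {Ω : Set Plane} (𝓜 : PolyMesh Ω)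
    (K : Geometry.SimplicialComplex ℝ Plane) (ϱ : ℝ) : Prop where
  shape : ∀ s ∈ triangles K,
    ϱ * Metric.diam (convexHull ℝ (s : Set Plane)) ≤ inradius (convexHull ℝ (s : Set Plane))
  size : ∀ T ∈ 𝓜.elems, ∀ s ∈ triangles K, interior (convexHull ℝ (s : Set Plane)) ⊆ T →
    ϱ * Metric.diam T ≤ Metric.diam (convexHull ℝ (s : Set Plane))

/-! ### The material tensor -/

/-- Fourth-order tensors on the plane. -/
abbrev Tensor4 : Type := Fin 2 → Fin 2 → Fin 2 → Fin 2 → ℝ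

/-- Action of a fourth-order tensor on a second-order one. -/
def Tensor4.app (A : Tensor4) (M : Matrix (Fin 2) (Fin 2) ℝ) : Matrix (Fin 2) (Fin 2) ℝ :=
  Matrix.of fun i j => ∑ k, ∑ l, A i j k l * M k l

/-- The Frobenius product of second-order tensors. -/
def frob (M N : Matrix (Fin 2) (Fin 2) ℝ) : ℝ := ∑ i, ∑ j, M i j * N i j

/-- Symmetry of a fourth-order tensor: it induces a self-adjoint endomorphism of the space of
symmetric matrices. -/
def Tensor4.Symmetric (A : Tensor4) : Prop :=
  ∀ i j k l, A i j k l = A j i k l ∧ A i j k l = A k l i j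

/-- Ellipticity on symmetric matrices, with lower bound `α` and upper bound `β`. -/
def Tensor4.Elliptic (A : Tensor4) (α β : ℝ) : Prop :=
  ∀ M : Matrix (Fin 2) (Fin 2) ℝ, M.IsSymm →
    α * frob M M ≤ frob (A.app M) M ∧ frob (A.app M) M ≤ β * frob M M

/-- The largest eigenvalue `𝒜⁺` of `A` as an endomorphism of the symmetric matrices. -/
def Tensor4.maxEigenvalue (A : Tensor4) : ℝ :=
  sSup {μ : ℝ | ∃ M : Matrix (Fin 2) (Fin 2) ℝ, M.IsSymm ∧ M ≠ 0 ∧ A.app M = μ • M}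

/-- `𝔸` is a symmetric, uniformly elliptic (with bounds `α`, `β`) tensor field that is constant on
each set of the partition `P` of the domain. -/
def IsMaterialField (P : Finset (Set Plane)) (𝔸 : Plane → Tensor4) (α β : ℝ) : Prop :=
  ∀ D ∈ P, ∃ B : Tensor4, B.Symmetric ∧ B.Elliptic α β ∧ ∀ x ∈ D, 𝔸 x = B

/-- The mesh is compliant with the data: each element lies in a unique set of the partition. -/
def PolyMesh.Compliant {Ω : Set Plane} (𝓜 : PolyMesh Ω) (P : Finset (Set Plane)) : Prop :=
  ∀ T ∈ 𝓜.elems, ∃! D : Set Plane, D ∈ P ∧ T ⊆ D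

/-! ### Derivatives, Sobolev spaces, traces -/

/-- Classical partial derivative. -/
def pd (i : Fin 2) (f : Plane → ℝ) (x : Plane) : ℝ :=
  fderiv ℝ f x (EuclideanSpace.single i 1)

/-- Classical derivative of multi-index `a`. -/
def pdMulti (a : Fin 2 → ℕ) (f : Plane → ℝ) : Plane → ℝ :=
  (pd 0)^[a 0] ((pd 1)^[a 1] f)

/-- `g` is the derivative of `v` of multi-index `a` on the open set `T`, in the sense of
distributions. -/
def IsWeakDeriv (T : Set Plane) (a : Fin 2 → ℕ) (v g : Plane → ℝ) : Prop :=
  ∀ φ : Plane → ℝ, ContDiff ℝ ∞ φ → HasCompactSupport φ → tsupport φ ⊆ T →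
    ∫ x in T, v x * pdMulti a φ x = (-1) ^ (∑ i, a i) * ∫ x in T, g x * φ x

/-- `v ∈ H^m(T)`. -/
def MemSobolev (m : ℕ) (T : Set Plane) (v : Plane → ℝ) : Prop :=
  MemLp v 2 (volume.restrict T) ∧
    ∀ a : Fin 2 → ℕ, ∑ i, a i ≤ m →
      ∃ g : Plane → ℝ, MemLp g 2 (volume.restrict T) ∧ IsWeakDeriv T a v g

/-- The weak derivative in `L²(T)` (unique up to a null set of `T` when it exists). -/
def weakDeriv (T : Set Plane) (a : Fin 2 → ℕ) (v : Plane → ℝ) : Plane → ℝ :=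
  Classical.epsilon fun g => MemLp g 2 (volume.restrict T) ∧ IsWeakDeriv T a v g

/-- The components of the weak gradient. -/
def weakGrad (T : Set Plane) (v : Plane → ℝ) (i : Fin 2) : Plane → ℝ :=
  weakDeriv T (Pi.single i 1) v

/-- The seminorm `|v|_{H^m(T)}`: the sum of the `L²(T)`-norms of the derivatives of order `m`. -/
def sobolevSeminorm (m : ℕ) (T : Set Plane) (v : Plane → ℝ) : ℝ :=
  ∑ a ∈ Finset.piAntidiag (Finset.univ : Finset (Fin 2)) m,
    √(∫ x in T, weakDeriv T a v x ^ 2)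

/-- Arc length on the plane (one-dimensional Hausdorff measure). -/
def arcLength : Measure Plane := Measure.hausdorffMeasure 1

/-- `g ∈ L²(∂T)` is the boundary trace of `w ∈ H¹(T)`. On a polygon the trace is the unique element
of `L²(∂T)` for which Green's formula holds against all smooth functions. -/
def IsTrace (T : Set Plane) (w g : Plane → ℝ) : Prop :=
  MemLp g 2 (arcLength.restrict (frontier T)) ∧
    ∀ (i : Fin 2) (φ : Plane → ℝ), ContDiff ℝ ∞ φ → HasCompactSupport φ →
      ∫ x in T, (w x * pd i φ x + weakGrad T w i x * φ x) =
        ∫ x in frontier T, g x * φ x * outwardNormal T x i ∂arcLength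

/-- The trace on the boundary of `T` (unique up to a set of zero length). -/
def trace (T : Set Plane) (w : Plane → ℝ) : Plane → ℝ :=
  Classical.epsilon fun g => IsTrace T w g

/-! ### Polynomial spaces and projectors -/

/-- Polynomial functions of the plane of total degree at most `l`. For a polygon `T`, this is
`ℙ^l(T)`: such a function is determined by its restriction to a nonempty open set. -/
def polySpace (l : ℕ) : Submodule ℝ (Plane → ℝ) where
  carrier := {f | ∃ p : MvPolynomial (Fin 2) ℝ, p.totalDegree ≤ l ∧
    ∀ x : Plane, f x = MvPolynomial.eval (fun i => x i) p}
  zero_mem' := ⟨0, by simp, by simp⟩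
  add_mem' := by
    rintro f g ⟨p, hp, hf⟩ ⟨q, hq, hg⟩
    exact ⟨p + q, (MvPolynomial.totalDegree_add p q).trans (max_le hp hq),
      fun x => by simp [hf x, hg x]⟩
  smul_mem' := by
    rintro c f ⟨p, hp, hf⟩
    exact ⟨c • p, (MvPolynomial.totalDegree_smul_le c p).trans hp,
      fun x => by simp [hf x, MvPolynomial.smul_eval]⟩

/-- The space `ℙ^l(F)` of the restrictions to `F` of polynomials of total degree at most `l`.
A function on `F` is represented by its extension by zero outside of `F`. -/
def facePolySpace (l : ℕ) (F : Set Plane) : Submodule ℝ (Plane → ℝ) where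
  carrier := {f | ∃ p ∈ polySpace l, f = F.indicator p}
  zero_mem' := ⟨0, Submodule.zero_mem _, by simp⟩
  add_mem' := by
    rintro f g ⟨p, hp, rfl⟩ ⟨q, hq, rfl⟩
    exact ⟨p + q, Submodule.add_mem _ hp hq, (indicator_add' F p q).symm⟩
  smul_mem' := by
    rintro c f ⟨p, hp, rfl⟩
    exact ⟨c • p, Submodule.smul_mem _ c hp, (indicator_const_smul F c p).symm⟩

/-- The `L²(μ)`-orthogonal projection of `f` on a finite-dimensional space `V` of functions: the
`p ∈ V` such that `(p - f, w) = 0` for all `w ∈ V`. -/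
def l2Proj (μ : Measure Plane) (V : Submodule ℝ (Plane → ℝ)) (f : Plane → ℝ) : V :=
  Classical.epsilon fun p : V =>
    ∀ w ∈ V, ∫ x, ((p : Plane → ℝ) x - f x) * w x ∂μ = 0

/-- The projector `π_T^l`. -/
def elemProj (l : ℕ) (T : Set Plane) (f : Plane → ℝ) : polySpace l :=
  l2Proj (volume.restrict T) (polySpace l) f

/-- The projector `π_F^l`. -/
def faceProj (l : ℕ) (F : Set Plane) (f : Plane → ℝ) : facePolySpace l F :=
  l2Proj (arcLength.restrict F) (facePolySpace l F) f

/-! ### Local unknowns, interpolation, reconstruction, stabilization -/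

/-- The local space of discrete unknowns `(v_T, (𝐯_{∇,F})_F, (v_F)_F)`, for an element whose set of
faces is `𝓕`. -/
abbrev LocalUnknowns (k : ℕ) (𝓕 : Finset (Set Plane)) : Type :=
  polySpace k × ((F : 𝓕) → Fin 2 → facePolySpace k (F : Set Plane)) ×
    ((F : 𝓕) → facePolySpace k (F : Set Plane))

variable {k : ℕ} {𝓕 : Finset (Set Plane)}

/-- The element unknown `v_T`. -/
def elemPart (v : LocalUnknowns k 𝓕) : Plane → ℝ := v.1

/-- The components of the gradient unknown `𝐯_{∇,F}`. -/
def gradPart (v : LocalUnknowns k 𝓕) (F : 𝓕) (i : Fin 2) : Plane → ℝ := v.2.1 F i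

/-- The face unknown `v_F`. -/
def facePart (v : LocalUnknowns k 𝓕) (F : 𝓕) : Plane → ℝ := v.2.2 F

/-- The local interpolation operator `I_T^k` on `H²(T)`. -/
def interp (k : ℕ) (T : Set Plane) (𝓕 : Finset (Set Plane)) (v : Plane → ℝ) :
    LocalUnknowns k 𝓕 :=
  (elemProj k T v,
    fun F i => faceProj k F (trace T (weakGrad T v i)),
    fun F => faceProj k F (trace T v))

/-- The Hessian matrix of a smooth function. -/
def hess (w : Plane → ℝ) (x : Plane) : Matrix (Fin 2) (Fin 2) ℝ :=
  Matrix.of fun i j => pd i (pd j w) x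

/-- The moment tensor `M_w = -A ∇²w`. -/
def moment (A : Tensor4) (w : Plane → ℝ) (x : Plane) : Matrix (Fin 2) (Fin 2) ℝ :=
  -(A.app (hess w x))

/-- The (row-wise) divergence of the moment tensor. -/
def divMoment (A : Tensor4) (w : Plane → ℝ) (x : Plane) (i : Fin 2) : ℝ :=
  ∑ j, pd j (fun y => moment A w y i j) x

/-- The scalar `div div M_w`. -/
def divDivMoment (A : Tensor4) (w : Plane → ℝ) (x : Plane) : ℝ :=
  ∑ i, pd i (fun y => divMoment A w y i) x

/-- The bilinear form `a_{|T}(p, w) = (A ∇²p, ∇²w)_T`, for polynomials. -/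
def energy (A : Tensor4) (T : Set Plane) (p w : Plane → ℝ) : ℝ :=
  ∫ x in T, frob (A.app (hess p x)) (hess w x)

/-- `p ∈ ℙ^{k+2}(T)` satisfies the defining relations of the deflection reconstruction of `v`: the
variational problem and the closure condition `π_T^1 p = π_T^1 v_T`. -/
def IsReconstruction (A : Tensor4) (T : Set Plane) (v : LocalUnknowns k 𝓕)
    (p : polySpace (k + 2)) : Prop :=
  (∀ w ∈ polySpace (k + 2),
    energy A T p w =
      -(∫ x in T, elemPart v x * divDivMoment A w x)
      - ∑ F : 𝓕, ∫ x in (F : Set Plane),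
          ∑ i, gradPart v F i x * ∑ j, moment A w x i j * outwardNormal T x j ∂arcLength
      + ∑ F : 𝓕, ∫ x in (F : Set Plane),
          facePart v F x * ∑ i, divMoment A w x i * outwardNormal T x i ∂arcLength) ∧
  elemProj 1 T p = elemProj 1 T (elemPart v)

/-- The local deflection reconstruction operator `p_T^{k+2}`. -/
def reconstruction (A : Tensor4) (T : Set Plane) (v : LocalUnknowns k 𝓕) : polySpace (k + 2) :=
  Classical.epsilon fun p => IsReconstruction A T v p

/-- The local stabilization bilinear form `s_T`. -/
def stab (A : Tensor4) (T : Set Plane) (u v : LocalUnknowns k 𝓕) : ℝ :=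
  let pu : Plane → ℝ := reconstruction A T u
  let pv : Plane → ℝ := reconstruction A T v
  let h : ℝ := Metric.diam T
  A.maxEigenvalue / h ^ 4 *
      (∫ x in T, (elemProj k T (pu - elemPart u) : Plane → ℝ) x *
        (elemProj k T (pv - elemPart v) : Plane → ℝ) x)
    + A.maxEigenvalue / h * ∑ F : 𝓕, ∫ x in (F : Set Plane), ∑ i,
        (faceProj k F (pd i pu - gradPart u F i) : Plane → ℝ) x *
          (faceProj k F (pd i pv - gradPart v F i) : Plane → ℝ) x ∂arcLength
    + A.maxEigenvalue / h ^ 3 * ∑ F : 𝓕, ∫ x in (F : Set Plane),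
        (faceProj k F (pu - facePart u F) : Plane → ℝ) x *
          (faceProj k F (pv - facePart v F) : Plane → ℝ) x ∂arcLength

end

end HHO

/-! ### Smooth functions, first-order weak derivatives and their uniqueness. -/

namespace HHO

/-! ### Squares of `L²` functions -/

/-! Put `p = p_T^{k+2} I_T^k v` and `e = v - p`. In each of the three terms of the stabilization the
outer projector is applied to `p` minus a projection of `v` (or of a trace of `v`, or of its
gradient), so it only sees the moments of `-e`. Orthogonal projections are contractions, hence the
stabilization is at most `β` times `h⁻⁴ ‖e‖²` on `T` plus `h⁻¹ ‖∇e‖² + h⁻³ ‖e‖²` on the boundary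
(`stab_interp_le`).

The reconstruction has two properties (`reconstruction_interp_spec`). First, `e` is orthogonal to
affine functions: this is the closure condition together with `k ≥ 1`. Second, `∇²e` is
`A`-orthogonal to the Hessians of polynomials of degree `k + 2`: the moments `M_w`, `div M_w` and
`div div M_w` have degree at most `k` and the normal is constant on each face, so the projectors
inside the interpolate are invisible, and two integrations by parts turn the right-hand side into
`(A ∇²v, ∇²w)` (`rhs_interp_eq`).

By the first property, Poincaré inequalities bound `e` and `∇e` on `T` by the appropriate powers of
`h` times `‖∇²e‖` (`integral_sq_le_of_orthogonal`), and the trace inequality carries the bounds to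
the boundary; all powers of `h` cancel, leaving `‖∇²e‖²` (`stab_interp_le_hess`). By the second
property and ellipticity, `‖∇²e‖² ≤ (β/α) ‖∇²(v - w)‖²` for every polynomial `w` of degree `k + 2`.
Choosing `w` so that all its derivatives up to order `k + 2` have the same means as those of `v`,
and iterating Poincaré, gives `h^(k+1) |v|` (`exists_poly_approx`).

What remains is to prove the Poincaré and trace inequalities with constants that depend on `ϱ` only,
on elements that may be nonconvex and have holes, and for weak derivatives and traces defined by
duality.

Poincaré: on a convex set, compare values along segments for smooth functions and pass to the limit
by density. On an element, go from triangle to triangle. Two triangles with a common edge both meet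
a disc centred at its midpoint in a set of controlled area, so closeness to one constant propagates
(`exists_const_integral_le`). An area count bounds the number of triangles, and the element stays
connected when the vertices are removed, so every triangle is reached through edges.

Traces: integration along the rays of the cone over an edge gives the estimate for smooth functions,
and completeness of `L²` gives an edge trace in `H¹`. To see that the glued edge traces satisfy
Green's formula, localize the test function by a partition of unity: near an interior point of a
boundary edge the element is a half-disc, and the remaining finitely many points are removed with
cutoffs whose Dirichlet energy stays bounded in dimension two (`greenHolds_of_diff_singleton`).
Uniqueness then transfers everything to the trace selected in the definition. -/

theorem add_sq_le_two (a b : ℝ) : (a + b) ^ 2 ≤ 2 * a ^ 2 + 2 * b ^ 2 := by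
  nlinarith [sq_nonneg (a - b)]

section SquareIntegrals

variable {α : Type*} [MeasurableSpace α] {μ : Measure α} {f g : α → ℝ}

theorem integral_add_sq_le (hf : MemLp f 2 μ) (hg : MemLp g 2 μ) :
    ∫ x, (f x + g x) ^ 2 ∂μ ≤ 2 * (∫ x, f x ^ 2 ∂μ) + 2 * ∫ x, g x ^ 2 ∂μ := by
  have i1 : Integrable (fun x => 2 * f x ^ 2) μ := hf.integrable_sq.const_mul 2
  have i2 : Integrable (fun x => 2 * g x ^ 2) μ := hg.integrable_sq.const_mul 2
  rw [← integral_const_mul, ← integral_const_mul, ← integral_add i1 i2]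
  exact integral_mono (hf.add hg).integrable_sq (i1.add i2) fun x => add_sq_le_two _ _

theorem integral_sub_sq_le (hf : MemLp f 2 μ) (hg : MemLp g 2 μ) :
    ∫ x, (f x - g x) ^ 2 ∂μ ≤ 2 * (∫ x, f x ^ 2 ∂μ) + 2 * ∫ x, g x ^ 2 ∂μ := by
  simpa [sub_eq_add_neg] using integral_add_sq_le hf hg.neg

theorem integral_sq_nonneg (f : α → ℝ) : 0 ≤ ∫ x, f x ^ 2 ∂μ :=
  integral_nonneg fun _ => sq_nonneg _

end SquareIntegrals

/-! ### Partial derivatives of smooth functions -/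

/-- The vectors of the canonical basis. -/
noncomputable abbrev stdVec (i : Fin 2) : Plane := EuclideanSpace.single i 1

theorem pd_apply (i : Fin 2) (f : Plane → ℝ) (x : Plane) : pd i f x = fderiv ℝ f x (stdVec i) := rfl

theorem contDiff_pd {f : Plane → ℝ} (hf : ContDiff ℝ ∞ f) (i : Fin 2) : ContDiff ℝ ∞ (pd i f) := by
  have h : ContDiff ℝ ∞ (fderiv ℝ f) := hf.fderiv_right (m := ∞) (by simp)
  exact h.clm_apply contDiff_const

theorem ContDiff.pdMulti {f : Plane → ℝ} (hf : ContDiff ℝ ∞ f) (a : Fin 2 → ℕ) :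
    ContDiff ℝ ∞ (pdMulti a f) := by
  have key : ∀ (i : Fin 2) (n : ℕ) (g : Plane → ℝ), ContDiff ℝ ∞ g → ContDiff ℝ ∞ ((pd i)^[n] g) := by
    intro i n
    induction n with
    | zero => intro g hg; simpa using hg
    | succ n ih => intro g hg; rw [Function.iterate_succ_apply]; exact ih _ (contDiff_pd hg i)
  exact key 0 _ _ (key 1 _ _ hf)

theorem differentiable_of_smooth {f : Plane → ℝ} (hf : ContDiff ℝ ∞ f) : Differentiable ℝ f :=
  hf.differentiable (by simp)

theorem pd_comm {f : Plane → ℝ} (hf : ContDiff ℝ ∞ f) (i j : Fin 2) :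
    pd i (pd j f) = pd j (pd i f) := by
  have h : ContDiff ℝ ∞ (fderiv ℝ f) := hf.fderiv_right (m := ∞) (by simp)
  have hd : Differentiable ℝ (fderiv ℝ f) := h.differentiable (by simp)
  ext x
  have hsymm : IsSymmSndFDerivAt ℝ f x :=
    hf.contDiffAt.isSymmSndFDerivAt (by simpa using (WithTop.coe_le_coe.2 le_top : ((2 : ℕ∞) : WithTop ℕ∞) ≤ ∞))
  have key : ∀ i j : Fin 2, pd i (pd j f) x = fderiv ℝ (fderiv ℝ f) x (stdVec i) (stdVec j) := by
    intro i j
    have : pd j f = fun y => fderiv ℝ f y (stdVec j) := rfl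
    rw [pd_apply, this, fderiv_clm_apply (hd x) (differentiableAt_const _)]
    simp
  rw [key, key, hsymm]

theorem pd_add {f g : Plane → ℝ} (hf : Differentiable ℝ f) (hg : Differentiable ℝ g) (i : Fin 2) :
    pd i (f + g) = pd i f + pd i g := by
  ext x; simp [pd, fderiv_add (hf x) (hg x)]

theorem pd_sub {f g : Plane → ℝ} (hf : Differentiable ℝ f) (hg : Differentiable ℝ g) (i : Fin 2) :
    pd i (f - g) = pd i f - pd i g := by
  ext x; simp [pd, fderiv_sub (hf x) (hg x)]

theorem pd_const_smul {f : Plane → ℝ} (hf : Differentiable ℝ f) (c : ℝ) (i : Fin 2) :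
    pd i (c • f) = c • pd i f := by
  ext x; simp [pd, fderiv_const_smul (hf x) c]

theorem pd_mul {f g : Plane → ℝ} (hf : Differentiable ℝ f) (hg : Differentiable ℝ g) (i : Fin 2) :
    pd i (fun x => f x * g x) = fun x => f x * pd i g x + pd i f x * g x := by
  ext x
  have := fderiv_mul (hf x) (hg x)
  simp only [pd]
  rw [show (fun x => f x * g x) = f * g from rfl, this]
  simp [mul_comm]

theorem pd_const (c : ℝ) (i : Fin 2) : pd i (fun _ => c) = 0 := by
  ext x; simp [pd]

theorem tsupport_pd_subset (f : Plane → ℝ) (i : Fin 2) : tsupport (pd i f) ⊆ tsupport f := by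
  refine (closure_mono ?_).trans (tsupport_fderiv_subset ℝ (f := f))
  intro x hx
  simp only [Function.mem_support, pd] at hx ⊢
  intro h; simp [h] at hx

theorem HasCompactSupport.pd {f : Plane → ℝ} (hf : HasCompactSupport f) (i : Fin 2) :
    HasCompactSupport (pd i f) :=
  hf.of_isClosed_subset (isClosed_tsupport _) (tsupport_pd_subset f i)

theorem pd_eq_of_eventuallyEq {f g : Plane → ℝ} {x : Plane} (h : f =ᶠ[nhds x] g) (i : Fin 2) :
    pd i f x = pd i g x := by
  simp [pd, h.fderiv_eq]

theorem pd_eqOn_of_isOpen {f g : Plane → ℝ} {U : Set Plane} (hU : IsOpen U) (h : EqOn f g U)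
    (i : Fin 2) : EqOn (pd i f) (pd i g) U := fun _ hx =>
  pd_eq_of_eventuallyEq (Filter.eventuallyEq_of_mem (hU.mem_nhds hx) h) i

theorem fderiv_eq_sum_pd (f : Plane → ℝ) (x v : Plane) :
    fderiv ℝ f x v = v 0 * pd 0 f x + v 1 * pd 1 f x := by
  have hv : v = v 0 • stdVec 0 + v 1 • stdVec 1 := by
    ext i; fin_cases i <;> simp [stdVec]
  conv_lhs => rw [hv]
  simp [pd]

theorem pdMulti_zero (f : Plane → ℝ) : pdMulti 0 f = f := rfl

theorem pdMulti_single (i : Fin 2) (f : Plane → ℝ) : pdMulti (Pi.single i 1) f = pd i f := by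
  fin_cases i <;> simp [pdMulti]

theorem iterate_pd_comm {f : Plane → ℝ} (hf : ContDiff ℝ ∞ f) (i j : Fin 2) (n : ℕ) :
    (pd i)^[n] (pd j f) = pd j ((pd i)^[n] f) := by
  induction n generalizing f with
  | zero => rfl
  | succ n ih =>
    rw [Function.iterate_succ_apply, Function.iterate_succ_apply, pd_comm hf, ih (contDiff_pd hf i)]

theorem contDiff_iterate_pd {f : Plane → ℝ} (hf : ContDiff ℝ ∞ f) (i : Fin 2) (n : ℕ) :
    ContDiff ℝ ∞ ((pd i)^[n] f) := by
  induction n generalizing f with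
  | zero => exact hf
  | succ n ih => rw [Function.iterate_succ_apply]; exact ih (contDiff_pd hf i)

theorem pdMulti_pd {f : Plane → ℝ} (hf : ContDiff ℝ ∞ f) (a : Fin 2 → ℕ) (i : Fin 2) :
    pdMulti a (pd i f) = pdMulti (a + Pi.single i 1) f := by
  fin_cases i
  · simp only [pdMulti, Fin.zero_eta, Pi.add_apply, Pi.single_eq_same, ne_eq, one_ne_zero,
      not_false_eq_true, Pi.single_eq_of_ne, add_zero, Function.iterate_succ_apply]
    rw [iterate_pd_comm hf]
  · simp [pdMulti]

theorem pd_pdMulti {f : Plane → ℝ} (hf : ContDiff ℝ ∞ f) (a : Fin 2 → ℕ) (i : Fin 2) :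
    pd i (pdMulti a f) = pdMulti (a + Pi.single i 1) f := by
  rw [← pdMulti_pd hf]
  simp only [pdMulti]
  rw [iterate_pd_comm hf, iterate_pd_comm (contDiff_iterate_pd hf 1 _)]

theorem tsupport_pdMulti_subset (f : Plane → ℝ) (a : Fin 2 → ℕ) :
    tsupport (pdMulti a f) ⊆ tsupport f := by
  have key : ∀ (i : Fin 2) (n : ℕ) (g : Plane → ℝ), tsupport ((pd i)^[n] g) ⊆ tsupport g := by
    intro i n
    induction n with
    | zero => intro g; exact subset_rfl
    | succ n ih =>
      intro g; rw [Function.iterate_succ_apply]; exact (ih _).trans (tsupport_pd_subset g i)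
  exact (key 0 _ _).trans (key 1 _ _)

/-! ### Weak derivatives of first order -/

theorem isWeakDeriv_single_iff {T : Set Plane} {i : Fin 2} {v g : Plane → ℝ} :
    IsWeakDeriv T (Pi.single i 1) v g ↔
      ∀ φ : Plane → ℝ, ContDiff ℝ ∞ φ → HasCompactSupport φ → tsupport φ ⊆ T →
        ∫ x in T, v x * pd i φ x = -∫ x in T, g x * φ x := by
  simp [IsWeakDeriv, pdMulti_single, Finset.sum_pi_single']

/-- `w ∈ H¹(X)`, with weak gradient `g`. -/
structure IsH1 (X : Set Plane) (w : Plane → ℝ) (g : Fin 2 → Plane → ℝ) : Prop where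
  memLp : MemLp w 2 (volume.restrict X)
  memLp_grad : ∀ i, MemLp (g i) 2 (volume.restrict X)
  weak : ∀ i, IsWeakDeriv X (Pi.single i 1) w (g i)

theorem setIntegral_mul_eq_of_tsupport {X Y : Set Plane} (hX : MeasurableSet X) (hYX : Y ⊆ X)
    (f φ : Plane → ℝ) (hφ : tsupport φ ⊆ Y) :
    ∫ x in X, f x * φ x = ∫ x in Y, f x * φ x := by
  refine setIntegral_eq_of_subset_of_forall_sdiff_eq_zero hX hYX ?_
  intro x hx
  rw [image_eq_zero_of_notMem_tsupport (fun h => hx.2 (hφ h)), mul_zero]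

theorem IsWeakDeriv.mono {X Y : Set Plane} (hX : MeasurableSet X) (hYX : Y ⊆ X) {a : Fin 2 → ℕ}
    {w g : Plane → ℝ} (h : IsWeakDeriv X a w g) : IsWeakDeriv Y a w g := by
  intro φ h1 h2 h3
  have := h φ h1 h2 (h3.trans hYX)
  rwa [setIntegral_mul_eq_of_tsupport hX hYX w _ ((tsupport_pdMulti_subset φ a).trans h3),
    setIntegral_mul_eq_of_tsupport hX hYX g _ h3] at this

theorem IsH1.mono {X Y : Set Plane} (hX : MeasurableSet X) (hYX : Y ⊆ X) {w : Plane → ℝ}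
    {g : Fin 2 → Plane → ℝ} (h : IsH1 X w g) : IsH1 Y w g :=
  ⟨h.memLp.mono_measure (Measure.restrict_mono hYX le_rfl),
    fun i => (h.memLp_grad i).mono_measure (Measure.restrict_mono hYX le_rfl),
    fun i => (h.weak i).mono hX hYX⟩

theorem integrable_mul_of_compactSupport {μ : Measure Plane} {f φ : Plane → ℝ}
    (hf : MemLp f 2 μ) [IsFiniteMeasureOnCompacts μ] (hφ : Continuous φ)
    (hc : HasCompactSupport φ) : Integrable (fun x => f x * φ x) μ :=
  MemLp.integrable_mul (p := 2) (q := 2) hf (hφ.memLp_of_hasCompactSupport hc)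

theorem memLp_of_continuous_of_isBounded {X : Set Plane} (hX : Bornology.IsBounded X)
    {μ : Measure Plane} [IsFiniteMeasureOnCompacts μ]
    {f : Plane → ℝ} (hf : Continuous f) : MemLp f 2 (μ.restrict X) := by
  have hc : IsCompact (closure X) := hX.isCompact_closure
  have h1 : MemLp f 2 (μ.restrict (closure X)) := by
    have : IsFiniteMeasure (μ.restrict (closure X)) := ⟨by simpa using hc.measure_lt_top⟩
    obtain ⟨C, hC⟩ := hc.exists_bound_of_continuousOn hf.continuousOn
    exact MemLp.of_bound hf.aestronglyMeasurable C
      ((ae_restrict_iff' isClosed_closure.measurableSet).2 (Filter.Eventually.of_forall hC))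
  exact h1.mono_measure (Measure.restrict_mono subset_closure le_rfl)

/-- Integration by parts over the whole plane. -/
theorem integral_pd_eq_zero {f : Plane → ℝ} (hf : ContDiff ℝ ∞ f) (hc : HasCompactSupport f)
    (i : Fin 2) : ∫ x, pd i f x = 0 := by
  have h1 : Integrable (fun x => fderiv ℝ f x (stdVec i)) :=
    ((contDiff_pd hf i).continuous.integrable_of_hasCompactSupport (HasCompactSupport.pd hc i))
  have := integral_mul_fderiv_eq_neg_fderiv_mul_of_integrable (μ := (volume : Measure Plane))
    (f := fun _ => (1 : ℝ)) (g := f) (v := stdVec i) (by simp) (by simpa using h1)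
    (by simpa using hf.continuous.integrable_of_hasCompactSupport hc)
    (fun _ _ => differentiableAt_const _)
    (fun x _ => differentiable_of_smooth hf x)
  simpa [pd] using this

theorem isWeakDeriv_of_smooth {X : Set Plane} {f : Plane → ℝ}
    (hf : ContDiff ℝ ∞ f) (i : Fin 2) : IsWeakDeriv X (Pi.single i 1) f (pd i f) := by
  refine IsWeakDeriv.mono MeasurableSet.univ (subset_univ X) ?_
  rw [isWeakDeriv_single_iff]
  intro φ h1 h2 _
  have h3 := integral_pd_eq_zero (hf.mul h1) (h2.mul_left (f := f)) i
  rw [show (fun x => f x * φ x) = fun x => f x * φ x from rfl,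
    pd_mul (differentiable_of_smooth hf) (differentiable_of_smooth h1) i, integral_add] at h3
  · simp only [setIntegral_univ]; linarith
  · exact (hf.continuous.mul (contDiff_pd h1 i).continuous).integrable_of_hasCompactSupport
      (HasCompactSupport.mul_left (HasCompactSupport.pd h2 i))
  · exact ((contDiff_pd hf i).continuous.mul h1.continuous).integrable_of_hasCompactSupport
      (HasCompactSupport.mul_left h2)

theorem isH1_of_smooth {X : Set Plane} (hb : Bornology.IsBounded X)
    {f : Plane → ℝ} (hf : ContDiff ℝ ∞ f) : IsH1 X f (fun i => pd i f) :=
  ⟨memLp_of_continuous_of_isBounded hb hf.continuous,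
    fun i => memLp_of_continuous_of_isBounded hb (contDiff_pd hf i).continuous,
    fun i => isWeakDeriv_of_smooth hf i⟩

theorem IsH1.sub {X : Set Plane} {v w : Plane → ℝ}
    {f g : Fin 2 → Plane → ℝ} (hv : IsH1 X v f) (hw : IsH1 X w g) :
    IsH1 X (v - w) (f - g) := by
  refine ⟨hv.memLp.sub hw.memLp, fun i => (hv.memLp_grad i).sub (hw.memLp_grad i), fun i => ?_⟩
  rw [isWeakDeriv_single_iff]
  intro φ h1 h2 h3
  have e1 := isWeakDeriv_single_iff.1 (hv.weak i) φ h1 h2 h3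
  have e2 := isWeakDeriv_single_iff.1 (hw.weak i) φ h1 h2 h3
  have c1 := (contDiff_pd h1 i).continuous
  have c2 := HasCompactSupport.pd h2 i
  simp only [Pi.sub_apply, sub_mul]
  rw [integral_sub (integrable_mul_of_compactSupport hv.memLp c1 c2)
      (integrable_mul_of_compactSupport hw.memLp c1 c2),
    integral_sub (integrable_mul_of_compactSupport (hv.memLp_grad i) h1.continuous h2)
      (integrable_mul_of_compactSupport (hw.memLp_grad i) h1.continuous h2), e1, e2]
  ring

/-- Uniqueness of weak derivatives. -/
theorem IsWeakDeriv.ae_eq {X : Set Plane} (hX : IsOpen X) {a : Fin 2 → ℕ} {w g g' : Plane → ℝ}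
    (hg : MemLp g 2 (volume.restrict X)) (hg' : MemLp g' 2 (volume.restrict X))
    (h : IsWeakDeriv X a w g) (h' : IsWeakDeriv X a w g') : g =ᵐ[volume.restrict X] g' := by
  have hi : LocallyIntegrableOn (g - g') X volume := by
    intro x hx
    obtain ⟨r, hr, hrX⟩ := Metric.isOpen_iff.1 hX x hx
    refine ⟨Metric.ball x r, mem_nhdsWithin_of_mem_nhds (Metric.ball_mem_nhds x hr), ?_⟩
    have : IsFiniteMeasure (volume.restrict (Metric.ball x r)) :=
      ⟨by simpa using (Metric.isBounded_ball (x := x) (r := r)).measure_lt_top (μ := volume)⟩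
    exact ((hg.sub hg').mono_measure (Measure.restrict_mono hrX le_rfl)).integrable (by norm_num)
  have := hX.ae_eq_zero_of_integral_contDiff_smul_eq_zero hi (fun φ h1 h2 h3 => ?_)
  · rw [Filter.EventuallyEq, ae_restrict_iff' hX.measurableSet]
    filter_upwards [this] with x hx hxX
    exact sub_eq_zero.1 (hx hxX)
  · have e1 := h φ h1 h2 h3
    have e2 := h' φ h1 h2 h3
    have e3 : ∫ x in X, g x * φ x = ∫ x in X, g' x * φ x := by
      have := e1.symm.trans e2
      exact mul_left_cancel₀ (pow_ne_zero _ (by norm_num : (-1 : ℝ) ≠ 0)) this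
    calc ∫ x, φ x • (g - g') x = ∫ x, (g - g') x * φ x := by
          congr 1; ext x; simp [mul_comm]
      _ = ∫ x in X, (g - g') x * φ x := by
          rw [← setIntegral_univ, setIntegral_mul_eq_of_tsupport MeasurableSet.univ
            (subset_univ X) _ _ h3]
      _ = 0 := by
          simp only [Pi.sub_apply, sub_mul]
          rw [integral_sub (integrable_mul_of_compactSupport hg h1.continuous h2)
            (integrable_mul_of_compactSupport hg' h1.continuous h2), e3, sub_self]

end HHO

/-! ### Analysis on convex sets, half-planes and triangles. -/

namespace HHO

noncomputable section

open scoped Convolution Topology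
open Filter

/-! ### Mollification on bounded convex sets -/

/-- The dilation of centre `c` and ratio `r`. -/
def dilation (c : Plane) (r : ℝ) (x : Plane) : Plane := c + r • (x - c)

theorem continuous_dilation (c : Plane) (r : ℝ) : Continuous (dilation c r) := by
  unfold dilation; fun_prop

theorem contDiff_dilation (c : Plane) (r : ℝ) : ContDiff ℝ ∞ (dilation c r) := by
  unfold dilation; fun_prop

theorem hasFDerivAt_dilation (c : Plane) (r : ℝ) (x : Plane) :
    HasFDerivAt (dilation c r) (r • ContinuousLinearMap.id ℝ Plane) x := by
  unfold dilation
  exact (((hasFDerivAt_id x).sub_const c).const_smul r).const_add c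

theorem integral_comp_dilation (f : Plane → ℝ) (c : Plane) {r : ℝ} (hr : 0 ≤ r) :
    ∫ x, f (dilation c r x) = (r ^ 2)⁻¹ * ∫ x, f x := by
  unfold dilation
  rw [integral_sub_right_eq_self (fun x => f (c + r • x)) c,
    Measure.integral_comp_smul_of_nonneg volume (fun x => f (c + x)) r (hR := hr),
    integral_add_left_eq_self f c]
  simp

theorem integrable_comp_dilation {f : Plane → ℝ} (hf : Integrable f) (c : Plane) {r : ℝ}
    (hr : r ≠ 0) : Integrable fun x => f (dilation c r x) := by
  unfold dilation
  have h1 : Integrable fun x => f (c + x) := hf.comp_add_left c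
  have h2 : Integrable fun x => f (c + r • x) := h1.comp_smul hr
  exact h2.comp_sub_right c

/-- Convolution with the normalized bump function `φ`. -/
def mollify (φ : ContDiffBump (0 : Plane)) (f : Plane → ℝ) : Plane → ℝ :=
  φ.normed volume ⋆[ContinuousLinearMap.lsmul ℝ ℝ, volume] f

variable {φ : ContDiffBump (0 : Plane)} {f g : Plane → ℝ}

theorem mollify_apply (x : Plane) : mollify φ f x = ∫ t, φ.normed volume t * f (x - t) := rfl

theorem mollify_integrable (hf : LocallyIntegrable f) (x : Plane) :
    Integrable fun t => φ.normed volume t * f (x - t) :=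
  (φ.hasCompactSupport_normed.convolutionExists_left (ContinuousLinearMap.lsmul ℝ ℝ)
    φ.continuous_normed hf x)

theorem contDiff_mollify (hf : LocallyIntegrable f) : ContDiff ℝ ∞ (mollify φ f) :=
  φ.hasCompactSupport_normed.contDiff_convolution_left _ φ.contDiff_normed hf

theorem mollify_sub (hf : LocallyIntegrable f) (hg : LocallyIntegrable g) :
    mollify φ (f - g) = mollify φ f - mollify φ g := by
  ext x
  simp only [mollify_apply, Pi.sub_apply, mul_sub]
  exact integral_sub (mollify_integrable hf x) (mollify_integrable hg x)

/-- Jensen's inequality for the probability density `φ`: the variance of `t ↦ f (x - t)` is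
nonnegative. -/
theorem sq_mollify_le (hf : MemLp f 2) (x : Plane) :
    mollify φ f x ^ 2 ≤ mollify φ (fun y => f y ^ 2) x := by
  have h1 : LocallyIntegrable f := hf.locallyIntegrable (by norm_num)
  have h2 : LocallyIntegrable fun y => f y ^ 2 := hf.integrable_sq.locallyIntegrable
  have i1 := mollify_integrable (φ := φ) h1 x
  have i2 := mollify_integrable (φ := φ) h2 x
  have i0 : Integrable (φ.normed (volume : Measure Plane)) := φ.integrable_normed
  set m := mollify φ f x with hm
  have key : 0 ≤ ∫ t, φ.normed volume t * (f (x - t) - m) ^ 2 :=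
    integral_nonneg fun t => mul_nonneg (φ.nonneg_normed t) (sq_nonneg _)
  have e : (fun t => φ.normed volume t * (f (x - t) - m) ^ 2) = fun t =>
      (φ.normed volume t * f (x - t) ^ 2 - (2 * m) * (φ.normed volume t * f (x - t)))
        + m ^ 2 * φ.normed volume t := by
    ext t; ring
  have i3 : Integrable fun t => φ.normed volume t * f (x - t) ^ 2 -
      (2 * m) * (φ.normed volume t * f (x - t)) := i2.sub (i1.const_mul _)
  rw [e, integral_add i3 (i0.const_mul _), integral_sub i2 (i1.const_mul _),
    integral_const_mul, integral_const_mul, φ.integral_normed, ← mollify_apply,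
    ← hm] at key
  rw [mollify_apply]
  linarith

/-- Mollification is a contraction of `L²` by the pointwise Jensen inequality, since convolution
with a density preserves the integral of `f²`; the dilation only adds its Jacobian. -/
theorem integral_sq_mollify_comp_dilation_le (hf : MemLp f 2) (c : Plane) {r : ℝ} (hr : 0 < r) :
    ∫ x, mollify φ f (dilation c r x) ^ 2 ≤ (r ^ 2)⁻¹ * ∫ x, f x ^ 2 ∧
      Integrable fun x => mollify φ f (dilation c r x) ^ 2 := by
  have h1 : Integrable (mollify φ fun y => f y ^ 2) :=
    φ.integrable_normed.integrable_convolution _ hf.integrable_sq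
  have h2 : ∫ x, mollify φ (fun y => f y ^ 2) x = ∫ x, f x ^ 2 := by
    have := integral_convolution (ContinuousLinearMap.lsmul ℝ ℝ) (φ.integrable_normed (μ := volume))
      hf.integrable_sq
    rw [φ.integral_normed] at this
    simpa [mollify] using this
  have h0 : Continuous (mollify φ f) :=
    (contDiff_mollify (hf.locallyIntegrable (by norm_num))).continuous
  have h3 : Integrable fun x => mollify φ f x ^ 2 := by
    refine h1.mono' (h0.pow 2).aestronglyMeasurable (Eventually.of_forall fun x => ?_)
    rw [Real.norm_of_nonneg (sq_nonneg _)]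
    exact sq_mollify_le hf x
  refine ⟨?_, integrable_comp_dilation h3 c hr.ne'⟩
  rw [integral_comp_dilation (fun y => mollify φ f y ^ 2) c hr.le, ← h2]
  exact mul_le_mul_of_nonneg_left (integral_mono h3 h1 fun x => sq_mollify_le hf x) (by positivity)

/-- The bump function with outer radius `δ`. -/
def bumpOfRadius (δ : ℝ) (hδ : 0 < δ) : ContDiffBump (0 : Plane) :=
  ⟨δ / 2, δ, half_pos hδ, half_lt_self hδ⟩

/-- Contract towards `c` with parameter `ε`, then mollify at the scale `ε δ`. -/
def smoothing (c : Plane) (δ : ℝ) (hδ : 0 < δ) (n : ℕ) (f : Plane → ℝ) (x : Plane) : ℝ :=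
  mollify (bumpOfRadius ((n + 2 : ℝ)⁻¹ * δ) (by positivity)) f
    (dilation c (1 - (n + 2 : ℝ)⁻¹) x)

/-- The shift `n + 2` keeps the contraction ratio `1 - (n + 2)⁻¹` at least `1/2`, so that its
inverse square is at most 4 uniformly in `n`. -/
theorem inv_add_two_le_half (n : ℕ) : (n + 2 : ℝ)⁻¹ ≤ 1 / 2 := by
  rw [inv_le_comm₀ (by positivity) (by norm_num)]
  norm_num

theorem tendsto_inv_add_two : Tendsto (fun n : ℕ => (n + 2 : ℝ)⁻¹) atTop (𝓝 0) :=
  tendsto_inv_atTop_zero.comp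
    (tendsto_atTop_add_const_right _ _ tendsto_natCast_atTop_atTop)

theorem contDiff_smoothing (hf : LocallyIntegrable f) (c : Plane) {δ : ℝ} (hδ : 0 < δ) (n : ℕ) :
    ContDiff ℝ ∞ (smoothing c δ hδ n f) :=
  (contDiff_mollify hf).comp (contDiff_dilation _ _)

/-- Uniform continuity suffices: with `ε = (n + 2)⁻¹`, contraction moves a point of `X` by at most
`ε R` and mollification averages over distances below `ε δ`. -/
theorem tendsto_smoothing_of_continuous {X : Set Plane} (hb : Bornology.IsBounded X)
    (hg : Continuous g) (hgc : HasCompactSupport g) (c : Plane) {δ : ℝ} (hδ : 0 < δ)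
    {η : ℝ} (hη : 0 < η) :
    ∀ᶠ n in atTop, ∀ x ∈ X, (smoothing c δ hδ n g x - g x) ^ 2 ≤ η := by
  obtain ⟨R, hR0, hR⟩ : ∃ R, 0 < R ∧ X ⊆ Metric.closedBall c R := by
    obtain ⟨R, hR⟩ := hb.subset_closedBall c
    exact ⟨max R 1, by positivity, hR.trans (Metric.closedBall_subset_closedBall (le_max_left _ _))⟩
  have huc : UniformContinuous g := hgc.uniformContinuous_of_continuous hg
  rw [Metric.uniformContinuous_iff] at huc
  obtain ⟨θ, hθ, H⟩ := huc (√η / 2) (by positivity)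
  have hlim : Tendsto (fun n : ℕ => (n + 2 : ℝ)⁻¹ * (R + δ)) atTop (𝓝 0) := by
    simpa using tendsto_inv_add_two.mul_const (R + δ)
  filter_upwards [hlim.eventually (gt_mem_nhds hθ)] with n hn x hx
  have hn0 : (0 : ℝ) < (n + 2 : ℝ)⁻¹ := by positivity
  have hxR : ‖x - c‖ ≤ R := by simpa [dist_eq_norm] using hR hx
  have d1 : dist (smoothing c δ hδ n g x) (g (dilation c (1 - (n + 2 : ℝ)⁻¹) x)) ≤ √η / 2 := by
    refine ContDiffBump.dist_normed_convolution_le hg.aestronglyMeasurable fun y hy => (H ?_).le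
    have : dist y (dilation c (1 - (n + 2 : ℝ)⁻¹) x) < (n + 2 : ℝ)⁻¹ * δ := hy
    refine this.trans (lt_of_le_of_lt ?_ hn)
    gcongr; linarith
  have d2 : dist (g (dilation c (1 - (n + 2 : ℝ)⁻¹) x)) (g x) ≤ √η / 2 := by
    refine (H ?_).le
    have e : dilation c (1 - (n + 2 : ℝ)⁻¹) x - x = -((n + 2 : ℝ)⁻¹ • (x - c)) := by
      unfold dilation; module
    rw [dist_eq_norm, e, norm_neg, norm_smul, Real.norm_of_nonneg hn0.le]
    refine lt_of_le_of_lt ?_ hn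
    gcongr; linarith
  have d3 : |smoothing c δ hδ n g x - g x| ≤ √η := by
    rw [← Real.dist_eq]
    exact (dist_triangle _ _ _).trans (by linarith)
  calc _ = |smoothing c δ hδ n g x - g x| ^ 2 := (sq_abs _).symm
    _ ≤ √η ^ 2 := by gcongr
    _ = η := Real.sq_sqrt hη.le

/-- Density of continuous compactly supported functions in `L²`, combined with the bound of the
smoothing operators on `L²` uniformly in `n`. -/
theorem tendsto_smoothing {X : Set Plane} (hX : MeasurableSet X)
    (hb : Bornology.IsBounded X) (hf : MemLp f 2) (c : Plane) {δ : ℝ} (hδ : 0 < δ) :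
    Tendsto (fun n => ∫ x in X, (smoothing c δ hδ n f x - f x) ^ 2) atTop (𝓝 0) := by
  have hfl : LocallyIntegrable f := hf.locallyIntegrable (by norm_num)
  have hXfin : volume X < ⊤ := hb.measure_lt_top
  have : IsFiniteMeasure (volume.restrict X) := ⟨by simpa using hXfin⟩
  rw [Metric.tendsto_atTop']
  intro η hη
  -- With tolerance `η / 32` the three pieces sum to `2·4·η/32 + 2·(2·η/32 + 2·η/32) = η/2`; the 4
  -- is the Jacobian bound.
  obtain ⟨g, hgc, hfg, hg, hgL⟩ := MemLp.exists_hasCompactSupport_integral_rpow_sub_le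
    (μ := (volume : Measure Plane)) (p := 2) (by norm_num) (by simpa using hf)
    (show (0 : ℝ) < η / 32 by positivity)
  have hgL2 : MemLp g 2 := by simpa using hgL
  have hgl : LocallyIntegrable g := hg.locallyIntegrable
  have hfg' : ∫ x, (f x - g x) ^ 2 ≤ η / 32 := by
    refine le_trans (le_of_eq ?_) hfg
    congr 1; ext x; simp
  set V := (volume X).toReal
  have hV : 0 ≤ V := ENNReal.toReal_nonneg
  have hη' : 0 < η / (32 * (V + 1)) := by positivity
  obtain ⟨N, hN⟩ := eventually_atTop.1
    (tendsto_smoothing_of_continuous hb hg hgc c hδ hη')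
  refine ⟨N, fun n hn => ?_⟩
  have hn0 : (0 : ℝ) < 1 - (n + 2 : ℝ)⁻¹ := by linarith [inv_add_two_le_half n]
  have hdiff : MemLp (f - g) 2 := hf.sub hgL2
  obtain ⟨b1, i1⟩ := integral_sq_mollify_comp_dilation_le
    (φ := bumpOfRadius ((n + 2 : ℝ)⁻¹ * δ) (by positivity)) hdiff c hn0
  set r := 1 - (n + 2 : ℝ)⁻¹ with hr
  have hr4 : (r ^ 2)⁻¹ ≤ 4 := by
    have : 1 / 2 ≤ r := by linarith [inv_add_two_le_half n]
    rw [inv_le_comm₀ (by positivity) (by norm_num)]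
    nlinarith
  have b2 : ∫ x in X, (smoothing c δ hδ n (f - g) x) ^ 2 ≤ 4 * (η / 32) := by
    calc _ ≤ ∫ x, (smoothing c δ hδ n (f - g) x) ^ 2 :=
          setIntegral_le_integral i1 (Eventually.of_forall fun x => sq_nonneg _)
      _ ≤ (r ^ 2)⁻¹ * ∫ x, (f - g) x ^ 2 := b1
      _ ≤ 4 * (η / 32) := by
          have h0 : 0 ≤ ∫ x, (f - g) x ^ 2 := integral_nonneg fun x => sq_nonneg _
          exact mul_le_mul hr4 hfg' h0 (by norm_num)
  have i3 : IntegrableOn (fun x => (smoothing c δ hδ n g x - g x) ^ 2) X :=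
    (memLp_of_continuous_of_isBounded hb
      ((contDiff_smoothing hgl c hδ n).continuous.sub hg)).integrable_sq
  have b3 : ∫ x in X, (smoothing c δ hδ n g x - g x) ^ 2 ≤ η / 32 := by
    calc _ ≤ ∫ x in X, η / (32 * (V + 1)) :=
          setIntegral_mono_on i3 (integrable_const _) hX (hN n hn.le)
      _ = V * (η / (32 * (V + 1))) := by simp [V, Measure.real]
      _ ≤ η / 32 := by
          rw [mul_div_assoc', div_le_div_iff₀ (by positivity) (by positivity)]
          nlinarith
  have b4 : ∫ x in X, (g x - f x) ^ 2 ≤ η / 32 := by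
    refine le_trans (setIntegral_le_integral (hgL2.sub hf).integrable_sq
      (Eventually.of_forall fun x => sq_nonneg _)) (le_of_eq_of_le ?_ hfg')
    congr 1; ext x; ring
  have m1 : MemLp (smoothing c δ hδ n (f - g)) 2 (volume.restrict X) :=
    memLp_of_continuous_of_isBounded hb
      (contDiff_smoothing (hfl.sub hgl) c hδ n).continuous
  have m2 : MemLp (smoothing c δ hδ n g - g) 2 (volume.restrict X) :=
    memLp_of_continuous_of_isBounded hb ((contDiff_smoothing hgl c hδ n).continuous.sub hg)
  have m3 : MemLp (g - f) 2 (volume.restrict X) :=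
    (hgL2.sub hf).mono_measure Measure.restrict_le_self
  have e : ∀ x, smoothing c δ hδ n f x - f x = smoothing c δ hδ n (f - g) x +
      ((smoothing c δ hδ n g - g) x + (g - f) x) := by
    intro x
    have : smoothing c δ hδ n (f - g) x = smoothing c δ hδ n f x - smoothing c δ hδ n g x := by
      simp only [smoothing, mollify_sub hfl hgl, Pi.sub_apply]
    simp only [Pi.sub_apply]
    rw [this]; ring
  have hle := integral_add_sq_le m1 (m2.add m3)
  have hle2 := integral_add_sq_le m2 m3
  have h0 := integral_sq_nonneg (μ := volume.restrict X) fun x => smoothing c δ hδ n f x - f x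
  rw [Real.dist_eq, sub_zero, abs_of_nonneg h0]
  simp only [e, Pi.sub_apply, Pi.add_apply] at hle hle2 ⊢
  linarith

/-- Mollification commutes with weak derivatives, away from the boundary. -/
theorem pd_mollify {X : Set Plane} (hX : IsOpen X) {w v : Plane → ℝ} {i : Fin 2}
    (hw : MemLp w 2 (volume.restrict X))
    (h : IsWeakDeriv X (Pi.single i 1) w v) {z : Plane} (hz : Metric.closedBall z φ.rOut ⊆ X) :
    pd i (mollify φ (X.indicator w)) z = mollify φ (X.indicator v) z := by
  have hwi : LocallyIntegrable (X.indicator w) :=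
    (MemLp.locallyIntegrable ((memLp_indicator_iff_restrict hX.measurableSet).2 hw) (by norm_num))
  have hd := φ.hasCompactSupport_normed (μ := (volume : Measure Plane)).hasFDerivAt_convolution_left
    (ContinuousLinearMap.lsmul ℝ ℝ) (φ.contDiff_normed (n := 1)) hwi z
  -- The reflected bump is an admissible test function because its support lies in the given ball.
  -- Reflection changes the sign of its derivative, which cancels the sign in the weak derivative.
  set ψ : Plane → ℝ := fun y => φ.normed volume (z - y) with hψ
  have hψs : ContDiff ℝ ∞ ψ := (φ.contDiff_normed).comp (contDiff_const.sub contDiff_id)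
  have hψt : tsupport ψ ⊆ Metric.closedBall z φ.rOut := by
    refine closure_minimal (fun y hy => ?_) Metric.isClosed_closedBall
    have : z - y ∈ Function.support (φ.normed (volume : Measure Plane)) := hy
    rw [φ.support_normed_eq] at this
    simpa [dist_eq_norm, norm_sub_rev] using (mem_ball_zero_iff.1 this).le
  have hψc : HasCompactSupport ψ :=
    (isCompact_closedBall z φ.rOut).of_isClosed_subset (isClosed_tsupport _) hψt
  have hpd : ∀ y, pd i ψ y = -pd i (φ.normed volume) (z - y) := by
    intro y
    have h1 : DifferentiableAt ℝ (φ.normed (volume : Measure Plane)) (z - y) :=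
      (φ.contDiff_normed (n := 1)).differentiable (by simp) _
    have h2 : HasFDerivAt ψ _ y := h1.hasFDerivAt.comp y ((hasFDerivAt_id y).const_sub z)
    simp only [pd]
    rw [h2.fderiv]
    simp
  have hw2 := isWeakDeriv_single_iff.1 h ψ hψs hψc (hψt.trans hz)
  have e1 : pd i (mollify φ (X.indicator w)) z =
      ∫ t, pd i (φ.normed volume) t * X.indicator w (z - t) := by
    have hint : Integrable fun t => ((ContinuousLinearMap.lsmul ℝ ℝ).precompL Plane
        (fderiv ℝ (φ.normed (volume : Measure Plane)) t)) (X.indicator w (z - t)) :=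
      (φ.hasCompactSupport_normed.fderiv (𝕜 := ℝ)).convolutionExists_left _
        ((φ.contDiff_normed (n := 1)).continuous_fderiv (by simp)) hwi z
    rw [pd_apply]
    change fderiv ℝ (φ.normed volume ⋆[ContinuousLinearMap.lsmul ℝ ℝ, volume] _) z (stdVec i) = _
    rw [hd.fderiv, convolution_def, ContinuousLinearMap.integral_apply hint]
    rfl
  rw [e1, mollify_apply]
  have s1 := integral_sub_left_eq_self (fun t => pd i (φ.normed volume) t * X.indicator w (z - t))
    (volume : Measure Plane) z
  have s2 := integral_sub_left_eq_self (fun t => φ.normed volume t * X.indicator v (z - t))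
    (volume : Measure Plane) z
  rw [← s1, ← s2]
  simp only [sub_sub_cancel]
  have t1 : ∀ (u : Plane → ℝ) (θ : Plane → ℝ), ∫ x, θ (z - x) * X.indicator u x =
      ∫ x in X, u x * θ (z - x) := by
    intro u θ
    rw [← integral_indicator hX.measurableSet]
    congr 1; ext x
    by_cases hx : x ∈ X <;> simp [hx, mul_comm]
  rw [t1, t1]
  simp only [hpd] at hw2
  simp only [mul_neg, integral_neg, neg_inj] at hw2
  exact hw2

theorem pd_comp_dilation {u : Plane → ℝ} (hu : Differentiable ℝ u) (c : Plane) (r : ℝ) (i : Fin 2)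
    (x : Plane) : pd i (fun y => u (dilation c r y)) x = r * pd i u (dilation c r x) := by
  have := (hu (dilation c r x)).hasFDerivAt.comp x (hasFDerivAt_dilation c r x)
  simp only [pd]
  rw [show (fun y => u (dilation c r y)) = u ∘ dilation c r from rfl, this.fderiv]
  simp

/-- Each point of the small ball is the convex combination of `x`, with weight `1 - r`, and of a
point of `closedBall c δ`, with weight `r`. This is why the mollification radius in `smoothing` is
proportional to the contraction parameter: mollification never reaches outside of `X`. -/
theorem closedBall_dilation_subset {X : Set Plane} (hX : Convex ℝ X) {c : Plane} {δ : ℝ}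
    (hc : Metric.closedBall c δ ⊆ X) {r : ℝ} (hr0 : 0 < r) (hr1 : r < 1) {x : Plane} (hx : x ∈ X) :
    Metric.closedBall (dilation c (1 - r) x) (r * δ) ⊆ X := by
  intro y hy
  have hy' : c + r⁻¹ • (y - dilation c (1 - r) x) ∈ X := by
    apply hc
    rw [mem_closedBall_iff_norm, add_sub_cancel_left, norm_smul, norm_inv,
      Real.norm_of_nonneg hr0.le, inv_mul_le_iff₀ hr0]
    exact mem_closedBall_iff_norm.1 hy
  have := hX hy' hx hr0.le (by linarith : 0 ≤ 1 - r) (by ring)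
  convert this using 1
  unfold dilation
  rw [smul_add, smul_smul, mul_inv_cancel₀ hr0.ne']
  module

/-- Density of smooth functions in `H¹` of a bounded convex open set. -/
theorem IsH1.exists_smooth_approx {X : Set Plane} (hX : IsOpen X) (hconv : Convex ℝ X)
    (hne : X.Nonempty) (hb : Bornology.IsBounded X) {w : Plane → ℝ} {v : Fin 2 → Plane → ℝ}
    (h : IsH1 X w v) :
    ∃ u : ℕ → Plane → ℝ, (∀ n, ContDiff ℝ ∞ (u n)) ∧
      Tendsto (fun n => ∫ x in X, (u n x - w x) ^ 2) atTop (𝓝 0) ∧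
      ∀ i, Tendsto (fun n => ∫ x in X, (pd i (u n) x - v i x) ^ 2) atTop (𝓝 0) := by
  obtain ⟨c, hc⟩ := hne
  obtain ⟨δ, hδ, hδX⟩ := Metric.nhds_basis_closedBall.mem_iff.1 (hX.mem_nhds hc)
  have hW : ∀ {f : Plane → ℝ}, MemLp f 2 (volume.restrict X) → MemLp (X.indicator f) 2 :=
    fun hf => (memLp_indicator_iff_restrict hX.measurableSet).2 hf
  have hL : ∀ {f : Plane → ℝ}, MemLp f 2 (volume.restrict X) →
      LocallyIntegrable (X.indicator f) := fun hf => (hW hf).locallyIntegrable (by norm_num)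
  have hs := fun n => contDiff_smoothing (hL h.memLp) c hδ n
  refine ⟨fun n => smoothing c δ hδ n (X.indicator w), hs, ?_, fun i => ?_⟩
  · refine (tendsto_smoothing hX.measurableSet hb (hW h.memLp) c hδ).congr fun n => ?_
    exact setIntegral_congr_fun hX.measurableSet fun x hx => by simp [hx]
  · have key : ∀ n, ∀ x ∈ X, pd i (smoothing c δ hδ n (X.indicator w)) x =
        (1 - (n + 2 : ℝ)⁻¹) * smoothing c δ hδ n (X.indicator (v i)) x := by
      intro n x hx
      have hn0 : (0 : ℝ) < (n + 2 : ℝ)⁻¹ := by positivity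
      have hn1 := inv_add_two_le_half n
      have := pd_comp_dilation (differentiable_of_smooth (contDiff_mollify
        (φ := bumpOfRadius ((n + 2 : ℝ)⁻¹ * δ) (by positivity)) (hL h.memLp))) c
        (1 - (n + 2 : ℝ)⁻¹) i x
      rw [show smoothing c δ hδ n (X.indicator w) = fun y =>
        mollify (bumpOfRadius ((n + 2 : ℝ)⁻¹ * δ) (by positivity)) (X.indicator w)
          (dilation c (1 - (n + 2 : ℝ)⁻¹) y) from rfl, this,
        pd_mollify hX h.memLp (h.weak i)]
      · rfl
      · exact closedBall_dilation_subset hconv hδX hn0 (by linarith) hx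
    have hlim := tendsto_smoothing hX.measurableSet hb (hW (h.memLp_grad i)) c hδ
    set s := fun n => smoothing c δ hδ n (X.indicator (v i))
    -- The chain rule leaves a factor `1 - ε` before the smoothed derivative. Its defect `ε v` is
    -- estimated separately and tends to zero.
    have hlim2 : Tendsto (fun n : ℕ => 2 * (∫ x in X, (s n x - X.indicator (v i) x) ^ 2) +
        2 * ((n + 2 : ℝ)⁻¹ ^ 2 * ∫ x in X, (v i x) ^ 2)) atTop (𝓝 0) := by
      have h2 := (((tendsto_inv_add_two.pow 2)).mul_const
        (∫ x in X, v i x ^ 2)).const_mul 2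
      simpa using (hlim.const_mul 2).add h2
    refine squeeze_zero (fun n => integral_nonneg fun x => sq_nonneg _) (fun n => ?_) hlim2
    have hn0 : (0 : ℝ) < (n + 2 : ℝ)⁻¹ := by positivity
    have hn1 := inv_add_two_le_half n
    set ε := (n + 2 : ℝ)⁻¹
    have m1 : MemLp (fun x => (1 - ε) * (s n x - v i x)) 2 (volume.restrict X) :=
      ((memLp_of_continuous_of_isBounded hb
        (contDiff_smoothing (hL (h.memLp_grad i)) c hδ n).continuous).sub
          (h.memLp_grad i)).const_mul _
    have m2 : MemLp (fun x => ε * v i x) 2 (volume.restrict X) := (h.memLp_grad i).const_mul _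
    have h1 := integral_sub_sq_le m1 m2
    have e1 : ∫ x in X, (pd i (smoothing c δ hδ n (X.indicator w)) x - v i x) ^ 2 =
        ∫ x in X, ((1 - ε) * (s n x - v i x) - ε * v i x) ^ 2 :=
      setIntegral_congr_fun hX.measurableSet fun x hx => by
        simp only [key n x hx]; ring
    have e2 : ∫ x in X, (s n x - X.indicator (v i) x) ^ 2 = ∫ x in X, (s n x - v i x) ^ 2 :=
      setIntegral_congr_fun hX.measurableSet fun x hx => by
        simp only [indicator_of_mem hx]
    rw [e1, e2]
    simp only [mul_pow, integral_const_mul] at h1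
    have h0 := integral_sq_nonneg (μ := volume.restrict X) fun x => s n x - v i x
    have : (1 - ε) ^ 2 ≤ 1 := by nlinarith
    nlinarith

end

end HHO

namespace HHO

noncomputable section

open Filter
open scoped Topology ENNReal

/-! ### The Poincaré inequality on convex sets -/

theorem lintegral_comp_dilation {F : Plane → ℝ≥0∞} (hF : Measurable F) (c : Plane) {r : ℝ}
    (hr : 0 < r) :
    ∫⁻ x, F (dilation c r x) = ENNReal.ofReal (r ^ 2)⁻¹ * ∫⁻ x, F x := by
  unfold dilation
  rw [lintegral_sub_right_eq_self (fun x => F (c + r • x)) c]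
  have h1 : ∫⁻ x, F (c + r • x) = ∫⁻ x, F (c + x) ∂(Measure.map (r • ·) (volume : Measure Plane)) :=
    (lintegral_map (f := fun x => F (c + x)) (hF.comp (measurable_const_add c))
      (measurable_const_smul r)).symm
  rw [h1, Measure.map_addHaar_smul volume hr.ne', lintegral_smul_measure,
    lintegral_add_left_eq_self F c]
  simp [abs_of_pos hr]

theorem sq_intervalIntegral_le {h : ℝ → ℝ} (hh : Continuous h) :
    (∫ t in (0 : ℝ)..1, h t) ^ 2 ≤ ∫ t in (0 : ℝ)..1, h t ^ 2 := by
  set m := ∫ t in (0 : ℝ)..1, h t with hm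
  have key : 0 ≤ ∫ t in (0 : ℝ)..1, (h t - m) ^ 2 :=
    intervalIntegral.integral_nonneg (by norm_num) fun t _ => sq_nonneg _
  have e : ∀ t, (h t - m) ^ 2 = h t ^ 2 - 2 * m * h t + m ^ 2 := fun t => by ring
  simp only [e] at key
  rw [intervalIntegral.integral_add (by apply Continuous.intervalIntegrable; fun_prop) (by simp),
    intervalIntegral.integral_sub (by apply Continuous.intervalIntegrable; fun_prop)
      (by apply Continuous.intervalIntegrable; fun_prop), intervalIntegral.integral_const_mul,
    ← hm] at key
  simp at key
  linarith

/-- The square of the euclidean norm of the gradient. -/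
def gradSq (u : Plane → ℝ) (x : Plane) : ℝ := pd 0 u x ^ 2 + pd 1 u x ^ 2

theorem gradSq_nonneg (u : Plane → ℝ) (x : Plane) : 0 ≤ gradSq u x := by
  unfold gradSq; positivity

theorem continuous_gradSq {u : Plane → ℝ} (hu : ContDiff ℝ ∞ u) : Continuous (gradSq u) :=
  ((contDiff_pd hu 0).continuous.pow 2).add ((contDiff_pd hu 1).continuous.pow 2)

theorem sq_fderiv_le (u : Plane → ℝ) (x v : Plane) :
    (fderiv ℝ u x v) ^ 2 ≤ ‖v‖ ^ 2 * gradSq u x := by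
  rw [fderiv_eq_sum_pd, EuclideanSpace.norm_sq_eq, gradSq]
  simp only [Fin.sum_univ_two, Real.norm_eq_abs, sq_abs]
  nlinarith [sq_nonneg (v 0 * pd 1 u x - v 1 * pd 0 u x)]

theorem hasDerivAt_comp_line {u : Plane → ℝ} (hu : Differentiable ℝ u) (x v : Plane) (t : ℝ) :
    HasDerivAt (fun s => u (x + s • v)) (fderiv ℝ u (x + t • v) v) t := by
  have h1 : HasDerivAt (fun s : ℝ => x + s • v) v t := by
    simpa using ((hasDerivAt_id t).smul_const v).const_add x
  exact (hu _).hasFDerivAt.comp_hasDerivAt t h1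

/-- Fundamental theorem of calculus along the segment, then Jensen in `t` and Cauchy–Schwarz in the
plane. -/
theorem sq_sub_le_segment {u : Plane → ℝ} (hu : ContDiff ℝ ∞ u) (x y : Plane) :
    (u y - u x) ^ 2 ≤ ‖y - x‖ ^ 2 * ∫ t in (0 : ℝ)..1, gradSq u (x + t • (y - x)) := by
  have hd := differentiable_of_smooth hu
  have hc1 : Continuous fun t : ℝ => fderiv ℝ u (x + t • (y - x)) (y - x) :=
    ((hu.continuous_fderiv (by simp)).comp (by fun_prop)).clm_apply continuous_const
  have hc2 : Continuous fun t : ℝ => gradSq u (x + t • (y - x)) :=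
    (continuous_gradSq hu).comp (by fun_prop)
  have h1 : u y - u x = ∫ t in (0 : ℝ)..1, fderiv ℝ u (x + t • (y - x)) (y - x) := by
    rw [intervalIntegral.integral_eq_sub_of_hasDerivAt
      (fun t _ => hasDerivAt_comp_line hd x (y - x) t) (hc1.intervalIntegrable _ _)]
    simp
  rw [h1, ← intervalIntegral.integral_const_mul]
  refine (sq_intervalIntegral_le hc1).trans (intervalIntegral.integral_mono_on (by norm_num)
    ((hc1.pow 2).intervalIntegrable _ _) ((hc2.const_mul _).intervalIntegrable _ _)
    fun t _ => sq_fderiv_le _ _ _)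

/-- For fixed `t` the point `x + t (y - x)` is a dilation of `y` with ratio `t` and of `x` with
ratio `1 - t`. Integrating first in the variable whose ratio is at least `1/2` bounds the Jacobian
by 4. -/
theorem lintegral_segment_le {X : Set Plane} {F : Plane → ℝ≥0∞} (hF : Measurable F) {t : ℝ}
    (ht0 : 0 < t) :
    ∫⁻ x in X, ∫⁻ y in X, F (x + t • (y - x)) ≤ volume X * (4 * ∫⁻ x, F x) := by
  have hm : Measurable fun p : Plane × Plane => F (p.1 + t • (p.2 - p.1)) :=
    hF.comp (by fun_prop)
  have four : ∀ r : ℝ, 1 / 2 ≤ r → ENNReal.ofReal (r ^ 2)⁻¹ ≤ 4 := by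
    intro r hr
    rw [show (4 : ℝ≥0∞) = ENNReal.ofReal 4 by simp]
    refine ENNReal.ofReal_le_ofReal ?_
    rw [inv_le_comm₀ (by positivity) (by norm_num)]
    nlinarith
  have bound : ∀ G : Plane → Plane → ℝ≥0∞, (∀ x, ∫⁻ y in X, G x y ≤ 4 * ∫⁻ z, F z) →
      ∫⁻ x in X, ∫⁻ y in X, G x y ≤ volume X * (4 * ∫⁻ x, F x) := by
    intro G hG
    calc _ ≤ ∫⁻ x in X, (4 * ∫⁻ z, F z) := lintegral_mono fun x => hG x
      _ = _ := by rw [setLIntegral_const, mul_comm]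
  rcases le_or_gt (1 / 2) t with h | h
  · refine bound _ fun x => ?_
    refine (setLIntegral_le_lintegral _ _).trans ?_
    have := lintegral_comp_dilation hF x ht0
    unfold dilation at this
    rw [this]
    gcongr
    exact four t h
  · rw [lintegral_lintegral_swap hm.aemeasurable]
    refine bound _ fun y => ?_
    refine (setLIntegral_le_lintegral _ _).trans ?_
    have := lintegral_comp_dilation hF y (r := 1 - t) (by linarith)
    unfold dilation at this
    have e : ∀ x, x + t • (y - x) = y + (1 - t) • (x - y) := fun x => by module
    simp only [e]
    rw [this]
    gcongr
    exact four _ (by linarith)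

/-- The double integral of `(u y - u x)²` is estimated along segments, which stay in `X` by
convexity. Lower Lebesgue integrals make the exchanges of integrals free of integrability
conditions. -/
theorem poincare_convex_smooth {X : Set Plane} (hX : IsOpen X) (hconv : Convex ℝ X)
    (hne : X.Nonempty) (hb : Bornology.IsBounded X) {d : ℝ} (hd : ∀ x ∈ X, ∀ y ∈ X, dist x y ≤ d)
    {u : Plane → ℝ} (hu : ContDiff ℝ ∞ u) :
    ∃ c, ∫ x in X, (u x - c) ^ 2 ≤ 4 * d ^ 2 * ∑ i, ∫ x in X, pd i u x ^ 2 := by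
  set F : Plane → ℝ≥0∞ := X.indicator fun x => ENNReal.ofReal (gradSq u x) with hF
  have hFm : Measurable F :=
    (ENNReal.measurable_ofReal.comp (continuous_gradSq hu).measurable).indicator hX.measurableSet
  have hd0 : 0 ≤ d := by
    obtain ⟨x, hx⟩ := hne
    exact dist_nonneg.trans (hd x hx x hx)
  have hvol0 : volume X ≠ 0 := (hX.measure_pos volume hne).ne'
  have hvol1 : volume X ≠ ⊤ := hb.measure_lt_top.ne
  have hint : ∀ i, IntegrableOn (fun x => pd i u x ^ 2) X := fun i =>
    (memLp_of_continuous_of_isBounded hb (contDiff_pd hu i).continuous).integrable_sq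
  have hFint : ∫⁻ x, F x = ENNReal.ofReal (∑ i, ∫ x in X, pd i u x ^ 2) := by
    rw [hF, lintegral_indicator hX.measurableSet, ← ofReal_integral_eq_lintegral_ofReal]
    · congr 1
      simp only [gradSq, Fin.sum_univ_two]
      exact integral_add (hint 0) (hint 1)
    · exact (hint 0).add (hint 1)
    · exact Eventually.of_forall fun x => gradSq_nonneg u x
  have pt : ∀ x ∈ X, ∀ y ∈ X, ENNReal.ofReal ((u y - u x) ^ 2) ≤
      ENNReal.ofReal (d ^ 2) * ∫⁻ t in Ioc (0 : ℝ) 1, F (x + t • (y - x)) := by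
    intro x hx y hy
    have hc2 : Continuous fun t : ℝ => gradSq u (x + t • (y - x)) :=
      (continuous_gradSq hu).comp (by fun_prop)
    have h1 : ∫⁻ t in Ioc (0 : ℝ) 1, F (x + t • (y - x)) =
        ENNReal.ofReal (∫ t in (0 : ℝ)..1, gradSq u (x + t • (y - x))) := by
      rw [intervalIntegral.integral_of_le (by norm_num), ofReal_integral_eq_lintegral_ofReal]
      · refine setLIntegral_congr_fun measurableSet_Ioc fun t ht => ?_
        have : x + t • (y - x) ∈ X := hconv.add_smul_sub_mem hx hy ⟨ht.1.le, ht.2⟩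
        simp only [hF, indicator_of_mem this]
      · exact (hc2.intervalIntegrable 0 1).1
      · exact Eventually.of_forall fun t => gradSq_nonneg u _
    rw [h1, ← ENNReal.ofReal_mul (by positivity)]
    refine ENNReal.ofReal_le_ofReal ((sq_sub_le_segment hu x y).trans ?_)
    have h2 : 0 ≤ ∫ t in (0 : ℝ)..1, gradSq u (x + t • (y - x)) :=
      intervalIntegral.integral_nonneg (by norm_num) fun t _ => gradSq_nonneg u _
    have h3 : ‖y - x‖ ≤ d := by rw [← dist_eq_norm]; exact hd y hy x hx
    gcongr
  have hmeas : Measurable fun p : (Plane × Plane) × ℝ => F (p.1.1 + p.2 • (p.1.2 - p.1.1)) :=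
    hFm.comp (by fun_prop)
  have total : ∫⁻ x in X, ∫⁻ y in X, ENNReal.ofReal ((u y - u x) ^ 2) ≤
      ENNReal.ofReal (d ^ 2) * (volume X * (4 * ∫⁻ x, F x)) := by
    have m1 : Measurable fun p : Plane × Plane =>
        ∫⁻ t in Ioc (0 : ℝ) 1, F (p.1 + t • (p.2 - p.1)) := hmeas.lintegral_prod_right'
    have s1 : ∫⁻ x in X, ∫⁻ y in X, ENNReal.ofReal ((u y - u x) ^ 2) ≤
        ∫⁻ x in X, ∫⁻ y in X,
          ENNReal.ofReal (d ^ 2) * ∫⁻ t in Ioc (0 : ℝ) 1, F (x + t • (y - x)) :=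
      setLIntegral_mono' hX.measurableSet fun x hx =>
        setLIntegral_mono' hX.measurableSet fun y hy => pt x hx y hy
    refine s1.trans ?_
    have s2 : ∀ x, ∫⁻ y in X, ENNReal.ofReal (d ^ 2) *
        ∫⁻ t in Ioc (0 : ℝ) 1, F (x + t • (y - x)) = ENNReal.ofReal (d ^ 2) *
        ∫⁻ t in Ioc (0 : ℝ) 1, ∫⁻ y in X, F (x + t • (y - x)) := by
      intro x
      rw [lintegral_const_mul (f := fun y => ∫⁻ t in Ioc (0 : ℝ) 1, F (x + t • (y - x))) _
        (m1.comp measurable_prodMk_left)]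
      congr 1
      exact lintegral_lintegral_swap (f := fun y t => F (x + t • (y - x)))
        (hFm.comp (by fun_prop)).aemeasurable
    simp only [s2]
    have m2 : Measurable fun p : Plane × ℝ => ∫⁻ y in X, F (p.1 + p.2 • (y - p.1)) := by
      have : Measurable fun q : (Plane × ℝ) × Plane => F (q.1.1 + q.1.2 • (q.2 - q.1.1)) :=
        hFm.comp (by fun_prop)
      exact this.lintegral_prod_right'
    rw [lintegral_const_mul _ m2.lintegral_prod_right']
    gcongr
    rw [lintegral_lintegral_swap m2.aemeasurable]
    calc _ ≤ ∫⁻ t in Ioc (0 : ℝ) 1, (volume X * (4 * ∫⁻ x, F x)) :=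
          setLIntegral_mono' measurableSet_Ioc fun t ht => lintegral_segment_le hFm ht.1
      _ = _ := by simp
  have m3 : Measurable fun x => ∫⁻ y in X, ENNReal.ofReal ((u y - u x) ^ 2) := by
    have : Measurable fun p : Plane × Plane => ENNReal.ofReal ((u p.2 - u p.1) ^ 2) := by
      have := hu.continuous.measurable
      fun_prop
    exact this.lintegral_prod_right'
  -- Some `x` does no worse than the average over `X`; the constant is the value of `u` there.
  obtain ⟨x, -, hx⟩ := exists_le_setLAverage hvol0 hvol1 m3.aemeasurable
  refine ⟨u x, ?_⟩
  rw [setLAverage_eq] at hx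
  have h4 : ∫⁻ y in X, ENNReal.ofReal ((u y - u x) ^ 2) ≤
      ENNReal.ofReal (4 * d ^ 2 * ∑ i, ∫ x in X, pd i u x ^ 2) := by
    refine hx.trans (ENNReal.div_le_of_le_mul (total.trans (le_of_eq ?_)))
    rw [hFint, ENNReal.ofReal_mul (by positivity), ENNReal.ofReal_mul (by positivity)]
    simp
    ring
  rw [← ofReal_integral_eq_lintegral_ofReal _ (Eventually.of_forall fun x => sq_nonneg _)] at h4
  · refine (ENNReal.ofReal_le_ofReal_iff ?_).1 h4
    have := Finset.sum_nonneg fun i (_ : i ∈ (Finset.univ : Finset (Fin 2))) =>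
      integral_sq_nonneg (μ := volume.restrict X) (pd i u)
    positivity
  · exact (memLp_of_continuous_of_isBounded hb (hu.continuous.sub continuous_const)).integrable_sq

/-- The mean is the best constant: the two sides differ by the total mass times `(m - c)²`. -/
theorem integral_sq_sub_average_le {α : Type*} [MeasurableSpace α] {μ : Measure α}
    [IsFiniteMeasure μ] {f : α → ℝ} (hf : MemLp f 2 μ) (c : ℝ) :
    ∫ x, (f x - ⨍ y, f y ∂μ) ^ 2 ∂μ ≤ ∫ x, (f x - c) ^ 2 ∂μ := by
  set m := ⨍ y, f y ∂μ with hm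
  have hi : Integrable f μ := hf.integrable (by norm_num)
  have i1 : Integrable (fun x => (f x - c) ^ 2) μ := (hf.sub (memLp_const c)).integrable_sq
  have i2 : Integrable (fun x => 2 * (m - c) * f x) μ := hi.const_mul _
  have i3 : Integrable (fun x => (f x - c) ^ 2 - 2 * (m - c) * f x) μ := i1.sub i2
  have e : ∀ x, (f x - m) ^ 2 = (f x - c) ^ 2 - 2 * (m - c) * f x + (m - c) * (m + c) :=
    fun x => by ring
  simp only [e]
  rw [integral_add i3 (integrable_const _), integral_sub i1 i2, integral_const_mul, integral_const]
  have h : μ.real univ • m = ∫ x, f x ∂μ := measure_smul_average μ f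
  rw [← h]
  simp only [smul_eq_mul]
  nlinarith [mul_nonneg (measureReal_nonneg : 0 ≤ μ.real univ) (sq_nonneg (m - c))]

/-- The Poincaré–Wirtinger inequality on a bounded convex open set. -/
theorem IsH1.poincare_convex {X : Set Plane} (hX : IsOpen X) (hconv : Convex ℝ X)
    (hb : Bornology.IsBounded X) {d : ℝ} (hd : ∀ x ∈ X, ∀ y ∈ X, dist x y ≤ d)
    {w : Plane → ℝ} {v : Fin 2 → Plane → ℝ} (h : IsH1 X w v) :
    ∃ c, ∫ x in X, (w x - c) ^ 2 ≤ 16 * d ^ 2 * ∑ i, ∫ x in X, v i x ^ 2 := by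
  rcases X.eq_empty_or_nonempty with rfl | hne
  · exact ⟨0, by simp⟩
  have : IsFiniteMeasure (volume.restrict X) := ⟨by simpa using hb.measure_lt_top (μ := volume)⟩
  obtain ⟨u, hu, hu0, hui⟩ := h.exists_smooth_approx hX hconv hne hb
  -- The constants of the approximants vary with `n`, but the mean of `w` does at least as well as
  -- each of them, so it can be fixed before the limit. The constant is `16 = 2·4·2`.
  refine ⟨⨍ x in X, w x, ?_⟩
  have hlim : Tendsto (fun n => 2 * (∫ x in X, (u n x - w x) ^ 2) +
      2 * (4 * d ^ 2 * ∑ i, (2 * (∫ x in X, (pd i (u n) x - v i x) ^ 2) +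
        2 * ∫ x in X, v i x ^ 2))) atTop (𝓝 (2 * 0 + 2 * (4 * d ^ 2 * ∑ i, (2 * 0 +
        2 * ∫ x in X, v i x ^ 2)))) := by
    refine (hu0.const_mul 2).add (((tendsto_finsetSum _ fun i _ => ?_).const_mul _).const_mul 2)
    exact ((hui i).const_mul 2).add tendsto_const_nhds
  have e : 16 * d ^ 2 * ∑ i, ∫ x in X, v i x ^ 2 = 2 * 0 + 2 * (4 * d ^ 2 * ∑ i, (2 * 0 +
        2 * ∫ x in X, v i x ^ 2)) := by
    simp only [Fin.sum_univ_two]; ring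
  rw [e]
  refine ge_of_tendsto hlim (Eventually.of_forall fun n => ?_)
  obtain ⟨c, hc⟩ := poincare_convex_smooth hX hconv hne hb hd (hu n)
  have mu := memLp_of_continuous_of_isBounded (μ := volume) hb (hu n).continuous
  refine (integral_sq_sub_average_le h.memLp c).trans ?_
  have h1 := integral_sub_sq_le (mu.sub (memLp_const c)) (mu.sub h.memLp)
  have h2 : ∀ i, ∫ x in X, pd i (u n) x ^ 2 ≤ 2 * (∫ x in X, (pd i (u n) x - v i x) ^ 2) +
        2 * ∫ x in X, v i x ^ 2 := by
    intro i
    have := integral_add_sq_le ((memLp_of_continuous_of_isBounded (μ := volume) hb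
      (contDiff_pd (hu n) i).continuous).sub (h.memLp_grad i)) (h.memLp_grad i)
    simpa using this
  have h3 := Finset.sum_le_sum fun i (_ : i ∈ (Finset.univ : Finset (Fin 2))) => h2 i
  have e1 : ∫ x in X, (w x - c) ^ 2 = ∫ x in X, ((u n x - c) - (u n x - w x)) ^ 2 := by
    congr 1; ext x; ring
  rw [e1]
  refine h1.trans ?_
  simp only [Pi.sub_apply]
  have h4 := hc.trans (mul_le_mul_of_nonneg_left h3 (by positivity))
  linarith

end

end HHO

namespace HHO

noncomputable section

open Filter
open scoped Topology ENNReal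

/-! ### Affine coordinates of the plane -/

/-- The determinant of two vectors of the plane. -/
def cross (p q : Plane) : ℝ := p 0 * q 1 - p 1 * q 0

/-- The rotation by a quarter turn. -/
def perp (n : Plane) : Plane := !₂[-n 1, n 0]

@[simp] theorem perp_zero (n : Plane) : perp n 0 = -n 1 := rfl
@[simp] theorem perp_one (n : Plane) : perp n 1 = n 0 := rfl

theorem inner_eq (p q : Plane) : inner ℝ p q = p 0 * q 0 + p 1 * q 1 := by
  simp [PiLp.inner_apply, Fin.sum_univ_two, mul_comm]

theorem norm_sq_eq (p : Plane) : ‖p‖ ^ 2 = p 0 ^ 2 + p 1 ^ 2 := by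
  rw [EuclideanSpace.norm_sq_eq]; simp [Fin.sum_univ_two]

theorem norm_perp (n : Plane) : ‖perp n‖ = ‖n‖ := by
  have : ‖perp n‖ ^ 2 = ‖n‖ ^ 2 := by rw [norm_sq_eq, norm_sq_eq]; simp; ring
  exact (sq_eq_sq₀ (norm_nonneg _) (norm_nonneg _)).1 this

theorem cross_perp_self (n : Plane) : cross (perp n) n = -‖n‖ ^ 2 := by
  rw [norm_sq_eq, cross]; simp; ring

/-- The point of coordinates `z` in the affine frame `(o, p, q)`. -/
def frame (o p q : Plane) (z : ℝ × ℝ) : Plane := o + z.1 • p + z.2 • q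

theorem continuous_frame (o p q : Plane) : Continuous (frame o p q) := by
  unfold frame; fun_prop

theorem map_frame (o p q : Plane) (h : cross p q ≠ 0) :
    Measure.map (frame o p q) volume = ENNReal.ofReal |(cross p q)⁻¹| • volume := by
  let Mt : Matrix (Fin 2) (Fin 2) ℝ := !![p 0, q 0; p 1, q 1]
  let lin : Plane →ₗ[ℝ] Plane := Matrix.toLin (EuclideanSpace.basisFun (Fin 2) ℝ).toBasis
    (EuclideanSpace.basisFun (Fin 2) ℝ).toBasis Mt
  have hdet : LinearMap.det lin = cross p q := by
    rw [LinearMap.det_toLin, Matrix.det_fin_two]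
    simp [Mt, cross]; ring
  have happ : ∀ x : Plane, lin x = x 0 • p + x 1 • q := by
    intro x
    simp only [lin, Matrix.toLin_apply]
    ext i
    fin_cases i <;> simp [Mt, Matrix.mulVec, dotProduct, Fin.sum_univ_two] <;> ring
  have e1 : MeasurePreserving (MeasurableEquiv.finTwoArrow (α := ℝ)).symm volume volume :=
    (volume_preserving_finTwoArrow ℝ).symm _
  have e2 := PiLp.volume_preserving_toLp (Fin 2)
  have e3 := e2.comp e1
  have hcomp : frame o p q = (fun x => o + x) ∘ lin ∘
      ((WithLp.toLp 2) ∘ (MeasurableEquiv.finTwoArrow (α := ℝ)).symm) := by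
    ext z i
    simp [happ, frame, MeasurableEquiv.finTwoArrow, add_assoc]
  have hl : Measurable lin := (LinearMap.continuous_of_finiteDimensional lin).measurable
  rw [hcomp, ← Measure.map_map (measurable_const_add o) (hl.comp e3.measurable),
    ← Measure.map_map hl e3.measurable, e3.map_eq,
    Measure.map_linearMap_addHaar_eq_smul_addHaar volume (by rw [hdet]; exact h), hdet,
    Measure.map_smul, map_add_left_eq_self]

theorem lintegral_frame (o p q : Plane) (h : cross p q ≠ 0) {F : Plane → ℝ≥0∞}
    (hF : Measurable F) :
    ∫⁻ s : ℝ, ∫⁻ t : ℝ, F (o + s • p + t • q) = ENNReal.ofReal |(cross p q)⁻¹| * ∫⁻ x, F x := by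
  rw [← smul_eq_mul, ← lintegral_smul_measure, ← map_frame o p q h,
    lintegral_map hF (continuous_frame o p q).measurable, Measure.volume_eq_prod,
    lintegral_prod (fun z => F (frame o p q z)) (hF.comp (continuous_frame o p q).measurable).aemeasurable]
  rfl

/-! ### Arc length on lines and segments -/

/-- The line through `o` with direction `τ`. -/
def lineMap (o τ : Plane) (t : ℝ) : Plane := o + t • τ

theorem isometry_lineMap (o : Plane) {τ : Plane} (hτ : ‖τ‖ = 1) : Isometry (lineMap o τ) := by
  refine Isometry.of_dist_eq fun s t => ?_
  rw [dist_eq_norm, dist_eq_norm]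
  have : lineMap o τ s - lineMap o τ t = (s - t) • τ := by unfold lineMap; module
  rw [this, norm_smul, hτ, mul_one]

/-- Arc length is a Hausdorff measure, carried by isometries, and on the real line it is Lebesgue
measure. All boundary integrals become one-dimensional through this identity. -/
theorem map_lineMap (o : Plane) {τ : Plane} (hτ : ‖τ‖ = 1) :
    Measure.map (lineMap o τ) volume = arcLength.restrict (range (lineMap o τ)) := by
  rw [← hausdorffMeasure_real]
  exact (isometry_lineMap o hτ).map_hausdorffMeasure (Or.inl zero_le_one)

theorem measurableEmbedding_lineMap (o : Plane) {τ : Plane} (hτ : ‖τ‖ = 1) :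
    MeasurableEmbedding (lineMap o τ) :=
  (isometry_lineMap o hτ).isClosedEmbedding.measurableEmbedding

theorem setIntegral_image_lineMap (o : Plane) {τ : Plane} (hτ : ‖τ‖ = 1) (I : Set ℝ)
    (f : Plane → ℝ) :
    ∫ x in lineMap o τ '' I, f x ∂arcLength = ∫ t in I, f (lineMap o τ t) := by
  have hm := measurableEmbedding_lineMap o hτ
  have h1 := hm.setIntegral_map (μ := volume) f (lineMap o τ '' I)
  rw [(isometry_lineMap o hτ).injective.preimage_image] at h1
  rw [← h1, map_lineMap o hτ, Measure.restrict_restrict_of_subset (image_subset_range _ _)]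

theorem integral_range_lineMap (o : Plane) {τ : Plane} (hτ : ‖τ‖ = 1) (f : Plane → ℝ) :
    ∫ x in range (lineMap o τ), f x ∂arcLength = ∫ t, f (lineMap o τ t) := by
  rw [← image_univ, setIntegral_image_lineMap o hτ, setIntegral_univ]

/-- The unit vector from `a` to `b`. -/
def unitDir (a b : Plane) : Plane := ‖b - a‖⁻¹ • (b - a)

theorem norm_unitDir {a b : Plane} (h : a ≠ b) : ‖unitDir a b‖ = 1 := by
  have : ‖b - a‖ ≠ 0 := norm_ne_zero_iff.2 (sub_ne_zero.2 h.symm)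
  simp [unitDir, norm_smul, this]

theorem openSegment_eq_image_lineMap {a b : Plane} (h : a ≠ b) :
    openSegment ℝ a b = lineMap a (unitDir a b) '' Ioo 0 ‖b - a‖ := by
  have hL : 0 < ‖b - a‖ := norm_pos_iff.2 (sub_ne_zero.2 h.symm)
  rw [openSegment_eq_image']
  ext x
  simp only [mem_image, lineMap, unitDir]
  constructor
  · rintro ⟨t, ht, rfl⟩
    refine ⟨t * ‖b - a‖, ⟨by have := ht.1; positivity, by nlinarith [ht.2]⟩, ?_⟩
    rw [smul_smul, mul_assoc, mul_inv_cancel₀ hL.ne', mul_one]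
  · rintro ⟨t, ht, rfl⟩
    refine ⟨t * ‖b - a‖⁻¹, ⟨by have := ht.1; positivity, ?_⟩, by rw [smul_smul]⟩
    rw [← div_eq_mul_inv, div_lt_one hL]; exact ht.2

theorem integral_openSegment {a b : Plane} (h : a ≠ b) (f : Plane → ℝ) :
    ∫ x in openSegment ℝ a b, f x ∂arcLength =
      ‖b - a‖ * ∫ t in (0 : ℝ)..1, f (a + t • (b - a)) := by
  have hL : ‖b - a‖ ≠ 0 := norm_ne_zero_iff.2 (sub_ne_zero.2 h.symm)
  rw [openSegment_eq_image_lineMap h, setIntegral_image_lineMap _ (norm_unitDir h),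
    ← integral_Ioc_eq_integral_Ioo, ← intervalIntegral.integral_of_le (norm_nonneg _)]
  have := intervalIntegral.smul_integral_comp_mul_left (a := 0) (b := 1)
    (fun t => f (lineMap a (unitDir a b) t)) ‖b - a‖
  simp only [mul_zero, mul_one, smul_eq_mul] at this
  rw [← this]
  congr 2; ext t
  simp only [lineMap, unitDir, smul_smul]
  rw [mul_right_comm, mul_inv_cancel₀ hL, one_mul]

theorem arcLength_segment (a b : Plane) : arcLength (segment ℝ a b) = edist a b :=
  hausdorffMeasure_segment a b

theorem arcLength_segment_lt_top (a b : Plane) : arcLength (segment ℝ a b) < ⊤ := by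
  rw [arcLength_segment]; exact edist_lt_top a b

instance : NullSingletonClass arcLength :=
  Measure.nullSingletonClass_hausdorff Plane zero_lt_one

theorem arcLength_finite {s : Set Plane} (hs : s.Finite) : arcLength s = 0 := hs.measure_zero _

/-! ### Green's formula on a half-plane -/

/-- In the orthonormal frame `(perp n, n)` the derivative `pd i` splits into a tangential part,
whose integral over each line parallel to the boundary vanishes, and a normal part, whose integral
over each half-line is the boundary value. -/
theorem integral_halfPlane_pd {f : Plane → ℝ} (hf : ContDiff ℝ ∞ f) (hc : HasCompactSupport f)
    {n : Plane} (hn : ‖n‖ = 1) (o : Plane) (i : Fin 2) :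
    ∫ y in {y | inner ℝ n (y - o) < 0}, pd i f y = n i * ∫ t, f (lineMap o (perp n) t) := by
  have hn2 : n 0 ^ 2 + n 1 ^ 2 = 1 := by rw [← norm_sq_eq, hn, one_pow]
  have hcross : cross (perp n) n = -1 := by rw [cross_perp_self, hn, one_pow]
  have hmap : Measure.map (frame o (perp n) n) volume = volume := by
    rw [map_frame _ _ _ (by rw [hcross]; norm_num), hcross]; simp
  have hframe := continuous_frame o (perp n) n
  set k : ℝ × ℝ → ℝ := fun z => f (frame o (perp n) n z) with hk
  have hframe_proper : IsCompact (frame o (perp n) n ⁻¹' tsupport f) := by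
    have hinv : ∀ z, (inner ℝ (perp n) (frame o (perp n) n z - o), inner ℝ n (frame o (perp n) n z - o)) = z := by
      intro z
      ext
      · simp only [inner_eq, frame, perp_zero, perp_one, PiLp.sub_apply, PiLp.add_apply,
          PiLp.smul_apply, smul_eq_mul]
        linear_combination z.1 * hn2
      · simp only [inner_eq, frame, perp_zero, perp_one, PiLp.sub_apply, PiLp.add_apply,
          PiLp.smul_apply, smul_eq_mul]
        linear_combination z.2 * hn2
    have hcont : Continuous fun x : Plane => ((inner ℝ (perp n) (x - o) : ℝ), (inner ℝ n (x - o) : ℝ)) := by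
      fun_prop
    refine (hc.isCompact.image hcont).of_isClosed_subset
      ((isClosed_tsupport f).preimage hframe) fun z hz => ?_
    exact ⟨_, hz, hinv z⟩
  have hsupp : ∀ (g : Plane → ℝ), tsupport g ⊆ tsupport f →
      HasCompactSupport fun z => g (frame o (perp n) n z) := by
    intro g hg
    refine HasCompactSupport.of_support_subset_isCompact hframe_proper fun z hz => ?_
    exact hg (subset_tsupport g hz)
  have hd := differentiable_of_smooth hf
  set g1 : Plane → ℝ := fun x => fderiv ℝ f x (perp n) with hg1
  set g2 : Plane → ℝ := fun x => fderiv ℝ f x n with hg2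
  have hfd : Continuous (fderiv ℝ f) := hf.continuous_fderiv (by simp)
  have hg1c : Continuous g1 := hfd.clm_apply continuous_const
  have hg2c : Continuous g2 := hfd.clm_apply continuous_const
  have hsub : ∀ v : Plane, tsupport (fun x => fderiv ℝ f x v) ⊆ tsupport f := by
    intro v
    refine (closure_mono fun x hx => ?_).trans (tsupport_fderiv_subset ℝ (f := f))
    intro h; simp [h] at hx
  have hg1i : Integrable fun z => g1 (frame o (perp n) n z) :=
    (hg1c.comp hframe).integrable_of_hasCompactSupport (hsupp g1 (hsub _))
  have hg2i : Integrable fun z => g2 (frame o (perp n) n z) :=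
    (hg2c.comp hframe).integrable_of_hasCompactSupport (hsupp g2 (hsub _))
  have hpd : ∀ x, pd i f x = perp n i * g1 x + n i * g2 x := by
    intro x
    have : stdVec i = perp n i • perp n + n i • n := by
      ext j
      fin_cases i <;> fin_cases j <;> simp [stdVec] <;> linarith
    rw [pd_apply, this]
    simp [hg1, hg2]
  have hH : MeasurableSet {y : Plane | inner ℝ n (y - o) < 0} :=
    (isOpen_lt (by fun_prop) continuous_const).measurableSet
  have hpre : frame o (perp n) n ⁻¹' {y : Plane | inner ℝ n (y - o) < 0} = univ ×ˢ Iio (0 : ℝ) := by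
    ext z
    have : inner ℝ n (frame o (perp n) n z - o) = z.2 := by
      simp only [inner_eq, frame, perp_zero, perp_one, PiLp.sub_apply, PiLp.add_apply,
        PiLp.smul_apply, smul_eq_mul]
      linear_combination z.2 * hn2
    simp [this]
  have hder1 : ∀ s t, HasDerivAt (fun s => f (frame o (perp n) n (s, t)))
      (g1 (frame o (perp n) n (s, t))) s := by
    intro s t
    have h1 : HasDerivAt (fun s : ℝ => frame o (perp n) n (s, t)) (perp n) s := by
      unfold frame
      simpa using (((hasDerivAt_id s).smul_const (perp n)).const_add o).add_const (t • n)
    exact (hd _).hasFDerivAt.comp_hasDerivAt s h1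
  have hder2 : ∀ s t, HasDerivAt (fun t => f (frame o (perp n) n (s, t)))
      (g2 (frame o (perp n) n (s, t))) t := by
    intro s t
    have h1 : HasDerivAt (fun t : ℝ => frame o (perp n) n (s, t)) n t := by
      unfold frame
      simpa using ((hasDerivAt_id t).smul_const n).const_add (o + s • perp n)
    exact (hd _).hasFDerivAt.comp_hasDerivAt t h1
  have hemb : ∀ t : ℝ, Topology.IsClosedEmbedding fun s : ℝ => (s, t) := fun t =>
    Function.LeftInverse.isClosedEmbedding (f := Prod.fst) (fun _ => rfl) (by fun_prop)
      (by fun_prop)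
  have hs1 : ∀ t, HasCompactSupport fun s => f (frame o (perp n) n (s, t)) := fun t =>
    (hsupp f subset_rfl).comp_isClosedEmbedding (g := fun s : ℝ => (s, t)) (hemb t)
  have hs2 : ∀ s, HasCompactSupport fun t => f (frame o (perp n) n (s, t)) := fun s =>
    (hsupp f subset_rfl).comp_isClosedEmbedding (g := fun t : ℝ => (s, t))
      (Function.LeftInverse.isClosedEmbedding (f := Prod.snd) (fun _ => rfl) (by fun_prop)
        (by fun_prop))
  have hI1 : ∫ z in univ ×ˢ Iio (0 : ℝ), g1 (frame o (perp n) n z) = 0 := by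
    rw [Measure.volume_eq_prod, ← Measure.prod_restrict, integral_prod_symm]
    · refine integral_eq_zero_of_ae (Eventually.of_forall fun t => ?_)
      simp only [Measure.restrict_univ, Pi.zero_apply]
      have hc1 : Continuous fun s => g1 (frame o (perp n) n (s, t)) :=
        hg1c.comp (hframe.comp (by fun_prop))
      exact integral_eq_zero_of_hasDerivAt_of_integrable (fun s => hder1 s t)
        (hc1.integrable_of_hasCompactSupport ((hsupp g1 (hsub _)).comp_isClosedEmbedding
          (g := fun s : ℝ => (s, t)) (hemb t)))
        ((hf.continuous.comp (hframe.comp (by fun_prop))).integrable_of_hasCompactSupport (hs1 t))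
    · rw [Measure.prod_restrict, ← Measure.volume_eq_prod]; exact hg1i.integrableOn
  have hI2 : ∫ z in univ ×ˢ Iio (0 : ℝ), g2 (frame o (perp n) n z) =
      ∫ t, f (lineMap o (perp n) t) := by
    rw [Measure.volume_eq_prod, ← Measure.prod_restrict, integral_prod]
    · rw [Measure.restrict_univ]
      congr 1; ext s
      have hde : (fun t => g2 (frame o (perp n) n (s, t))) =
          deriv fun t => f (frame o (perp n) n (s, t)) := by
        ext t; exact (hder2 s t).deriv.symm
      rw [← integral_Iic_eq_integral_Iio, hde, (hs2 s).integral_Iic_deriv_eq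
        (contDiff_one_iff_deriv.2 ⟨fun t => (hder2 s t).differentiableAt, by
          rw [← hde]; exact hg2c.comp (hframe.comp (by fun_prop))⟩)]
      simp [frame, lineMap]
    · rw [Measure.prod_restrict, ← Measure.volume_eq_prod]; exact hg2i.integrableOn
  have hfin : ∫ y in {y | inner ℝ n (y - o) < 0}, pd i f y =
      ∫ z in univ ×ˢ Iio (0 : ℝ), pd i f (frame o (perp n) n z) := by
    conv_lhs => rw [← hmap]
    rw [setIntegral_map hH (contDiff_pd hf i).continuous.aestronglyMeasurable hframe.aemeasurable,
      hpre]
  rw [hfin]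
  simp only [hpd]
  rw [integral_add (hg1i.integrableOn.const_mul _) (hg2i.integrableOn.const_mul _),
    integral_const_mul, integral_const_mul, hI1, hI2]
  ring

end

end HHO

namespace HHO

noncomputable section

open Filter
open scoped Topology ENNReal

/-! ### Trace inequality on a cone -/

/-- Integrate the derivative of `s² u(c + s v)²`, which vanishes at the apex, and absorb the mixed
product by Young's inequality. The weight `s` left in front is the Jacobian of the parametrization
of the cone by `s` and the position on the edge. -/
theorem sq_le_integral_cone {u : Plane → ℝ} (hu : ContDiff ℝ ∞ u) (c v : Plane) {h : ℝ}
    (hv : ‖v‖ ≤ h) :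
    u (c + v) ^ 2 ≤ ∫ s in (0 : ℝ)..1, s * (3 * u (c + s • v) ^ 2 + h ^ 2 * gradSq u (c + s • v)) := by
  have hd := differentiable_of_smooth hu
  have cu : Continuous fun s : ℝ => u (c + s • v) := hu.continuous.comp (by fun_prop)
  have cg : Continuous fun s : ℝ => gradSq u (c + s • v) :=
    (continuous_gradSq hu).comp (by fun_prop)
  have cf : Continuous fun s : ℝ => fderiv ℝ u (c + s • v) v :=
    ((hu.continuous_fderiv (by simp)).comp (by fun_prop)).clm_apply continuous_const
  have hder : ∀ s : ℝ, HasDerivAt (fun s : ℝ => s ^ 2 * u (c + s • v) ^ 2)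
      (2 * s * u (c + s • v) ^ 2 + s ^ 2 * (2 * u (c + s • v) * fderiv ℝ u (c + s • v) v)) s := by
    intro s
    have h1 := (hasDerivAt_pow 2 s).mul ((hasDerivAt_comp_line hd c v s).pow 2)
    refine h1.congr_deriv ?_
    simp
  have h1 := intervalIntegral.integral_eq_sub_of_hasDerivAt (a := 0) (b := 1)
    (fun s _ => hder s) (by apply Continuous.intervalIntegrable; fun_prop)
  have e : u (c + v) ^ 2 = ∫ s in (0 : ℝ)..1, (2 * s * u (c + s • v) ^ 2 +
      s ^ 2 * (2 * u (c + s • v) * fderiv ℝ u (c + s • v) v)) := by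
    rw [h1]; simp
  rw [e]
  refine intervalIntegral.integral_mono_on (by norm_num)
    (by apply Continuous.intervalIntegrable; fun_prop)
    (by apply Continuous.intervalIntegrable; fun_prop) fun s hs => ?_
  have h2 := sq_fderiv_le u (c + s • v) v
  set A := u (c + s • v)
  set B := fderiv ℝ u (c + s • v) v
  have hg := gradSq_nonneg u (c + s • v)
  have h3 : ‖v‖ ^ 2 * gradSq u (c + s • v) ≤ h ^ 2 * gradSq u (c + s • v) := by
    gcongr
  have h4 : B ^ 2 ≤ h ^ 2 * gradSq u (c + s • v) := h2.trans h3
  have h5 : 2 * s * A * B ≤ A ^ 2 + B ^ 2 := by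
    have : 2 * (s * A) * B ≤ (s * A) ^ 2 + B ^ 2 := two_mul_le_add_sq _ _
    have : s ^ 2 * A ^ 2 ≤ A ^ 2 := by
      have : s ^ 2 ≤ 1 := by nlinarith [hs.1, hs.2]
      nlinarith [sq_nonneg A]
    nlinarith
  have h6 := mul_le_mul_of_nonneg_left (h5.trans (add_le_add_right h4 _)) hs.1
  nlinarith

theorem lintegral_mul_left_le {F : ℝ → ℝ≥0∞} (hF : Measurable F) {s : ℝ} (hs : 0 < s) :
    ENNReal.ofReal s * ∫⁻ t, F (s * t) = ∫⁻ t, F t := by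
  have h1 : ∫⁻ t, F (s * t) = ∫⁻ t, F t ∂(Measure.map (s * ·) volume) :=
    (lintegral_map hF (measurable_const_mul s)).symm
  rw [h1, Real.map_volume_mul_left hs.ne', lintegral_smul_measure, smul_eq_mul, ← mul_assoc,
    ← ENNReal.ofReal_mul hs.le, abs_of_pos (by positivity), mul_inv_cancel₀ hs.ne']
  simp

/-- For fixed `s`, the substitution `t ↦ s t` absorbs the weight `s` and turns the cone
parametrization into the linear frame `(a - c, b - a)` with origin `c`. -/
theorem lintegral_cone_le {F : Plane → ℝ≥0∞} (hF : Measurable F) (a b c : Plane)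
    (hD : cross (a - c) (b - a) ≠ 0) :
    ∫⁻ t in Ioc (0 : ℝ) 1, ∫⁻ s in Ioc (0 : ℝ) 1,
      ENNReal.ofReal s * F (c + s • (a + t • (b - a) - c)) ≤
      ENNReal.ofReal |(cross (a - c) (b - a))⁻¹| * ∫⁻ x, F x := by
  have hm : Measurable fun p : ℝ × ℝ =>
      ENNReal.ofReal p.2 * F (c + p.2 • (a + p.1 • (b - a) - c)) :=
    (ENNReal.measurable_ofReal.comp measurable_snd).mul (hF.comp (by fun_prop))
  rw [lintegral_lintegral_swap hm.aemeasurable, ← lintegral_frame c _ _ hD hF]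
  refine le_trans (setLIntegral_mono' measurableSet_Ioc fun s hs => ?_) (setLIntegral_le_lintegral _ _)
  refine (setLIntegral_le_lintegral _ _).trans (le_of_eq ?_)
  have hG : Measurable fun t : ℝ => F (c + s • (a - c) + t • (b - a)) := hF.comp (by fun_prop)
  have hcm := lintegral_const_mul (μ := volume)
    (f := fun t : ℝ => F (c + s • (a - c) + (s * t) • (b - a))) (ENNReal.ofReal s)
    (hG.comp (measurable_const_mul s))
  rw [← lintegral_mul_left_le hG hs.1, ← hcm]
  congr 1; ext t
  congr 2; module

/-- Trace inequality for smooth functions: the value on the edge `[a, b]` is controlled by the values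
in the cone of apex `c` over this edge. -/
theorem integral_edge_sq_le {X : Set Plane} (hX : MeasurableSet X) (hb : Bornology.IsBounded X)
    {a b c : Plane} (hD : cross (a - c) (b - a) ≠ 0) {h : ℝ}
    (hcone : ∀ t ∈ Ioo (0 : ℝ) 1, ∀ s ∈ Ioo (0 : ℝ) 1, c + s • (a + t • (b - a) - c) ∈ X)
    (hh : ∀ t ∈ Ioo (0 : ℝ) 1, ‖a + t • (b - a) - c‖ ≤ h)
    {u : Plane → ℝ} (hu : ContDiff ℝ ∞ u) :
    ∫ t in (0 : ℝ)..1, u (a + t • (b - a)) ^ 2 ≤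
      |cross (a - c) (b - a)|⁻¹ * (3 * (∫ x in X, u x ^ 2) + h ^ 2 * ∑ i, ∫ x in X, pd i u x ^ 2) := by
  have hc := hu.continuous
  set f : Plane → ℝ := fun x => 3 * u x ^ 2 + h ^ 2 * gradSq u x with hf
  have hfc : Continuous f := by
    have := continuous_gradSq hu
    fun_prop
  have hf0 : ∀ x, 0 ≤ f x := fun x => by
    have := gradSq_nonneg u x
    positivity
  set F : Plane → ℝ≥0∞ := X.indicator fun x => ENNReal.ofReal (f x) with hF
  have hFm : Measurable F := (ENNReal.measurable_ofReal.comp hfc.measurable).indicator hX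
  have i0 : IntegrableOn (fun x => u x ^ 2) X := (memLp_of_continuous_of_isBounded hb hc).integrable_sq
  have hi : ∀ i, IntegrableOn (fun x => pd i u x ^ 2) X := fun i =>
    (memLp_of_continuous_of_isBounded hb (contDiff_pd hu i).continuous).integrable_sq
  have ig : IntegrableOn (gradSq u) X := (hi 0).add (hi 1)
  have i1 : IntegrableOn (fun x => 3 * u x ^ 2) X := i0.const_mul 3
  have i2 : IntegrableOn (fun x => h ^ 2 * gradSq u x) X := ig.const_mul _
  have i3 : IntegrableOn f X := i1.add i2
  have hFint : ∫⁻ x, F x = ENNReal.ofReal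
      (3 * (∫ x in X, u x ^ 2) + h ^ 2 * ∑ i, ∫ x in X, pd i u x ^ 2) := by
    rw [hF, lintegral_indicator hX, ← ofReal_integral_eq_lintegral_ofReal i3
      (Eventually.of_forall hf0)]
    congr 1
    rw [hf, integral_add i1 i2, integral_const_mul, integral_const_mul]
    congr 2
    simp only [gradSq, Fin.sum_univ_two]
    exact integral_add (hi 0) (hi 1)
  have h1 : ENNReal.ofReal (∫ t in (0 : ℝ)..1, u (a + t • (b - a)) ^ 2) ≤
      ENNReal.ofReal |(cross (a - c) (b - a))⁻¹| * ∫⁻ x, F x := by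
    refine le_trans ?_ (lintegral_cone_le hFm a b c hD)
    rw [intervalIntegral.integral_of_le (by norm_num), ofReal_integral_eq_lintegral_ofReal
      (by apply Continuous.integrableOn_Ioc; fun_prop) (Eventually.of_forall fun t => sq_nonneg _),
      ← restrict_Ioo_eq_restrict_Ioc]
    refine setLIntegral_mono' measurableSet_Ioo fun t ht => ?_
    have h2 := sq_le_integral_cone hu c (a + t • (b - a) - c) (hh t ht)
    rw [add_sub_cancel] at h2
    refine (ENNReal.ofReal_le_ofReal h2).trans ?_
    have hfs : Continuous fun s : ℝ => s * f (c + s • (a + t • (b - a) - c)) := by fun_prop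
    rw [intervalIntegral.integral_of_le (by norm_num), integral_Ioc_eq_integral_Ioo,
      ofReal_integral_eq_lintegral_ofReal (hfs.integrableOn_Ioc.mono_set Ioo_subset_Ioc_self)]
    · refine setLIntegral_mono' measurableSet_Ioo fun s hs => ?_
      rw [ENNReal.ofReal_mul hs.1.le, hF, indicator_of_mem (hcone t ht s hs)]
    · rw [EventuallyLE, ae_restrict_iff' measurableSet_Ioo]
      exact Eventually.of_forall fun s hs => mul_nonneg hs.1.le (hf0 _)
  rw [hFint, ← ENNReal.ofReal_mul (abs_nonneg _), abs_inv] at h1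
  refine (ENNReal.ofReal_le_ofReal_iff ?_).1 h1
  have := Finset.sum_nonneg fun i (_ : i ∈ (Finset.univ : Finset (Fin 2))) =>
    integral_sq_nonneg (μ := volume.restrict X) (pd i u)
  have := integral_sq_nonneg (μ := volume.restrict X) u
  positivity

/-! ### Triangles -/

/-- The barycentric coordinate of `x` with respect to the vertex `a` of the triangle `a b c`. -/
def bary (a b c x : Plane) : ℝ := cross (x - b) (c - b) / cross (a - b) (c - b)

theorem cross_rotate (a b c : Plane) : cross (b - c) (a - c) = cross (a - b) (c - b) := by
  simp only [cross, PiLp.sub_apply]; ring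

theorem bary_add_smul (a b c x v : Plane) (t : ℝ) :
    bary a b c (x + t • v) = bary a b c x + t * (cross v (c - b) / cross (a - b) (c - b)) := by
  simp only [bary, cross, PiLp.sub_apply, PiLp.add_apply, PiLp.smul_apply, smul_eq_mul]
  rw [← mul_div_assoc, ← add_div]
  congr 1; ring

theorem continuous_bary (a b c : Plane) : Continuous (bary a b c) := by
  unfold bary cross
  refine Continuous.div_const ?_ _
  simp only [PiLp.sub_apply]
  fun_prop

section Triangle

variable {a b c : Plane} (hD : cross (a - b) (c - b) ≠ 0)
include hD

theorem bary_self : bary a b c a = 1 := div_self hD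

theorem bary_sum (x : Plane) : bary a b c x + bary b c a x + bary c a b x = 1 := by
  have h2 : cross (b - c) (a - c) = cross (a - b) (c - b) := cross_rotate a b c
  have h3 : cross (c - a) (b - a) = cross (a - b) (c - b) := by
    simp only [cross, PiLp.sub_apply]; ring
  simp only [bary, h2, h3]
  rw [← add_div, ← add_div, div_eq_one_iff_eq hD]
  simp only [cross, PiLp.sub_apply]; ring

theorem eq_sum_bary (x : Plane) :
    x = bary a b c x • a + bary b c a x • b + bary c a b x • c := by
  have h2 : cross (b - c) (a - c) = cross (a - b) (c - b) := cross_rotate a b c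
  have h3 : cross (c - a) (b - a) = cross (a - b) (c - b) := by
    simp only [cross, PiLp.sub_apply]; ring
  ext i
  simp only [bary, h2, h3, PiLp.add_apply, PiLp.smul_apply, smul_eq_mul]
  rw [div_mul_eq_mul_div, div_mul_eq_mul_div, div_mul_eq_mul_div, ← add_div, ← add_div,
    eq_div_iff hD]
  fin_cases i <;> simp only [cross, PiLp.sub_apply, Fin.zero_eta, Fin.mk_one] <;> ring

omit hD in
theorem bary_combo {α β γ : ℝ} (h : α + β + γ = 1) (hD : cross (a - b) (c - b) ≠ 0) :
    bary a b c (α • a + β • b + γ • c) = α := by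
  have hγ : γ = 1 - α - β := by linarith
  subst hγ
  rw [bary, div_eq_iff hD]
  simp only [cross, PiLp.sub_apply, PiLp.add_apply, PiLp.smul_apply, smul_eq_mul]
  ring

theorem cross_rotate_ne : cross (b - c) (a - c) ≠ 0 := by rwa [cross_rotate]

theorem mem_convexHull_triangle {x : Plane} : x ∈ convexHull ℝ ({a, b, c} : Set Plane) ↔
    0 ≤ bary a b c x ∧ 0 ≤ bary b c a x ∧ 0 ≤ bary c a b x := by
  rw [convexHull_insert (by simp), convexHull_pair]
  simp only [convexJoin_singleton_left, mem_iUnion, exists_prop]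
  constructor
  · rintro ⟨y, ⟨s, t, hs, ht, hst, rfl⟩, ⟨p, q, hp, hq, hpq, rfl⟩⟩
    have e : p • a + q • (s • b + t • c) = p • a + (q * s) • b + (q * t) • c := by module
    have hsum : p + q * s + q * t = 1 := by rw [add_assoc, ← mul_add, hst, mul_one, hpq]
    have hD2 := cross_rotate_ne hD
    have hD3 := cross_rotate_ne hD2
    rw [e]
    refine ⟨?_, ?_, ?_⟩
    · rw [bary_combo hsum hD]; exact hp
    · rw [show p • a + (q * s) • b + (q * t) • c = (q * s) • b + (q * t) • c + p • a by module,
        bary_combo (by linarith) hD2]; positivity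
    · rw [show p • a + (q * s) • b + (q * t) • c = (q * t) • c + p • a + (q * s) • b by module,
        bary_combo (by linarith) hD3]; positivity
  · rintro ⟨h1, h2, h3⟩
    have hs := bary_sum hD x
    have hx := eq_sum_bary hD x
    set α := bary a b c x
    set β := bary b c a x
    set γ := bary c a b x
    rcases eq_or_lt_of_le (add_nonneg h2 h3) with h0 | h0
    · have hβ : β = 0 := by linarith
      have hγ : γ = 0 := by linarith
      have hα : α = 1 := by linarith
      exact ⟨b, left_mem_segment _ _ _, ⟨1, 0, by norm_num, le_rfl, by norm_num, by
        rw [hx, hα, hβ, hγ]; module⟩⟩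
    · refine ⟨(β / (β + γ)) • b + (γ / (β + γ)) • c, ⟨β / (β + γ), γ / (β + γ), by positivity,
        by positivity, by rw [← add_div, div_self h0.ne'], rfl⟩,
        ⟨α, β + γ, h1, h0.le, by linarith, ?_⟩⟩
      rw [smul_add, smul_smul, smul_smul, mul_div_cancel₀ _ h0.ne', mul_div_cancel₀ _ h0.ne',
        ← add_assoc]
      exact hx.symm

/-- Moving in the direction `b - a` decreases the coordinate at unit rate, so a zero at an interior
point would produce negative values inside the triangle. -/
theorem bary_pos_of_mem_interior {x : Plane}
    (hx : x ∈ interior (convexHull ℝ ({a, b, c} : Set Plane))) : 0 < bary a b c x := by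
  obtain ⟨r, hr, hball⟩ := Metric.isOpen_iff.1 isOpen_interior x hx
  by_contra hneg
  have h0 := ((mem_convexHull_triangle hD).1 (interior_subset hx)).1
  have hz : bary a b c x = 0 := le_antisymm (not_lt.1 hneg) h0
  have hlim : Tendsto (fun t : ℝ => x + t • (b - a)) (𝓝[>] 0) (𝓝 x) := by
    have : Continuous fun t : ℝ => x + t • (b - a) := by fun_prop
    simpa using (this.tendsto 0).mono_left nhdsWithin_le_nhds
  obtain ⟨t, ht, ht0⟩ := ((hlim.eventually (Metric.ball_mem_nhds x hr)).and
    self_mem_nhdsWithin).exists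
  have ht0' : 0 < t := ht0
  have h1 := ((mem_convexHull_triangle hD).1 (interior_subset (hball ht))).1
  rw [bary_add_smul, hz, zero_add] at h1
  have : cross (b - a) (c - b) / cross (a - b) (c - b) = -1 := by
    rw [div_eq_iff hD]; simp only [cross, PiLp.sub_apply]; ring
  rw [this] at h1
  linarith

theorem interior_triangle : interior (convexHull ℝ ({a, b, c} : Set Plane)) =
    {x | 0 < bary a b c x ∧ 0 < bary b c a x ∧ 0 < bary c a b x} := by
  have hD2 := cross_rotate_ne hD
  have hD3 := cross_rotate_ne hD2
  have p1 : ({a, b, c} : Set Plane) = {b, c, a} := by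
    ext x; simp only [mem_insert_iff, mem_singleton_iff]; tauto
  have p2 : ({a, b, c} : Set Plane) = {c, a, b} := by
    ext x; simp only [mem_insert_iff, mem_singleton_iff]; tauto
  refine Subset.antisymm (fun x hx => ⟨bary_pos_of_mem_interior hD hx,
    bary_pos_of_mem_interior hD2 (p1 ▸ hx), bary_pos_of_mem_interior hD3 (p2 ▸ hx)⟩) ?_
  refine interior_maximal (fun x hx => (mem_convexHull_triangle hD).2
    ⟨hx.1.le, hx.2.1.le, hx.2.2.le⟩) ?_
  exact (isOpen_lt continuous_const (continuous_bary _ _ _)).inter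
    ((isOpen_lt continuous_const (continuous_bary _ _ _)).inter
      (isOpen_lt continuous_const (continuous_bary _ _ _)))

/-- The slope of a barycentric coordinate is controlled by the radius of a disc in the triangle. -/
theorem abs_bary_slope_le {z : Plane} {r : ℝ} (hr : 0 < r)
    (hball : Metric.closedBall z r ⊆ convexHull ℝ ({a, b, c} : Set Plane)) (v : Plane) :
    |cross v (c - b) / cross (a - b) (c - b)| ≤ ‖v‖ / (2 * r) := by
  rcases eq_or_ne v 0 with rfl | hv
  · simp [cross]
  have hv0 : 0 < ‖v‖ := norm_pos_iff.2 hv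
  have hrv : 0 < r / ‖v‖ := by positivity
  have key : ∀ y ∈ Metric.closedBall z r, 0 ≤ bary a b c y ∧ bary a b c y ≤ 1 := by
    intro y hy
    have h1 := (mem_convexHull_triangle hD).1 (hball hy)
    have h2 := bary_sum hD y
    exact ⟨h1.1, by linarith [h1.2.1, h1.2.2]⟩
  have hp : ∀ s : ℝ, |s| ≤ r / ‖v‖ → z + s • v ∈ Metric.closedBall z r := by
    intro s hs
    rw [mem_closedBall_iff_norm, add_sub_cancel_left, norm_smul, Real.norm_eq_abs]
    rwa [le_div_iff₀ hv0] at hs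
  have h1 := key _ (hp (r / ‖v‖) (abs_of_pos hrv).le)
  have h2 := key _ (hp (-(r / ‖v‖)) (by rw [abs_neg, abs_of_pos hrv]))
  rw [bary_add_smul] at h1 h2
  set m := cross v (c - b) / cross (a - b) (c - b)
  rw [le_div_iff₀ (by positivity)]
  -- Between the ends of the diameter parallel to `v` the coordinate changes by exactly this amount,
  -- and it stays in `[0, 1]`.
  have h3 : 2 * (r / ‖v‖) * |m| ≤ 1 := by
    rcases abs_cases m with ⟨h, _⟩ | ⟨h, _⟩ <;> rw [h] <;> linarith [h1.1, h1.2, h2.1, h2.2]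
  have h4 : r / ‖v‖ * ‖v‖ = r := div_mul_cancel₀ _ hv0.ne'
  calc |m| * (2 * r) = (2 * (r / ‖v‖) * |m|) * ‖v‖ := by rw [← h4]; field_simp
    _ ≤ 1 * ‖v‖ := by gcongr
    _ = ‖v‖ := one_mul _

/-- The height of the triangle is at least the diameter of an inscribed disc. -/
theorem two_mul_radius_mul_le {z : Plane} {r : ℝ} (hr : 0 < r)
    (hball : Metric.closedBall z r ⊆ convexHull ℝ ({a, b, c} : Set Plane)) :
    2 * r * ‖c - b‖ ≤ |cross (a - b) (c - b)| := by
  have h := abs_bary_slope_le hD hr hball (perp (c - b))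
  have e : cross (perp (c - b)) (c - b) = -‖c - b‖ ^ 2 := cross_perp_self _
  rw [e, norm_perp, abs_div, abs_neg, abs_of_nonneg (by positivity : 0 ≤ ‖c - b‖ ^ 2),
    div_le_div_iff₀ (abs_pos.2 hD) (by positivity)] at h
  rcases eq_or_ne (‖c - b‖) 0 with h0 | h0
  · rw [h0]; simp
  · have : 0 < ‖c - b‖ := lt_of_le_of_ne (norm_nonneg _) (Ne.symm h0)
    nlinarith

/-- Near the midpoint of the edge `[b, c]`, the triangle coincides with a half-plane. -/
theorem bary_pos_of_mem_ball_midpoint {z : Plane} {r : ℝ} (hr : 0 < r)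
    (hball : Metric.closedBall z r ⊆ convexHull ℝ ({a, b, c} : Set Plane)) {x : Plane}
    (hx : x ∈ Metric.ball (midpoint ℝ b c) r) :
    0 < bary b c a x ∧ 0 < bary c a b x := by
  have hD2 := cross_rotate_ne hD
  have hD3 := cross_rotate_ne hD2
  have p1 : ({a, b, c} : Set Plane) = {b, c, a} := by
    ext x; simp only [mem_insert_iff, mem_singleton_iff]; tauto
  have p2 : ({a, b, c} : Set Plane) = {c, a, b} := by
    ext x; simp only [mem_insert_iff, mem_singleton_iff]; tauto
  -- Both coordinates equal `1/2` at the midpoint, and the slope bound lets them vary by less than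
  -- `1/2` within distance `r`.
  set m := midpoint ℝ b c with hm
  have hm' : m = (0 : ℝ) • a + (1 / 2 : ℝ) • b + (1 / 2 : ℝ) • c := by
    rw [hm, midpoint_eq_smul_add]; simp [smul_add]
  have hx' : ‖x - m‖ < r := by rwa [← mem_ball_iff_norm]
  have ex : x = m + (1 : ℝ) • (x - m) := by module
  have hlt : ‖x - m‖ / (2 * r) < 1 / 2 := by
    rw [div_lt_div_iff₀ (by positivity) (by norm_num)]; linarith
  refine ⟨?_, ?_⟩
  · have h := (abs_le.1 (abs_bary_slope_le hD2 hr (p1 ▸ hball) (x - m))).1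
    rw [ex, bary_add_smul]
    have : bary b c a m = 1 / 2 := by
      rw [hm', show (0 : ℝ) • a + (1 / 2 : ℝ) • b + (1 / 2 : ℝ) • c =
        (1 / 2 : ℝ) • b + (1 / 2 : ℝ) • c + (0 : ℝ) • a by module, bary_combo (by norm_num) hD2]
    rw [this]; linarith
  · have h := (abs_le.1 (abs_bary_slope_le hD3 hr (p2 ▸ hball) (x - m))).1
    rw [ex, bary_add_smul]
    have : bary c a b m = 1 / 2 := by
      rw [hm', show (0 : ℝ) • a + (1 / 2 : ℝ) • b + (1 / 2 : ℝ) • c =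
        (1 / 2 : ℝ) • c + (0 : ℝ) • a + (1 / 2 : ℝ) • b by module, bary_combo (by norm_num) hD3]
    rw [this]; linarith

end Triangle

end

end HHO

/-! ### Geometry of triangulated elements and Poincaré inequality by chaining. -/

namespace HHO

noncomputable section

open Filter
open scoped Topology ENNReal

/-! ### Connectedness after removal of countably many points -/

theorem one_lt_rank_plane : 1 < Module.rank ℝ Plane := by
  rw [← Module.finrank_eq_rank, finrank_euclideanSpace_fin]
  norm_num

/-- The plane minus a countable set is connected, and the ball is homeomorphic to the plane. -/
theorem isPreconnected_ball_diff_countable (x : Plane) {r : ℝ} (hr : 0 < r) {Z : Set Plane}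
    (hZ : Z.Countable) : IsPreconnected (Metric.ball x r \ Z) := by
  let φ := OpenPartialHomeomorph.univBall x r
  have hsrc : φ.source = univ := OpenPartialHomeomorph.univBall_source x r
  have htgt : φ.target = Metric.ball x r := OpenPartialHomeomorph.univBall_target x hr
  have hinj : Function.Injective φ := by
    rw [← injOn_univ, ← hsrc]; exact φ.injOn
  have hcont : Continuous φ := OpenPartialHomeomorph.continuous_univBall x r
  have h1 : IsPreconnected (φ ⁻¹' Z)ᶜ :=
    ((hZ.preimage_of_injOn hinj.injOn).isConnected_compl_of_one_lt_rank
      one_lt_rank_plane).isPreconnected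
  convert h1.image φ hcont.continuousOn using 1
  ext y
  constructor
  · rintro ⟨hy, hyZ⟩
    rw [← htgt] at hy
    exact ⟨φ.symm y, by simp [φ.right_inv hy, hyZ], φ.right_inv hy⟩
  · rintro ⟨z, hz, rfl⟩
    refine ⟨?_, hz⟩
    rw [← htgt]; exact φ.map_source (by rw [hsrc]; trivial)

theorem ball_diff_countable_nonempty (x : Plane) {r : ℝ} (hr : 0 < r) {Z : Set Plane}
    (hZ : Z.Countable) : (Metric.ball x r \ Z).Nonempty := by
  by_contra h
  rw [not_nonempty_iff_eq_empty, sdiff_eq_empty] at h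
  have h1 : volume (Metric.ball x r) = 0 :=
    measure_mono_null h (hZ.measure_zero volume)
  exact (Metric.measure_ball_pos volume x hr).ne' h1

/-- A separation of `T \ Z` extends to one of `T`: assign to `u` or `v` each point with a small ball
whose part outside `Z` lies in that set. Such punctured balls are connected and nonempty, hence the
two classes cover `T` and are disjoint. It is applied with `Z` the set of vertices. -/
theorem isPreconnected_diff_countable {T : Set Plane} (hT : IsOpen T) (hc : IsPreconnected T)
    {Z : Set Plane} (hZ : Z.Countable) : IsPreconnected (T \ Z) := by
  rw [isPreconnected_iff_subset_of_disjoint] at hc ⊢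
  intro u v hu hv huv hdisj
  have hopen : ∀ w : Set Plane,
      IsOpen {x | ∃ r > 0, Metric.ball x r ⊆ T ∧ Metric.ball x r \ Z ⊆ w} := by
    intro w
    rw [Metric.isOpen_iff]
    rintro x ⟨r, hr, h1, h2⟩
    refine ⟨r / 2, by positivity, fun y hy => ⟨r / 2, by positivity, ?_, ?_⟩⟩ <;>
    · have : Metric.ball y (r / 2) ⊆ Metric.ball x r :=
        Metric.ball_subset_ball' (by rw [Metric.mem_ball] at hy; linarith)
      first
        | exact this.trans h1
        | exact (sdiff_subset_sdiff_left this).trans h2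
  have key := hc _ _ (hopen u) (hopen v) ?_ ?_
  · have fin : ∀ w : Set Plane,
        T ⊆ {x | ∃ r > 0, Metric.ball x r ⊆ T ∧ Metric.ball x r \ Z ⊆ w} → T \ Z ⊆ w := by
      intro w hw x hx
      obtain ⟨r, hr, -, h2⟩ := hw hx.1
      exact h2 ⟨Metric.mem_ball_self hr, hx.2⟩
    exact key.imp (fin u) (fin v)
  · intro x hx
    obtain ⟨r, hr, hrT⟩ := Metric.isOpen_iff.1 hT x hx
    have h1 := isPreconnected_ball_diff_countable x hr hZ
    rw [isPreconnected_iff_subset_of_disjoint] at h1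
    have hsub : Metric.ball x r \ Z ⊆ T \ Z := sdiff_subset_sdiff_left hrT
    have h2 := h1 u v hu hv (hsub.trans huv)
      (subset_empty_iff.1 ((inter_subset_inter_left _ hsub).trans hdisj.subset))
    exact h2.imp (fun h => ⟨r, hr, hrT, h⟩) (fun h => ⟨r, hr, hrT, h⟩)
  · rw [eq_empty_iff_forall_notMem]
    rintro x ⟨-, ⟨r, hr, h1, h2⟩, ⟨r', hr', h1', h2'⟩⟩
    obtain ⟨y, hy, hyZ⟩ := ball_diff_countable_nonempty x (lt_min hr hr') hZ
    have hy1 : y ∈ Metric.ball x r := Metric.ball_subset_ball (min_le_left _ _) hy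
    have hy2 : y ∈ Metric.ball x r' := Metric.ball_subset_ball (min_le_right _ _) hy
    have : y ∈ T \ Z ∩ (u ∩ v) := ⟨⟨h1 hy1, hyZ⟩, h2 ⟨hy1, hyZ⟩, h2' ⟨hy2, hyZ⟩⟩
    rw [hdisj] at this
    exact this

/-! ### Polygons -/

theorem IsOutwardNormalAt.exists_mem_not_mem_closure {T : Set Plane} {x n : Plane}
    (h : IsOutwardNormalAt T x n) {ε : ℝ} (hε : 0 < ε) :
    ∃ y ∈ Metric.ball x ε, y ∉ closure T := by
  obtain ⟨hn, δ, hδ, H⟩ := h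
  set t := min ε δ / 2 with ht
  have ht0 : 0 < t := by positivity
  have htε : t < ε := lt_of_lt_of_le (half_lt_self (by positivity)) (min_le_left _ _)
  have htδ : t < δ := lt_of_lt_of_le (half_lt_self (by positivity)) (min_le_right _ _)
  have hd : ‖t • n‖ = t := by rw [norm_smul, hn, mul_one, Real.norm_of_nonneg ht0.le]
  refine ⟨x + t • n, by simpa [hd] using htε, fun hcl => ?_⟩
  have hU : IsOpen (Metric.ball x δ ∩ {y | 0 < inner ℝ n (y - x)}) :=
    Metric.isOpen_ball.inter (isOpen_lt continuous_const (by fun_prop))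
  have hmem : x + t • n ∈ Metric.ball x δ ∩ {y | 0 < inner ℝ n (y - x)} := by
    refine ⟨by simpa [hd] using htδ, ?_⟩
    simp only [mem_ofPred_eq, add_sub_cancel_left, inner_smul_right, real_inner_self_eq_norm_sq, hn]
    simpa using ht0
  obtain ⟨y, ⟨hy1, hy2⟩, hyT⟩ := mem_closure_iff.1 hcl _ hU hmem
  exact absurd ((H y hy1).1 hyT) (not_lt.2 (le_of_lt hy2))

/-- There are no cracks: a boundary point interior to the closure would lie on a boundary segment,
and just beyond the segment, on the outer side, there are points away from the closure. Thus an open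
set contained in `closure T` is contained in `T`. -/
theorem IsPolygon.interior_closure {T : Set Plane} (hT : IsPolygon T) :
    interior (closure T) = T := by
  refine Subset.antisymm (fun x hx => ?_) (interior_maximal subset_closure hT.isOpen)
  by_contra hxT
  have hxf : x ∈ frontier T := by
    rw [frontier, hT.isOpen.interior_eq]; exact ⟨interior_subset hx, hxT⟩
  obtain ⟨E, hE1, hE2⟩ := hT.frontier_eq
  have hxf' := hxf
  rw [hE2] at hxf'
  obtain ⟨e, he, hxe⟩ := mem_iUnion₂.1 hxf'
  have hsub : openSegment ℝ e.1 e.2 ⊆ frontier T := by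
    rw [hE2]
    exact (openSegment_subset_segment ℝ _ _).trans (subset_biUnion_of_mem (u := fun e : Plane × Plane => segment ℝ e.1 e.2) he)
  obtain ⟨n, hn⟩ := hT.one_sided e.1 e.2 (hE1 e he) hsub
  have hxcl : x ∈ closure (openSegment ℝ e.1 e.2) := by
    rw [closure_openSegment]; exact hxe
  obtain ⟨z, hz1, hz2⟩ := mem_closure_iff.1 hxcl _ isOpen_interior hx
  obtain ⟨ε, hε, hball⟩ := Metric.isOpen_iff.1 isOpen_interior z hz1
  obtain ⟨y, hy, hyc⟩ := (hn z hz2).exists_mem_not_mem_closure hε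
  exact hyc (interior_subset (hball hy))

/-! ### Triangles of a simplicial complex -/

open Geometry

variable {K : SimplicialComplex ℝ Plane}

theorem cross_eq_zero_imp {p q : Plane} (hq : q ≠ 0) (h : cross p q = 0) : ∃ t : ℝ, p = t • q := by
  have hq2 : q 0 ^ 2 + q 1 ^ 2 ≠ 0 := by
    rw [← norm_sq_eq]; exact pow_ne_zero 2 (norm_ne_zero_iff.2 hq)
  refine ⟨(p 0 * q 0 + p 1 * q 1) / (q 0 ^ 2 + q 1 ^ 2), ?_⟩
  unfold cross at h
  ext i
  simp only [PiLp.smul_apply, smul_eq_mul]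
  rw [div_mul_eq_mul_div, eq_div_iff hq2]
  fin_cases i
  · simp only [Fin.zero_eta]; linear_combination q 1 * h
  · simp only [Fin.mk_one]; linear_combination -(q 0) * h

theorem cross_ne_zero_of_affineIndependent {a b c : Plane} {s : Finset Plane} (hs : s.card = 3)
    (hs' : (s : Set Plane) = {a, b, c}) (h : AffineIndependent ℝ ((↑) : s → Plane)) :
    cross (a - b) (c - b) ≠ 0 := by
  intro h0
  have hcb : c - b ≠ 0 := by
    intro hcb
    rw [sub_eq_zero] at hcb
    subst hcb
    have h3 : (s : Set Plane).ncard = 3 := by rw [ncard_coe_finset, hs]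
    have : ({a, c} : Set Plane).ncard ≤ 2 :=
      (ncard_insert_le a {c}).trans (by rw [ncard_singleton])
    rw [hs', show ({a, c, c} : Set Plane) = {a, c} by simp] at h3
    omega
  have hcol : Collinear ℝ (s : Set Plane) := by
    rw [hs', collinear_iff_of_mem (p₀ := b) (by simp)]
    refine ⟨c - b, ?_⟩
    obtain ⟨t, ht⟩ := cross_eq_zero_imp hcb h0
    intro p hp
    rcases hp with rfl | rfl | rfl
    · exact ⟨t, by rw [← ht]; simp⟩
    · exact ⟨0, by simp⟩
    · exact ⟨1, by simp⟩
  have hr : range ((↑) : s → Plane) = (s : Set Plane) := Subtype.range_coe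
  have hf := h.finrank_vectorSpan (n := 2) (by simp [hs])
  rw [hr] at hf
  have := collinear_iff_finrank_le_one.1 hcol
  omega

theorem cross_ne_zero_of_face {a b c : Plane} {s : Finset Plane} (hs : s ∈ triangles K)
    (hs' : (s : Set Plane) = {a, b, c}) : cross (a - b) (c - b) ≠ 0 :=
  cross_ne_zero_of_affineIndependent hs.2 hs' (K.indep hs.1)

theorem interior_convexHull_of_card_le_two {t : Finset Plane} (ht : t.card ≤ 2) :
    interior (convexHull ℝ (t : Set Plane)) = ∅ := by
  by_contra h
  have h1 := interior_convexHull_nonempty_iff_affineSpan_eq_top.1 (nonempty_iff_ne_empty.2 h)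
  have h2 : vectorSpan ℝ (t : Set Plane) = ⊤ := by
    rw [← direction_affineSpan, h1, AffineSubspace.direction_top]
  rcases t.eq_empty_or_nonempty with rfl | hne
  · simp at h
  · have hc : Collinear ℝ (t : Set Plane) := by
      rcases Nat.lt_or_ge t.card 2 with h3 | h3
      · obtain ⟨x, rfl⟩ := Finset.card_eq_one.1 (by have := hne.card_pos; omega : t.card = 1)
        simpa using collinear_singleton ℝ x
      · obtain ⟨x, y, -, rfl⟩ := Finset.card_eq_two.1 (le_antisymm ht h3)
        simpa using collinear_pair ℝ x y
    have h4 := collinear_iff_finrank_le_one.1 hc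
    rw [h2, finrank_top, finrank_euclideanSpace_fin] at h4
    omega

theorem inter_card_le_two {s s' : Finset Plane} [DecidableEq Plane] (hs : s.card = 3)
    (hs' : s'.card = 3) (hne : s ≠ s') : (s ∩ s').card ≤ 2 := by
  by_contra h
  have h1 : (s ∩ s').card = 3 := le_antisymm (hs ▸ Finset.card_le_card Finset.inter_subset_left)
    (by omega)
  have h2 : s ∩ s' = s := Finset.eq_of_subset_of_card_le Finset.inter_subset_left (by omega)
  have h3 : s ∩ s' = s' := Finset.eq_of_subset_of_card_le Finset.inter_subset_right (by omega)
  exact hne (h2.symm.trans h3)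

/-- Two triangles of the complex meet in the convex hull of their common vertices; if distinct they
share at most two, and the hull has empty interior. -/
theorem disjoint_interior_triangles {s s' : Finset Plane} (hs : s ∈ triangles K)
    (hs' : s' ∈ triangles K) (hne : s ≠ s') :
    Disjoint (interior (convexHull ℝ (s : Set Plane))) (interior (convexHull ℝ (s' : Set Plane))) := by
  classical
  rw [Set.disjoint_iff_inter_eq_empty, ← interior_inter,
    K.convexHull_inter_convexHull hs.1 hs'.1, ← Finset.coe_inter]
  exact interior_convexHull_of_card_le_two (inter_card_le_two hs.2 hs'.2 hne)

/-- A point of an open edge that belongs to a face forces the edge to be an edge of this face. -/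
theorem pair_subset_of_mem {p q x : Plane} {e s : Finset Plane} (he : e ∈ K.faces)
    (hs : s ∈ K.faces) (hepq : (e : Set Plane) = {p, q}) (hxp : x ≠ p) (hxq : x ≠ q)
    (hx : x ∈ segment ℝ p q) (hxs : x ∈ convexHull ℝ (s : Set Plane)) : p ∈ s ∧ q ∈ s := by
  have hxe : x ∈ convexHull ℝ (e : Set Plane) := by rw [hepq, convexHull_pair]; exact hx
  have h := K.inter_subset_convexHull he hs ⟨hxe, hxs⟩
  rw [hepq] at h
  by_contra hcon
  have : ({p, q} ∩ (s : Set Plane)) ⊆ {p} ∨ ({p, q} ∩ (s : Set Plane)) ⊆ {q} := by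
    by_cases hp : p ∈ s
    · left
      rintro y ⟨hy | hy, hys⟩
      · exact hy
      · rw [mem_singleton_iff] at hy; subst hy; exact absurd ⟨hp, hys⟩ hcon
    · right
      rintro y ⟨hy | hy, hys⟩
      · subst hy; exact absurd hys hp
      · exact hy
  rcases this with h1 | h1
  · have := convexHull_mono h1 h; rw [convexHull_singleton] at this; exact hxp this
  · have := convexHull_mono h1 h; rw [convexHull_singleton] at this; exact hxq this

theorem exists_third_vertex {p q : Plane} {s : Finset Plane} (hs : s.card = 3) (hpq : p ≠ q)
    (hp : p ∈ s) (hq : q ∈ s) : ∃ c, c ≠ p ∧ c ≠ q ∧ (s : Set Plane) = {c, p, q} := by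
  classical
  have h1 : ((s.erase p).erase q).card = 1 := by
    rw [Finset.card_erase_of_mem (Finset.mem_erase.2 ⟨hpq.symm, hq⟩), Finset.card_erase_of_mem hp, hs]
  obtain ⟨c, hc⟩ := Finset.card_eq_one.1 h1
  have hc' : c ∈ (s.erase p).erase q := by rw [hc]; simp
  simp only [Finset.mem_erase] at hc'
  refine ⟨c, hc'.2.1, hc'.1, ?_⟩
  ext y
  have : y ∈ (s.erase p).erase q ↔ y = c := by rw [hc]; simp
  simp only [Finset.mem_erase] at this
  simp only [Finset.mem_coe, mem_insert_iff, mem_singleton_iff]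
  constructor
  · intro hy
    by_cases h1 : y = q
    · exact Or.inr (Or.inr h1)
    by_cases h2 : y = p
    · exact Or.inr (Or.inl h2)
    exact Or.inl (this.1 ⟨h1, h2, hy⟩)
  · rintro (rfl | rfl | rfl)
    · exact hc'.2.2
    · exact hp
    · exact hq

/-! ### Triangulated elements -/

/-- The triangles of `K` that are contained in `T`. -/
def elemTriangles (K : SimplicialComplex ℝ Plane) (T : Set Plane) : Set (Finset Plane) :=
  {s | s ∈ triangles K ∧ interior (convexHull ℝ (s : Set Plane)) ⊆ T}

/-- The edges of `K` that are contained in the boundary of `T`. -/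
def boundaryEdges (K : SimplicialComplex ℝ Plane) (T : Set Plane) : Set (Finset Plane) :=
  {e | e ∈ K.faces ∧ e.card = 2 ∧ convexHull ℝ (e : Set Plane) ⊆ frontier T}

/-- The polygon `T` and its boundary are decomposed into triangles and edges of `K`, and every
triangle contains a disc of radius `r`. -/
structure IsTriangulated (K : SimplicialComplex ℝ Plane) (T : Set Plane) (r : ℝ) : Prop where
  isPolygon : IsPolygon T
  finite : K.faces.Finite
  closure_eq : closure T = ⋃ s ∈ elemTriangles K T, convexHull ℝ (s : Set Plane)
  radius_pos : 0 < r
  ball : ∀ s ∈ elemTriangles K T, ∃ z, Metric.closedBall z r ⊆ convexHull ℝ (s : Set Plane)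
  frontier_subset : ∃ Z : Set Plane, Z.Finite ∧
    frontier T ⊆ (⋃ e ∈ boundaryEdges K T, convexHull ℝ (e : Set Plane)) ∪ Z

namespace IsTriangulated

variable {T : Set Plane} {r : ℝ} (hT : IsTriangulated K T r)
include hT

theorem finite_elemTriangles : (elemTriangles K T).Finite :=
  hT.finite.subset fun _ hs => hs.1.1

theorem finite_boundaryEdges : (boundaryEdges K T).Finite :=
  hT.finite.subset fun _ hs => hs.1

theorem finite_vertices : (⋃ s ∈ K.faces, (s : Set Plane)).Finite :=
  hT.finite.biUnion fun s _ => s.finite_toSet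

theorem convexHull_subset_closure {s : Finset Plane} (hs : s ∈ elemTriangles K T) :
    convexHull ℝ (s : Set Plane) ⊆ closure T := by
  rw [hT.closure_eq]; exact subset_biUnion_of_mem (u := fun s : Finset Plane => convexHull ℝ (s : Set Plane)) hs

theorem interior_nonempty {s : Finset Plane} (hs : s ∈ elemTriangles K T) :
    (interior (convexHull ℝ (s : Set Plane))).Nonempty := by
  obtain ⟨z, hz⟩ := hT.ball s hs
  exact ⟨z, interior_mono hz (Metric.ball_subset_interior_closedBall
    (Metric.mem_ball_self hT.radius_pos))⟩

/-- Two triangles of `T` that share the edge `[p, q]` cover a disc centred at its midpoint, one side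
each. -/
theorem adjacent {s s' : Finset Plane} (hs : s ∈ elemTriangles K T) (hs' : s' ∈ elemTriangles K T)
    {p q c c' : Plane} (hsc : (s : Set Plane) = {c, p, q}) (hsc' : (s' : Set Plane) = {c', p, q})
    (hne : s ≠ s') :
    Metric.ball (midpoint ℝ p q) r ⊆ T ∧
      ∀ x ∈ Metric.ball (midpoint ℝ p q) r,
        (0 < bary c p q x → x ∈ interior (convexHull ℝ (s : Set Plane))) ∧
        (0 < bary c' p q x → x ∈ interior (convexHull ℝ (s' : Set Plane))) := by
  obtain ⟨z, hz⟩ := hT.ball s hs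
  obtain ⟨z', hz'⟩ := hT.ball s' hs'
  have hD := cross_ne_zero_of_face hs.1 hsc
  have hD' := cross_ne_zero_of_face hs'.1 hsc'
  have hdisj := disjoint_interior_triangles hs.1 hs'.1 hne
  rw [hsc] at hz hdisj ⊢
  rw [hsc'] at hz' hdisj ⊢
  have hr := hT.radius_pos
  have hpos : ∀ x ∈ Metric.ball (midpoint ℝ p q) r,
        (0 < bary c p q x → x ∈ interior (convexHull ℝ ({c, p, q} : Set Plane))) ∧
        (0 < bary c' p q x → x ∈ interior (convexHull ℝ ({c', p, q} : Set Plane))) := by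
    intro x hx
    rw [interior_triangle hD, interior_triangle hD']
    exact ⟨fun h => ⟨h, bary_pos_of_mem_ball_midpoint hD hr hz hx⟩,
      fun h => ⟨h, bary_pos_of_mem_ball_midpoint hD' hr hz' hx⟩⟩
  refine ⟨?_, hpos⟩
  -- The third vertices lie on opposite sides of the edge; otherwise a point slightly off the
  -- midpoint would be interior to both triangles.
  have hsign : cross (c - p) (q - p) * cross (c' - p) (q - p) < 0 := by
    by_contra hcon
    have hmul : 0 < cross (c - p) (q - p) * cross (c' - p) (q - p) :=
      lt_of_le_of_ne (not_lt.1 hcon) (Ne.symm (mul_ne_zero hD hD'))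
    set m := midpoint ℝ p q
    have hm : bary c p q m = 0 := by
      have : m = (0 : ℝ) • c + (1 / 2 : ℝ) • p + (1 / 2 : ℝ) • q := by
        simp only [m, midpoint_eq_smul_add]; simp [smul_add]
      rw [this, bary_combo (by norm_num) hD]
    have hlim : Tendsto (fun t : ℝ => m + t • (c - p)) (𝓝[>] 0) (𝓝 m) := by
      have : Continuous fun t : ℝ => m + t • (c - p) := by fun_prop
      simpa using (this.tendsto 0).mono_left nhdsWithin_le_nhds
    obtain ⟨t, ht, ht0⟩ := ((hlim.eventually (Metric.ball_mem_nhds m hr)).and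
      self_mem_nhdsWithin).exists
    have ht0' : 0 < t := ht0
    have hb : bary c p q (m + t • (c - p)) = t := by
      rw [bary_add_smul, hm, div_self hD]; ring
    have hb' : 0 < bary c' p q (m + t • (c - p)) := by
      have : bary c' p q (m + t • (c - p)) =
          bary c p q (m + t • (c - p)) * cross (c - p) (q - p) / cross (c' - p) (q - p) := by
        simp only [bary]; rw [div_mul_cancel₀ _ hD]
      rw [this, hb, mul_div_assoc]
      refine mul_pos ht0' ?_
      rw [← mul_div_mul_right _ _ hD']
      exact div_pos hmul (mul_self_pos.2 hD')
    exact Set.disjoint_left.1 hdisj ((hpos _ ht).1 (by rw [hb]; exact ht0')) ((hpos _ ht).2 hb')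
  -- Each point of the disc lies in one of the two closed triangles, according to its side. The
  -- absence of cracks then puts the open disc inside `T`.
  have hsub : Metric.ball (midpoint ℝ p q) r ⊆ closure T := by
    intro x hx
    have h1 := bary_pos_of_mem_ball_midpoint hD hr hz hx
    have h2 := bary_pos_of_mem_ball_midpoint hD' hr hz' hx
    rcases le_or_gt 0 (bary c p q x) with h | h
    · refine hT.convexHull_subset_closure hs ?_
      rw [hsc, mem_convexHull_triangle hD]
      exact ⟨h, h1.1.le, h1.2.le⟩
    · refine hT.convexHull_subset_closure hs' ?_
      rw [hsc', mem_convexHull_triangle hD']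
      refine ⟨?_, h2.1.le, h2.2.le⟩
      have : bary c' p q x =
          bary c p q x * (cross (c - p) (q - p) * cross (c' - p) (q - p)) /
            cross (c' - p) (q - p) ^ 2 := by
        simp only [bary]; field_simp
      rw [this]
      exact div_nonneg (mul_nonneg_of_nonpos_of_nonpos h.le hsign.le) (sq_nonneg _)
  have := interior_maximal hsub Metric.isOpen_ball
  rwa [hT.isPolygon.interior_closure] at this

/-- Connectedness of the set of triangles of `T` through edges. -/
theorem exists_adjacent {R : Set (Finset Plane)} (hR : R ⊆ elemTriangles K T) (hne : R.Nonempty)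
    (hR' : R ≠ elemTriangles K T) :
    ∃ s ∈ R, ∃ s' ∈ elemTriangles K T, s' ∉ R ∧ ∃ p q c c' : Plane, p ≠ q ∧
      (s : Set Plane) = {c, p, q} ∧ (s' : Set Plane) = {c', p, q} := by
  classical
  set Z : Set Plane := ⋃ s ∈ K.faces, (s : Set Plane)
  have hZ : Z.Countable := hT.finite_vertices.countable
  have hconn := isPreconnected_diff_countable hT.isPolygon.isOpen
    hT.isPolygon.isConnected.isPreconnected hZ
  have hclosed : ∀ Q ⊆ elemTriangles K T,
      IsClosed (⋃ s ∈ Q, convexHull ℝ (s : Set Plane)) := fun Q hQ =>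
    (hT.finite_elemTriangles.subset hQ).isClosed_biUnion fun s _ =>
      (s.finite_toSet.isCompact_convexHull ℝ).isClosed
  have hnonempty : ∀ Q ⊆ elemTriangles K T, Q.Nonempty →
      ((T \ Z) ∩ ⋃ s ∈ Q, convexHull ℝ (s : Set Plane)).Nonempty := by
    rintro Q hQ ⟨s, hs⟩
    obtain ⟨z, hz⟩ := hT.interior_nonempty (hQ hs)
    obtain ⟨ε, hε, hball⟩ := Metric.isOpen_iff.1 isOpen_interior z hz
    obtain ⟨y, hy, hyZ⟩ := ball_diff_countable_nonempty z hε hZ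
    exact ⟨y, ⟨(hQ hs).2 (hball hy), hyZ⟩, mem_biUnion hs (interior_subset (hball hy))⟩
  have hdiff : (elemTriangles K T \ R).Nonempty := by
    rw [nonempty_iff_ne_empty, Ne, sdiff_eq_empty]
    exact fun h => hR' (hR.antisymm h)
  -- Away from the vertices, the connected set `T \ Z` is covered by two closed sets, the triangles
  -- in `R` and the others. They meet at a point that is not a vertex, so the common face through it
  -- must be an edge.
  rw [isPreconnected_closed_iff] at hconn
  obtain ⟨x, ⟨hxT, hxZ⟩, hxU, hxV⟩ := hconn _ _ (hclosed R hR)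
    (hclosed (elemTriangles K T \ R) sdiff_subset) (by
      intro x hx
      have := subset_closure hx.1
      rw [hT.closure_eq] at this
      obtain ⟨s, hs, hxs⟩ := mem_iUnion₂.1 this
      by_cases hsR : s ∈ R
      · exact Or.inl (mem_biUnion hsR hxs)
      · exact Or.inr (mem_biUnion (show s ∈ elemTriangles K T \ R from ⟨hs, hsR⟩) hxs))
    (hnonempty R hR hne) (hnonempty _ sdiff_subset hdiff)
  obtain ⟨s, hs, hxs⟩ := mem_iUnion₂.1 hxU
  obtain ⟨s', hs', hxs'⟩ := mem_iUnion₂.1 hxV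
  have hss' : s ≠ s' := fun h => hs'.2 (h ▸ hs)
  have hx := K.inter_subset_convexHull (hR hs).1.1 hs'.1.1.1 ⟨hxs, hxs'⟩
  rw [← Finset.coe_inter] at hx
  have hcard := inter_card_le_two (hR hs).1.2 hs'.1.1.2 hss'
  have hxz : ∀ y ∈ s, x ≠ y := by
    rintro y hy rfl
    exact hxZ (mem_biUnion (hR hs).1.1 hy)
  have hcard2 : (s ∩ s').card = 2 := by
    rcases Nat.lt_or_ge (s ∩ s').card 2 with h | h
    · exfalso
      rcases (s ∩ s').eq_empty_or_nonempty with h0 | h0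
      · rw [h0] at hx; simp at hx
      · obtain ⟨y, hy⟩ := Finset.card_eq_one.1 (by have := h0.card_pos; omega : (s ∩ s').card = 1)
        rw [hy] at hx
        simp only [Finset.coe_singleton, convexHull_singleton, mem_singleton_iff] at hx
        have : y ∈ s ∩ s' := by rw [hy]; simp
        exact hxz y (Finset.mem_inter.1 this).1 hx
    · exact le_antisymm hcard h
  obtain ⟨p, q, hpq, hpq'⟩ := Finset.card_eq_two.1 hcard2
  have hp : p ∈ s ∩ s' := by rw [hpq']; simp
  have hq : q ∈ s ∩ s' := by rw [hpq']; simp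
  rw [Finset.mem_inter] at hp hq
  obtain ⟨c, -, -, hc⟩ := exists_third_vertex (hR hs).1.2 hpq hp.1 hq.1
  obtain ⟨c', -, -, hc'⟩ := exists_third_vertex hs'.1.1.2 hpq hp.2 hq.2
  exact ⟨s, hs, s', hs'.1, hs'.2, p, q, c, c', hpq, hc, hc'⟩

end IsTriangulated

end

end HHO

namespace HHO

noncomputable section

open Filter Geometry
open scoped Topology ENNReal

/-! ### The Poincaré inequality on an element -/

theorem volume_real_ball (x : Plane) {r : ℝ} (hr : 0 ≤ r) :
    volume.real (Metric.ball x r) = r ^ 2 * Real.pi := by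
  rw [Measure.real, EuclideanSpace.volume_ball_fin_two]
  simp [hr, Real.pi_pos.le]

theorem volume_real_closedBall (x : Plane) {r : ℝ} (hr : 0 ≤ r) :
    volume.real (Metric.closedBall x r) = r ^ 2 * Real.pi := by
  rw [Measure.real, Measure.addHaar_closedBall_eq_addHaar_ball, ← Measure.real,
    volume_real_ball x hr]

theorem volume_real_le {X : Set Plane} {h : ℝ} (hX : ∀ x ∈ X, ∀ y ∈ X, dist x y ≤ h) :
    volume.real X ≤ h ^ 2 * Real.pi := by
  rcases X.eq_empty_or_nonempty with rfl | ⟨x, hx⟩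
  · have := Real.pi_pos; simp; positivity
  · have h0 : 0 ≤ h := dist_nonneg.trans (hX x hx x hx)
    rw [← volume_real_closedBall x h0]
    exact measureReal_mono (fun y hy => hX y hy x hx) Metric.isBounded_closedBall.measure_lt_top.ne

/-- Closeness to a constant propagates between overlapping sets. -/
theorem integral_sq_sub_propagate {X Y : Set Plane}
    (hbX : Bornology.IsBounded X) (hbY : Bornology.IsBounded Y) {w : Plane → ℝ}
    (hwX : MemLp w 2 (volume.restrict X)) (hwY : MemLp w 2 (volume.restrict Y)) {c d A B P Q : ℝ}
    (hc : ∫ x in X, (w x - c) ^ 2 ≤ A) (hd : ∫ x in Y, (w x - d) ^ 2 ≤ B) (hP : 0 < P)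
    (hPQ : P ≤ volume.real (X ∩ Y)) (hQ : volume.real Y ≤ Q) :
    ∫ x in Y, (w x - c) ^ 2 ≤ 2 * B + 4 * (A + B) * (Q / P) := by
  have fX : IsFiniteMeasure (volume.restrict X) := ⟨by simpa using hbX.measure_lt_top (μ := volume)⟩
  have fY : IsFiniteMeasure (volume.restrict Y) := ⟨by simpa using hbY.measure_lt_top (μ := volume)⟩
  have fI : IsFiniteMeasure (volume.restrict (X ∩ Y)) :=
    ⟨by simpa using (hbX.subset inter_subset_left).measure_lt_top (μ := volume)⟩
  have mI : MemLp w 2 (volume.restrict (X ∩ Y)) :=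
    hwX.mono_measure (Measure.restrict_mono inter_subset_left le_rfl)
  have h1 := integral_sub_sq_le (mI.sub (memLp_const d)) (mI.sub (memLp_const c))
  -- On the overlap the difference of the two errors is the constant `c - d`; hence `(c - d)² ≤ 2 (A
  -- + B) / P`.
  have e1 : ∫ x in X ∩ Y, ((w x - d) - (w x - c)) ^ 2 = volume.real (X ∩ Y) * (c - d) ^ 2 := by
    have : ∀ x, ((w x - d) - (w x - c)) ^ 2 = (c - d) ^ 2 := fun x => by ring
    simp only [this, integral_const, smul_eq_mul, measureReal_restrict_apply_univ]
  have e2 : ∫ x in X ∩ Y, (w x - d) ^ 2 ≤ B := (setIntegral_mono_set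
    (hwY.sub (memLp_const d)).integrable_sq (Eventually.of_forall fun x => sq_nonneg _)
    inter_subset_right.eventuallyLE).trans hd
  have e3 : ∫ x in X ∩ Y, (w x - c) ^ 2 ≤ A := (setIntegral_mono_set
    (hwX.sub (memLp_const c)).integrable_sq (Eventually.of_forall fun x => sq_nonneg _)
    inter_subset_left.eventuallyLE).trans hc
  simp only [Pi.sub_apply] at h1
  rw [e1] at h1
  have h2 := integral_add_sq_le (hwY.sub (memLp_const d)) (memLp_const (μ := volume.restrict Y)
    (p := 2) (d - c))
  have e4 : ∫ x in Y, ((w x - d) + (d - c)) ^ 2 = ∫ x in Y, (w x - c) ^ 2 := by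
    congr 1; ext x; ring
  simp only [Pi.sub_apply, e4, integral_const, smul_eq_mul, measureReal_restrict_apply_univ] at h2
  have h3 : P * (c - d) ^ 2 ≤ 2 * (A + B) := by
    have := mul_le_mul_of_nonneg_right hPQ (sq_nonneg (c - d))
    linarith
  have hQ0 : 0 ≤ Q := measureReal_nonneg.trans hQ
  have h4 : (c - d) ^ 2 ≤ 2 * (A + B) / P := by rw [le_div_iff₀ hP]; linarith
  have h5 : volume.real Y * (d - c) ^ 2 ≤ Q * (2 * (A + B) / P) := by
    rw [show (d - c) ^ 2 = (c - d) ^ 2 by ring]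
    exact mul_le_mul hQ h4 (sq_nonneg _) hQ0
  calc _ ≤ 2 * B + 2 * (Q * (2 * (A + B) / P)) := by linarith
    _ = _ := by ring

namespace IsTriangulated

variable {K : SimplicialComplex ℝ Plane} {T : Set Plane} {r : ℝ} (hT : IsTriangulated K T r)
include hT

theorem dist_le_diam {x y : Plane} (hx : x ∈ T) (hy : y ∈ T) : dist x y ≤ Metric.diam T :=
  Metric.dist_le_diam_of_mem hT.isPolygon.isBounded hx hy

theorem volume_interior_ge {s : Finset Plane} (hs : s ∈ elemTriangles K T) :
    r ^ 2 * Real.pi ≤ volume.real (interior (convexHull ℝ (s : Set Plane))) := by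
  obtain ⟨z, hz⟩ := hT.ball s hs
  rw [← volume_real_ball z hT.radius_pos.le]
  refine measureReal_mono (Metric.ball_subset_interior_closedBall.trans (interior_mono hz))
    (hT.isPolygon.isBounded.subset hs.2).measure_lt_top.ne

theorem nonempty_elemTriangles : (elemTriangles K T).Nonempty := by
  obtain ⟨x, hx⟩ := hT.isPolygon.isConnected.nonempty
  have := subset_closure hx
  rw [hT.closure_eq] at this
  obtain ⟨s, hs, -⟩ := mem_iUnion₂.1 this
  exact ⟨s, hs⟩

omit hT in
theorem pairwiseDisjoint_interior : (elemTriangles K T).PairwiseDisjoint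
    fun s => interior (convexHull ℝ (s : Set Plane)) :=
  fun _ hs _ hs' hne => disjoint_interior_triangles hs.1 hs'.1 hne

/-- Only the boundaries of the triangles are lost, and the boundary of a convex set is null. -/
theorem ae_eq_iUnion_interior :
    (T : Set Plane) =ᵐ[volume] ⋃ s ∈ hT.finite_elemTriangles.toFinset,
      interior (convexHull ℝ (s : Set Plane)) := by
  simp only [Set.Finite.mem_toFinset]
  refine Filter.EventuallyLE.antisymm ?_ (iUnion₂_subset fun s hs => hs.2).eventuallyLE
  refine (ae_le_set).2 (measure_mono_null (t := ⋃ s ∈ elemTriangles K T,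
    frontier (convexHull ℝ (s : Set Plane))) ?_ ?_)
  · rintro x ⟨hx, hx'⟩
    have := subset_closure hx
    rw [hT.closure_eq] at this
    obtain ⟨s, hs, hxs⟩ := mem_iUnion₂.1 this
    refine mem_biUnion hs ⟨subset_closure hxs, fun h => hx' (mem_biUnion hs h)⟩
  · exact (measure_biUnion_null_iff hT.finite_elemTriangles.countable).2 fun s _ =>
      (convex_convexHull ℝ _).addHaar_frontier volume

theorem setIntegral_eq_sum {f : Plane → ℝ} (hf : IntegrableOn f T) :
    ∫ x in T, f x = ∑ s ∈ hT.finite_elemTriangles.toFinset,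
      ∫ x in interior (convexHull ℝ (s : Set Plane)), f x := by
  rw [setIntegral_congr_set hT.ae_eq_iUnion_interior]
  refine integral_biUnion_finset _ (fun s _ => isOpen_interior.measurableSet) ?_ fun s hs => ?_
  · intro s hs s' hs' hne
    simp only [Set.Finite.coe_toFinset] at hs hs'
    exact pairwiseDisjoint_interior hs hs' hne
  · exact hf.mono_set ((Set.Finite.mem_toFinset _).1 hs).2

/-- Area count: the triangles have disjoint interiors, each of area at least `π r²`, inside a set of
area at most `π h²`. -/
theorem card_mul_sq_le :
    (hT.finite_elemTriangles.toFinset.card : ℝ) * r ^ 2 ≤ Metric.diam T ^ 2 := by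
  have hfin : volume T ≠ ⊤ := hT.isPolygon.isBounded.measure_lt_top.ne
  have h1 := hT.setIntegral_eq_sum (f := fun _ => 1) (integrableOn_const hfin)
  simp only [integral_const, smul_eq_mul, mul_one, measureReal_restrict_apply_univ] at h1
  have h2 : (hT.finite_elemTriangles.toFinset.card : ℝ) * (r ^ 2 * Real.pi) ≤ volume.real T := by
    rw [h1, ← nsmul_eq_mul]
    exact Finset.card_nsmul_le_sum _ _ _ fun s hs =>
      hT.volume_interior_ge ((Set.Finite.mem_toFinset _).1 hs)
  have h3 := volume_real_le fun x hx y hy => hT.dist_le_diam (x := x) (y := y) hx hy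
  have := Real.pi_pos
  have h4 := h2.trans h3
  rw [← mul_assoc] at h4
  exact le_of_mul_le_mul_right h4 this

/-- A triangle contains a disc of radius `r / 2` in any disc of radius `r` centred at the midpoint
of an edge, on the side of the triangle. -/
theorem overlap_ge {X : Set Plane} (hbX : Bornology.IsBounded X) {c p q : Plane}
    (hD : cross (c - p) (q - p) ≠ 0) (hpq : p ≠ q)
    (hX : ∀ x ∈ Metric.ball (midpoint ℝ p q) r, 0 < bary c p q x → x ∈ X) :
    (r / 2) ^ 2 * Real.pi ≤ volume.real (Metric.ball (midpoint ℝ p q) r ∩ X) := by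
  have hr := hT.radius_pos
  set m := midpoint ℝ p q with hm
  have hm0 : bary c p q m = 0 := by
    have : m = (0 : ℝ) • c + (1 / 2 : ℝ) • p + (1 / 2 : ℝ) • q := by
      rw [hm, midpoint_eq_smul_add]; simp [smul_add]
    rw [this, bary_combo (by norm_num) hD]
  set L := ‖q - p‖ with hL
  have hL0 : 0 < L := norm_pos_iff.2 (sub_ne_zero.2 hpq.symm)
  -- `ν` is the unit normal to the edge that points into the triangle; the required disc is centred
  -- at `m + (r / 2) ν`.
  obtain ⟨ν, hν, hνD⟩ : ∃ ν : Plane, ‖ν‖ = 1 ∧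
      cross ν (q - p) / cross (c - p) (q - p) = L / |cross (c - p) (q - p)| := by
    rcases lt_or_gt_of_ne hD with h | h
    · refine ⟨L⁻¹ • perp (q - p), by rw [norm_smul, norm_perp, norm_inv, norm_norm]; exact inv_mul_cancel₀ hL0.ne', ?_⟩
      have : cross (L⁻¹ • perp (q - p)) (q - p) = -L := by
        have : cross (L⁻¹ • perp (q - p)) (q - p) = L⁻¹ * cross (perp (q - p)) (q - p) := by
          simp only [cross, PiLp.smul_apply, smul_eq_mul]; ring
        rw [this, cross_perp_self, ← hL]; field_simp
      rw [this, abs_of_neg h, neg_div, div_neg]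
    · refine ⟨-(L⁻¹ • perp (q - p)), by rw [norm_neg, norm_smul, norm_perp, norm_inv, norm_norm]; exact inv_mul_cancel₀ hL0.ne', ?_⟩
      have : cross (-(L⁻¹ • perp (q - p))) (q - p) = L := by
        have : cross (-(L⁻¹ • perp (q - p))) (q - p) = -(L⁻¹ * cross (perp (q - p)) (q - p)) := by
          simp only [cross, PiLp.neg_apply, PiLp.smul_apply, smul_eq_mul]; ring
        rw [this, cross_perp_self, ← hL]; field_simp
      rw [this, abs_of_pos h]
  rw [← volume_real_ball (m + (r / 2) • ν) (by positivity)]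
  refine measureReal_mono (fun y hy => ?_) (hbX.subset inter_subset_right).measure_lt_top.ne
  have hy' : ‖y - (m + (r / 2) • ν)‖ < r / 2 := mem_ball_iff_norm.1 hy
  have hym : y ∈ Metric.ball m r := by
    rw [mem_ball_iff_norm]
    have : y - m = (y - (m + (r / 2) • ν)) + (r / 2) • ν := by module
    rw [this]
    refine (norm_add_le _ _).trans_lt ?_
    rw [norm_smul, hν, Real.norm_of_nonneg (by positivity)]
    linarith
  refine ⟨hym, hX y hym ?_⟩
  have ey : y = (m + (r / 2) • ν) + (1 : ℝ) • (y - (m + (r / 2) • ν)) := by module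
  rw [ey, bary_add_smul, bary_add_smul, hm0, hνD]
  set v := y - (m + (r / 2) • ν)
  have hcs : |cross v (q - p)| ≤ ‖v‖ * L := by
    have h0 : cross v (q - p) ^ 2 ≤ (‖v‖ * L) ^ 2 := by
      rw [mul_pow, hL, norm_sq_eq, norm_sq_eq]
      simp only [cross]
      nlinarith [sq_nonneg (v 0 * (q - p) 0 + v 1 * (q - p) 1)]
    exact abs_le_of_sq_le_sq h0 (by positivity)
  have hD0 : 0 < |cross (c - p) (q - p)| := abs_pos.2 hD
  have h1 : |cross v (q - p) / cross (c - p) (q - p)| < r / 2 * (L / |cross (c - p) (q - p)|) := by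
    rw [abs_div, ← mul_div_assoc]
    refine div_lt_div_of_pos_right (hcs.trans_lt ?_) hD0
    exact mul_lt_mul_of_pos_right hy' hL0
  have h2 := (abs_lt.1 h1).1
  linarith

omit hT in
theorem memLp_mono {w : Plane → ℝ} (hw : MemLp w 2 (volume.restrict T)) {X : Set Plane}
    (hX : X ⊆ T) : MemLp w 2 (volume.restrict X) :=
  hw.mono_measure (Measure.restrict_mono hX le_rfl)

/-- Poincaré–Wirtinger inequality on an element, with explicit constant. -/
theorem exists_const_integral_le {w : Plane → ℝ} {v : Fin 2 → Plane → ℝ} (h : IsH1 T w v) {N : ℕ}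
    {κ : ℝ} (hκ1 : 1 ≤ κ) (hκ : 4 * Metric.diam T ^ 2 ≤ κ * r ^ 2) (hN : κ ≤ N) :
    ∃ c, ∫ x in T, (w x - c) ^ 2 ≤
      N * (100 * κ ^ 2) ^ N * (16 * Metric.diam T ^ 2 * ∑ i, ∫ x in T, v i x ^ 2) := by
  classical
  have hr := hT.radius_pos
  have hTo := hT.isPolygon.isOpen
  have hTm := hTo.measurableSet
  have hbT := hT.isPolygon.isBounded
  set d := Metric.diam T
  set e := 16 * d ^ 2 * ∑ i, ∫ x in T, v i x ^ 2 with he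
  have hint : ∀ i, IntegrableOn (fun x => v i x ^ 2) T := fun i => (h.memLp_grad i).integrable_sq
  have he0 : 0 ≤ e := by
    have := Finset.sum_nonneg fun i (_ : i ∈ (Finset.univ : Finset (Fin 2))) =>
      integral_sq_nonneg (μ := volume.restrict T) (v i)
    positivity
  have hconv : ∀ X ⊆ T, IsOpen X → Convex ℝ X → ∃ c, ∫ x in X, (w x - c) ^ 2 ≤ e := by
    intro X hXT hXo hXc
    obtain ⟨c, hc⟩ := (h.mono hTm hXT).poincare_convex hXo hXc (hbT.subset hXT)
      (fun x hx y hy => hT.dist_le_diam (hXT hx) (hXT hy))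
    refine ⟨c, hc.trans ?_⟩
    refine mul_le_mul_of_nonneg_left (Finset.sum_le_sum fun i _ => ?_) (by positivity)
    exact setIntegral_mono_set (hint i) (Eventually.of_forall fun x => sq_nonneg _)
      hXT.eventuallyLE
  -- `P` bounds the overlaps from below and `Q` the area of any piece from above; their quotient `4
  -- d² / r²` is what `κ` controls.
  set P := (r / 2) ^ 2 * Real.pi with hP
  have hP0 : 0 < P := by have := Real.pi_pos; positivity
  set Q := d ^ 2 * Real.pi with hQ
  have hQP : Q / P ≤ κ := by
    rw [div_le_iff₀ hP0, hQ, hP]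
    have := Real.pi_pos
    nlinarith
  have hQ' : ∀ X ⊆ T, volume.real X ≤ Q := fun X hX =>
    volume_real_le fun x hx y hy => hT.dist_le_diam (hX hx) (hX hy)
  have step : ∀ X ⊆ T, ∀ Y ⊆ T, IsOpen X → IsOpen Y → Convex ℝ Y → P ≤ volume.real (X ∩ Y) →
      ∀ c M, 1 ≤ M → ∫ x in X, (w x - c) ^ 2 ≤ M * e → ∫ x in Y, (w x - c) ^ 2 ≤ 10 * κ * M * e := by
    intro X hX Y hY hXo hYo hYc hPXY c M hM hc
    obtain ⟨c', hc'⟩ := hconv Y hY hYo hYc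
    refine (integral_sq_sub_propagate (hbT.subset hX)
      (hbT.subset hY) (memLp_mono h.memLp hX) (memLp_mono h.memLp hY) hc hc' hP0 hPXY
      (hQ' Y hY)).trans ?_
    have h1 : 4 * (M * e + e) * (Q / P) ≤ 4 * (M * e + e) * κ := by gcongr
    have h2 : 2 * e + 4 * (M * e + e) * κ ≤ 10 * κ * M * e := by
      have : 2 + 4 * (M + 1) * κ ≤ 10 * κ * M := by nlinarith
      nlinarith [mul_le_mul_of_nonneg_right this he0]
    linarith
  set X : Finset Plane → Set Plane := fun s => interior (convexHull ℝ (s : Set Plane)) with hX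
  have hXconv : ∀ s, Convex ℝ (X s) := fun s => (convex_convexHull ℝ _).interior
  have hXo : ∀ s, IsOpen (X s) := fun s => isOpen_interior
  set S := hT.finite_elemTriangles.toFinset with hS
  have hSmem : ∀ s, s ∈ S ↔ s ∈ elemTriangles K T := fun s => Set.Finite.mem_toFinset _
  obtain ⟨s₀, hs₀⟩ := hT.nonempty_elemTriangles
  obtain ⟨c, hc⟩ := hconv (X s₀) hs₀.2 (hXo s₀) (hXconv s₀)
  have hκ2 : 1 ≤ 100 * κ ^ 2 := by nlinarith
  -- Triangles are added one at a time, each adjacent to one already reached. Passing from triangle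
  -- to disc to triangle costs `(10 κ)²`, whence the factor `100 κ²`.
  have chain : ∀ n, n + 1 ≤ S.card → ∃ R ⊆ S, R.card = n + 1 ∧
      ∀ s ∈ R, ∫ x in X s, (w x - c) ^ 2 ≤ (100 * κ ^ 2) ^ n * e := by
    intro n
    induction n with
    | zero =>
      intro _
      refine ⟨{s₀}, by simpa [hSmem] using hs₀, by simp, fun s hs => ?_⟩
      rw [Finset.mem_singleton.1 hs]; simpa using hc
    | succ n ih =>
      intro hn
      obtain ⟨R, hRS, hRc, hR⟩ := ih (by omega)
      obtain ⟨s, hs, s', hs', hs'R, p, q, a, a', hpq, hsa, hsa'⟩ := hT.exists_adjacent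
        (R := (R : Set (Finset Plane))) (fun s hs => (hSmem s).1 (hRS hs))
        (by rw [Finset.coe_nonempty, ← Finset.card_pos]; omega)
        (by
          intro h
          have : R = S := by ext s; rw [hSmem, ← h]; simp
          rw [this] at hRc; omega)
      have hsT : s ∈ elemTriangles K T := (hSmem s).1 (hRS hs)
      have hne : s ≠ s' := fun h => hs'R (h ▸ hs)
      obtain ⟨hB, hside⟩ := hT.adjacent hsT hs' hsa hsa' hne
      set B := Metric.ball (midpoint ℝ p q) r
      have o1 := hT.overlap_ge (hbT.subset hsT.2) (cross_ne_zero_of_face hsT.1 hsa) hpq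
        fun x hx => (hside x hx).1
      have o2 := hT.overlap_ge (hbT.subset hs'.2) (cross_ne_zero_of_face hs'.1 hsa') hpq
        fun x hx => (hside x hx).2
      rw [inter_comm] at o1
      have b1 := step (X s) hsT.2 B hB (hXo s) Metric.isOpen_ball (convex_ball _ _) o1 c _
        (one_le_pow₀ hκ2) (hR s hs)
      have b2 := step B hB (X s') hs'.2 Metric.isOpen_ball (hXo s') (hXconv s') o2 c _
        (by nlinarith [one_le_pow₀ hκ2 (n := n)]) b1
      refine ⟨insert s' R, Finset.insert_subset ((hSmem s').2 hs') hRS, by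
        rw [Finset.card_insert_of_notMem (by simpa using hs'R), hRc], fun t ht => ?_⟩
      rcases Finset.mem_insert.1 ht with rfl | ht
      · refine b2.trans (le_of_eq ?_); ring
      · exact (hR t ht).trans
          (mul_le_mul_of_nonneg_right (pow_le_pow_right₀ hκ2 (Nat.le_succ n)) he0)
  have hScard : 1 ≤ S.card := Finset.card_pos.2 ⟨s₀, (hSmem s₀).2 hs₀⟩
  -- The area count bounds the number of triangles by `κ`, hence the length of the chain by a number
  -- independent of the element.
  have hSN : S.card ≤ N := by
    have h1 := hT.card_mul_sq_le
    have h2 : (S.card : ℝ) * r ^ 2 ≤ κ * r ^ 2 := by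
      have : d ^ 2 ≤ 4 * d ^ 2 := by nlinarith [sq_nonneg d]
      linarith
    have h3 : (S.card : ℝ) ≤ κ := le_of_mul_le_mul_right h2 (by positivity)
    exact_mod_cast h3.trans hN
  obtain ⟨R, hRS, hRc, hR⟩ := chain (S.card - 1) (by omega)
  have hRS' : R = S := Finset.eq_of_subset_of_card_le hRS (by omega)
  have : IsFiniteMeasure (volume.restrict T) := ⟨by simpa using hbT.measure_lt_top (μ := volume)⟩
  refine ⟨c, ?_⟩
  have hi : IntegrableOn (fun x => (w x - c) ^ 2) T :=
    (h.memLp.sub (memLp_const c)).integrable_sq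
  rw [hT.setIntegral_eq_sum hi]
  calc _ ≤ ∑ s ∈ S, (100 * κ ^ 2) ^ N * e := by
        refine Finset.sum_le_sum fun s hs => (hR s (hRS' ▸ hs)).trans ?_
        have : (100 * κ ^ 2) ^ (S.card - 1) ≤ (100 * κ ^ 2) ^ N :=
          pow_le_pow_right₀ hκ2 (by omega)
        gcongr
    _ = S.card * ((100 * κ ^ 2) ^ N * e) := by rw [Finset.sum_const, nsmul_eq_mul]
    _ ≤ N * ((100 * κ ^ 2) ^ N * e) := by gcongr
    _ = _ := by ring

end IsTriangulated

/-- The constant of the Poincaré–Wirtinger inequality on an element that contains discs of radius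
`θ` times its diameter. -/
def poincareConst (θ : ℝ) : ℝ :=
  ⌈1 + 4 / θ ^ 2⌉₊ * (100 * (1 + 4 / θ ^ 2) ^ 2) ^ ⌈1 + 4 / θ ^ 2⌉₊ * 16

theorem poincareConst_pos (θ : ℝ) : 0 < poincareConst θ := by
  have h1 : 0 < 1 + 4 / θ ^ 2 := by positivity
  have h2 : 0 < ⌈1 + 4 / θ ^ 2⌉₊ := Nat.ceil_pos.2 h1
  unfold poincareConst
  positivity

/-- The Poincaré–Wirtinger inequality on an element. -/
theorem IsTriangulated.poincare {K : SimplicialComplex ℝ Plane} {T : Set Plane} {θ : ℝ}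
    (hθ : 0 < θ) (hT : IsTriangulated K T (θ * Metric.diam T)) {w : Plane → ℝ}
    {v : Fin 2 → Plane → ℝ} (h : IsH1 T w v) (hmean : ∫ x in T, w x = 0) :
    ∫ x in T, w x ^ 2 ≤ poincareConst θ * Metric.diam T ^ 2 * ∑ i, ∫ x in T, v i x ^ 2 := by
  have hκ1 : 1 ≤ 1 + 4 / θ ^ 2 := by
    have : 0 ≤ 4 / θ ^ 2 := by positivity
    linarith
  obtain ⟨c, hc⟩ := hT.exists_const_integral_le h hκ1
    (by
      have : 4 / θ ^ 2 * (θ * Metric.diam T) ^ 2 = 4 * Metric.diam T ^ 2 := by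
        field_simp
      nlinarith [sq_nonneg (θ * Metric.diam T)])
    (Nat.le_ceil _)
  have : IsFiniteMeasure (volume.restrict T) :=
    ⟨by simpa using hT.isPolygon.isBounded.measure_lt_top (μ := volume)⟩
  have h1 := (integral_sq_sub_average_le h.memLp c).trans hc
  rw [average_eq, hmean] at h1
  simp only [smul_zero, sub_zero] at h1
  refine h1.trans (le_of_eq ?_)
  unfold poincareConst
  ring

end

end HHO

/-! ### Traces on the boundary of an element. -/

namespace HHO

noncomputable section

open Filter Geometry
open scoped Topology ENNReal

/-! ### Limits in `L²` -/

section L2Limits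

variable {α : Type*} [MeasurableSpace α] {μ : Measure α}

theorem norm_toLp_sq {f : α → ℝ} (hf : MemLp f 2 μ) : ‖hf.toLp f‖ ^ 2 = ∫ x, f x ^ 2 ∂μ := by
  rw [← real_inner_self_eq_norm_sq, L2.inner_def]
  refine integral_congr_ae ?_
  filter_upwards [hf.coeFn_toLp] with x hx
  simp [hx, sq]

/-- Completeness of `L²`, phrased with square integrals. The Cauchy condition has the form in which
the edge estimate bounds the difference of two smooth approximants. -/
theorem exists_memLp_tendsto {u : ℕ → α → ℝ} (hu : ∀ n, MemLp (u n) 2 μ) {a : ℕ → ℝ}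
    (ha : Tendsto a atTop (𝓝 0)) (h : ∀ m n, ∫ x, (u m x - u n x) ^ 2 ∂μ ≤ a m + a n) :
    ∃ g, MemLp g 2 μ ∧ Tendsto (fun n => ∫ x, (u n x - g x) ^ 2 ∂μ) atTop (𝓝 0) := by
  have hdist : ∀ m n, dist ((hu m).toLp) ((hu n).toLp) ^ 2 ≤ a m + a n := by
    intro m n
    rw [dist_eq_norm, ← MemLp.toLp_sub, norm_toLp_sq]
    exact h m n
  have hc : CauchySeq fun n => (hu n).toLp := by
    rw [Metric.cauchySeq_iff]
    intro ε hε
    have : ∀ᶠ n in atTop, a n < ε ^ 2 / 2 := ha.eventually_lt_const (by positivity)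
    obtain ⟨N, hN⟩ := eventually_atTop.1 this
    refine ⟨N, fun m hm n hn => ?_⟩
    have h1 := hdist m n
    have h2 := hN m hm
    have h3 := hN n hn
    exact lt_of_pow_lt_pow_left₀ 2 hε.le (by linarith)
  obtain ⟨G, hG⟩ := cauchySeq_tendsto_of_complete hc
  have hGm := Lp.memLp G
  refine ⟨G, hGm, ?_⟩
  have h1 := (tendsto_iff_norm_sub_tendsto_zero.1 hG).pow 2
  rw [zero_pow two_ne_zero] at h1
  refine h1.congr fun n => ?_
  have h2 : (hu n).toLp - G = ((hu n).sub hGm).toLp := by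
    rw [MemLp.toLp_sub (hu n) hGm, Lp.toLp_coeFn]
  rw [h2, norm_toLp_sq]
  rfl

theorem integral_sq_sub_le_of_tendsto {u : ℕ → α → ℝ} (hu : ∀ n, MemLp (u n) 2 μ) {g ψ : α → ℝ}
    (hg : MemLp g 2 μ) (hψ : MemLp ψ 2 μ)
    (h : Tendsto (fun n => ∫ x, (u n x - g x) ^ 2 ∂μ) atTop (𝓝 0)) {b : ℕ → ℝ} {B : ℝ}
    (hb : ∀ n, ∫ x, (u n x - ψ x) ^ 2 ∂μ ≤ b n) (hB : Tendsto b atTop (𝓝 B)) :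
    ∫ x, (g x - ψ x) ^ 2 ∂μ ≤ 2 * B := by
  have h1 : ∀ n, ∫ x, (g x - ψ x) ^ 2 ∂μ ≤ 2 * b n + 2 * ∫ x, (u n x - g x) ^ 2 ∂μ := by
    intro n
    have := integral_sub_sq_le ((hu n).sub hψ) ((hu n).sub hg)
    simp only [Pi.sub_apply, sub_sub_sub_cancel_left] at this
    linarith [hb n]
  have h2 := (hB.const_mul 2).add (h.const_mul 2)
  simpa using ge_of_tendsto' h2 h1

theorem integrable_mul_of_memLp {f g : α → ℝ} (hf : MemLp f 2 μ) (hg : MemLp g 2 μ) :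
    Integrable (fun x => f x * g x) μ :=
  MemLp.integrable_mul (p := 2) (q := 2) hf hg

/-- Cauchy–Schwarz, from the discriminant of the nonnegative quadratic `t ↦ ∫ (t f + g)²`. -/
theorem sq_integral_mul_le {f g : α → ℝ} (hf : MemLp f 2 μ) (hg : MemLp g 2 μ) :
    (∫ x, f x * g x ∂μ) ^ 2 ≤ (∫ x, f x ^ 2 ∂μ) * ∫ x, g x ^ 2 ∂μ := by
  have i0 : Integrable (fun x => f x * g x) μ := integrable_mul_of_memLp hf hg
  have key : ∀ t : ℝ, 0 ≤ (∫ x, f x ^ 2 ∂μ) * (t * t) + (2 * ∫ x, f x * g x ∂μ) * t +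
      ∫ x, g x ^ 2 ∂μ := by
    intro t
    have i1 : Integrable (fun x => f x ^ 2 * (t * t)) μ := hf.integrable_sq.mul_const _
    have i2 : Integrable (fun x => f x * g x * (2 * t)) μ := i0.mul_const _
    have i12 : Integrable (fun x => f x ^ 2 * (t * t) + f x * g x * (2 * t)) μ := i1.add i2
    have e : ∫ x, (f x * t + g x) ^ 2 ∂μ = (∫ x, f x ^ 2 ∂μ) * (t * t) +
        (2 * ∫ x, f x * g x ∂μ) * t + ∫ x, g x ^ 2 ∂μ := by
      have : ∀ x, (f x * t + g x) ^ 2 = f x ^ 2 * (t * t) + f x * g x * (2 * t) + g x ^ 2 :=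
        fun x => by ring
      simp only [this]
      rw [integral_add i12 hg.integrable_sq, integral_add i1 i2, integral_mul_const,
        integral_mul_const]
      ring
    rw [← e]
    exact integral_nonneg fun x => sq_nonneg _
  have := discrim_le_zero key
  unfold discrim at this
  linarith

theorem tendsto_integral_mul {u : ℕ → α → ℝ} (hu : ∀ n, MemLp (u n) 2 μ) {g ψ : α → ℝ}
    (hg : MemLp g 2 μ) (hψ : MemLp ψ 2 μ)
    (h : Tendsto (fun n => ∫ x, (u n x - g x) ^ 2 ∂μ) atTop (𝓝 0)) :
    Tendsto (fun n => ∫ x, u n x * ψ x ∂μ) atTop (𝓝 (∫ x, g x * ψ x ∂μ)) := by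
  rw [tendsto_iff_norm_sub_tendsto_zero]
  have h1 : ∀ n, ‖(∫ x, u n x * ψ x ∂μ) - ∫ x, g x * ψ x ∂μ‖ ≤
      √((∫ x, (u n x - g x) ^ 2 ∂μ) * ∫ x, ψ x ^ 2 ∂μ) := by
    intro n
    refine Real.le_sqrt_of_sq_le ?_
    rw [Real.norm_eq_abs, sq_abs, ← integral_sub (integrable_mul_of_memLp (hu n) hψ)
      (integrable_mul_of_memLp hg hψ)]
    have := sq_integral_mul_le ((hu n).sub hg) hψ
    simpa [sub_mul] using this
  have h2 := (h.mul_const (∫ x, ψ x ^ 2 ∂μ)).sqrt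
  rw [zero_mul, Real.sqrt_zero] at h2
  exact squeeze_zero (fun n => norm_nonneg _) h1 h2

end L2Limits

/-- Arc length is infinite on discs, hence not finite on compact sets; finiteness on `X` alone has
to do. -/
theorem memLp_of_continuous_of_measure_lt_top {X : Set Plane} (hX : Bornology.IsBounded X)
    {μ : Measure Plane} (hμ : μ X < ⊤) (hXm : MeasurableSet X) {f : Plane → ℝ}
    (hf : Continuous f) : MemLp f 2 (μ.restrict X) := by
  have : IsFiniteMeasure (μ.restrict X) := ⟨by simpa using hμ⟩
  obtain ⟨C, hC⟩ := hX.isCompact_closure.exists_bound_of_continuousOn hf.continuousOn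
  exact MemLp.of_bound hf.aestronglyMeasurable C
    ((ae_restrict_iff' hXm).2 (Eventually.of_forall fun x hx => hC x (subset_closure hx)))

/-! ### Traces on an edge of a triangle -/

theorem isBounded_openSegment (p q : Plane) : Bornology.IsBounded (openSegment ℝ p q) := by
  refine Bornology.IsBounded.subset ?_ (openSegment_subset_segment ℝ p q)
  rw [← convexHull_pair]
  exact (isBounded_convexHull.2 (toFinite _).isBounded)

theorem measurableSet_openSegment (p q : Plane) : MeasurableSet (openSegment ℝ p q) := by
  rcases eq_or_ne p q with rfl | h
  · simp
  · rw [openSegment_eq_image_lineMap h]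
    exact (measurableEmbedding_lineMap p (norm_unitDir h)).measurableSet_image.2 measurableSet_Ioo

theorem memLp_openSegment (p q : Plane) {f : Plane → ℝ} (hf : Continuous f) :
    MemLp f 2 (arcLength.restrict (openSegment ℝ p q)) :=
  memLp_of_continuous_of_measure_lt_top (isBounded_openSegment p q)
    ((measure_mono (openSegment_subset_segment ℝ p q)).trans_lt (arcLength_segment_lt_top p q))
    (measurableSet_openSegment p q) hf

section EdgeTrace

variable {c p q z : Plane} {r h : ℝ} (hD : cross (c - p) (q - p) ≠ 0) (hr : 0 < r)
  (hball : Metric.closedBall z r ⊆ convexHull ℝ ({c, p, q} : Set Plane))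
  (hh : ∀ x ∈ convexHull ℝ ({c, p, q} : Set Plane), ∀ y ∈ convexHull ℝ ({c, p, q} : Set Plane),
    dist x y ≤ h)
include hD hr hball hh

/-- The cone estimate with apex the opposite vertex. The edge length divided by `|cross|` is the
inverse of the height, which is at least `2 r`. -/
theorem integral_openSegment_sq_le {u : Plane → ℝ} (hu : ContDiff ℝ ∞ u) :
    ∫ x in openSegment ℝ p q, u x ^ 2 ∂arcLength ≤ (2 * r)⁻¹ *
      (3 * (∫ x in interior (convexHull ℝ ({c, p, q} : Set Plane)), u x ^ 2) +
        h ^ 2 * ∑ i, ∫ x in interior (convexHull ℝ ({c, p, q} : Set Plane)), pd i u x ^ 2) := by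
  have hD2 := cross_rotate_ne hD
  have hD3 := cross_rotate_ne hD2
  have hpq : p ≠ q := by
    rintro rfl
    simp [cross] at hD
  have hcr : cross (p - c) (q - p) = -cross (c - p) (q - p) := by
    simp only [cross, PiLp.sub_apply]; ring
  have hmem : ∀ y ∈ ({c, p, q} : Set Plane), y ∈ convexHull ℝ ({c, p, q} : Set Plane) :=
    fun y hy => subset_convexHull ℝ _ hy
  have hb : Bornology.IsBounded (interior (convexHull ℝ ({c, p, q} : Set Plane))) :=
    (isBounded_convexHull.2 (toFinite _).isBounded).subset interior_subset
  have key := integral_edge_sq_le (X := interior (convexHull ℝ ({c, p, q} : Set Plane)))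
    isOpen_interior.measurableSet hb (a := p) (b := q) (c := c) (by rw [hcr]; exact neg_ne_zero.2 hD)
    (h := h)
    (by
      intro t ht s hs
      have ht' := sub_pos.2 ht.2
      have hs' := sub_pos.2 hs.2
      have hst : 0 < s * (1 - t) := mul_pos hs.1 ht'
      have hst' : 0 < s * t := mul_pos hs.1 ht.1
      rw [interior_triangle hD]
      have e1 : c + s • (p + t • (q - p) - c) = (1 - s) • c + (s * (1 - t)) • p + (s * t) • q := by
        module
      have e2 : c + s • (p + t • (q - p) - c) = (s * (1 - t)) • p + (s * t) • q + (1 - s) • c := by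
        module
      have e3 : c + s • (p + t • (q - p) - c) = (s * t) • q + (1 - s) • c + (s * (1 - t)) • p := by
        module
      refine ⟨?_, ?_, ?_⟩
      · rw [e1, bary_combo (by ring) hD]; exact hs'
      · rw [e2, bary_combo (by ring) hD2]; exact hst
      · rw [e3, bary_combo (by ring) hD3]; exact hst')
    (by
      intro t ht
      rw [← dist_eq_norm]
      refine hh _ ?_ _ (hmem c (by simp))
      have : p + t • (q - p) ∈ segment ℝ p q := by
        rw [segment_eq_image']
        exact ⟨t, ⟨ht.1.le, ht.2.le⟩, rfl⟩
      rw [← convexHull_pair] at this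
      exact convexHull_mono (by intro y; simp; tauto) this) hu
  rw [integral_openSegment hpq]
  have h2 := two_mul_radius_mul_le hD hr hball
  have hD0 : 0 < |cross (c - p) (q - p)| := abs_pos.2 hD
  rw [hcr, abs_neg] at key
  set E := 3 * (∫ x in interior (convexHull ℝ ({c, p, q} : Set Plane)), u x ^ 2) +
        h ^ 2 * ∑ i, ∫ x in interior (convexHull ℝ ({c, p, q} : Set Plane)), pd i u x ^ 2 with hE
  have hE0 : 0 ≤ E := by
    have h1 := Finset.sum_nonneg fun i (_ : i ∈ (Finset.univ : Finset (Fin 2))) =>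
      integral_sq_nonneg (μ := volume.restrict
        (interior (convexHull ℝ ({c, p, q} : Set Plane)))) (pd i u)
    have h2 := integral_sq_nonneg (μ := volume.restrict
        (interior (convexHull ℝ ({c, p, q} : Set Plane)))) u
    positivity
  have h3 : ‖q - p‖ * |cross (c - p) (q - p)|⁻¹ ≤ (2 * r)⁻¹ := by
    rw [← div_eq_mul_inv, div_le_iff₀ hD0, ← div_eq_inv_mul, le_div_iff₀ (by positivity)]
    linarith
  calc _ ≤ ‖q - p‖ * (|cross (c - p) (q - p)|⁻¹ * E) :=
        mul_le_mul_of_nonneg_left key (norm_nonneg _)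
    _ = ‖q - p‖ * |cross (c - p) (q - p)|⁻¹ * E := by ring
    _ ≤ _ := mul_le_mul_of_nonneg_right h3 hE0

/-- The edge estimate makes the boundary values of smooth approximants of `w` a Cauchy sequence, and
`g` is their limit. The bound against an arbitrary smooth `ψ` has two uses: with `ψ` an approximant
it shows that `g` is the right limit, and with `ψ` a polynomial it is the trace inequality for the
error. -/
theorem IsH1.exists_edge_trace {w : Plane → ℝ} {v : Fin 2 → Plane → ℝ}
    (H : IsH1 (interior (convexHull ℝ ({c, p, q} : Set Plane))) w v) :
    ∃ g, MemLp g 2 (arcLength.restrict (openSegment ℝ p q)) ∧ ∀ ψ : Plane → ℝ, ContDiff ℝ ∞ ψ →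
      ∫ x in openSegment ℝ p q, (g x - ψ x) ^ 2 ∂arcLength ≤ 2 / r *
        (3 * (∫ x in interior (convexHull ℝ ({c, p, q} : Set Plane)), (w x - ψ x) ^ 2) +
          h ^ 2 * ∑ i, ∫ x in interior (convexHull ℝ ({c, p, q} : Set Plane)),
            (v i x - pd i ψ x) ^ 2) := by
  set X := interior (convexHull ℝ ({c, p, q} : Set Plane)) with hX
  have hb : Bornology.IsBounded X :=
    (isBounded_convexHull.2 (toFinite _).isBounded).subset interior_subset
  have hne : X.Nonempty :=
    ⟨z, interior_mono hball (Metric.ball_subset_interior_closedBall (Metric.mem_ball_self hr))⟩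
  obtain ⟨u, hu, hu0, hui⟩ := H.exists_smooth_approx isOpen_interior
    (convex_convexHull ℝ _).interior hne hb
  have hcont : ∀ {f : Plane → ℝ}, ContDiff ℝ ∞ f → MemLp f 2 (volume.restrict X) :=
    fun hf => memLp_of_continuous_of_isBounded hb hf.continuous
  set a : ℕ → ℝ := fun n => (2 * r)⁻¹ * (2 * (3 * (∫ x in X, (u n x - w x) ^ 2) +
    h ^ 2 * ∑ i, ∫ x in X, (pd i (u n) x - v i x) ^ 2)) with ha
  have ha0 : Tendsto a atTop (𝓝 0) := by
    have := ((((hu0.const_mul 3).add ((tendsto_finsetSum Finset.univ fun i _ =>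
      hui i).const_mul (h ^ 2))).const_mul 2).const_mul (2 * r)⁻¹)
    simpa [ha] using this
  have hbound : ∀ n, ∀ ψ : Plane → ℝ, ContDiff ℝ ∞ ψ →
      ∫ x in openSegment ℝ p q, (u n x - ψ x) ^ 2 ∂arcLength ≤ a n + r⁻¹ *
        (3 * (∫ x in X, (w x - ψ x) ^ 2) + h ^ 2 * ∑ i, ∫ x in X, (v i x - pd i ψ x) ^ 2) := by
    intro n ψ hψ
    have h1 := integral_openSegment_sq_le hD hr hball hh ((hu n).sub hψ)
    rw [← hX] at h1
    change _ ≤ (2 * r)⁻¹ * (3 * (∫ x in X, (u n x - ψ x) ^ 2) +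
      h ^ 2 * ∑ i, ∫ x in X, pd i (u n - ψ) x ^ 2) at h1
    refine h1.trans ?_
    have h2 : ∫ x in X, (u n x - ψ x) ^ 2 ≤
        2 * (∫ x in X, (u n x - w x) ^ 2) + 2 * ∫ x in X, (w x - ψ x) ^ 2 := by
      have := integral_add_sq_le ((hcont (hu n)).sub H.memLp) (H.memLp.sub (hcont hψ))
      simpa using this
    have h3 : ∀ i, ∫ x in X, pd i (u n - ψ) x ^ 2 ≤
        2 * (∫ x in X, (pd i (u n) x - v i x) ^ 2) + 2 * ∫ x in X, (v i x - pd i ψ x) ^ 2 := by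
      intro i
      rw [pd_sub (differentiable_of_smooth (hu n)) (differentiable_of_smooth hψ)]
      have := integral_add_sq_le ((hcont (contDiff_pd (hu n) i)).sub (H.memLp_grad i))
        ((H.memLp_grad i).sub (hcont (contDiff_pd hψ i)))
      simpa using this
    have h4 := Finset.sum_le_sum fun i (_ : i ∈ (Finset.univ : Finset (Fin 2))) => h3 i
    rw [Finset.sum_add_distrib, ← Finset.mul_sum, ← Finset.mul_sum] at h4
    have h5 : r⁻¹ = (2 * r)⁻¹ * 2 := by rw [mul_inv]; ring
    rw [ha, h5, mul_assoc (2 * r)⁻¹ 2, ← mul_add]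
    refine mul_le_mul_of_nonneg_left ?_ (by positivity)
    have h6 := mul_le_mul_of_nonneg_left h4 (sq_nonneg h)
    linarith
  obtain ⟨g, hg, hgu⟩ := exists_memLp_tendsto (fun n => memLp_openSegment p q (hu n).continuous)
    ha0 (fun m n => by
      refine (hbound m (u n) (hu n)).trans (le_of_eq ?_)
      have e1 : ∫ x in X, (w x - u n x) ^ 2 = ∫ x in X, (u n x - w x) ^ 2 := by
        congr 1; ext x; ring
      have e2 : ∀ i, ∫ x in X, (v i x - pd i (u n) x) ^ 2 =
          ∫ x in X, (pd i (u n) x - v i x) ^ 2 := by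
        intro i; congr 1; ext x; ring
      simp only [e1, e2, ha, mul_inv]
      ring)
  refine ⟨g, hg, fun ψ hψ => ?_⟩
  refine (integral_sq_sub_le_of_tendsto (fun n => memLp_openSegment p q (hu n).continuous) hg
    (memLp_openSegment p q hψ.continuous) hgu (fun n => hbound n ψ hψ)
    (ha0.add_const _)).trans (le_of_eq ?_)
  ring

end EdgeTrace

end

end HHO

namespace HHO

noncomputable section

open Filter Geometry
open scoped Topology ENNReal

/-! ### Outward normals -/

theorem exists_smul_mem_ball (x v : Plane) {ε : ℝ} (hε : 0 < ε) :
    ∃ t : ℝ, 0 < t ∧ x + t • v ∈ Metric.ball x ε := by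
  have hlim : Tendsto (fun t : ℝ => x + t • v) (𝓝[>] 0) (𝓝 x) := by
    have : Continuous fun t : ℝ => x + t • v := by fun_prop
    simpa using (this.tendsto 0).mono_left nhdsWithin_le_nhds
  obtain ⟨t, ht, ht0⟩ := ((hlim.eventually (Metric.ball_mem_nhds x hε)).and
    self_mem_nhdsWithin).exists
  exact ⟨t, ht0, ht⟩

/-- If two unit normals differed, a small step along `n - m` would be inside `T` according to `m`
and outside according to `n`. -/
theorem IsOutwardNormalAt.eq {T : Set Plane} {x n m : Plane} (hn : IsOutwardNormalAt T x n)
    (hm : IsOutwardNormalAt T x m) : n = m := by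
  obtain ⟨hn1, ε, hε, Hn⟩ := hn
  obtain ⟨hm1, δ, hδ, Hm⟩ := hm
  by_contra hne
  have h1 : 0 < ‖n - m‖ ^ 2 := by
    have : 0 < ‖n - m‖ := norm_pos_iff.2 (sub_ne_zero.2 hne)
    positivity
  rw [norm_sub_sq_real, hn1, hm1] at h1
  obtain ⟨t, ht, hb⟩ := exists_smul_mem_ball x (n - m) (lt_min hε hδ)
  have e1 := (Hm _ (Metric.ball_subset_ball (min_le_right _ _) hb)).2 (by
    rw [add_sub_cancel_left, inner_smul_right, inner_sub_right, real_inner_self_eq_norm_sq, hm1,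
      real_inner_comm]
    nlinarith)
  have e2 := (Hn _ (Metric.ball_subset_ball (min_le_left _ _) hb)).1 e1
  rw [add_sub_cancel_left, inner_smul_right, inner_sub_right, real_inner_self_eq_norm_sq, hn1] at e2
  nlinarith

theorem outwardNormal_eq {T : Set Plane} {x n : Plane} (hn : IsOutwardNormalAt T x n) :
    outwardNormal T x = n :=
  (Classical.epsilon_spec (p := fun n => IsOutwardNormalAt T x n) ⟨n, hn⟩).eq hn

/-- Two half-planes, one of which contains the other, coincide. -/
theorem inner_neg_iff_of_imp {n m : Plane} (hm : m ≠ 0)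
    (h : ∀ v, 0 < (inner ℝ m v : ℝ) → (inner ℝ n v : ℝ) < 0) (v : Plane) :
    (inner ℝ n v : ℝ) < 0 ↔ 0 < (inner ℝ m v : ℝ) := by
  refine ⟨fun hv => ?_, h v⟩
  by_contra hcon
  have hcon := not_lt.1 hcon
  have hlim : Tendsto (fun t : ℝ => (inner ℝ n (-v + t • m) : ℝ)) (𝓝[>] 0) (𝓝 (inner ℝ n (-v))) := by
    have : Continuous fun t : ℝ => (inner ℝ n (-v + t • m) : ℝ) := by fun_prop
    simpa using (this.tendsto 0).mono_left nhdsWithin_le_nhds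
  have hpos : (0 : ℝ) < inner ℝ n (-v) := by rw [inner_neg_right]; linarith
  obtain ⟨t, ht, ht0⟩ := ((hlim.eventually (lt_mem_nhds hpos)).and self_mem_nhdsWithin).exists
  have ht0' : 0 < t := ht0
  have hmm : 0 < ‖m‖ := norm_pos_iff.2 hm
  have := h (-v + t • m) (by
    rw [inner_add_right, inner_neg_right, inner_smul_right, real_inner_self_eq_norm_sq]
    have : 0 < t * ‖m‖ ^ 2 := by positivity
    linarith)
  linarith

/-! ### Open edges -/

/-- An edge without its endpoints. -/
def openEdge (e : Finset Plane) : Set Plane := convexHull ℝ (e : Set Plane) \ e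

theorem openEdge_eq {e : Finset Plane} {p q : Plane} (hpq : p ≠ q) (he : (e : Set Plane) = {p, q}) :
    openEdge e = openSegment ℝ p q := by
  rw [openEdge, he, convexHull_pair, ← insert_endpoints_openSegment]
  ext x
  simp only [Set.mem_sdiff, mem_insert_iff, mem_singleton_iff]
  constructor
  · rintro ⟨h1 | h1 | h1, h2⟩
    · exact absurd (Or.inl h1) h2
    · exact absurd (Or.inr h1) h2
    · exact h1
  · intro h
    refine ⟨Or.inr (Or.inr h), ?_⟩
    rintro (rfl | rfl)
    · exact hpq (left_mem_openSegment_iff.1 h)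
    · exact hpq (right_mem_openSegment_iff.1 h)

variable {K : SimplicialComplex ℝ Plane}

theorem disjoint_openEdge {e e' : Finset Plane} (he : e ∈ K.faces) (he' : e' ∈ K.faces)
    (hc : e.card = 2) (hc' : e'.card = 2) (hne : e ≠ e') : Disjoint (openEdge e) (openEdge e') := by
  classical
  rw [Set.disjoint_left]
  rintro x ⟨hx, hxe⟩ ⟨hx', -⟩
  have h := K.inter_subset_convexHull he he' ⟨hx, hx'⟩
  rw [← Finset.coe_inter] at h
  have h1 : (e ∩ e').card ≤ 1 := by
    by_contra hcon
    have h2 : e ∩ e' = e := Finset.eq_of_subset_of_card_le Finset.inter_subset_left (by omega)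
    have h3 : e ∩ e' = e' := Finset.eq_of_subset_of_card_le Finset.inter_subset_right (by omega)
    exact hne (h2.symm.trans h3)
  rcases Finset.card_le_one_iff_subset_singleton.1 h1 with ⟨y, hy⟩
  have hxy := convexHull_mono (Finset.coe_subset.2 hy) h
  rw [Finset.coe_singleton, convexHull_singleton, mem_singleton_iff] at hxy
  subst hxy
  rcases (e ∩ e').eq_empty_or_nonempty with h0 | ⟨z, hz⟩
  · rw [h0] at h; simp at h
  · have := Finset.mem_singleton.1 (hy hz)
    subst this
    exact hxe (Finset.mem_inter.1 hz).1

namespace IsTriangulated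

variable {T : Set Plane} {r : ℝ} (hT : IsTriangulated K T r)
include hT

/-- The midpoint of the edge lies in `closure T`, hence in one of its triangles. As it is not an
endpoint, the whole edge must belong to that triangle. -/
theorem exists_triangle_of_edge {e : Finset Plane} (he : e ∈ boundaryEdges K T) :
    ∃ p q c s, p ≠ q ∧ (e : Set Plane) = {p, q} ∧ openEdge e = openSegment ℝ p q ∧
      s ∈ elemTriangles K T ∧ e ⊆ s ∧ (s : Set Plane) = {c, p, q} := by
  classical
  obtain ⟨p, q, hpq, rfl⟩ := Finset.card_eq_two.1 he.2.1
  have he' : (({p, q} : Finset Plane) : Set Plane) = {p, q} := by simp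
  have hm : midpoint ℝ p q ∈ segment ℝ p q := midpoint_mem_segment p q
  have hmc : midpoint ℝ p q ∈ closure T := frontier_subset_closure (he.2.2 (by
    rw [he', convexHull_pair]; exact hm))
  rw [hT.closure_eq] at hmc
  obtain ⟨s, hs, hms⟩ := mem_iUnion₂.1 hmc
  obtain ⟨hp, hq⟩ := pair_subset_of_mem he.1 hs.1.1 he' (by simpa using hpq)
    (by simpa using hpq) hm hms
  obtain ⟨c, -, -, hc⟩ := exists_third_vertex hs.1.2 hpq hp hq
  refine ⟨p, q, c, s, hpq, he', openEdge_eq hpq he', hs, ?_, hc⟩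
  intro x hx
  rcases Finset.mem_insert.1 hx with rfl | hx
  · exact hp
  · rwa [Finset.mem_singleton.1 hx]

omit hT in
theorem openEdge_subset_frontier {e : Finset Plane} (he : e ∈ boundaryEdges K T) :
    openEdge e ⊆ frontier T := sdiff_subset.trans he.2.2

theorem exists_normal {e : Finset Plane} (he : e ∈ boundaryEdges K T) :
    ∃ n : Plane, ∀ x ∈ openEdge e, IsOutwardNormalAt T x n := by
  obtain ⟨p, q, c, s, hpq, -, ho, -⟩ := hT.exists_triangle_of_edge he
  rw [ho]
  exact hT.isPolygon.one_sided p q hpq (ho ▸ openEdge_subset_frontier he)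

/-- The exceptional points of the boundary. -/
theorem finite_frontier_diff :
    (frontier T \ ⋃ e ∈ boundaryEdges K T, openEdge e).Finite := by
  obtain ⟨Z, hZ, hZT⟩ := hT.frontier_subset
  refine (hT.finite_vertices.union hZ).subset ?_
  rintro x ⟨hx, hxe⟩
  rcases hZT hx with h | h
  · obtain ⟨e, he, hxe'⟩ := mem_iUnion₂.1 h
    by_cases hv : x ∈ e
    · exact Or.inl (mem_biUnion he.1 hv)
    · exact absurd (mem_biUnion (t := openEdge) he (show x ∈ openEdge e from ⟨hxe', hv⟩)) hxe
  · exact Or.inr h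

theorem frontier_ae_eq : frontier T =ᵐ[arcLength]
    ⋃ e ∈ hT.finite_boundaryEdges.toFinset, openEdge e := by
  simp only [Set.Finite.mem_toFinset]
  have h1 : (⋃ e ∈ boundaryEdges K T, openEdge e) ⊆ frontier T :=
    iUnion₂_subset fun e he => openEdge_subset_frontier he
  refine Filter.EventuallyLE.antisymm ?_ h1.eventuallyLE
  have h0 : arcLength (frontier T \ ⋃ e ∈ boundaryEdges K T, openEdge e) = 0 :=
    arcLength_finite hT.finite_frontier_diff
  exact (ae_le_set).2 h0

theorem measurableSet_openEdge {e : Finset Plane} (he : e ∈ boundaryEdges K T) :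
    MeasurableSet (openEdge e) := by
  obtain ⟨p, q, c, s, hpq, -, ho, -⟩ := hT.exists_triangle_of_edge he
  rw [ho]; exact measurableSet_openSegment p q

theorem setIntegral_frontier_eq_sum {f : Plane → ℝ} (hf : IntegrableOn f (frontier T) arcLength) :
    ∫ x in frontier T, f x ∂arcLength =
      ∑ e ∈ hT.finite_boundaryEdges.toFinset, ∫ x in openEdge e, f x ∂arcLength := by
  rw [setIntegral_congr_set hT.frontier_ae_eq]
  refine integral_biUnion_finset _ (fun e he => hT.measurableSet_openEdge
    ((Set.Finite.mem_toFinset _).1 he)) ?_ fun e he => ?_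
  · intro e he e' he' hne
    simp only [Set.Finite.coe_toFinset] at he he'
    exact disjoint_openEdge he.1 he'.1 he.2.1 he'.2.1 hne
  · exact hf.mono_set (openEdge_subset_frontier ((Set.Finite.mem_toFinset _).1 he))

theorem arcLength_frontier_lt_top : arcLength (frontier T) < ⊤ := by
  obtain ⟨E, -, hE⟩ := hT.isPolygon.frontier_eq
  rw [hE]
  exact measure_biUnion_lt_top E.finite_toSet fun e _ => arcLength_segment_lt_top _ _

theorem isFiniteMeasure_frontier : IsFiniteMeasure (arcLength.restrict (frontier T)) :=
  ⟨by simpa using hT.arcLength_frontier_lt_top⟩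

theorem memLp_frontier {f : Plane → ℝ} (hf : Continuous f) :
    MemLp f 2 (arcLength.restrict (frontier T)) :=
  memLp_of_continuous_of_measure_lt_top
    (hT.isPolygon.isBounded.closure.subset frontier_subset_closure)
    hT.arcLength_frontier_lt_top isClosed_frontier.measurableSet hf

/-- Near a point of a boundary edge, the element is a half-disc that is contained in the adjacent
triangle. -/
theorem exists_halfDisc {e : Finset Plane} {p q c x n : Plane}
    {s : Finset Plane} (ho : openEdge e = openSegment ℝ p q) (hs : s ∈ elemTriangles K T)
    (hsc : (s : Set Plane) = {c, p, q}) (hx : x ∈ openEdge e) (hn : IsOutwardNormalAt T x n) :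
    ∃ ε > 0, ∀ y ∈ Metric.ball x ε, (y ∈ T ↔ (inner ℝ n (y - x) : ℝ) < 0) ∧
      (y ∈ interior (convexHull ℝ (s : Set Plane)) ↔ (inner ℝ n (y - x) : ℝ) < 0) ∧
      (y ∈ openEdge e ↔ (inner ℝ n (y - x) : ℝ) = 0) ∧ (y ∈ frontier T → y ∈ openEdge e) := by
  obtain ⟨hn1, δ, hδ, H⟩ := hn
  have hD := cross_ne_zero_of_face hs.1 hsc
  have hD2 := cross_rotate_ne hD
  have hD3 := cross_rotate_ne hD2
  have hseg : ∀ y, y ∈ openSegment ℝ p q ↔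
      bary c p q y = 0 ∧ 0 < bary p q c y ∧ 0 < bary q c p y := by
    intro y
    constructor
    · rintro ⟨a, b, ha, hb, hab, rfl⟩
      have e1 : a • p + b • q = (0 : ℝ) • c + a • p + b • q := by module
      have e2 : a • p + b • q = a • p + b • q + (0 : ℝ) • c := by module
      have e3 : a • p + b • q = b • q + (0 : ℝ) • c + a • p := by module
      refine ⟨?_, ?_, ?_⟩
      · rw [e1, bary_combo (by linarith) hD]
      · rw [e2, bary_combo (by linarith) hD2]; exact ha
      · rw [e3, bary_combo (by linarith) hD3]; exact hb
    · rintro ⟨h0, h1, h2⟩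
      have hsum := bary_sum hD y
      refine ⟨_, _, h1, h2, by linarith, ?_⟩
      have := eq_sum_bary hD y
      rw [h0, zero_smul, zero_add] at this
      exact this.symm
  have hxs := (hseg x).1 (ho ▸ hx)
  have hU : IsOpen {y | 0 < bary p q c y ∧ 0 < bary q c p y} :=
    (isOpen_lt continuous_const (continuous_bary p q c)).inter
      (isOpen_lt continuous_const (continuous_bary q c p))
  obtain ⟨η, hη, hηU⟩ := Metric.isOpen_iff.1 hU x hxs.2
  -- `m` is the gradient of the barycentric coordinate of `c`, so near `x` the triangle is the
  -- half-plane where the product with `m` is positive.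
  set m : Plane := (cross (c - p) (q - p))⁻¹ • (-perp (q - p)) with hmdef
  have hbm : ∀ y, bary c p q y = inner ℝ m (y - x) := by
    intro y
    have h1 := bary_add_smul c p q x (y - x) 1
    rw [one_smul, add_sub_cancel, hxs.1, zero_add, one_mul] at h1
    rw [h1, hmdef, inner_eq]
    simp only [cross, perp, PiLp.smul_apply, PiLp.neg_apply, PiLp.sub_apply, smul_eq_mul]
    simp
    ring
  have hm0 : m ≠ 0 := by
    intro h0
    have := hbm c
    rw [bary_self hD, h0, inner_zero_left] at this
    norm_num at this
  have hXT : ∀ y ∈ Metric.ball x η, (y ∈ interior (convexHull ℝ (s : Set Plane)) ↔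
      0 < (inner ℝ m (y - x) : ℝ)) := by
    intro y hy
    have := hηU hy
    rw [hsc, interior_triangle hD, ← hbm]
    exact ⟨fun h => h.1, fun h => ⟨h, this⟩⟩
  -- The triangle lies in `T`, so its half-plane is contained in that of `T`; nested half-planes
  -- with a common boundary point coincide.
  have himp : ∀ v, 0 < (inner ℝ m v : ℝ) → (inner ℝ n v : ℝ) < 0 := by
    intro v hv
    obtain ⟨t, ht, hb⟩ := exists_smul_mem_ball x v (lt_min hδ hη)
    have h1 := (hXT _ (Metric.ball_subset_ball (min_le_right _ _) hb)).2 (by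
      rw [add_sub_cancel_left, inner_smul_right]; positivity)
    have h2 := (H _ (Metric.ball_subset_ball (min_le_left _ _) hb)).1 (hs.2 h1)
    rw [add_sub_cancel_left, inner_smul_right] at h2
    by_contra hcon
    have := not_lt.1 hcon
    have : 0 ≤ t * (inner ℝ n v : ℝ) := by positivity
    linarith
  have hiff := inner_neg_iff_of_imp hm0 himp
  have hzero : ∀ v, (inner ℝ m v : ℝ) = 0 ↔ (inner ℝ n v : ℝ) = 0 := by
    intro v
    have h1 := hiff v
    have h2 := hiff (-v)
    rw [inner_neg_right, inner_neg_right] at h2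
    constructor
    · intro h
      rw [h] at h1 h2
      have h3 := h1.not.2 (lt_irrefl 0)
      have h4 := h2.not.2 (by norm_num)
      linarith
    · intro h
      rw [h] at h1 h2
      have h3 := h1.not.1 (lt_irrefl 0)
      have h4 := h2.not.1 (by norm_num)
      linarith
  refine ⟨min δ η, lt_min hδ hη, fun y hy => ?_⟩
  have hy1 := Metric.ball_subset_ball (min_le_left δ η) hy
  have hy2 := Metric.ball_subset_ball (min_le_right δ η) hy
  have hedge : y ∈ openEdge e ↔ (inner ℝ n (y - x) : ℝ) = 0 := by
    rw [ho, hseg, ← hzero, hbm]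
    exact ⟨fun h => h.1, fun h => ⟨h, hηU hy2⟩⟩
  refine ⟨H y hy1, (hXT y hy2).trans (hiff _).symm, hedge, fun hyf => hedge.2 ?_⟩
  have h1 : ¬(inner ℝ n (y - x) : ℝ) < 0 := by
    rw [← H y hy1]
    rw [hT.isPolygon.isOpen.frontier_eq] at hyf
    exact hyf.2
  -- Points strictly beyond the line have a neighbourhood that misses `T`, so they are not boundary
  -- points.
  refine le_antisymm ?_ (not_lt.1 h1)
  by_contra hcon
  have hV : IsOpen (Metric.ball x δ ∩ {y | 0 < (inner ℝ n (y - x) : ℝ)}) :=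
    Metric.isOpen_ball.inter (isOpen_lt continuous_const (by fun_prop))
  obtain ⟨z, ⟨hz1, hz2⟩, hzT⟩ := mem_closure_iff.1 (frontier_subset_closure hyf) _ hV
    ⟨hy1, not_le.1 hcon⟩
  exact absurd ((H z hz1).1 hzT) (not_lt.2 (le_of_lt hz2))

end IsTriangulated

end

end HHO

namespace HHO

noncomputable section

open Filter Geometry
open scoped Topology ENNReal

/-! ### Localization of identities between test functions -/

/-- A property of test functions that is additive and local holds for all test functions. -/
theorem testFunction_induction {P : (Plane → ℝ) → Prop} (h0 : P 0)
    (hadd : ∀ φ ψ : Plane → ℝ, ContDiff ℝ ∞ φ → HasCompactSupport φ → ContDiff ℝ ∞ ψ →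
      HasCompactSupport ψ → P φ → P ψ → P (φ + ψ))
    {φ : Plane → ℝ} (hφ : ContDiff ℝ ∞ φ) (hc : HasCompactSupport φ)
    (hloc : ∀ x ∈ tsupport φ, ∃ U : Set Plane, IsOpen U ∧ x ∈ U ∧ ∀ ψ : Plane → ℝ,
      ContDiff ℝ ∞ ψ → HasCompactSupport ψ → tsupport ψ ⊆ U → P ψ) : P φ := by
  classical
  choose! U hUo hxU hU using hloc
  obtain ⟨t, ht, hts⟩ := hc.isCompact.elim_nhds_subcover U
    (fun x hx => (hUo x hx).mem_nhds (hxU x hx))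
  obtain ⟨f, hf⟩ := SmoothPartitionOfUnity.exists_isSubordinate (modelWithCornersSelf ℝ Plane)
    (isClosed_tsupport φ) (fun x : t => U x) (fun x => hUo _ (ht x x.2)) (by
      intro x hx
      obtain ⟨y, hy, hxy⟩ := mem_iUnion₂.1 (hts hx)
      exact mem_iUnion.2 ⟨⟨y, hy⟩, hxy⟩)
  have hsm : ∀ i, ContDiff ℝ ∞ fun x => f i x * φ x := fun i =>
    (f i).contMDiff.contDiff.mul hφ
  have hcs : ∀ i, HasCompactSupport fun x => f i x * φ x := fun i => hc.mul_left
  have hsum : φ = ∑ i, fun x => f i x * φ x := by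
    ext x
    rw [Finset.sum_apply, ← Finset.sum_mul]
    by_cases hx : x ∈ tsupport φ
    · rw [← finsum_eq_sum_of_fintype, f.sum_eq_one hx, one_mul]
    · rw [image_eq_zero_of_notMem_tsupport hx, mul_zero]
  have hPi : ∀ i, P fun x => f i x * φ x := by
    intro i
    refine hU _ (ht i i.2) _ (hsm i) (hcs i) (Subset.trans ?_ (hf i))
    exact closure_mono fun x hx => left_ne_zero_of_mul hx
  have key : ∀ s : Finset t, P (∑ i ∈ s, fun x => f i x * φ x) ∧
      ContDiff ℝ ∞ (∑ i ∈ s, fun x => f i x * φ x) ∧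
      HasCompactSupport (∑ i ∈ s, fun x => f i x * φ x) := by
    intro s
    induction s using Finset.induction_on with
    | empty => exact ⟨by simpa using h0, by
        rw [Finset.sum_empty]; exact contDiff_const (c := (0 : ℝ)),
        by simpa using HasCompactSupport.zero⟩
    | insert i s his ih =>
      rw [Finset.sum_insert his]
      exact ⟨hadd _ _ (hsm i) (hcs i) ih.2.1 ih.2.2 (hPi i) ih.1, (hsm i).add ih.2.1,
        (hcs i).add ih.2.2⟩
  rw [hsum]
  exact (key Finset.univ).1

/-! ### Green's formula on an element -/

/-- Green's formula on `T` for a function `w` with `i`-th partial derivative `v` and boundary values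
`g`, tested with `φ`. -/
def GreenHolds (T : Set Plane) (w v g : Plane → ℝ) (i : Fin 2) (φ : Plane → ℝ) : Prop :=
  ∫ x in T, (w x * pd i φ x + v x * φ x) =
    ∫ x in frontier T, g x * φ x * outwardNormal T x i ∂arcLength

theorem setIntegral_eq_of_locally_eq {A A' B : Set Plane} {μ : Measure Plane} {f : Plane → ℝ}
    (hA : MeasurableSet A) (hA' : MeasurableSet A') (h : ∀ y ∈ B, (y ∈ A ↔ y ∈ A'))
    (hf : ∀ y, y ∉ B → f y = 0) : ∫ x in A, f x ∂μ = ∫ x in A', f x ∂μ := by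
  classical
  rw [← integral_indicator hA, ← integral_indicator hA']
  congr 1
  ext y
  by_cases hy : y ∈ B
  · by_cases hyA : y ∈ A
    · rw [indicator_of_mem hyA, indicator_of_mem ((h y hy).1 hyA)]
    · rw [indicator_of_notMem hyA, indicator_of_notMem (fun h' => hyA ((h y hy).2 h'))]
  · rw [indicator_apply, indicator_apply, hf y hy, ite_self, ite_self]

theorem mem_range_lineMap_perp {n : Plane} (hn : ‖n‖ = 1) (x y : Plane) :
    y ∈ range (lineMap x (perp n)) ↔ (inner ℝ n (y - x) : ℝ) = 0 := by
  have hn2 : n 0 ^ 2 + n 1 ^ 2 = 1 := by rw [← norm_sq_eq, hn, one_pow]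
  simp only [mem_range, lineMap, inner_eq, PiLp.sub_apply]
  constructor
  · rintro ⟨t, rfl⟩
    simp only [PiLp.add_apply, PiLp.smul_apply, smul_eq_mul, perp_zero, perp_one]
    ring
  · intro h
    refine ⟨-n 1 * (y 0 - x 0) + n 0 * (y 1 - x 1), ?_⟩
    ext j
    fin_cases j
    · simp only [Fin.zero_eta, PiLp.add_apply, PiLp.smul_apply, smul_eq_mul, perp_zero]
      linear_combination (y 0 - x 0) * hn2 - n 0 * h
    · simp only [Fin.mk_one, PiLp.add_apply, PiLp.smul_apply, smul_eq_mul, perp_one]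
      linear_combination (y 1 - x 1) * hn2 - n 1 * h

/-- Dominated convergence: the cutoffs concentrate at the single point `z`, which is null. It serves
for area and for arc length alike. -/
theorem tendsto_integral_mul_cutoff {μ : Measure Plane} [NullSingletonClass μ] {F : Plane → ℝ}
    (hF : Integrable F μ) (z : Plane) {θ : ℕ → Plane → ℝ} (hθ : ∀ n, Measurable (θ n))
    (hb : ∀ n x, |θ n x| ≤ 1) (h0 : ∀ x, x ≠ z → ∀ᶠ n in atTop, θ n x = 0) :
    Tendsto (fun n => ∫ x, F x * θ n x ∂μ) atTop (𝓝 0) := by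
  have h := tendsto_integral_of_dominated_convergence (μ := μ) (F := fun n x => F x * θ n x)
    (f := fun _ => 0) (fun x => |F x|)
    (fun n => hF.aestronglyMeasurable.mul (hθ n).aestronglyMeasurable) hF.abs
    (fun n => Eventually.of_forall fun x => by
      rw [norm_mul, Real.norm_eq_abs, Real.norm_eq_abs]
      exact mul_le_of_le_one_right (abs_nonneg _) (hb n x))
    (by
      have : ∀ᵐ x ∂μ, x ≠ z := by
        rw [ae_iff]
        simp
      filter_upwards [this] with x hx
      refine tendsto_const_nhds.congr' ?_
      filter_upwards [h0 x hx] with n hn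
      rw [hn, mul_zero])
  simpa using h

namespace IsTriangulated

variable {K : SimplicialComplex ℝ Plane} {T : Set Plane} {r : ℝ} (hT : IsTriangulated K T r)
include hT

theorem isFiniteMeasure : IsFiniteMeasure (volume.restrict T) :=
  ⟨by simpa using hT.isPolygon.isBounded.measure_lt_top (μ := volume)⟩

/-- The normal is an arbitrary choice at exceptional points, so measurability comes from its being
constant on each of the finitely many open edges that make up almost all of the boundary. -/
theorem aestronglyMeasurable_normal (i : Fin 2) :
    AEStronglyMeasurable (fun x => outwardNormal T x i) (arcLength.restrict (frontier T)) := by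
  rw [Measure.restrict_congr_set hT.frontier_ae_eq, ← Finset.set_biUnion_coe, biUnion_eq_iUnion,
    aestronglyMeasurable_iUnion_iff]
  rintro ⟨e, he⟩
  have he : e ∈ boundaryEdges K T := by simpa using he
  obtain ⟨n, hn⟩ := hT.exists_normal he
  refine (aestronglyMeasurable_const (b := n i)).congr ?_
  refine (ae_restrict_iff' (hT.measurableSet_openEdge he)).2 (Eventually.of_forall fun x hx => ?_)
  simp only [outwardNormal_eq (hn x hx)]

theorem ae_abs_normal_le (i : Fin 2) :
    ∀ᵐ x ∂(arcLength.restrict (frontier T)), ‖outwardNormal T x i‖ ≤ 1 := by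
  rw [Measure.restrict_congr_set hT.frontier_ae_eq]
  refine (ae_restrict_iff' ?_).2 (Eventually.of_forall fun x hx => ?_)
  · exact Finset.measurableSet_biUnion _ fun e he =>
      hT.measurableSet_openEdge ((Set.Finite.mem_toFinset _).1 he)
  · obtain ⟨e, he, hxe⟩ := mem_iUnion₂.1 hx
    obtain ⟨n, hn⟩ := hT.exists_normal ((Set.Finite.mem_toFinset _).1 he)
    rw [outwardNormal_eq (hn x hxe), ← (hn x hxe).1]
    exact PiLp.norm_apply_le n i

theorem memLp_mul_normal {g : Plane → ℝ} (hg : MemLp g 2 (arcLength.restrict (frontier T)))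
    (i : Fin 2) :
    MemLp (fun x => g x * outwardNormal T x i) 2 (arcLength.restrict (frontier T)) := by
  refine hg.mono (hg.aestronglyMeasurable.mul (hT.aestronglyMeasurable_normal i)) ?_
  filter_upwards [hT.ae_abs_normal_le i] with x hx
  rw [norm_mul]
  exact mul_le_of_le_one_right (norm_nonneg _) hx

variable {w v g : Plane → ℝ}

theorem integrable_green (hw : MemLp w 2 (volume.restrict T)) (hv : MemLp v 2 (volume.restrict T))
    (i : Fin 2) {φ : Plane → ℝ} (hφ : ContDiff ℝ ∞ φ) :
    IntegrableOn (fun x => w x * pd i φ x + v x * φ x) T :=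
  Integrable.add (integrable_mul_of_memLp hw (memLp_of_continuous_of_isBounded
      hT.isPolygon.isBounded (contDiff_pd hφ i).continuous))
    (integrable_mul_of_memLp hv (memLp_of_continuous_of_isBounded hT.isPolygon.isBounded
      hφ.continuous))

theorem integrable_boundary (hg : MemLp g 2 (arcLength.restrict (frontier T))) (i : Fin 2)
    {φ : Plane → ℝ} (hφ : Continuous φ) :
    IntegrableOn (fun x => g x * φ x * outwardNormal T x i) (frontier T) arcLength := by
  refine (integrable_mul_of_memLp (hT.memLp_mul_normal hg i) (hT.memLp_frontier hφ)).congr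
    (Eventually.of_forall fun x => ?_)
  ring

theorem greenHolds_add (hw : MemLp w 2 (volume.restrict T)) (hv : MemLp v 2 (volume.restrict T))
    (hg : MemLp g 2 (arcLength.restrict (frontier T))) {i : Fin 2} {φ ψ : Plane → ℝ}
    (hφ : ContDiff ℝ ∞ φ) (hψ : ContDiff ℝ ∞ ψ) (h : GreenHolds T w v g i φ)
    (h' : GreenHolds T w v g i ψ) : GreenHolds T w v g i (φ + ψ) := by
  unfold GreenHolds at *
  have e1 : ∀ x, w x * pd i (φ + ψ) x + v x * (φ + ψ) x =
      (w x * pd i φ x + v x * φ x) + (w x * pd i ψ x + v x * ψ x) := by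
    intro x
    rw [pd_add (differentiable_of_smooth hφ) (differentiable_of_smooth hψ)]
    simp only [Pi.add_apply]; ring
  have e2 : ∀ x, g x * (φ + ψ) x * outwardNormal T x i =
      g x * φ x * outwardNormal T x i + g x * ψ x * outwardNormal T x i := by
    intro x; simp only [Pi.add_apply]; ring
  simp only [e1, e2]
  rw [integral_add (hT.integrable_green hw hv i hφ) (hT.integrable_green hw hv i hψ),
    integral_add (hT.integrable_boundary hg i hφ.continuous)
      (hT.integrable_boundary hg i hψ.continuous), h, h']

/-- Green's formula for test functions with support near a point of a boundary edge. -/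
theorem exists_greenHolds_nhds {w : Plane → ℝ} {v : Fin 2 → Plane → ℝ} (h : IsH1 T w v)
    {g : Plane → ℝ} {e : Finset Plane} (he : e ∈ boundaryEdges K T) {p q c : Plane}
    {s : Finset Plane} (ho : openEdge e = openSegment ℝ p q) (hs : s ∈ elemTriangles K T)
    (hsc : (s : Set Plane) = {c, p, q}) {C d : ℝ}
    (hg : MemLp g 2 (arcLength.restrict (openEdge e)))
    (hgψ : ∀ ψ : Plane → ℝ, ContDiff ℝ ∞ ψ → ∫ x in openEdge e, (g x - ψ x) ^ 2 ∂arcLength ≤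
      C * (3 * (∫ x in interior (convexHull ℝ (s : Set Plane)), (w x - ψ x) ^ 2) +
          d * ∑ i, ∫ x in interior (convexHull ℝ (s : Set Plane)), (v i x - pd i ψ x) ^ 2))
    {x : Plane} (hx : x ∈ openEdge e) (i : Fin 2) :
    ∃ U : Set Plane, IsOpen U ∧ x ∈ U ∧ ∀ φ : Plane → ℝ, ContDiff ℝ ∞ φ → HasCompactSupport φ →
      tsupport φ ⊆ U → GreenHolds T w (v i) g i φ := by
  obtain ⟨n, hn⟩ := hT.exists_normal he
  have hn1 := (hn x hx).1
  obtain ⟨ε, hε, H⟩ := hT.exists_halfDisc ho hs hsc hx (hn x hx)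
  refine ⟨Metric.ball x ε, Metric.isOpen_ball, Metric.mem_ball_self hε, fun φ hφ hφc hφB => ?_⟩
  set X := interior (convexHull ℝ (s : Set Plane)) with hX
  have hXo : IsOpen X := isOpen_interior
  have hb : Bornology.IsBounded X := hT.isPolygon.isBounded.subset hs.2
  have hem := hT.measurableSet_openEdge he
  have hφ0 : ∀ y, y ∉ Metric.ball x ε → φ y = 0 := fun y hy =>
    image_eq_zero_of_notMem_tsupport fun h' => hy (hφB h')
  have hφ0' : ∀ y, y ∉ Metric.ball x ε → pd i φ y = 0 := fun y hy =>
    image_eq_zero_of_notMem_tsupport fun h' => hy (hφB (tsupport_pd_subset φ i h'))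
  have L : ∀ {f : Plane → ℝ}, ContDiff ℝ ∞ f → MemLp f 2 (volume.restrict X) :=
    fun hf => memLp_of_continuous_of_isBounded hb hf.continuous
  -- In the ball the triangle coincides with a half-plane and the edge with its boundary line, and
  -- `φ` vanishes outside, so the half-plane formula applies to `u φ`.
  have smooth : ∀ u : Plane → ℝ, ContDiff ℝ ∞ u →
      (∫ x in X, u x * pd i φ x) + ∫ x in X, pd i u x * φ x =
        n i * ∫ x in openEdge e, u x * φ x ∂arcLength := by
    intro u hu
    have h1 := integral_halfPlane_pd (hu.mul hφ) (hφc.mul_left (f := u)) hn1 x i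
    rw [pd_mul (differentiable_of_smooth hu)
      (differentiable_of_smooth hφ), ← integral_range_lineMap x (τ := perp n) (by rw [norm_perp, hn1])
      (fun y => u y * φ y)] at h1
    simp only [] at h1
    rw [← integral_add (integrable_mul_of_memLp (L hu) (L (contDiff_pd hφ i)))
      (integrable_mul_of_memLp (L (contDiff_pd hu i)) (L hφ))]
    have hH : MeasurableSet {y : Plane | (inner ℝ n (y - x) : ℝ) < 0} :=
      (isOpen_lt (by fun_prop) continuous_const).measurableSet
    rw [setIntegral_eq_of_locally_eq (B := Metric.ball x ε) hXo.measurableSet hH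
      (fun y hy => (H y hy).2.1) (fun y hy => by rw [hφ0 y hy, hφ0' y hy]; simp), h1,
      setIntegral_eq_of_locally_eq (B := Metric.ball x ε)
        (measurableEmbedding_lineMap x (by rw [norm_perp, hn1])).measurableSet_range hem
        (fun y hy => by rw [mem_range_lineMap_perp hn1, (H y hy).2.2.1])
        (fun y hy => by rw [hφ0 y hy, mul_zero])]
  have hH1 := h.mono hT.isPolygon.isOpen.measurableSet hs.2
  obtain ⟨u, hu, hu0, hui⟩ := hH1.exists_smooth_approx hXo (convex_convexHull ℝ _).interior
    (hT.interior_nonempty hs) hb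
  -- Taking the approximants themselves as `ψ` in the trace estimate identifies `g` as the limit of
  -- their boundary values.
  have hge : Tendsto (fun n => ∫ x in openEdge e, (u n x - g x) ^ 2 ∂arcLength) atTop (𝓝 0) := by
    have hlim : Tendsto (fun n => C * (3 * (∫ x in X, (u n x - w x) ^ 2) +
        d * ∑ i, ∫ x in X, (pd i (u n) x - v i x) ^ 2)) atTop (𝓝 0) := by
      have := ((((hu0.const_mul 3).add ((tendsto_finsetSum Finset.univ fun i _ =>
        hui i).const_mul d))).const_mul C)
      simpa using this
    refine squeeze_zero (fun n => integral_sq_nonneg _) (fun n => ?_) hlim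
    have := hgψ (u n) (hu n)
    simpa only [sub_sq_comm] using this
  have hem2 : ∀ {f : Plane → ℝ}, ContDiff ℝ ∞ f → MemLp f 2 (arcLength.restrict (openEdge e)) := by
    intro f hf
    rw [ho]; exact memLp_openSegment p q hf.continuous
  have lim1 := (tendsto_integral_mul (fun n => L (hu n)) hH1.memLp (L (contDiff_pd hφ i)) hu0).add
    (tendsto_integral_mul (fun n => L (contDiff_pd (hu n) i)) (hH1.memLp_grad i) (L hφ) (hui i))
  have lim2 := (tendsto_integral_mul (fun n => hem2 (hu n)) hg (hem2 hφ) hge).const_mul (n i)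
  have key := tendsto_nhds_unique (lim1.congr fun m => smooth (u m) (hu m)) lim2
  unfold GreenHolds
  rw [setIntegral_eq_of_locally_eq (B := Metric.ball x ε) hT.isPolygon.isOpen.measurableSet
      hXo.measurableSet (fun y hy => (H y hy).1.trans (H y hy).2.1.symm)
      (fun y hy => by rw [hφ0 y hy, hφ0' y hy]; simp),
    integral_add (integrable_mul_of_memLp hH1.memLp (L (contDiff_pd hφ i)))
      (integrable_mul_of_memLp (hH1.memLp_grad i) (L hφ)), key,
    setIntegral_eq_of_locally_eq (B := Metric.ball x ε) isClosed_frontier.measurableSet hem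
      (fun y hy => ⟨(H y hy).2.2.2, fun h' => openEdge_subset_frontier he h'⟩)
      (fun y hy => by rw [hφ0 y hy]; simp), ← integral_const_mul]
  refine setIntegral_congr_fun hem fun y hy => ?_
  simp only [outwardNormal_eq (hn y hy)]
  ring

/-- A point can be removed from the exceptional set of Green's formula. -/
theorem greenHolds_of_diff_singleton (hw : MemLp w 2 (volume.restrict T))
    (hv : MemLp v 2 (volume.restrict T)) (hg : MemLp g 2 (arcLength.restrict (frontier T)))
    {i : Fin 2} {z : Plane} {V : Set Plane}
    (H : ∀ φ : Plane → ℝ, ContDiff ℝ ∞ φ → HasCompactSupport φ →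
      Disjoint (tsupport φ) (insert z V) → GreenHolds T w v g i φ)
    {φ : Plane → ℝ} (hφ : ContDiff ℝ ∞ φ) (hc : HasCompactSupport φ)
    (hd : Disjoint (tsupport φ) V) : GreenHolds T w v g i φ := by
  -- The formula is known for `φ (1 - η_n)`, which vanishes near `z`, where `η_n` is the bump
  -- rescaled to radius of order `1/n`. Every term that contains `η_n` must be shown to disappear in
  -- the limit.
  let η : ContDiffBump z := ⟨1, 2, one_pos, one_lt_two⟩
  have hηs : ContDiff ℝ ∞ (η : Plane → ℝ) := η.contDiff
  set ηn : ℕ → Plane → ℝ := fun n x => η (dilation z (n + 1) x) with hηn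
  have hs : ∀ n, ContDiff ℝ ∞ (ηn n) := fun n => hηs.comp (contDiff_dilation z _)
  have hdist : ∀ (n : ℕ) x, dist (dilation z (n + 1) x) z = (n + 1) * dist x z := by
    intro n x
    rw [dilation, dist_eq_norm, add_sub_cancel_left, norm_smul, dist_eq_norm,
      Real.norm_of_nonneg (by positivity)]
  have hlarge : ∀ x, x ≠ z → ∀ᶠ n : ℕ in atTop, 2 < (n + 1) * dist x z := by
    intro x hx
    have h1 : Tendsto (fun n : ℕ => ((n : ℝ) + 1) * dist x z) atTop atTop :=
      (tendsto_atTop_add_const_right _ _ tendsto_natCast_atTop_atTop).atTop_mul_const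
        (dist_pos.2 hx)
    exact h1.eventually_gt_atTop 2
  set D : ℕ → Set Plane := fun n => dilation z (n + 1) ⁻¹' Metric.closedBall z 2 with hD
  have hDm : ∀ n, MeasurableSet (D n) := fun n =>
    (Metric.isClosed_closedBall.preimage (continuous_dilation z _)).measurableSet
  have cut1 : ∀ x, x ≠ z → ∀ᶠ n in atTop, ηn n x = 0 := by
    intro x hx
    filter_upwards [hlarge x hx] with n hn
    refine η.zero_of_le_dist ?_
    rw [hdist]; exact hn.le
  have cut2 : ∀ x, x ≠ z → ∀ᶠ n in atTop, (D n).indicator (fun _ => (1 : ℝ)) x = 0 := by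
    intro x hx
    filter_upwards [hlarge x hx] with n hn
    refine indicator_of_notMem ?_ _
    rw [hD, mem_preimage, Metric.mem_closedBall, hdist]
    exact not_le.2 hn
  have ηb : ∀ n x, |ηn n x| ≤ 1 := by
    intro n x
    rw [abs_of_nonneg η.nonneg]; exact η.le_one
  have Lp : ∀ {f : Plane → ℝ}, Continuous f → MemLp f 2 (volume.restrict T) :=
    fun hf => memLp_of_continuous_of_isBounded hT.isPolygon.isBounded hf
  have cφ := hφ.continuous
  have cφ' := (contDiff_pd hφ i).continuous
  -- the three regular terms
  have i1 : IntegrableOn (fun x => w x * pd i φ x + v x * φ x) T := hT.integrable_green hw hv i hφ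
  have i2 := hT.integrable_boundary hg i cφ
  have lim1 := tendsto_integral_mul_cutoff i1 z (fun n => (hs n).continuous.measurable) ηb cut1
  have lim2 := tendsto_integral_mul_cutoff i2 z (fun n => (hs n).continuous.measurable) ηb cut1
  -- the singular term
  have mwφ : MemLp (fun x => w x * φ x) 2 (volume.restrict T) := by
    obtain ⟨B, hB⟩ := hc.exists_bound_of_continuous cφ
    refine MemLp.of_le_mul (c := B) hw (hw.aestronglyMeasurable.mul cφ.aestronglyMeasurable)
      (Eventually.of_forall fun x => ?_)
    rw [norm_mul, mul_comm]
    exact mul_le_mul_of_nonneg_right (hB x) (norm_nonneg _)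
  have pdη : ∀ n x, pd i (ηn n) x = (n + 1) * pd i η (dilation z (n + 1) x) := fun n x =>
    pd_comp_dilation (differentiable_of_smooth hηs) z _ i x
  have hηc : HasCompactSupport (η : Plane → ℝ) := η.hasCompactSupport
  have pdη0 : ∀ n x, x ∉ D n → pd i (ηn n) x = 0 := by
    intro n x hx
    rw [pdη]
    refine mul_eq_zero_of_right _ (image_eq_zero_of_notMem_tsupport fun h' => hx ?_)
    have := tsupport_pd_subset _ i h'
    rwa [η.tsupport_eq] at this
  -- In dimension two the Dirichlet integral is invariant under dilation, so the energy of the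
  -- rescaled bumps does not grow.
  have en : ∀ n, ∫ x in T, pd i (ηn n) x ^ 2 ≤ ∫ x, pd i η x ^ 2 := by
    intro n
    have hcont : Continuous fun x => pd i η x ^ 2 := (contDiff_pd hηs i).continuous.pow 2
    have hcs : HasCompactSupport fun x => pd i η x ^ 2 :=
      (HasCompactSupport.pd hηc i).comp_left (g := fun t : ℝ => t ^ 2) (by simp)
    have hint := integrable_comp_dilation (hcont.integrable_of_hasCompactSupport (μ := volume) hcs) z
      (r := (n : ℝ) + 1) (by positivity)
    have h1 : ∀ x, pd i (ηn n) x ^ 2 = ((n : ℝ) + 1) ^ 2 * pd i η (dilation z (n + 1) x) ^ 2 := by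
      intro x; rw [pdη, mul_pow]
    have h2 : ∫ x, pd i (ηn n) x ^ 2 = ∫ x, pd i η x ^ 2 := by
      simp only [h1]
      rw [integral_const_mul, integral_comp_dilation (fun x => pd i η x ^ 2) z (by positivity),
        ← mul_assoc, mul_inv_cancel₀ (by positivity), one_mul]
    rw [← h2]
    refine setIntegral_le_integral ?_ (Eventually.of_forall fun x => sq_nonneg _)
    simp only [h1]
    exact hint.const_mul _
  -- By Cauchy–Schwarz the term is at most the `L²` norm of `w φ` on the shrinking set `D n`, which
  -- tends to zero, times the bounded energy of the cutoff.
  have lim3 : Tendsto (fun n => ∫ x in T, w x * φ x * pd i (ηn n) x) atTop (𝓝 0) := by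
    have hsq := tendsto_integral_mul_cutoff mwφ.integrable_sq z
      (fun n => measurable_const.indicator (hDm n)) (fun n x => by
        by_cases hx : x ∈ D n <;> simp [hx]) cut2
    have hsq2 := (hsq.mul_const (∫ x, pd i η x ^ 2)).sqrt
    rw [zero_mul, Real.sqrt_zero] at hsq2
    rw [tendsto_zero_iff_abs_tendsto_zero]
    refine squeeze_zero (fun n => abs_nonneg _) (fun n => Real.le_sqrt_of_sq_le ?_) hsq2
    have h1 : MemLp ((D n).indicator fun x => w x * φ x) 2 (volume.restrict T) :=
      mwφ.indicator (hDm n)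
    have h2 := sq_integral_mul_le h1 (Lp (contDiff_pd (hs n) i).continuous)
    have e1 : ∀ x, (D n).indicator (fun x => w x * φ x) x * pd i (ηn n) x =
        w x * φ x * pd i (ηn n) x := by
      intro x
      by_cases hx : x ∈ D n
      · rw [indicator_of_mem hx]
      · rw [pdη0 n x hx, mul_zero, mul_zero]
    have e2 : ∀ x, (D n).indicator (fun x => w x * φ x) x ^ 2 =
        (w x * φ x) ^ 2 * (D n).indicator (fun _ => (1 : ℝ)) x := by
      intro x
      by_cases hx : x ∈ D n
      · rw [indicator_of_mem hx, indicator_of_mem hx, mul_one]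
      · rw [indicator_of_notMem hx, indicator_of_notMem hx]; ring
    simp only [e1, e2] at h2
    rw [Function.comp_apply, sq_abs]
    refine h2.trans (mul_le_mul_of_nonneg_left (en n) (integral_nonneg fun x => ?_))
    exact mul_nonneg (sq_nonneg _) (indicator_nonneg (fun _ _ => zero_le_one) _)
  -- conclusion
  have key : ∀ n, (∫ x in T, (w x * pd i φ x + v x * φ x)) - ((∫ x in T, (w x * pd i φ x + v x * φ x) * ηn n x) +
      ∫ x in T, w x * φ x * pd i (ηn n) x) =
      (∫ x in frontier T, g x * φ x * outwardNormal T x i ∂arcLength) -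
        ∫ x in frontier T, g x * φ x * outwardNormal T x i * ηn n x ∂arcLength := by
    intro n
    have hsm : ContDiff ℝ ∞ fun x => φ x * (1 - ηn n x) := hφ.mul (contDiff_const.sub (hs n))
    have hG := H (fun x => φ x * (1 - ηn n x)) hsm hc.mul_right (by
      rw [Set.disjoint_insert_right]
      have hsub : tsupport (fun x => φ x * (1 - ηn n x)) ⊆ tsupport φ :=
        closure_mono fun x hx => left_ne_zero_of_mul hx
      refine ⟨?_, hd.mono_left hsub⟩
      rw [notMem_tsupport_iff_eventuallyEq]
      have h1 : ∀ᶠ x in 𝓝 z, ηn n x = 1 := by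
        have h2 : Tendsto (dilation z ((n : ℝ) + 1)) (𝓝 z) (𝓝 z) := by
          have := (continuous_dilation z ((n : ℝ) + 1)).tendsto z
          simpa [dilation] using this
        exact h2.eventually η.eventuallyEq_one
      filter_upwards [h1] with x hx
      simp [hx])
    unfold GreenHolds at hG
    have hpd : ∀ x, w x * pd i (fun x => φ x * (1 - ηn n x)) x + v x * (φ x * (1 - ηn n x)) =
        (w x * pd i φ x + v x * φ x) -
          ((w x * pd i φ x + v x * φ x) * ηn n x + w x * φ x * pd i (ηn n) x) := by
      intro x
      have h3 : pd i (fun x => 1 - ηn n x) = -pd i (ηn n) := by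
        have := pd_sub (f := fun _ => (1 : ℝ)) (differentiable_const _)
          (differentiable_of_smooth (hs n)) i
        rw [pd_const, zero_sub] at this
        exact this
      rw [pd_mul (g := fun x => 1 - ηn n x) (differentiable_of_smooth hφ)
        ((differentiable_const (1 : ℝ)).sub (differentiable_of_smooth (hs n))), h3]
      simp only [Pi.neg_apply]; ring
    have hbd : ∀ x, g x * (φ x * (1 - ηn n x)) * outwardNormal T x i =
        g x * φ x * outwardNormal T x i - g x * φ x * outwardNormal T x i * ηn n x := by
      intro x; ring
    simp only [hpd, hbd] at hG
    have j1 : IntegrableOn (fun x => (w x * pd i φ x + v x * φ x) * ηn n x) T :=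
      i1.mul_bdd (hs n).continuous.aestronglyMeasurable (Eventually.of_forall (ηb n))
    have j2 : IntegrableOn (fun x => w x * φ x * pd i (ηn n) x) T :=
      integrable_mul_of_memLp mwφ (Lp (contDiff_pd (hs n) i).continuous)
    have j12 : IntegrableOn (fun x => (w x * pd i φ x + v x * φ x) * ηn n x +
      w x * φ x * pd i (ηn n) x) T := j1.add j2
    have j3 : IntegrableOn (fun x => g x * φ x * outwardNormal T x i * ηn n x) (frontier T)
        arcLength :=
      i2.mul_bdd (hs n).continuous.aestronglyMeasurable (Eventually.of_forall (ηb n))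
    rwa [integral_sub i1 j12, integral_add j1 j2, integral_sub i2 j3] at hG
  have l1 := (lim1.add lim3).const_sub (∫ x in T, (w x * pd i φ x + v x * φ x))
  have l2 := lim2.const_sub (∫ x in frontier T, g x * φ x * outwardNormal T x i ∂arcLength)
  have := tendsto_nhds_unique (l1.congr key) l2
  simpa [GreenHolds] using this

end IsTriangulated

end

end HHO

namespace HHO

noncomputable section

open Filter Geometry
open scoped Topology ENNReal

/-! ### Weak derivatives and traces as chosen representatives -/

theorem weakDeriv_spec {T : Set Plane} {a : Fin 2 → ℕ} {v g : Plane → ℝ}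
    (hg : MemLp g 2 (volume.restrict T)) (h : IsWeakDeriv T a v g) :
    MemLp (weakDeriv T a v) 2 (volume.restrict T) ∧ IsWeakDeriv T a v (weakDeriv T a v) :=
  Classical.epsilon_spec (p := fun g => MemLp g 2 (volume.restrict T) ∧ IsWeakDeriv T a v g)
    ⟨g, hg, h⟩

theorem IsH1.weakGrad_ae_eq {T : Set Plane} (hT : IsOpen T) {w : Plane → ℝ}
    {v : Fin 2 → Plane → ℝ} (h : IsH1 T w v) (i : Fin 2) :
    weakGrad T w i =ᵐ[volume.restrict T] v i :=
  have hs := weakDeriv_spec (h.memLp_grad i) (h.weak i)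
  IsWeakDeriv.ae_eq hT hs.1 (h.memLp_grad i) hs.2 (h.weak i)

/-- The weak gradient in the definition of the trace is an arbitrary representative; any other weak
gradient gives the same Green identity. -/
theorem IsH1.isTrace_iff {T : Set Plane} (hT : IsOpen T) {w g : Plane → ℝ}
    {v : Fin 2 → Plane → ℝ} (h : IsH1 T w v) :
    IsTrace T w g ↔ MemLp g 2 (arcLength.restrict (frontier T)) ∧
      ∀ (i : Fin 2) (φ : Plane → ℝ), ContDiff ℝ ∞ φ → HasCompactSupport φ →
        GreenHolds T w (v i) g i φ := by
  refine and_congr_right fun _ => forall₄_congr fun i φ _ _ => ?_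
  rw [GreenHolds, integral_congr_ae (g := fun x => w x * pd i φ x + v i x * φ x)]
  filter_upwards [h.weakGrad_ae_eq hT i] with x hx
  rw [hx]

namespace IsTriangulated

variable {K : SimplicialComplex ℝ Plane} {T : Set Plane} {r : ℝ} (hT : IsTriangulated K T r)
include hT

/-- Every boundary edge is one of the three edges of a triangle of `T`. -/
theorem card_boundaryEdges_le :
    hT.finite_boundaryEdges.toFinset.card ≤ 3 * hT.finite_elemTriangles.toFinset.card := by
  classical
  have h1 : hT.finite_boundaryEdges.toFinset ⊆
      hT.finite_elemTriangles.toFinset.biUnion fun s => s.powersetCard 2 := by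
    intro e he
    rw [Set.Finite.mem_toFinset] at he
    obtain ⟨p, q, c, s, -, -, -, hs, hes, -⟩ := hT.exists_triangle_of_edge he
    rw [Finset.mem_biUnion]
    exact ⟨s, (Set.Finite.mem_toFinset _).2 hs, Finset.mem_powersetCard.2 ⟨hes, he.2.1⟩⟩
  refine (Finset.card_le_card h1).trans (Finset.card_biUnion_le.trans ?_)
  rw [mul_comm, ← smul_eq_mul]
  refine Finset.sum_le_card_nsmul _ _ _ fun s hs => ?_
  rw [Finset.card_powersetCard, ((Set.Finite.mem_toFinset _).1 hs).1.2]
  rfl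

theorem greenHolds_of_finite {w v g : Plane → ℝ} (hw : MemLp w 2 (volume.restrict T))
    (hv : MemLp v 2 (volume.restrict T)) (hg : MemLp g 2 (arcLength.restrict (frontier T)))
    {i : Fin 2} {V : Set Plane} (hV : V.Finite) :
    (∀ φ : Plane → ℝ, ContDiff ℝ ∞ φ → HasCompactSupport φ →
      Disjoint (tsupport φ) V → GreenHolds T w v g i φ) →
    ∀ φ : Plane → ℝ, ContDiff ℝ ∞ φ → HasCompactSupport φ → GreenHolds T w v g i φ := by
  induction V, hV using Set.Finite.induction_on with
  | empty => exact fun H φ h1 h2 => H φ h1 h2 (disjoint_empty _)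
  | insert _ _ ih =>
    exact fun H => ih fun φ h1 h2 h3 => hT.greenHolds_of_diff_singleton hw hv hg H h1 h2 h3

/-- Existence of the trace of a function of `H¹(T)`, with a trace inequality. -/
theorem exists_trace {w : Plane → ℝ} {v : Fin 2 → Plane → ℝ} (h : IsH1 T w v) :
    ∃ g, MemLp g 2 (arcLength.restrict (frontier T)) ∧
      (∀ (i : Fin 2) (φ : Plane → ℝ), ContDiff ℝ ∞ φ → HasCompactSupport φ →
        GreenHolds T w (v i) g i φ) ∧
      ∀ ψ : Plane → ℝ, ContDiff ℝ ∞ ψ → ∫ x in frontier T, (g x - ψ x) ^ 2 ∂arcLength ≤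
        hT.finite_boundaryEdges.toFinset.card * (2 / r * (3 * (∫ x in T, (w x - ψ x) ^ 2) +
          Metric.diam T ^ 2 * ∑ i, ∫ x in T, (v i x - pd i ψ x) ^ 2)) := by
  classical
  have hr := hT.radius_pos
  have hTm := hT.isPolygon.isOpen.measurableSet
  have hbT := hT.isPolygon.isBounded
  have hloc : ∀ e, ∃ g, e ∈ boundaryEdges K T → ∃ p q c s, openEdge e = openSegment ℝ p q ∧
      s ∈ elemTriangles K T ∧ (s : Set Plane) = {c, p, q} ∧
      MemLp g 2 (arcLength.restrict (openEdge e)) ∧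
      ∀ ψ : Plane → ℝ, ContDiff ℝ ∞ ψ → ∫ x in openEdge e, (g x - ψ x) ^ 2 ∂arcLength ≤ 2 / r *
        (3 * (∫ x in interior (convexHull ℝ (s : Set Plane)), (w x - ψ x) ^ 2) +
          Metric.diam T ^ 2 * ∑ i, ∫ x in interior (convexHull ℝ (s : Set Plane)),
            (v i x - pd i ψ x) ^ 2) := by
    intro e
    by_cases he : e ∈ boundaryEdges K T
    · obtain ⟨p, q, c, s, hpq, -, ho, hs, -, hsc⟩ := hT.exists_triangle_of_edge he
      obtain ⟨z, hz⟩ := hT.ball s hs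
      have hcl := hT.convexHull_subset_closure hs
      rw [hsc] at hz hcl
      have hX := h.mono hTm hs.2
      rw [hsc] at hX
      obtain ⟨g, hg1, hg2⟩ := hX.exists_edge_trace (cross_ne_zero_of_face hs.1 hsc) hr hz
        (h := Metric.diam T) (fun x hx y hy => by
          rw [← Metric.diam_closure]
          exact Metric.dist_le_diam_of_mem hbT.closure (hcl hx) (hcl hy))
      refine ⟨g, fun _ => ⟨p, q, c, s, ho, hs, hsc, by rwa [ho], ?_⟩⟩
      rw [hsc, ho]
      exact hg2
    · exact ⟨0, fun h' => absurd h' he⟩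
  choose ge hge using hloc
  set E := hT.finite_boundaryEdges.toFinset with hE
  have hmem : ∀ e, e ∈ E ↔ e ∈ boundaryEdges K T := fun e => Set.Finite.mem_toFinset _
  -- The edge traces are glued by extension by zero; the open edges are disjoint, so on each of them
  -- only one term survives.
  set g : Plane → ℝ := fun x => ∑ e ∈ E, (openEdge e).indicator (ge e) x with hg
  have hgeq : ∀ e ∈ boundaryEdges K T, ∀ x ∈ openEdge e, g x = ge e x := by
    intro e he x hx
    rw [hg]
    simp only
    rw [Finset.sum_eq_single e, indicator_of_mem hx]
    · intro e' he' hne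
      have he'' := (hmem e').1 he'
      exact indicator_of_notMem (fun hx' => Set.disjoint_left.1
        (disjoint_openEdge he''.1 he.1 he''.2.1 he.2.1 hne) hx' hx) _
    · exact fun h' => absurd ((hmem e).2 he) h'
  have hgm : MemLp g 2 (arcLength.restrict (frontier T)) := by
    refine MemLp.restrict _ (memLp_finsetSum _ fun e he => ?_)
    have he := (hmem e).1 he
    obtain ⟨p, q, c, s, ho, hs, hsc, h1, h2⟩ := hge e he
    exact (memLp_indicator_iff_restrict (hT.measurableSet_openEdge he)).2 h1
  have hgψ : ∀ e ∈ boundaryEdges K T, ∀ ψ : Plane → ℝ,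
      ∫ x in openEdge e, (g x - ψ x) ^ 2 ∂arcLength =
        ∫ x in openEdge e, (ge e x - ψ x) ^ 2 ∂arcLength := fun e he ψ =>
    setIntegral_congr_fun (hT.measurableSet_openEdge he) fun x hx => by
      simp only [hgeq e he x hx]
  refine ⟨g, hgm, fun i => ?_, fun ψ hψ => ?_⟩
  · refine hT.greenHolds_of_finite h.memLp (h.memLp_grad i) hgm hT.finite_frontier_diff
      fun φ hφ hc hd => ?_
    -- Green's formula is local. At a point of `T` it is the definition of the weak derivative, on
    -- an open edge it is the half-disc formula, outside the closure both sides vanish; the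
    -- exceptional points are away from the support.
    refine testFunction_induction (P := GreenHolds T w (v i) g i) ?_
      (fun φ ψ h1 _ h2 _ h3 h4 => hT.greenHolds_add h.memLp (h.memLp_grad i) hgm h1 h2 h3 h4) hφ hc
      fun x hx => ?_
    · have h0 : pd i (0 : Plane → ℝ) = 0 := pd_const 0 i
      simp [GreenHolds, h0]
    · by_cases hxT : x ∈ closure T
      · by_cases hxT' : x ∈ T
        · refine ⟨T, hT.isPolygon.isOpen, hxT', fun φ h1 h2 h3 => ?_⟩
          have h4 := isWeakDeriv_single_iff.1 (h.weak i) φ h1 h2 h3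
          have h5 : ∫ x in frontier T, g x * φ x * outwardNormal T x i ∂arcLength = 0 := by
            refine setIntegral_eq_zero_of_forall_eq_zero fun x hx => ?_
            rw [hT.isPolygon.isOpen.frontier_eq] at hx
            rw [image_eq_zero_of_notMem_tsupport fun h' => hx.2 (h3 h')]
            ring
          rw [GreenHolds, h5, integral_add, h4, neg_add_cancel]
          · exact integrable_mul_of_memLp h.memLp
              (memLp_of_continuous_of_isBounded hbT (contDiff_pd h1 i).continuous)
          · exact integrable_mul_of_memLp (h.memLp_grad i)
              (memLp_of_continuous_of_isBounded hbT h1.continuous)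
        · have hxf : x ∈ frontier T := by
            rw [hT.isPolygon.isOpen.frontier_eq]; exact ⟨hxT, hxT'⟩
          have hxe : x ∈ ⋃ e ∈ boundaryEdges K T, openEdge e := by
            by_contra hcon
            exact Set.disjoint_left.1 hd hx ⟨hxf, hcon⟩
          obtain ⟨e, he, hxe⟩ := mem_iUnion₂.1 hxe
          obtain ⟨p, q, c, s, ho, hs, hsc, h1, h2⟩ := hge e he
          refine hT.exists_greenHolds_nhds h he ho hs hsc (C := 2 / r) (d := Metric.diam T ^ 2)
            (hgm.mono_measure (Measure.restrict_mono (openEdge_subset_frontier he) le_rfl))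
            (fun ψ hψ => ?_) hxe i
          rw [hgψ e he]
          exact h2 ψ hψ
      · refine ⟨(closure T)ᶜ, isClosed_closure.isOpen_compl, hxT, fun φ h1 h2 h3 => ?_⟩
        have hφ0 : ∀ y ∈ closure T, φ y = 0 := fun y hy =>
          image_eq_zero_of_notMem_tsupport fun h' => h3 h' hy
        have hφ0' : ∀ y ∈ closure T, pd i φ y = 0 := fun y hy =>
          image_eq_zero_of_notMem_tsupport fun h' => h3 (tsupport_pd_subset φ i h') hy
        rw [GreenHolds, setIntegral_eq_zero_of_forall_eq_zero fun x hx => by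
            rw [hφ0 x (subset_closure hx), hφ0' x (subset_closure hx)]; ring,
          setIntegral_eq_zero_of_forall_eq_zero fun x hx => by
            rw [hφ0 x (frontier_subset_closure hx)]; ring]
  · have hi : IntegrableOn (fun x => (g x - ψ x) ^ 2) (frontier T) arcLength :=
      (hgm.sub (hT.memLp_frontier hψ.continuous)).integrable_sq
    rw [hT.setIntegral_frontier_eq_sum hi, ← nsmul_eq_mul]
    refine Finset.sum_le_card_nsmul _ _ _ fun e he => ?_
    have he := (hmem e).1 he
    obtain ⟨p, q, c, s, ho, hs, hsc, h1, h2⟩ := hge e he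
    rw [hgψ e he]
    refine (h2 ψ hψ).trans (mul_le_mul_of_nonneg_left ?_ (by positivity))
    have hψL : ∀ {f : Plane → ℝ}, ContDiff ℝ ∞ f → MemLp f 2 (volume.restrict T) :=
      fun hf => memLp_of_continuous_of_isBounded hbT hf.continuous
    have m1 := setIntegral_mono_set (h.memLp.sub (hψL hψ)).integrable_sq
      (Eventually.of_forall fun x => sq_nonneg _) hs.2.eventuallyLE
    have m2 := Finset.sum_le_sum fun i (_ : i ∈ (Finset.univ : Finset (Fin 2))) =>
      setIntegral_mono_set ((h.memLp_grad i).sub (hψL (contDiff_pd hψ i))).integrable_sq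
        (Eventually.of_forall fun x => sq_nonneg _) hs.2.eventuallyLE
    simp only [Pi.sub_apply] at m1 m2
    gcongr

/-- The trace is unique up to a set of zero length. -/
theorem trace_ae_eq {w g g' : Plane → ℝ} {v : Fin 2 → Plane → ℝ}
    (hg : MemLp g 2 (arcLength.restrict (frontier T)))
    (hg' : MemLp g' 2 (arcLength.restrict (frontier T)))
    (h : ∀ (i : Fin 2) (φ : Plane → ℝ), ContDiff ℝ ∞ φ → HasCompactSupport φ →
      GreenHolds T w (v i) g i φ)
    (h' : ∀ (i : Fin 2) (φ : Plane → ℝ), ContDiff ℝ ∞ φ → HasCompactSupport φ →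
      GreenHolds T w (v i) g' i φ) : g =ᵐ[arcLength.restrict (frontier T)] g' := by
  have := hT.isFiniteMeasure_frontier
  have hi : ∀ i, ∀ᵐ x ∂(arcLength.restrict (frontier T)), (g x - g' x) * outwardNormal T x i = 0 := by
    intro i
    refine ae_eq_zero_of_integral_contDiff_smul_eq_zero
      ((hT.memLp_mul_normal (hg.sub hg') i).integrable (by norm_num)).locallyIntegrable
      fun φ hφ hc => ?_
    have e1 := (h i φ hφ hc).symm.trans (h' i φ hφ hc)
    have e2 : ∀ x, φ x • ((g x - g' x) * outwardNormal T x i) =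
        g x * φ x * outwardNormal T x i - g' x * φ x * outwardNormal T x i := by
      intro x; rw [smul_eq_mul]; ring
    simp only [e2]
    rw [integral_sub (hT.integrable_boundary hg i hφ.continuous)
      (hT.integrable_boundary hg' i hφ.continuous), e1, sub_self]
  have hn : ∀ᵐ x ∂(arcLength.restrict (frontier T)), ‖outwardNormal T x‖ = 1 := by
    rw [Measure.restrict_congr_set hT.frontier_ae_eq]
    refine (ae_restrict_iff' ?_).2 (Eventually.of_forall fun x hx => ?_)
    · exact Finset.measurableSet_biUnion _ fun e he =>
        hT.measurableSet_openEdge ((Set.Finite.mem_toFinset _).1 he)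
    · obtain ⟨e, he, hxe⟩ := mem_iUnion₂.1 hx
      obtain ⟨n, hn⟩ := hT.exists_normal ((Set.Finite.mem_toFinset _).1 he)
      rw [outwardNormal_eq (hn x hxe), (hn x hxe).1]
  filter_upwards [hi 0, hi 1, hn] with x h0 h1 hx
  have h2 : (outwardNormal T x) 0 ^ 2 + (outwardNormal T x) 1 ^ 2 = 1 := by
    rw [← norm_sq_eq, hx, one_pow]
  -- Both components of `(g - g') n` vanish and `n` is a unit vector.
  have h3 : g x - g' x = 0 := by
    linear_combination (-(g x - g' x)) * h2 + (outwardNormal T x) 0 * h0 + (outwardNormal T x) 1 * h1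
  linarith

/-- This cutoff extends Green's formula to smooth test functions without compact support, in
particular polynomials. -/
theorem exists_contDiff_eq_one : ∃ χ : Plane → ℝ, ContDiff ℝ ∞ χ ∧ HasCompactSupport χ ∧
    ∃ U : Set Plane, IsOpen U ∧ closure T ⊆ U ∧ ∀ x ∈ U, χ x = 1 := by
  obtain ⟨R, hR⟩ := hT.isPolygon.isBounded.closure.subset_ball 0
  have hR1 : R < max R 0 + 1 := by linarith [le_max_left R 0]
  let η : ContDiffBump (0 : Plane) := ⟨max R 0 + 1, max R 0 + 2, by positivity, by linarith⟩
  exact ⟨η, η.contDiff, η.hasCompactSupport, Metric.ball 0 R, Metric.isOpen_ball, hR,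
    fun x hx => η.one_of_mem_closedBall
      (Metric.ball_subset_closedBall (Metric.ball_subset_ball hR1.le hx))⟩

/-- Properties of the trace. -/
theorem trace_spec {w : Plane → ℝ} {v : Fin 2 → Plane → ℝ} (h : IsH1 T w v) :
    MemLp (trace T w) 2 (arcLength.restrict (frontier T)) ∧
      (∀ (i : Fin 2) (φ : Plane → ℝ), ContDiff ℝ ∞ φ → GreenHolds T w (v i) (trace T w) i φ) ∧
      ∀ ψ : Plane → ℝ, ContDiff ℝ ∞ ψ → ∫ x in frontier T, (trace T w x - ψ x) ^ 2 ∂arcLength ≤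
        hT.finite_boundaryEdges.toFinset.card * (2 / r * (3 * (∫ x in T, (w x - ψ x) ^ 2) +
          Metric.diam T ^ 2 * ∑ i, ∫ x in T, (v i x - pd i ψ x) ^ 2)) := by
  have hTo := hT.isPolygon.isOpen
  obtain ⟨g, hg, hG, hψ⟩ := hT.exists_trace h
  have hspec : IsTrace T w (trace T w) :=
    Classical.epsilon_spec (p := fun g => IsTrace T w g) ⟨g, (h.isTrace_iff hTo).2 ⟨hg, hG⟩⟩
  obtain ⟨ht, htG⟩ := (h.isTrace_iff hTo).1 hspec
  -- The selected trace agrees almost everywhere with the constructed one and so inherits its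
  -- estimate.
  have hae := hT.trace_ae_eq hg ht hG htG
  refine ⟨ht, fun i φ hφ => ?_, fun ψ hψ' => ?_⟩
  · obtain ⟨χ, h1, h2, U, hU, hTU, hχ⟩ := hT.exists_contDiff_eq_one
    have h3 := htG i (fun x => φ x * χ x) (hφ.mul h1) h2.mul_left
    have heq : EqOn (fun x => φ x * χ x) φ U := fun x hx => by simp [hχ x hx]
    have h4 := pd_eqOn_of_isOpen hU heq i
    unfold GreenHolds at *
    rw [setIntegral_congr_fun hTo.measurableSet (g := fun x => w x * pd i φ x + v i x * φ x)
      (fun x hx => ?_), setIntegral_congr_fun isClosed_frontier.measurableSet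
      (g := fun x => trace T w x * φ x * outwardNormal T x i) (fun x hx => ?_)] at h3
    · exact h3
    · simp only [hχ x (hTU (frontier_subset_closure hx)), mul_one]
    · simp only [hχ x (hTU (subset_closure hx)), h4 (hTU (subset_closure hx)), mul_one]
  · refine le_trans (le_of_eq (integral_congr_ae ?_)) (hψ ψ hψ')
    filter_upwards [hae] with x hx
    rw [hx]

end IsTriangulated

end

end HHO

/-! ### From the mesh to triangulated elements and decomposed boundaries. -/

namespace HHO

noncomputable section

open Filter Geometry
open scoped Topology ENNReal

/-! ### Faces of a polygonal mesh -/

theorem finite_closure_diff_openSegment (a b : Plane) :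
    (closure (openSegment ℝ a b) \ openSegment ℝ a b).Finite := by
  refine (toFinite ({a, b} : Set Plane)).subset ?_
  rw [closure_openSegment, ← insert_endpoints_openSegment]
  rintro x ⟨h1 | h1 | h1, h2⟩
  · exact Or.inl h1
  · exact Or.inr h1
  · exact absurd h1 h2

theorem IsPolygon.exists_normal {T : Set Plane} (hT : IsPolygon T) {a b : Plane} (hab : a ≠ b)
    {F : Set Plane} (hF : F = openSegment ℝ a b) (hFT : F ⊆ frontier T) :
    ∃ n : Plane, ∀ x ∈ F, IsOutwardNormalAt T x n := by
  subst hF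
  exact hT.one_sided a b hab hFT

/-- A third domain cannot touch the interior of an interface. -/
theorem notMem_closure_of_normals {T T₁ T₂ : Set Plane} {x n₁ n₂ : Plane} (hT : IsOpen T)
    (h₁ : IsOutwardNormalAt T₁ x n₁) (h₂ : IsOutwardNormalAt T₂ x n₂) (h₁₂ : Disjoint T₁ T₂)
    (hd₁ : Disjoint T T₁) (hd₂ : Disjoint T T₂) : x ∉ closure T := by
  obtain ⟨hn₁, ε, hε, H₁⟩ := h₁
  obtain ⟨hn₂, δ, hδ, H₂⟩ := h₂
  -- Otherwise a small step along `-(n₁ + n₂)` would enter both disjoint domains.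
  have hopp : n₂ = -n₁ := by
    by_contra hne
    have h1 : 0 < ‖n₁ + n₂‖ ^ 2 := by
      have : n₁ + n₂ ≠ 0 := fun h0 => hne (eq_neg_of_add_eq_zero_right h0)
      have := norm_pos_iff.2 this
      positivity
    rw [norm_add_sq_real, hn₁, hn₂] at h1
    obtain ⟨t, ht, hb⟩ := exists_smul_mem_ball x (-(n₁ + n₂)) (lt_min hε hδ)
    have e1 := (H₁ _ (Metric.ball_subset_ball (min_le_left _ _) hb)).2 (by
      rw [add_sub_cancel_left, inner_smul_right, inner_neg_right, inner_add_right,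
        real_inner_self_eq_norm_sq, hn₁]
      nlinarith)
    have e2 := (H₂ _ (Metric.ball_subset_ball (min_le_right _ _) hb)).2 (by
      rw [add_sub_cancel_left, inner_smul_right, inner_neg_right, inner_add_right,
        real_inner_self_eq_norm_sq, hn₂, real_inner_comm]
      nlinarith)
    exact Set.disjoint_left.1 h₁₂ e1 e2
  intro hx
  obtain ⟨y, hyB, hyT⟩ := mem_closure_iff.1 hx _ Metric.isOpen_ball
    (Metric.mem_ball_self (lt_min hε hδ))
  have hy1 : ¬(inner ℝ n₁ (y - x) : ℝ) < 0 := fun h => Set.disjoint_left.1 hd₁ hyT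
    ((H₁ y (Metric.ball_subset_ball (min_le_left _ _) hyB)).2 h)
  have hy2 : ¬(inner ℝ n₂ (y - x) : ℝ) < 0 := fun h => Set.disjoint_left.1 hd₂ hyT
    ((H₂ y (Metric.ball_subset_ball (min_le_right _ _) hyB)).2 h)
  rw [hopp, inner_neg_left] at hy2
  have hy0 : (inner ℝ n₁ (y - x) : ℝ) = 0 := by linarith [not_lt.1 hy1, not_lt.1 hy2]
  -- The point `y` of `T` lies on the line that separates the two half-discs. Since `T` is open, a
  -- small push along `-n₁` stays in `T` but enters `T₁`.
  obtain ⟨η, hη, hηT⟩ := Metric.isOpen_iff.1 (hT.inter (Metric.isOpen_ball (x := x) (ε := ε))) y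
    ⟨hyT, Metric.ball_subset_ball (min_le_left _ _) hyB⟩
  obtain ⟨t, ht, hb⟩ := exists_smul_mem_ball y (-n₁) hη
  have hz := hηT hb
  refine Set.disjoint_left.1 hd₁ hz.1 ((H₁ _ hz.2).2 ?_)
  have : y + t • -n₁ - x = (y - x) + t • -n₁ := by abel
  rw [this, inner_add_right, hy0, inner_smul_right, inner_neg_right, real_inner_self_eq_norm_sq, hn₁]
  linarith

/-- A second subdomain cannot touch the interior of a boundary face. -/
theorem notMem_closure_of_boundary_normal {T T₁ Ω : Set Plane} {x n₁ n : Plane}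
    (h₁ : IsOutwardNormalAt T₁ x n₁) (h : IsOutwardNormalAt Ω x n) (hT₁Ω : T₁ ⊆ Ω) (hTΩ : T ⊆ Ω)
    (hd : Disjoint T T₁) : x ∉ closure T := by
  obtain ⟨hn₁, ε, hε, H₁⟩ := h₁
  obtain ⟨hn, δ, hδ, H⟩ := h
  -- The inclusion of `T₁` in `Ω` gives nested half-planes, which then coincide: near `x` all of `Ω`
  -- is `T₁`, and no room is left for `T`.
  have himp : ∀ v, 0 < (inner ℝ (-n₁) v : ℝ) → (inner ℝ n v : ℝ) < 0 := by
    intro v hv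
    rw [inner_neg_left] at hv
    obtain ⟨t, ht, hb⟩ := exists_smul_mem_ball x v (lt_min hε hδ)
    have e1 := (H₁ _ (Metric.ball_subset_ball (min_le_left _ _) hb)).2 (by
      rw [add_sub_cancel_left, inner_smul_right]; nlinarith)
    have e2 := (H _ (Metric.ball_subset_ball (min_le_right _ _) hb)).1 (hT₁Ω e1)
    rw [add_sub_cancel_left, inner_smul_right] at e2
    by_contra hcon
    nlinarith [mul_nonneg ht.le (not_lt.1 hcon)]
  have hm : -n₁ ≠ 0 := by
    rw [neg_ne_zero]; intro h0; rw [h0, norm_zero] at hn₁; norm_num at hn₁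
  intro hx
  obtain ⟨y, hyB, hyT⟩ := mem_closure_iff.1 hx _ Metric.isOpen_ball
    (Metric.mem_ball_self (lt_min hε hδ))
  have e1 := (H y (Metric.ball_subset_ball (min_le_right _ _) hyB)).1 (hTΩ hyT)
  have e2 := (inner_neg_iff_of_imp hm himp (y - x)).1 e1
  rw [inner_neg_left] at e2
  exact Set.disjoint_left.1 hd hyT
    ((H₁ y (Metric.ball_subset_ball (min_le_left _ _) hyB)).2 (by linarith))

/-- The boundary of `T` is, up to finitely many points, the disjoint union of the segments `𝓕`. -/
structure IsBoundaryDecomposition (T : Set Plane) (𝓕 : Finset (Set Plane)) : Prop where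
  segment : ∀ F ∈ 𝓕, ∃ a b : Plane, a ≠ b ∧ F = openSegment ℝ a b
  subset : ∀ F ∈ 𝓕, F ⊆ frontier T
  disjoint : ∀ F ∈ 𝓕, ∀ F' ∈ 𝓕, F ≠ F' → Disjoint F F'
  finite_diff : (frontier T \ ⋃ F ∈ 𝓕, F).Finite

namespace PolyMesh

variable {Ω : Set Plane} (𝓜 : PolyMesh Ω)

/-- An open set contained in the closure of `Ω` is contained in `Ω`, which has no cracks. -/
theorem elem_subset (hΩ : IsPolygon Ω) {T : Set Plane} (hT : T ∈ 𝓜.elems) : T ⊆ Ω := by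
  rw [← hΩ.interior_closure]
  refine interior_maximal ?_ (𝓜.elems_partition.isPolygon T hT).isOpen
  rw [𝓜.elems_partition.closure_eq]
  exact subset_closure.trans (subset_biUnion_of_mem (u := fun T : Set Plane => closure T) hT)

/-- A face is contained in the boundary of an element or does not meet it. -/
theorem face_subset_or_disjoint (hΩ : IsPolygon Ω) {T F : Set Plane} (hT : T ∈ 𝓜.elems)
    (hF : F ∈ 𝓜.faces) : F ⊆ frontier T ∨ Disjoint F (frontier T) := by
  by_contra! hcon
  obtain ⟨h1, h2⟩ := hcon
  obtain ⟨x, hxF, hxT⟩ := Set.not_disjoint_iff.1 h2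
  obtain ⟨a, b, hab, hFab⟩ := 𝓜.faces_segment F hF
  have hpoly := 𝓜.elems_partition.isPolygon
  have hdisj := 𝓜.elems_partition.disjoint
  have hxc := frontier_subset_closure hxT
  rcases 𝓜.faces_cases F hF with ⟨T₁, hT₁, T₂, hT₂, hne, hsub⟩ | ⟨T₁, hT₁, hsub⟩
  · have hF₁ := hsub.trans inter_subset_left
    have hF₂ := hsub.trans inter_subset_right
    have hne₁ : T ≠ T₁ := by rintro rfl; exact h1 hF₁
    have hne₂ : T ≠ T₂ := by rintro rfl; exact h1 hF₂
    obtain ⟨n₁, hn₁⟩ := (hpoly T₁ hT₁).exists_normal hab hFab hF₁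
    obtain ⟨n₂, hn₂⟩ := (hpoly T₂ hT₂).exists_normal hab hFab hF₂
    exact notMem_closure_of_normals (hpoly T hT).isOpen (hn₁ x hxF) (hn₂ x hxF)
      (hdisj _ hT₁ _ hT₂ hne) (hdisj _ hT _ hT₁ hne₁) (hdisj _ hT _ hT₂ hne₂) hxc
  · have hF₁ := hsub.trans inter_subset_left
    have hne₁ : T ≠ T₁ := by rintro rfl; exact h1 hF₁
    obtain ⟨n₁, hn₁⟩ := (hpoly T₁ hT₁).exists_normal hab hFab hF₁
    obtain ⟨n, hn⟩ := hΩ.exists_normal hab hFab (hsub.trans inter_subset_right)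
    exact notMem_closure_of_boundary_normal (hn₁ x hxF) (hn x hxF) (𝓜.elem_subset hΩ hT₁)
      (𝓜.elem_subset hΩ hT) (hdisj _ hT _ hT₁ hne₁) hxc

theorem finite_closure_diff_faces : (⋃ F ∈ 𝓜.faces, closure F \ F).Finite := by
  refine 𝓜.faces.finite_toSet.biUnion fun F hF => ?_
  obtain ⟨a, b, hab, hFab⟩ := 𝓜.faces_segment F hF
  rw [hFab]
  exact finite_closure_diff_openSegment a b

theorem mem_facesOf {T F : Set Plane} : F ∈ 𝓜.facesOf T ↔ F ∈ 𝓜.faces ∧ F ⊆ frontier T := by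
  classical
  simp [facesOf]

/-- The skeleton is covered by the closed faces. A face that meets the boundary of `T` is contained
in it, so a boundary point outside the faces of `T` can only be an endpoint of some face. -/
theorem isBoundaryDecomposition (hΩ : IsPolygon Ω) {T : Set Plane} (hT : T ∈ 𝓜.elems) :
    IsBoundaryDecomposition T (𝓜.facesOf T) where
  segment F hF := 𝓜.faces_segment F (𝓜.mem_facesOf.1 hF).1
  subset F hF := (𝓜.mem_facesOf.1 hF).2
  disjoint F hF F' hF' := 𝓜.faces_disjoint F (𝓜.mem_facesOf.1 hF).1 F' (𝓜.mem_facesOf.1 hF').1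
  finite_diff := by
    refine 𝓜.finite_closure_diff_faces.subset ?_
    rintro x ⟨hx, hxF⟩
    have h1 : x ∈ ⋃ T ∈ 𝓜.elems, frontier T :=
      mem_biUnion (t := fun T : Set Plane => frontier T) hT hx
    rw [𝓜.skeleton] at h1
    obtain ⟨F, hF, hxc⟩ := mem_iUnion₂.1 h1
    refine mem_iUnion₂.2 ⟨F, hF, hxc, fun hxF' => hxF ?_⟩
    rcases 𝓜.face_subset_or_disjoint hΩ hT hF with h | h
    · exact mem_iUnion₂.2 ⟨F, 𝓜.mem_facesOf.2 ⟨hF, h⟩, hxF'⟩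
    · exact absurd hx (Set.disjoint_left.1 h hxF')

/-- The elements of a regular mesh with a matching simplicial submesh are triangulated. -/
theorem isTriangulated (hΩ : IsPolygon Ω) {K : SimplicialComplex ℝ Plane} {ϱ : ℝ} (hϱ : 0 < ϱ)
    (hK : IsMatchingSubmesh 𝓜 K) (hreg : IsRegular 𝓜 K ϱ) {T : Set Plane} (hT : T ∈ 𝓜.elems) :
    IsTriangulated K T (ϱ ^ 2 / 2 * Metric.diam T) := by
  have hpoly := 𝓜.elems_partition.isPolygon T hT
  have hdiam : 0 < Metric.diam T := by
    obtain ⟨x, hx⟩ := hpoly.isConnected.nonempty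
    obtain ⟨ε, hε, hb⟩ := Metric.isOpen_iff.1 hpoly.isOpen x hx
    obtain ⟨t, ht, hy⟩ := exists_smul_mem_ball x (EuclideanSpace.single 0 1) hε
    refine lt_of_lt_of_le (dist_pos.2 ?_) (Metric.dist_le_diam_of_mem hpoly.isBounded hx (hb hy))
    intro h
    have := congrArg (fun z : Plane => z 0) h
    simp at this
    exact ht.ne' this
  refine ⟨hpoly, hK.finite, hK.elems_decomposed T hT, by positivity, fun s hs => ?_, ?_⟩
  · have h1 := hreg.shape s hs.1
    have h2 := hreg.size T hT s hs.1 hs.2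
    have h3 : 0 < ϱ * Metric.diam (convexHull ℝ (s : Set Plane)) :=
      mul_pos hϱ (lt_of_lt_of_le (mul_pos hϱ hdiam) h2)
    -- The inradius is a supremum; giving up a factor 2 yields an actual disc. With `ϱ h_T ≤ h_S`
    -- this explains the radius `ϱ² h_T / 2`.
    have h4 : ϱ * Metric.diam (convexHull ℝ (s : Set Plane)) / 2 <
        inradius (convexHull ℝ (s : Set Plane)) := by linarith
    unfold inradius at h4
    -- The set of radii is nonempty: otherwise its supremum would be the default value 0, against
    -- the positive lower bound.
    obtain ⟨ρ, ⟨z, hz⟩, hρ⟩ := exists_lt_of_lt_csSup (by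
      by_contra hne
      rw [not_nonempty_iff_eq_empty] at hne
      rw [hne, Real.sSup_empty] at h4
      linarith) h4
    refine ⟨z, (Metric.closedBall_subset_closedBall ?_).trans hz⟩
    nlinarith [mul_le_mul_of_nonneg_left h2 hϱ.le]
  · refine ⟨_, 𝓜.finite_closure_diff_faces, fun x hx => ?_⟩
    have h1 : x ∈ ⋃ T ∈ 𝓜.elems, frontier T :=
      mem_biUnion (t := fun T : Set Plane => frontier T) hT hx
    rw [𝓜.skeleton] at h1
    obtain ⟨F, hF, hxc⟩ := mem_iUnion₂.1 h1
    by_cases hxF : x ∈ F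
    · have hsub : F ⊆ frontier T := by
        rcases 𝓜.face_subset_or_disjoint hΩ hT hF with h | h
        · exact h
        · exact absurd hx (Set.disjoint_left.1 h hxF)
      have hcl : closure F ⊆ frontier T := closure_minimal hsub isClosed_frontier
      left
      rw [hK.faces_decomposed F hF] at hxc
      obtain ⟨e, ⟨he1, he2, he3⟩, hxe⟩ := mem_iUnion₂.1 hxc
      exact mem_iUnion₂.2 ⟨e, ⟨he1, he2, he3.trans hcl⟩, hxe⟩
    · exact Or.inr (mem_iUnion₂.2 ⟨F, hF, hxc, hxF⟩)

end PolyMesh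

namespace IsBoundaryDecomposition

variable {T : Set Plane} {𝓕 : Finset (Set Plane)} (h𝓕 : IsBoundaryDecomposition T 𝓕)
include h𝓕

theorem measurableSet {F : Set Plane} (hF : F ∈ 𝓕) : MeasurableSet F := by
  obtain ⟨a, b, -, rfl⟩ := h𝓕.segment F hF
  exact measurableSet_openSegment a b

theorem sum_integral_eq {f : Plane → ℝ} (hf : IntegrableOn f (frontier T) arcLength) :
    ∑ F : 𝓕, ∫ x in (F : Set Plane), f x ∂arcLength = ∫ x in frontier T, f x ∂arcLength := by
  have hae : frontier T =ᵐ[arcLength] ⋃ F ∈ 𝓕, F := by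
    have h1 : (⋃ F ∈ 𝓕, F) ⊆ frontier T := iUnion₂_subset h𝓕.subset
    refine Filter.EventuallyLE.antisymm ?_ h1.eventuallyLE
    have h0 : arcLength (frontier T \ ⋃ F ∈ 𝓕, F) = 0 := arcLength_finite h𝓕.finite_diff
    exact (ae_le_set).2 h0
  rw [setIntegral_congr_set hae, integral_biUnion_finset 𝓕 (fun F hF => h𝓕.measurableSet hF)
    (fun F hF F' hF' hne => h𝓕.disjoint F hF F' hF' hne)
    (fun F hF => hf.mono_set (h𝓕.subset F hF)), ← Finset.sum_coe_sort 𝓕]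

theorem exists_normal (hT : IsPolygon T) {F : Set Plane} (hF : F ∈ 𝓕) :
    ∃ n : Plane, ∀ x ∈ F, outwardNormal T x = n := by
  obtain ⟨a, b, hab, hFab⟩ := h𝓕.segment F hF
  obtain ⟨n, hn⟩ := hT.exists_normal hab hFab (h𝓕.subset F hF)
  exact ⟨n, fun x hx => outwardNormal_eq (hn x hx)⟩

end IsBoundaryDecomposition

end

end HHO

/-! ### Polynomials and the approximation of Sobolev functions on an element. -/

namespace HHO

noncomputable section

open Filter Geometry
open scoped Topology ENNReal

/-! ### Polynomial functions -/

/-- The monomial of exponents `(i, j)`, divided by `i! j!`. -/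
def mono (i j : ℕ) (x : Plane) : ℝ := x 0 ^ i / i.factorial * (x 1 ^ j / j.factorial)

theorem contDiff_coord (i : Fin 2) : ContDiff ℝ ∞ fun x : Plane => x i :=
  (EuclideanSpace.proj i : Plane →L[ℝ] ℝ).contDiff

theorem contDiff_mono (i j : ℕ) : ContDiff ℝ ∞ (mono i j) :=
  (((contDiff_coord 0).pow i).div_const _).mul (((contDiff_coord 1).pow j).div_const _)

theorem hasDerivAt_pow_div_factorial (a : ℝ) (i : ℕ) :
    HasDerivAt (fun t : ℝ => (a + t) ^ (i + 1) / (i + 1).factorial) (a ^ i / i.factorial) 0 := by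
  have h1 := (((hasDerivAt_id (0 : ℝ)).const_add a).pow (i + 1)).div_const
    ((i + 1).factorial : ℝ)
  convert! h1 using 1
  rw [Nat.factorial_succ]
  have : (i.factorial : ℝ) ≠ 0 := Nat.cast_ne_zero.2 i.factorial_ne_zero
  push_cast
  field_simp
  simp

theorem pd_eq_of_hasDerivAt {f : Plane → ℝ} (hf : Differentiable ℝ f) {i : Fin 2} {x : Plane} {d : ℝ}
    (h : HasDerivAt (fun t : ℝ => f (x + t • stdVec i)) d 0) : pd i f x = d := by
  have := hasDerivAt_comp_line hf x (stdVec i) 0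
  rw [zero_smul, add_zero] at this
  exact this.unique h

/-- The division by factorials makes differentiation a mere shift of exponents. -/
theorem pd_zero_mono_succ (i j : ℕ) : pd 0 (mono (i + 1) j) = mono i j := by
  ext x
  refine pd_eq_of_hasDerivAt (differentiable_of_smooth (contDiff_mono _ _)) ?_
  simpa [mono] using (hasDerivAt_pow_div_factorial (x 0) i).mul_const (x 1 ^ j / j.factorial)

theorem pd_one_mono_succ (i j : ℕ) : pd 1 (mono i (j + 1)) = mono i j := by
  ext x
  refine pd_eq_of_hasDerivAt (differentiable_of_smooth (contDiff_mono _ _)) ?_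
  simpa [mono] using (hasDerivAt_pow_div_factorial (x 1) j).const_mul (x 0 ^ i / i.factorial)

theorem pd_zero_mono_zero (j : ℕ) : pd 0 (mono 0 j) = 0 := by
  ext x
  refine pd_eq_of_hasDerivAt (differentiable_of_smooth (contDiff_mono _ _)) ?_
  simpa [mono] using hasDerivAt_const (0 : ℝ) (x 1 ^ j / (j.factorial : ℝ))

theorem pd_one_mono_zero (i : ℕ) : pd 1 (mono i 0) = 0 := by
  ext x
  refine pd_eq_of_hasDerivAt (differentiable_of_smooth (contDiff_mono _ _)) ?_
  simpa [mono] using hasDerivAt_const (0 : ℝ) (x 0 ^ i / (i.factorial : ℝ))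

theorem polySpace_mono {l m : ℕ} (h : l ≤ m) : polySpace l ≤ polySpace m := by
  rintro f ⟨p, hp, hf⟩
  exact ⟨p, hp.trans h, hf⟩

theorem mono_mem (i j : ℕ) : mono i j ∈ polySpace (i + j) := by
  refine ⟨MvPolynomial.C (((i.factorial : ℝ))⁻¹ * ((j.factorial : ℝ))⁻¹) *
    (MvPolynomial.X 0 ^ i * MvPolynomial.X 1 ^ j), ?_, fun x => ?_⟩
  · refine (MvPolynomial.totalDegree_mul _ _).trans ?_
    rw [MvPolynomial.totalDegree_C, zero_add]
    refine (MvPolynomial.totalDegree_mul _ _).trans ?_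
    rw [MvPolynomial.totalDegree_X_pow, MvPolynomial.totalDegree_X_pow]
  · simp only [mono, map_mul, MvPolynomial.eval_C, map_pow, MvPolynomial.eval_X]
    ring

/-- Finite dimension, smoothness and the action of derivatives on degrees all reduce to monomials
through this description. -/
theorem polySpace_eq_span (l : ℕ) : polySpace l =
    Submodule.span ℝ ((fun s : ℕ × ℕ => mono s.1 s.2) '' {s | s.1 + s.2 ≤ l}) := by
  refine le_antisymm ?_ (Submodule.span_le.2 ?_)
  · rintro f ⟨p, hp, hf⟩
    have hfs : f = ∑ s ∈ p.support, (p.coeff s * ((s 0).factorial * (s 1).factorial)) •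
        mono (s 0) (s 1) := by
      ext x
      rw [hf, MvPolynomial.eval_eq', Finset.sum_apply]
      refine Finset.sum_congr rfl fun s _ => ?_
      have h0 : ((s 0).factorial : ℝ) ≠ 0 := Nat.cast_ne_zero.2 (Nat.factorial_ne_zero _)
      have h1 : ((s 1).factorial : ℝ) ≠ 0 := Nat.cast_ne_zero.2 (Nat.factorial_ne_zero _)
      simp only [Fin.prod_univ_two, Pi.smul_apply, smul_eq_mul, mono]
      field_simp
    rw [hfs]
    refine Submodule.sum_mem _ fun s hs => Submodule.smul_mem _ _ (Submodule.subset_span ?_)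
    refine ⟨(s 0, s 1), ?_, rfl⟩
    have h1 := MvPolynomial.le_totalDegree hs
    rw [Finsupp.sum_fintype _ _ (fun _ => rfl), Fin.sum_univ_two] at h1
    exact h1.trans hp
  · rintro _ ⟨s, hs, rfl⟩
    exact polySpace_mono hs (mono_mem _ _)

instance finiteDimensional_polySpace (l : ℕ) : FiniteDimensional ℝ (polySpace l) := by
  rw [polySpace_eq_span]
  refine FiniteDimensional.span_of_finite ℝ (Set.Finite.image _ ?_)
  refine (Set.finite_Iic (l, l)).subset fun s (hs : s.1 + s.2 ≤ l) => ⟨?_, ?_⟩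
  · exact le_trans (Nat.le_add_right _ _) hs
  · exact le_trans (Nat.le_add_left _ _) hs

instance finiteDimensional_facePolySpace (l : ℕ) (F : Set Plane) :
    FiniteDimensional ℝ (facePolySpace l F) := by
  let R : (Plane → ℝ) →ₗ[ℝ] (Plane → ℝ) :=
    { toFun := fun p => F.indicator p
      map_add' := fun p q => indicator_add' F p q
      map_smul' := fun c p => indicator_const_smul F c p }
  have : facePolySpace l F = (polySpace l).map R := by
    ext f
    rw [Submodule.mem_map]
    constructor
    · rintro ⟨p, hp, rfl⟩; exact ⟨p, hp, rfl⟩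
    · rintro ⟨p, hp, rfl⟩; exact ⟨p, hp, rfl⟩
  rw [this]
  infer_instance

theorem contDiff_of_mem_polySpace {l : ℕ} {f : Plane → ℝ} (hf : f ∈ polySpace l) :
    ContDiff ℝ ∞ f := by
  rw [polySpace_eq_span] at hf
  induction hf using Submodule.span_induction with
  | mem f hf => obtain ⟨s, -, rfl⟩ := hf; exact contDiff_mono _ _
  | zero => exact contDiff_const (c := (0 : ℝ))
  | add f g _ _ hf hg => exact hf.add hg
  | smul c f _ hf => exact contDiff_const.smul hf

theorem pd_mem_span {l : ℕ} {f : Plane → ℝ} (hf : f ∈ polySpace l) {V : Submodule ℝ (Plane → ℝ)}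
    (i : Fin 2) (hV : ∀ a b, a + b ≤ l → pd i (mono a b) ∈ V) : pd i f ∈ V := by
  rw [polySpace_eq_span] at hf
  induction hf using Submodule.span_induction with
  | mem f hf => obtain ⟨s, hs, rfl⟩ := hf; exact hV _ _ hs
  | zero =>
    have : pd i (0 : Plane → ℝ) = 0 := pd_const 0 i
    rw [this]; exact V.zero_mem
  | add f g hf' hg' hf hg =>
    rw [← polySpace_eq_span] at hf' hg'
    rw [pd_add (differentiable_of_smooth (contDiff_of_mem_polySpace hf'))
      (differentiable_of_smooth (contDiff_of_mem_polySpace hg'))]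
    exact V.add_mem hf hg
  | smul c f hf' hf =>
    rw [← polySpace_eq_span] at hf'
    rw [pd_const_smul (differentiable_of_smooth (contDiff_of_mem_polySpace hf'))]
    exact V.smul_mem c hf

theorem pd_mem_polySpace {l : ℕ} {f : Plane → ℝ} (hf : f ∈ polySpace (l + 1)) (i : Fin 2) :
    pd i f ∈ polySpace l := by
  refine pd_mem_span hf i fun a b hab => ?_
  fin_cases i
  · rcases a with _ | a
    · simp only [Fin.zero_eta, pd_zero_mono_zero]; exact Submodule.zero_mem _
    · simp only [Fin.zero_eta, pd_zero_mono_succ]; exact polySpace_mono (by omega) (mono_mem _ _)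
  · rcases b with _ | b
    · simp only [Fin.mk_one, pd_one_mono_zero]; exact Submodule.zero_mem _
    · simp only [Fin.mk_one, pd_one_mono_succ]; exact polySpace_mono (by omega) (mono_mem _ _)

theorem pd_mem_polySpace_self {l : ℕ} {f : Plane → ℝ} (hf : f ∈ polySpace l) (i : Fin 2) :
    pd i f ∈ polySpace l :=
  pd_mem_polySpace (polySpace_mono (Nat.le_succ l) hf) i

theorem pd_eq_zero_of_mem {f : Plane → ℝ} (hf : f ∈ polySpace 0) (i : Fin 2) : pd i f = 0 := by
  have : pd i f ∈ (⊥ : Submodule ℝ (Plane → ℝ)) := by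
    refine pd_mem_span hf i fun a b hab => ?_
    obtain ⟨rfl, rfl⟩ : a = 0 ∧ b = 0 := by omega
    fin_cases i
    · simp only [Fin.zero_eta, pd_zero_mono_zero]; exact Submodule.zero_mem _
    · simp only [Fin.mk_one, pd_one_mono_zero]; exact Submodule.zero_mem _
  simpa using this

theorem pdMulti_zero_fun (a : Fin 2 → ℕ) : pdMulti a 0 = 0 := by
  have h : ∀ i : Fin 2, Function.IsFixedPt (pd i) 0 := fun i => pd_const 0 i
  simp only [pdMulti]
  rw [((h 1).iterate _).eq, ((h 0).iterate _).eq]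

theorem exists_eq_add_single {a : Fin 2 → ℕ} (h : 0 < ∑ i, a i) :
    ∃ (b : Fin 2 → ℕ) (i : Fin 2), a = b + Pi.single i 1 ∧ ∑ i, a i = (∑ i, b i) + 1 := by
  obtain ⟨i, -, hi⟩ := Finset.exists_ne_zero_of_sum_ne_zero h.ne'
  have hle : Pi.single i 1 ≤ a := by
    intro j
    rcases eq_or_ne j i with rfl | hj
    · simp only [Pi.single_eq_same]; omega
    · simp [hj]
  have h1 : a = (a - Pi.single i 1) + Pi.single i 1 := (tsub_add_cancel_of_le hle).symm
  refine ⟨a - Pi.single i 1, i, h1, ?_⟩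
  conv_lhs => rw [h1]
  simp [Finset.sum_add_distrib, Finset.sum_pi_single']

theorem sum_add_single (b : Fin 2 → ℕ) (i : Fin 2) :
    ∑ j, (b + Pi.single i 1 : Fin 2 → ℕ) j = (∑ j, b j) + 1 := by
  simp [Finset.sum_add_distrib, Finset.sum_pi_single']

theorem pdMulti_eq_zero_of_mem {l : ℕ} {f : Plane → ℝ} (hf : f ∈ polySpace l) {a : Fin 2 → ℕ}
    (ha : l < ∑ i, a i) : pdMulti a f = 0 := by
  induction l generalizing f a with
  | zero =>
    obtain ⟨b, i, rfl, -⟩ := exists_eq_add_single ha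
    rw [← pdMulti_pd (contDiff_of_mem_polySpace hf), pd_eq_zero_of_mem hf, pdMulti_zero_fun]
  | succ l ih =>
    obtain ⟨b, i, rfl, hb⟩ := exists_eq_add_single (lt_of_le_of_lt (Nat.zero_le _) ha)
    rw [← pdMulti_pd (contDiff_of_mem_polySpace hf)]
    exact ih (pd_mem_polySpace hf i) (by omega)

theorem iterate_pd_zero_mono (n i j : ℕ) : (pd 0)^[n] (mono (i + n) j) = mono i j := by
  induction n with
  | zero => rfl
  | succ n ih => rw [Function.iterate_succ_apply, ← add_assoc, pd_zero_mono_succ, ih]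

theorem iterate_pd_one_mono (n i j : ℕ) : (pd 1)^[n] (mono i (j + n)) = mono i j := by
  induction n with
  | zero => rfl
  | succ n ih => rw [Function.iterate_succ_apply, ← add_assoc, pd_one_mono_succ, ih]

theorem pdMulti_mono_self (a : Fin 2 → ℕ) : pdMulti a (mono (a 0) (a 1)) = fun _ => 1 := by
  have h1 := iterate_pd_one_mono (a 1) (a 0) 0
  have h2 := iterate_pd_zero_mono (a 0) 0 0
  rw [zero_add] at h1 h2
  rw [pdMulti, h1, h2]
  ext x
  simp [mono]

/-- For distinct multi-indices of the same length, one exponent of the monomial is smaller than the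
order of differentiation in that variable. -/
theorem pdMulti_mono_eq_zero {a b : Fin 2 → ℕ} (hab : ∑ i, a i = ∑ i, b i) (hne : a ≠ b) :
    pdMulti a (mono (b 0) (b 1)) = 0 := by
  simp only [Fin.sum_univ_two] at hab
  have h0 : ∀ (i : Fin 2) n, (pd i)^[n] (0 : Plane → ℝ) = 0 := fun i n =>
    (Function.IsFixedPt.iterate (pd_const 0 i) n).eq
  rcases lt_trichotomy (a 1) (b 1) with h | h | h
  · obtain ⟨c, hc⟩ := Nat.exists_eq_add_of_lt h
    have h1 : (pd 1)^[a 1] (mono (b 0) (b 1)) = mono (b 0) (c + 1) := by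
      rw [show b 1 = (c + 1) + a 1 by omega, iterate_pd_one_mono]
    have h2 := iterate_pd_zero_mono (b 0) 0 (c + 1)
    rw [zero_add] at h2
    rw [pdMulti, h1, show a 0 = c + 1 + b 0 by omega, Function.iterate_add_apply, h2,
      Function.iterate_succ_apply, pd_zero_mono_zero, h0]
  · refine absurd ?_ hne
    ext i; fin_cases i
    · simp only [Fin.zero_eta]; omega
    · exact h
  · obtain ⟨c, hc⟩ := Nat.exists_eq_add_of_lt h
    have h1 := iterate_pd_one_mono (b 1) (b 0) 0
    rw [zero_add] at h1
    rw [pdMulti, show a 1 = c + 1 + b 1 by omega, Function.iterate_add_apply, h1,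
      Function.iterate_succ_apply, pd_one_mono_zero, h0, h0]

theorem pdMulti_add {f g : Plane → ℝ} (hf : ContDiff ℝ ∞ f) (hg : ContDiff ℝ ∞ g)
    (a : Fin 2 → ℕ) : pdMulti a (f + g) = pdMulti a f + pdMulti a g := by
  have key : ∀ (i : Fin 2) n (f g : Plane → ℝ), ContDiff ℝ ∞ f → ContDiff ℝ ∞ g →
      (pd i)^[n] (f + g) = (pd i)^[n] f + (pd i)^[n] g := by
    intro i n
    induction n with
    | zero => intros; rfl
    | succ n ih =>
      intro f g hf hg
      simp only [Function.iterate_succ_apply]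
      rw [pd_add (differentiable_of_smooth hf) (differentiable_of_smooth hg),
        ih _ _ (contDiff_pd hf i) (contDiff_pd hg i)]
  simp only [pdMulti]
  rw [key 1 _ _ _ hf hg, key 0 _ _ _ (contDiff_iterate_pd hf 1 _) (contDiff_iterate_pd hg 1 _)]

theorem pdMulti_const_smul {f : Plane → ℝ} (hf : ContDiff ℝ ∞ f) (c : ℝ) (a : Fin 2 → ℕ) :
    pdMulti a (c • f) = c • pdMulti a f := by
  have key : ∀ (i : Fin 2) n (f : Plane → ℝ), ContDiff ℝ ∞ f →
      (pd i)^[n] (c • f) = c • (pd i)^[n] f := by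
    intro i n
    induction n with
    | zero => intros; rfl
    | succ n ih =>
      intro f hf
      simp only [Function.iterate_succ_apply]
      rw [pd_const_smul (differentiable_of_smooth hf), ih _ (contDiff_pd hf i)]
  simp only [pdMulti]
  rw [key 1 _ _ hf, key 0 _ _ (contDiff_iterate_pd hf 1 _)]

/-- The leading part of a polynomial can be prescribed. -/
theorem exists_pdMulti_eq_const (m : ℕ) (c : (Fin 2 → ℕ) → ℝ) :
    ∃ w ∈ polySpace m, ∀ a : Fin 2 → ℕ, ∑ i, a i = m → pdMulti a w = fun _ => c a := by
  classical
  set S := Finset.piAntidiag (Finset.univ : Finset (Fin 2)) m with hS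
  have hmemS : ∀ a : Fin 2 → ℕ, a ∈ S ↔ ∑ i, a i = m := by
    intro a; simp [hS, Finset.mem_piAntidiag]
  have hm : ∀ b ∈ S, c b • mono (b 0) (b 1) ∈ polySpace m := by
    intro b hb
    refine Submodule.smul_mem _ _ (polySpace_mono (le_of_eq ?_) (mono_mem _ _))
    rw [← (hmemS b).1 hb, Fin.sum_univ_two]
  refine ⟨∑ b ∈ S, c b • mono (b 0) (b 1), Submodule.sum_mem _ hm, fun a ha => ?_⟩
  have hsum : ∀ R ⊆ S, pdMulti a (∑ b ∈ R, c b • mono (b 0) (b 1)) =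
      ∑ b ∈ R, c b • pdMulti a (mono (b 0) (b 1)) := by
    intro R
    induction R using Finset.induction_on with
    | empty => intro _; simp [pdMulti_zero_fun]
    | insert b R hb ih =>
      intro hR
      have hb' : c b • mono (b 0) (b 1) ∈ polySpace m := hm b (hR (Finset.mem_insert_self b R))
      have hR' : R ⊆ S := (Finset.subset_insert b R).trans hR
      rw [Finset.sum_insert hb, Finset.sum_insert hb, pdMulti_add (contDiff_of_mem_polySpace hb')
        (contDiff_of_mem_polySpace (Submodule.sum_mem _ fun d hd => hm d (hR' hd))), ih hR',
        pdMulti_const_smul (contDiff_mono _ _)]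
  rw [hsum S subset_rfl, Finset.sum_eq_single a, pdMulti_mono_self]
  · ext x; simp
  · intro b hb hba
    rw [pdMulti_mono_eq_zero (ha.trans ((hmemS b).1 hb).symm) hba.symm, smul_zero]
  · exact fun h => absurd ((hmemS a).2 ha) h

/-- The means of the derivatives of a polynomial can be prescribed. -/
theorem exists_integral_pdMulti_eq {T : Set Plane} (hb : Bornology.IsBounded T)
    (hT : volume.real T ≠ 0) (m : ℕ) (c : (Fin 2 → ℕ) → ℝ) :
    ∃ w ∈ polySpace m, ∀ a : Fin 2 → ℕ, ∑ i, a i ≤ m → ∫ x in T, pdMulti a w x = c a := by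
  have hfin : IsFiniteMeasure (volume.restrict T) := ⟨by simpa using hb.measure_lt_top (μ := volume)⟩
  have top : ∀ (m : ℕ) (c : (Fin 2 → ℕ) → ℝ), ∃ w ∈ polySpace m, ∀ a : Fin 2 → ℕ,
      ∑ i, a i = m → ∫ x in T, pdMulti a w x = c a := by
    intro m c
    obtain ⟨w, hw, hwa⟩ := exists_pdMulti_eq_const m fun a => c a / volume.real T
    refine ⟨w, hw, fun a ha => ?_⟩
    rw [hwa a ha, integral_const, measureReal_restrict_apply_univ, smul_eq_mul,
      mul_div_cancel₀ _ hT]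
  induction m generalizing c with
  | zero =>
    obtain ⟨w, hw, hwa⟩ := top 0 c
    exact ⟨w, hw, fun a ha => hwa a (Nat.le_zero.1 ha)⟩
  | succ m ih =>
    obtain ⟨w, hw, hwa⟩ := top (m + 1) c
    -- The system is triangular: the leading part `w` settles the derivatives of top order, and the
    -- correction `u` of lower degree repairs the others without touching them.
    obtain ⟨u, hu, hua⟩ := ih fun a => c a - ∫ x in T, pdMulti a w x
    have hws := contDiff_of_mem_polySpace hw
    have hus := contDiff_of_mem_polySpace hu
    refine ⟨u + w, Submodule.add_mem _ (polySpace_mono (Nat.le_succ m) hu) hw, fun a ha => ?_⟩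
    have hint : ∀ {f : Plane → ℝ}, ContDiff ℝ ∞ f → IntegrableOn (pdMulti a f) T := fun hf =>
      (memLp_of_continuous_of_isBounded hb (ContDiff.pdMulti hf a).continuous).integrable
        (by norm_num)
    have e : ∫ x in T, pdMulti a (u + w) x =
        (∫ x in T, pdMulti a u x) + ∫ x in T, pdMulti a w x := by
      rw [pdMulti_add hus hws]
      exact integral_add (hint hus) (hint hws)
    rw [e]
    rcases Nat.lt_or_ge m (∑ i, a i) with h | h
    · rw [pdMulti_eq_zero_of_mem hu h, hwa a (by omega)]
      simp
    · rw [hua a h]; ring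

end

end HHO

namespace HHO

noncomputable section

open Filter Geometry
open scoped Topology ENNReal

/-! ### Weak derivatives of all orders -/

/-- The weak derivative of multi-index `a` of `v`, where `v` represents its own derivative of order
zero. -/
def jet (T : Set Plane) (v : Plane → ℝ) (a : Fin 2 → ℕ) : Plane → ℝ :=
  open Classical in if a = 0 then v else weakDeriv T a v

theorem jet_zero (T : Set Plane) (v : Plane → ℝ) : jet T v 0 = v := if_pos rfl

theorem jet_of_ne_zero (T : Set Plane) (v : Plane → ℝ) {a : Fin 2 → ℕ} (ha : a ≠ 0) :
    jet T v a = weakDeriv T a v := if_neg ha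

theorem single_ne_zero (i : Fin 2) : (Pi.single i 1 : Fin 2 → ℕ) ≠ 0 := fun h => by
  have := congrFun h i
  simp at this

theorem jet_single (T : Set Plane) (v : Plane → ℝ) (i : Fin 2) :
    jet T v (Pi.single i 1) = weakGrad T v i := jet_of_ne_zero T v (single_ne_zero i)

theorem MemSobolev.jet_spec {m : ℕ} {T : Set Plane} {v : Plane → ℝ} (hv : MemSobolev m T v)
    {a : Fin 2 → ℕ} (ha : ∑ i, a i ≤ m) :
    MemLp (jet T v a) 2 (volume.restrict T) ∧ IsWeakDeriv T a v (jet T v a) := by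
  rcases eq_or_ne a 0 with rfl | h
  · rw [jet_zero]
    refine ⟨hv.1, fun φ _ _ _ => ?_⟩
    rw [pdMulti_zero]
    simp
  · rw [jet_of_ne_zero T v h]
    obtain ⟨g, hg, hg'⟩ := hv.2 a ha
    exact weakDeriv_spec hg hg'

/-- Testing the derivative of order `a` with `pd i φ` shows that consecutive jets are linked by
first-order weak derivatives. Thus the Poincaré and trace inequalities for `H¹` apply to derivatives
of every order. -/
theorem MemSobolev.isH1_jet {m : ℕ} {T : Set Plane} {v : Plane → ℝ}
    (hv : MemSobolev (m + 1) T v) {a : Fin 2 → ℕ} (ha : ∑ i, a i ≤ m) :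
    IsH1 T (jet T v a) fun i => jet T v (a + Pi.single i 1) := by
  have h1 := hv.jet_spec (ha.trans (Nat.le_succ m))
  have h2 := fun i => hv.jet_spec (a := a + Pi.single i 1) (by rw [sum_add_single]; omega)
  refine ⟨h1.1, fun i => (h2 i).1, fun i => isWeakDeriv_single_iff.2 fun φ hφ hc hs => ?_⟩
  have e1 := h1.2 (pd i φ) (contDiff_pd hφ i) (HasCompactSupport.pd hc i)
    ((tsupport_pd_subset φ i).trans hs)
  have e2 := (h2 i).2 φ hφ hc hs
  rw [pdMulti_pd hφ, e2, sum_add_single, pow_succ] at e1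
  have h3 : ((-1 : ℝ) ^ ∑ i, a i) ≠ 0 := pow_ne_zero _ (by norm_num)
  apply mul_left_cancel₀ h3
  linarith

theorem integral_jet_sq_le {T : Set Plane} (v : Plane → ℝ) {m : ℕ} {a : Fin 2 → ℕ}
    (ha : ∑ i, a i = m + 1) :
    ∫ x in T, jet T v a x ^ 2 ≤ sobolevSeminorm (m + 1) T v ^ 2 := by
  have hne : a ≠ 0 := by rintro rfl; simp at ha
  rw [jet_of_ne_zero T v hne]
  have h1 : √(∫ x in T, weakDeriv T a v x ^ 2) ≤ sobolevSeminorm (m + 1) T v :=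
    Finset.single_le_sum (f := fun a => √(∫ x in T, weakDeriv T a v x ^ 2))
      (fun a _ => Real.sqrt_nonneg _) (by simp [Finset.mem_piAntidiag, ← ha])
  rw [← Real.sq_sqrt (integral_sq_nonneg (μ := volume.restrict T) (weakDeriv T a v))]
  exact pow_le_pow_left₀ (Real.sqrt_nonneg _) h1 2

namespace IsTriangulated

variable {K : SimplicialComplex ℝ Plane} {T : Set Plane} {r : ℝ}

theorem volume_real_pos (hT : IsTriangulated K T r) : 0 < volume.real T := by
  obtain ⟨s, hs⟩ := hT.nonempty_elemTriangles
  have h1 := hT.volume_interior_ge hs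
  have h2 : volume.real (interior (convexHull ℝ (s : Set Plane))) ≤ volume.real T :=
    measureReal_mono hs.2 hT.isPolygon.isBounded.measure_lt_top.ne
  have := hT.radius_pos
  have := Real.pi_pos
  have : 0 < r ^ 2 * Real.pi := by positivity
  linarith

variable {θ : ℝ}

/-- Polynomial approximation of the derivatives of a function on an element. -/
theorem exists_poly_approx (hθ : 0 < θ) (hT : IsTriangulated K T (θ * Metric.diam T)) {m : ℕ}
    {v : Plane → ℝ} (hv : MemSobolev (m + 1) T v) :
    ∃ w ∈ polySpace m, ∀ (j : ℕ) (a : Fin 2 → ℕ), ∑ i, a i + j = m + 1 →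
      ∫ x in T, (jet T v a x - pdMulti a w x) ^ 2 ≤
        (2 * poincareConst θ * Metric.diam T ^ 2) ^ j * sobolevSeminorm (m + 1) T v ^ 2 := by
  have hbT := hT.isPolygon.isBounded
  have hfin := hT.isFiniteMeasure
  obtain ⟨w, hw, hwa⟩ := exists_integral_pdMulti_eq hbT hT.volume_real_pos.ne' m
    fun a => ∫ x in T, jet T v a x
  have hws := contDiff_of_mem_polySpace hw
  refine ⟨w, hw, fun j => ?_⟩
  -- Induction downwards from the top order, `j` being the number of missing derivatives. At the top
  -- the derivatives of `w` vanish; below, the error has mean zero, and Poincaré passes to the two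
  -- derivatives of the next order, whence the 2.
  induction j with
  | zero =>
    intro a ha
    rw [pdMulti_eq_zero_of_mem hw (by omega)]
    simpa using integral_jet_sq_le v ha
  | succ j ih =>
    intro a ha
    have ham : ∑ i, a i ≤ m := by omega
    have hH1 := (hv.isH1_jet ham).sub (isH1_of_smooth hbT (ContDiff.pdMulti hws a))
    have hmean : ∫ x in T, (jet T v a - pdMulti a w) x = 0 := by
      have h1 : Integrable (jet T v a) (volume.restrict T) :=
        (hv.isH1_jet ham).memLp.integrable (by norm_num)
      have h2 : Integrable (pdMulti a w) (volume.restrict T) :=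
        (isH1_of_smooth hbT (ContDiff.pdMulti hws a)).memLp.integrable (by norm_num)
      have : ∫ x in T, (jet T v a - pdMulti a w) x =
          (∫ x in T, jet T v a x) - ∫ x in T, pdMulti a w x := integral_sub h1 h2
      rw [this, hwa a ham, sub_self]
    refine (IsTriangulated.poincare hθ hT hH1 hmean).trans ?_
    have h3 : ∀ i, ∫ x in T, ((fun i => jet T v (a + Pi.single i 1)) -
        (fun i => pd i (pdMulti a w)) : Fin 2 → Plane → ℝ) i x ^ 2 ≤
        (2 * poincareConst θ * Metric.diam T ^ 2) ^ j * sobolevSeminorm (m + 1) T v ^ 2 := by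
      intro i
      simp only [Pi.sub_apply, pd_pdMulti hws]
      exact ih (a + Pi.single i 1) (by rw [sum_add_single]; omega)
    have h4 := Finset.sum_le_sum fun i (_ : i ∈ (Finset.univ : Finset (Fin 2))) => h3 i
    rw [Finset.sum_const, Finset.card_univ, Fintype.card_fin, nsmul_eq_mul] at h4
    have hC := poincareConst_pos θ
    refine (mul_le_mul_of_nonneg_left h4 (by positivity)).trans (le_of_eq ?_)
    push_cast
    ring

/-- Inverse inequality for affine functions. -/
theorem slope_sq_mul_le (hT : IsTriangulated K T r) {l : Plane → ℝ} (hl : Continuous l) {γ : ℝ}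
    {i : Fin 2} (hγ : ∀ x t, l (x + t • stdVec i) = l x + γ * t) :
    γ ^ 2 * (r ^ 4 * Real.pi) ≤ 64 * ∫ x in T, l x ^ 2 := by
  have hr := hT.radius_pos
  obtain ⟨s, hs⟩ := hT.nonempty_elemTriangles
  obtain ⟨z, hz⟩ := hT.ball s hs
  have hball : Metric.ball z r ⊆ T :=
    (interior_maximal (Metric.ball_subset_closedBall.trans hz) Metric.isOpen_ball).trans hs.2
  -- Two discs of radius `r / 2`, one shifted by `r / 2`, lie in the inscribed disc, and `l` differs
  -- between them by `γ r / 2`. The bound `γ² (r/2)² · π (r/2)² ≤ 4 ∫ l²` explains the 64.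
  set τ : Plane := (r / 2) • stdVec i with hτ
  have hτn : ‖τ‖ = r / 2 := by
    rw [hτ, norm_smul, Real.norm_of_nonneg (by positivity)]; simp [stdVec]
  set B := Metric.ball z (r / 2) with hB
  have hBT : B ⊆ T := (Metric.ball_subset_ball (by linarith)).trans hball
  have hB'T : Metric.ball (z + τ) (r / 2) ⊆ T := by
    refine (Metric.ball_subset_ball' ?_).trans hball
    rw [dist_eq_norm, add_sub_cancel_left, hτn]; linarith
  have hL : ∀ {X : Set Plane}, X ⊆ T → ∀ {f : Plane → ℝ}, Continuous f →
      MemLp f 2 (volume.restrict X) := fun hX _ hf =>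
    memLp_of_continuous_of_isBounded (hT.isPolygon.isBounded.subset hX) hf
  have hmono : ∀ X ⊆ T, ∫ x in X, l x ^ 2 ≤ ∫ x in T, l x ^ 2 := fun X hX =>
    setIntegral_mono_set (hL subset_rfl hl).integrable_sq (Eventually.of_forall fun x => sq_nonneg _)
      hX.eventuallyLE
  have h1 := integral_sub_sq_le (hL hBT (hl.comp (continuous_add_const τ))) (hL hBT hl)
  have e1 : ∀ x, ((l ∘ fun y => y + τ) x - l x) ^ 2 = γ ^ 2 * (r / 2) ^ 2 := by
    intro x
    rw [Function.comp_apply, hτ, hγ]; ring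
  have e2 : ∫ x in B, (l ∘ fun y => y + τ) x ^ 2 = ∫ x in Metric.ball (z + τ) (r / 2), l x ^ 2 := by
    have := (measurePreserving_add_right (volume : Measure Plane) τ).setIntegral_preimage_emb
      (measurableEmbedding_addRight τ) (fun x => l x ^ 2) (Metric.ball (z + τ) (r / 2))
    rw [← this]
    congr 2
    ext x
    simp [hB, Metric.mem_ball, dist_eq_norm]
  simp only [e1] at h1
  rw [e2, integral_const, measureReal_restrict_apply_univ, volume_real_ball z (by positivity),
    smul_eq_mul] at h1
  have h2 := hmono _ hBT
  have h3 := hmono _ hB'T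
  nlinarith

/-- Poincaré inequalities for functions that are orthogonal to affine functions. -/
theorem integral_sq_le_of_orthogonal (hθ : 0 < θ) (hT : IsTriangulated K T (θ * Metric.diam T))
    {e : Plane → ℝ} {d : Fin 2 → Plane → ℝ} {dd : Fin 2 → Fin 2 → Plane → ℝ} (h0 : IsH1 T e d)
    (h1 : ∀ i, IsH1 T (d i) (dd i)) (horth : ∀ p ∈ polySpace 1, ∫ x in T, e x * p x = 0) :
    ∫ x in T, e x ^ 2 ≤ poincareConst θ ^ 2 * Metric.diam T ^ 4 * ∑ i, ∑ j, ∫ x in T, dd i j x ^ 2 ∧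
      ∀ i, ∫ x in T, d i x ^ 2 ≤ (2 * poincareConst θ + 128 * poincareConst θ ^ 2 / θ ^ 4) *
        Metric.diam T ^ 2 * ∑ i, ∑ j, ∫ x in T, dd i j x ^ 2 := by
  have hfin := hT.isFiniteMeasure
  have hbT := hT.isPolygon.isBounded
  have hV := hT.volume_real_pos
  set C := poincareConst θ with hCdef
  have hC : 0 < C := poincareConst_pos θ
  have hh : 0 < Metric.diam T := pos_of_mul_pos_right hT.radius_pos hθ.le
  set h := Metric.diam T with hhdef
  set H := ∑ i, ∑ j, ∫ x in T, dd i j x ^ 2 with hH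
  have hdd : ∀ i, 0 ≤ ∑ j, ∫ x in T, dd i j x ^ 2 := fun i =>
    Finset.sum_nonneg fun j _ => integral_sq_nonneg _
  have hH0 : 0 ≤ H := Finset.sum_nonneg fun i _ => hdd i
  -- `l` is the affine function with the mean gradient of `e` for which `e - l` has mean zero;
  -- Poincaré can then be applied twice to `e - l`. Since `e` is orthogonal to `l`, the resulting
  -- bound also holds for `e` and for `l` separately.
  set γ : Fin 2 → ℝ := fun i => (∫ x in T, d i x) / volume.real T with hγ
  set l₀ : Plane → ℝ := γ 0 • mono 1 0 + γ 1 • mono 0 1 with hl₀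
  have hl₀m : l₀ ∈ polySpace 1 := Submodule.add_mem _ (Submodule.smul_mem _ _ (mono_mem 1 0))
    (Submodule.smul_mem _ _ (mono_mem 0 1))
  set c := (∫ x in T, (e x - l₀ x)) / volume.real T with hc
  set l : Plane → ℝ := l₀ + c • mono 0 0 with hl
  have hlm : l ∈ polySpace 1 := Submodule.add_mem _ hl₀m
    (Submodule.smul_mem _ _ (polySpace_mono zero_le_one (mono_mem 0 0)))
  have hls := contDiff_of_mem_polySpace hlm
  have hlapp : ∀ x, l x = γ 0 * x 0 + γ 1 * x 1 + c := by
    intro x; simp [hl, hl₀, mono]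
  have hltr : ∀ i x t, l (x + t • stdVec i) = l x + γ i * t := by
    intro i x t
    rw [hlapp, hlapp]
    fin_cases i <;> simp <;> ring
  have hpd : ∀ i, pd i l = fun _ => γ i := by
    intro i
    ext x
    refine pd_eq_of_hasDerivAt (differentiable_of_smooth hls) ?_
    simp only [hltr]
    simpa using ((hasDerivAt_id (0 : ℝ)).const_mul (γ i)).const_add (l x)
  have hL : ∀ {f : Plane → ℝ}, Continuous f → MemLp f 2 (volume.restrict T) := fun hf =>
    memLp_of_continuous_of_isBounded hbT hf
  have hLl := hL hls.continuous
  -- Poincaré inequality for the gradient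
  have g1 : ∀ i, ∫ x in T, (d i x - γ i) ^ 2 ≤ C * h ^ 2 * ∑ j, ∫ x in T, dd i j x ^ 2 := by
    intro i
    have hs := (h1 i).sub (isH1_of_smooth hbT (contDiff_const (c := γ i)))
    have := IsTriangulated.poincare hθ hT hs (by
      simp only [Pi.sub_apply]
      rw [integral_sub ((h1 i).memLp.integrable (by norm_num)) (integrable_const _), integral_const,
        measureReal_restrict_apply_univ, smul_eq_mul, hγ]
      field_simp
      simp)
    simpa [pd_const] using this
  have g2 : ∑ i, ∫ x in T, (d i x - γ i) ^ 2 ≤ C * h ^ 2 * H := by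
    rw [hH, Finset.mul_sum]
    exact Finset.sum_le_sum fun i _ => g1 i
  -- Poincaré inequality for the function
  have g3 : ∫ x in T, (e x - l x) ^ 2 ≤ C ^ 2 * h ^ 4 * H := by
    have hs := h0.sub (isH1_of_smooth hbT hls)
    have := IsTriangulated.poincare hθ hT hs (by
      have i1 : Integrable (fun x => e x - l₀ x) (volume.restrict T) :=
        (h0.memLp.sub (hL (contDiff_of_mem_polySpace hl₀m).continuous)).integrable (by norm_num)
      have e1 : ∀ x, (e - l) x = (e x - l₀ x) - c := by
        intro x; simp [hl, mono]; ring
      simp only [e1]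
      rw [integral_sub i1 (integrable_const _), integral_const, measureReal_restrict_apply_univ,
        smul_eq_mul, hc]
      field_simp
      simp)
    simp only [Pi.sub_apply, hpd] at this
    refine this.trans ?_
    calc _ ≤ C * h ^ 2 * (C * h ^ 2 * H) := mul_le_mul_of_nonneg_left g2 (by positivity)
      _ = _ := by ring
  -- orthogonality
  have g4 : ∫ x in T, (e x - l x) ^ 2 = (∫ x in T, e x ^ 2) + ∫ x in T, l x ^ 2 := by
    have e1 : ∀ x, (e x - l x) ^ 2 = e x ^ 2 - 2 * (e x * l x) + l x ^ 2 := fun x => by ring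
    have i1 : Integrable (fun x => e x ^ 2) (volume.restrict T) := h0.memLp.integrable_sq
    have i2 : Integrable (fun x => 2 * (e x * l x)) (volume.restrict T) :=
      (integrable_mul_of_memLp h0.memLp hLl).const_mul 2
    have i12 : Integrable (fun x => e x ^ 2 - 2 * (e x * l x)) (volume.restrict T) := i1.sub i2
    simp only [e1]
    rw [integral_add i12 hLl.integrable_sq, integral_sub i1 i2, integral_const_mul, horth l hlm]
    ring
  have p1 := integral_sq_nonneg (μ := volume.restrict T) e
  have p2 := integral_sq_nonneg (μ := volume.restrict T) l
  refine ⟨by linarith, fun i => ?_⟩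
  have g5 := hT.slope_sq_mul_le hls.continuous (hltr i)
  have hvol : volume.real T ≤ h ^ 2 * Real.pi :=
    volume_real_le fun x hx y hy => hT.dist_le_diam (x := x) (y := y) hx hy
  -- The bound on `∫ l²` becomes one on the slope by the inverse inequality with `r = θ h`; the area
  -- of `T` is at most `π h²`.
  have g6 : γ i ^ 2 * volume.real T ≤ 64 * C ^ 2 / θ ^ 4 * h ^ 2 * H := by
    have h2 : γ i ^ 2 * volume.real T ≤ γ i ^ 2 * (h ^ 2 * Real.pi) :=
      mul_le_mul_of_nonneg_left hvol (sq_nonneg _)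
    have h3 : γ i ^ 2 * (h ^ 2 * Real.pi) * (θ ^ 4 * h ^ 2) ≤ 64 * (C ^ 2 * h ^ 4 * H) := by
      calc _ = γ i ^ 2 * ((θ * h) ^ 4 * Real.pi) := by ring
        _ ≤ 64 * ∫ x in T, l x ^ 2 := g5
        _ ≤ _ := by linarith
    have h4 : γ i ^ 2 * (h ^ 2 * Real.pi) ≤ 64 * (C ^ 2 * h ^ 4 * H) / (θ ^ 4 * h ^ 2) := by
      rw [le_div_iff₀ (by positivity)]; exact h3
    refine h2.trans (h4.trans (le_of_eq ?_))
    field_simp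
  have g7 := integral_add_sq_le ((h1 i).memLp.sub (memLp_const (γ i)))
    (memLp_const (μ := volume.restrict T) (p := 2) (γ i))
  simp only [Pi.sub_apply, sub_add_cancel, integral_const, measureReal_restrict_apply_univ,
    smul_eq_mul] at g7
  have g8 : ∫ x in T, (d i x - γ i) ^ 2 ≤ C * h ^ 2 * H :=
    (g1 i).trans (mul_le_mul_of_nonneg_left
      (Finset.single_le_sum (f := fun i => ∑ j, ∫ x in T, dd i j x ^ 2) (fun i _ => hdd i)
        (Finset.mem_univ i)) (by positivity))
  calc _ ≤ 2 * (C * h ^ 2 * H) + 2 * (64 * C ^ 2 / θ ^ 4 * h ^ 2 * H) := by linarith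
    _ = _ := by ring

end IsTriangulated

end

end HHO

/-! ### Projections, Galerkin orthogonality and the reconstruction of an interpolate. -/

namespace HHO

noncomputable section

open Filter Geometry
open scoped Topology ENNReal

/-! ### Orthogonal projections on finite-dimensional spaces of functions -/

/-- A linear form that vanishes on the kernel of a symmetric bilinear form is represented by it. -/
theorem exists_eq_of_symmetric {V : Type*} [AddCommGroup V] [Module ℝ V] [FiniteDimensional ℝ V]
    (B : V →ₗ[ℝ] V →ₗ[ℝ] ℝ) (hB : ∀ x y, B x y = B y x) (L : V →ₗ[ℝ] ℝ)
    (hL : ∀ z, B z = 0 → L z = 0) : ∃ x, B x = L := by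
  -- By symmetry, a vector annihilated by the range of `B` is in its kernel. In finite dimension the
  -- range is the annihilator of that space.
  have h1 : L ∈ (LinearMap.range B).dualCoannihilator.dualAnnihilator := by
    rw [Submodule.mem_dualAnnihilator]
    intro z hz
    rw [Submodule.mem_dualCoannihilator] at hz
    refine hL z (LinearMap.ext fun x => ?_)
    rw [hB]
    exact hz (B x) ⟨x, rfl⟩
  rw [Subspace.dualCoannihilator_dualAnnihilator_eq] at h1
  exact h1

section Projection

variable {μ : Measure Plane} {V : Submodule ℝ (Plane → ℝ)}

/-- The space consists of functions, not of classes, so the `L²` form may be degenerate on it.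
Elements of its kernel are null almost everywhere, and the functional defined by `f` vanishes on
them by Cauchy–Schwarz. -/
theorem exists_l2Proj [FiniteDimensional ℝ V] (hV : ∀ p ∈ V, MemLp p 2 μ) {f : Plane → ℝ}
    (hf : MemLp f 2 μ) : ∃ p : V, ∀ w ∈ V, ∫ x, ((p : Plane → ℝ) x - f x) * w x ∂μ = 0 := by
  have hi : ∀ p q : V, Integrable (fun x => (p : Plane → ℝ) x * (q : Plane → ℝ) x) μ := fun p q =>
    integrable_mul_of_memLp (hV p p.2) (hV q q.2)
  have hfi : ∀ q : V, Integrable (fun x => f x * (q : Plane → ℝ) x) μ := fun q =>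
    integrable_mul_of_memLp hf (hV q q.2)
  let B : V →ₗ[ℝ] V →ₗ[ℝ] ℝ := LinearMap.mk₂ ℝ
    (fun p q => ∫ x, (p : Plane → ℝ) x * (q : Plane → ℝ) x ∂μ)
    (fun p p' q => by
      rw [← integral_add (hi p q) (hi p' q)]
      exact integral_congr_ae (Eventually.of_forall fun x => add_mul _ _ _))
    (fun c p q => by
      rw [smul_eq_mul, ← integral_const_mul]
      exact integral_congr_ae (Eventually.of_forall fun x => mul_assoc _ _ _))
    (fun p q q' => by
      rw [← integral_add (hi p q) (hi p q')]
      exact integral_congr_ae (Eventually.of_forall fun x => mul_add _ _ _))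
    (fun c p q => by
      rw [smul_eq_mul, ← integral_const_mul]
      exact integral_congr_ae (Eventually.of_forall fun x => mul_left_comm _ _ _))
  let L : V →ₗ[ℝ] ℝ :=
    { toFun := fun q => ∫ x, f x * (q : Plane → ℝ) x ∂μ
      map_add' := fun q q' => by
        rw [← integral_add (hfi q) (hfi q')]
        exact integral_congr_ae (Eventually.of_forall fun x => mul_add _ _ _)
      map_smul' := fun c q => by
        rw [RingHom.id_apply, smul_eq_mul, ← integral_const_mul]
        exact integral_congr_ae (Eventually.of_forall fun x => mul_left_comm _ _ _) }
  obtain ⟨p, hp⟩ := exists_eq_of_symmetric B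
    (fun p q => integral_congr_ae (Eventually.of_forall fun x => mul_comm _ _)) L (by
      intro z hz
      have h1 : ∫ x, (z : Plane → ℝ) x ^ 2 ∂μ = 0 := by
        have : ∫ x, (z : Plane → ℝ) x * (z : Plane → ℝ) x ∂μ = 0 := DFunLike.congr_fun hz z
        simpa only [pow_two] using this
      have h2 := sq_integral_mul_le hf (hV z z.2)
      rw [h1, mul_zero] at h2
      exact pow_eq_zero_iff two_ne_zero |>.1 (le_antisymm h2 (sq_nonneg _)))
  refine ⟨p, fun w hw => ?_⟩
  have h1 : ∫ x, (p : Plane → ℝ) x * w x ∂μ = ∫ x, f x * w x ∂μ := DFunLike.congr_fun hp ⟨w, hw⟩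
  simp only [sub_mul]
  rw [integral_sub (hi p ⟨w, hw⟩) (hfi ⟨w, hw⟩), h1, sub_self]

theorem integral_l2Proj_mul [FiniteDimensional ℝ V] (hV : ∀ p ∈ V, MemLp p 2 μ) {f : Plane → ℝ}
    (hf : MemLp f 2 μ) {w : Plane → ℝ} (hw : w ∈ V) :
    ∫ x, (l2Proj μ V f : Plane → ℝ) x * w x ∂μ = ∫ x, f x * w x ∂μ := by
  have h1 : ∫ x, ((l2Proj μ V f : Plane → ℝ) x - f x) * w x ∂μ = 0 :=
    Classical.epsilon_spec (exists_l2Proj hV hf) w hw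
  simp only [sub_mul] at h1
  rw [integral_sub (integrable_mul_of_memLp (hV _ (l2Proj μ V f).2) (hV w hw))
    (integrable_mul_of_memLp hf (hV w hw))] at h1
  exact sub_eq_zero.1 h1

/-- The orthogonal projection is a contraction. -/
theorem integral_l2Proj_sq_le [FiniteDimensional ℝ V] (hV : ∀ p ∈ V, MemLp p 2 μ) {f g : Plane → ℝ}
    (hf : MemLp f 2 μ) (hg : MemLp g 2 μ) (h : ∀ w ∈ V, ∫ x, f x * w x ∂μ = ∫ x, g x * w x ∂μ) :
    ∫ x, (l2Proj μ V f : Plane → ℝ) x ^ 2 ∂μ ≤ ∫ x, g x ^ 2 ∂μ := by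
  set p : Plane → ℝ := (l2Proj μ V f : Plane → ℝ) with hp
  have hpV : p ∈ V := (l2Proj μ V f).2
  have h1 : ∫ x, p x ^ 2 ∂μ = ∫ x, g x * p x ∂μ := by
    rw [← h p hpV, ← integral_l2Proj_mul hV hf hpV]
    simp only [pow_two, hp]
  have h2 := sq_integral_mul_le hg (hV p hpV)
  rw [← h1] at h2
  have h3 := integral_sq_nonneg (μ := μ) p
  have h4 := integral_sq_nonneg (μ := μ) g
  by_contra! hlt
  nlinarith

/-- Against `V`, the functions `p - πf` and `p - f` have the same moments, so the contraction
property can be applied with the latter. This removes the projectors from the stabilization. -/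
theorem integral_l2Proj_sub_sq_le [FiniteDimensional ℝ V] (hV : ∀ p ∈ V, MemLp p 2 μ)
    {f p : Plane → ℝ} (hf : MemLp f 2 μ) (hp : MemLp p 2 μ) :
    ∫ x, (l2Proj μ V (p - (l2Proj μ V f : Plane → ℝ)) : Plane → ℝ) x ^ 2 ∂μ ≤
      ∫ x, (f x - p x) ^ 2 ∂μ := by
  have hfV := hV _ (l2Proj μ V f).2
  refine (integral_l2Proj_sq_le hV (hp.sub hfV) (hp.sub hf) fun w hw => ?_).trans (le_of_eq ?_)
  · simp only [Pi.sub_apply, sub_mul]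
    rw [integral_sub (integrable_mul_of_memLp hp (hV w hw)) (integrable_mul_of_memLp hfV (hV w hw)),
      integral_sub (integrable_mul_of_memLp hp (hV w hw)) (integrable_mul_of_memLp hf (hV w hw)),
      integral_l2Proj_mul hV hf hw]
  · refine integral_congr_ae (Eventually.of_forall fun x => ?_)
    simp only [Pi.sub_apply]
    ring

/-- The projection is a choice among the solutions of its defining relations; identical relations
give literally the same choice, as the closure condition of the reconstruction requires. -/
theorem l2Proj_congr {f g : Plane → ℝ} (h : ∀ p ∈ V, ∀ w ∈ V,
    ∫ x, (p x - f x) * w x ∂μ = ∫ x, (p x - g x) * w x ∂μ) : l2Proj μ V f = l2Proj μ V g := by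
  unfold l2Proj
  congr 1
  ext p
  refine forall₂_congr fun w hw => ?_
  rw [h p p.2 w hw]

end Projection

/-! ### Quadratic forms defined by fourth-order tensors -/

/-- `L²` product of matrix fields weighted by a fourth-order tensor. -/
def tensorForm (A : Tensor4) (μ : Measure Plane) (M N : Plane → Matrix (Fin 2) (Fin 2) ℝ) : ℝ :=
  ∫ x, frob (A.app (M x)) (N x) ∂μ

/-- The entries of `M` are square integrable. -/
def MemLpMatrix (μ : Measure Plane) (M : Plane → Matrix (Fin 2) (Fin 2) ℝ) : Prop :=
  ∀ i j, MemLp (fun x => M x i j) 2 μ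

section TensorForm

variable {μ : Measure Plane} {A : Tensor4} {M M' N : Plane → Matrix (Fin 2) (Fin 2) ℝ}

theorem Tensor4.app_add (A : Tensor4) (M N : Matrix (Fin 2) (Fin 2) ℝ) :
    A.app (M + N) = A.app M + A.app N := by
  ext i j
  simp [Tensor4.app, mul_add, Finset.sum_add_distrib]

theorem Tensor4.app_smul (A : Tensor4) (c : ℝ) (M : Matrix (Fin 2) (Fin 2) ℝ) :
    A.app (c • M) = c • A.app M := by
  ext i j
  simp [Tensor4.app]
  ring

theorem frob_add_left (M N P : Matrix (Fin 2) (Fin 2) ℝ) : frob (M + N) P = frob M P + frob N P := by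
  simp [frob, add_mul, Finset.sum_add_distrib]

theorem frob_smul_left (c : ℝ) (M N : Matrix (Fin 2) (Fin 2) ℝ) : frob (c • M) N = c * frob M N := by
  simp [frob]
  ring

theorem frob_self_nonneg (M : Matrix (Fin 2) (Fin 2) ℝ) : 0 ≤ frob M M :=
  Finset.sum_nonneg fun _ _ => Finset.sum_nonneg fun _ _ => mul_self_nonneg _

theorem frob_self_eq_zero {M : Matrix (Fin 2) (Fin 2) ℝ} (h : frob M M = 0) : M = 0 := by
  ext i j
  have h1 := (Finset.sum_eq_zero_iff_of_nonneg fun i _ =>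
    Finset.sum_nonneg fun j _ => mul_self_nonneg (M i j)).1 h i (Finset.mem_univ _)
  have h2 := (Finset.sum_eq_zero_iff_of_nonneg fun j _ => mul_self_nonneg (M i j)).1 h1 j
    (Finset.mem_univ _)
  simpa using h2

theorem Tensor4.Symmetric.frob_app_comm (hA : A.Symmetric) (M N : Matrix (Fin 2) (Fin 2) ℝ) :
    frob (A.app M) N = frob (A.app N) M := by
  have h : ∀ i j k l, A i j k l = A k l i j := fun i j k l => (hA i j k l).2
  simp only [frob, Tensor4.app, Matrix.of_apply, Fin.sum_univ_two]
  rw [h 0 1 0 0, h 1 0 0 0, h 1 1 0 0, h 1 0 0 1, h 1 1 0 1, h 1 1 1 0]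
  ring

theorem MemLpMatrix.app (hM : MemLpMatrix μ M) (A : Tensor4) :
    MemLpMatrix μ fun x => A.app (M x) := by
  intro i j
  change MemLp (fun x => ∑ k, ∑ l, A i j k l * M x k l) 2 μ
  exact memLp_finsetSum _ fun k _ => memLp_finsetSum _ fun l _ => (hM k l).const_mul _

theorem MemLpMatrix.add (hM : MemLpMatrix μ M) (hN : MemLpMatrix μ N) :
    MemLpMatrix μ fun x => M x + N x := fun i j => (hM i j).add (hN i j)

theorem MemLpMatrix.sub (hM : MemLpMatrix μ M) (hN : MemLpMatrix μ N) :
    MemLpMatrix μ fun x => M x - N x := fun i j => (hM i j).sub (hN i j)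

theorem MemLpMatrix.integrable_frob (hM : MemLpMatrix μ M) (hN : MemLpMatrix μ N) :
    Integrable (fun x => frob (M x) (N x)) μ :=
  integrable_finsetSum _ fun i _ => integrable_finsetSum _ fun j _ =>
    integrable_mul_of_memLp (hM i j) (hN i j)

theorem tensorForm_add_left (hM : MemLpMatrix μ M) (hM' : MemLpMatrix μ M')
    (hN : MemLpMatrix μ N) : tensorForm A μ (fun x => M x + M' x) N =
      tensorForm A μ M N + tensorForm A μ M' N := by
  simp only [tensorForm, Tensor4.app_add, frob_add_left]
  exact integral_add ((hM.app A).integrable_frob hN) ((hM'.app A).integrable_frob hN)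

theorem tensorForm_smul_left (c : ℝ) : tensorForm A μ (fun x => c • M x) N = c * tensorForm A μ M N := by
  simp only [tensorForm, Tensor4.app_smul, frob_smul_left]
  exact integral_const_mul _ _

theorem tensorForm_comm (hA : A.Symmetric) (M N : Plane → Matrix (Fin 2) (Fin 2) ℝ) :
    tensorForm A μ M N = tensorForm A μ N M := by
  simp only [tensorForm, hA.frob_app_comm]

variable {α β : ℝ}

theorem le_tensorForm (hA : A.Elliptic α β) (hM : MemLpMatrix μ M) (hs : ∀ x, (M x).IsSymm) :
    α * ∫ x, frob (M x) (M x) ∂μ ≤ tensorForm A μ M M := by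
  rw [← integral_const_mul]
  exact integral_mono ((hM.integrable_frob hM).const_mul α) ((hM.app A).integrable_frob hM)
    fun x => (hA _ (hs x)).1

theorem tensorForm_le (hA : A.Elliptic α β) (hM : MemLpMatrix μ M) (hs : ∀ x, (M x).IsSymm) :
    tensorForm A μ M M ≤ β * ∫ x, frob (M x) (M x) ∂μ := by
  rw [← integral_const_mul]
  exact integral_mono ((hM.app A).integrable_frob hM) ((hM.integrable_frob hM).const_mul β)
    fun x => (hA _ (hs x)).2

theorem integral_frob_self_nonneg : 0 ≤ ∫ x, frob (M x) (M x) ∂μ :=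
  integral_nonneg fun _ => frob_self_nonneg _

/-- Coercivity makes `M` vanish almost everywhere. This is the kernel condition for solving the
variational problem. -/
theorem tensorForm_eq_zero (hα : 0 < α) (hA : A.Elliptic α β) (hM : MemLpMatrix μ M)
    (hs : ∀ x, (M x).IsSymm) (h : tensorForm A μ M M = 0)
    (N : Plane → Matrix (Fin 2) (Fin 2) ℝ) : tensorForm A μ M N = 0 := by
  have h1 := le_tensorForm hA hM hs
  rw [h] at h1
  have h2 : ∫ x, frob (M x) (M x) ∂μ = 0 :=
    le_antisymm (by by_contra! h3; nlinarith) integral_frob_self_nonneg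
  rw [integral_eq_zero_iff_of_nonneg (fun _ => frob_self_nonneg _) (hM.integrable_frob hM)] at h2
  refine integral_eq_zero_of_ae ?_
  filter_upwards [h2] with x hx
  rw [frob_self_eq_zero hx]
  simp [frob, Tensor4.app]

/-- A Galerkin approximation is quasi-optimal. -/
theorem integral_frob_le_of_orthogonal (hα : 0 < α) (hs : A.Symmetric) (hA : A.Elliptic α β)
    {E Z : Plane → Matrix (Fin 2) (Fin 2) ℝ} (hE : MemLpMatrix μ E) (hZ : MemLpMatrix μ Z)
    (hEs : ∀ x, (E x).IsSymm) (hZs : ∀ x, (Z x).IsSymm) (h : tensorForm A μ E Z = 0) :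
    ∫ x, frob (E x) (E x) ∂μ ≤ β / α * ∫ x, frob (E x + Z x) (E x + Z x) ∂μ := by
  have hD := hE.add hZ
  have h1 := tensorForm_le hA hD fun x => (hEs x).add (hZs x)
  have h2 : tensorForm A μ (fun x => E x + Z x) (fun x => E x + Z x) =
      tensorForm A μ E E + tensorForm A μ Z Z := by
    rw [tensorForm_add_left hE hZ hD, tensorForm_comm hs E, tensorForm_comm hs Z,
      tensorForm_add_left hE hZ hE, tensorForm_add_left hE hZ hZ, tensorForm_comm hs Z E, h]
    ring
  have h3 := le_tensorForm hA hE hEs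
  have h4 := le_tensorForm hA hZ hZs
  have h5 : 0 ≤ α * ∫ x, frob (Z x) (Z x) ∂μ := mul_nonneg hα.le integral_frob_self_nonneg
  rw [div_mul_eq_mul_div, le_div_iff₀ hα]
  linarith

theorem Tensor4.Elliptic.nonneg (hα : 0 < α) (hA : A.Elliptic α β) : 0 ≤ β := by
  have h1 := hA 1 Matrix.isSymm_one
  have h2 : frob (1 : Matrix (Fin 2) (Fin 2) ℝ) 1 = 2 := by
    simp [frob, Fin.sum_univ_two]; norm_num
  rw [h2] at h1
  linarith

/-- Each eigenvalue is a Rayleigh quotient. Nonnegativity of `β` covers the default value of the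
supremum of an empty set. -/
theorem Tensor4.Elliptic.maxEigenvalue_le (hα : 0 < α) (hA : A.Elliptic α β) :
    A.maxEigenvalue ≤ β := by
  refine Real.sSup_le ?_ (hA.nonneg hα)
  rintro c ⟨M, hM, hM0, hc⟩
  have h1 := (hA M hM).2
  rw [hc, frob_smul_left] at h1
  refine le_of_mul_le_mul_right h1 (lt_of_le_of_ne (frob_self_nonneg M) fun h => hM0 ?_)
  exact frob_self_eq_zero h.symm

end TensorForm

end

end HHO

namespace HHO

noncomputable section

open Filter Geometry
open scoped Topology ENNReal

/-! ### Weak Hessians -/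

/-- The matrix of the weak second derivatives. -/
def weakHess (T : Set Plane) (v : Plane → ℝ) (x : Plane) : Matrix (Fin 2) (Fin 2) ℝ :=
  Matrix.of fun i j => jet T v (Pi.single i 1 + Pi.single j 1) x

theorem isSymm_weakHess (T : Set Plane) (v : Plane → ℝ) (x : Plane) : (weakHess T v x).IsSymm := by
  ext i j
  simp [weakHess, add_comm]

theorem isSymm_hess {w : Plane → ℝ} (hw : ContDiff ℝ ∞ w) (x : Plane) : (hess w x).IsSymm := by
  ext i j
  simp [hess, pd_comm hw i j]

theorem MemSobolev.of_le {m n : ℕ} {T : Set Plane} {v : Plane → ℝ} (hv : MemSobolev n T v)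
    (h : m ≤ n) : MemSobolev m T v := ⟨hv.1, fun a ha => hv.2 a (ha.trans h)⟩

theorem MemSobolev.isH1 {T : Set Plane} {v : Plane → ℝ} (hv : MemSobolev 2 T v) :
    IsH1 T v (weakGrad T v) := by
  have h : IsH1 T (jet T v 0) (fun i => jet T v (0 + Pi.single i 1)) :=
    MemSobolev.isH1_jet (m := 1) hv (by simp)
  simpa only [zero_add, jet_zero, jet_single] using h

theorem MemSobolev.isH1_weakGrad {T : Set Plane} {v : Plane → ℝ} (hv : MemSobolev 2 T v)
    (i : Fin 2) : IsH1 T (weakGrad T v i) (fun j x => weakHess T v x i j) := by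
  have h : IsH1 T (jet T v (Pi.single i 1)) (fun j => jet T v (Pi.single i 1 + Pi.single j 1)) :=
    MemSobolev.isH1_jet (m := 1) hv (by simp)
  rw [jet_single] at h
  exact h

theorem memLpMatrix_weakHess {T : Set Plane} {v : Plane → ℝ} (hv : MemSobolev 2 T v) :
    MemLpMatrix (volume.restrict T) (weakHess T v) := fun i => (hv.isH1_weakGrad i).memLp_grad

theorem memLpMatrix_hess {T : Set Plane} (hT : Bornology.IsBounded T) {w : Plane → ℝ}
    (hw : ContDiff ℝ ∞ w) : MemLpMatrix (volume.restrict T) (hess w) := fun i j =>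
  memLp_of_continuous_of_isBounded hT (contDiff_pd (contDiff_pd hw j) i).continuous

theorem hess_add {p q : Plane → ℝ} (hp : ContDiff ℝ ∞ p) (hq : ContDiff ℝ ∞ q) (x : Plane) :
    hess (p + q) x = hess p x + hess q x := by
  ext i j
  have h1 := pd_add (differentiable_of_smooth hp) (differentiable_of_smooth hq) j
  have h2 := pd_add (differentiable_of_smooth (contDiff_pd hp j))
    (differentiable_of_smooth (contDiff_pd hq j)) i
  simp [hess, h1, h2]

theorem hess_smul {p : Plane → ℝ} (hp : ContDiff ℝ ∞ p) (c : ℝ) (x : Plane) :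
    hess (c • p) x = c • hess p x := by
  ext i j
  have h1 := pd_const_smul (differentiable_of_smooth hp) c j
  have h2 := pd_const_smul (differentiable_of_smooth (contDiff_pd hp j)) c i
  simp [hess, h1, h2]

theorem hess_eq_zero {p : Plane → ℝ} (hp : p ∈ polySpace 1) (x : Plane) : hess p x = 0 := by
  ext i j
  have h1 : pd j p ∈ polySpace 0 := pd_mem_polySpace hp j
  have h2 : pd i (pd j p) = 0 := by
    have := pdMulti_eq_zero_of_mem (a := Pi.single i 1) h1 (by simp)
    rwa [pdMulti_single] at this
  simp [hess, h2]

/-! ### Moments of polynomials -/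

section Moment

variable {k : ℕ} {w : Plane → ℝ} (A : Tensor4)

theorem moment_mem_polySpace (hw : w ∈ polySpace (k + 2)) (i j : Fin 2) :
    (fun x => moment A w x i j) ∈ polySpace k := by
  have h : (fun x => moment A w x i j) = -∑ a, ∑ b, A i j a b • pd a (pd b w) := by
    ext x
    simp [moment, Tensor4.app, hess]
  rw [h]
  refine Submodule.neg_mem _ (Submodule.sum_mem _ fun a _ => Submodule.sum_mem _ fun b _ =>
    Submodule.smul_mem _ _ (pd_mem_polySpace (pd_mem_polySpace hw b) a))

/-- The degree actually drops further, but degree `k` is all that is needed for the projectors of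
degree `k` to be invisible. -/
theorem divMoment_mem_polySpace (hw : w ∈ polySpace (k + 2)) (i : Fin 2) :
    (fun x => divMoment A w x i) ∈ polySpace k := by
  have h : (fun x => divMoment A w x i) = ∑ j, pd j (fun y => moment A w y i j) := by
    ext x
    simp [divMoment]
  rw [h]
  exact Submodule.sum_mem _ fun j _ => pd_mem_polySpace_self (moment_mem_polySpace A hw i j) j

theorem divDivMoment_mem_polySpace (hw : w ∈ polySpace (k + 2)) :
    (fun x => divDivMoment A w x) ∈ polySpace k := by
  have h : (fun x => divDivMoment A w x) = ∑ i, pd i (fun y => divMoment A w y i) := by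
    ext x
    simp [divDivMoment]
  rw [h]
  exact Submodule.sum_mem _ fun i _ => pd_mem_polySpace_self (divMoment_mem_polySpace A hw i) i

end Moment

namespace IsTriangulated

variable {K : SimplicialComplex ℝ Plane} {T : Set Plane} {r : ℝ} (hT : IsTriangulated K T r)

include hT

/-! ### Projections on elements and faces -/

theorem memLp_of_mem_polySpace {l : ℕ} {p : Plane → ℝ} (hp : p ∈ polySpace l) :
    MemLp p 2 (volume.restrict T) :=
  memLp_of_continuous_of_isBounded hT.isPolygon.isBounded (contDiff_of_mem_polySpace hp).continuous

theorem integral_elemProj_mul {l : ℕ} {f q : Plane → ℝ} (hf : MemLp f 2 (volume.restrict T))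
    (hq : q ∈ polySpace l) :
    ∫ x in T, (elemProj l T f : Plane → ℝ) x * q x = ∫ x in T, f x * q x :=
  integral_l2Proj_mul (fun _ hp => hT.memLp_of_mem_polySpace hp) hf hq

variable {𝓕 : Finset (Set Plane)} (h𝓕 : IsBoundaryDecomposition T 𝓕)

include h𝓕

theorem memLp_of_mem_facePolySpace {F : Set Plane} (hF : F ∈ 𝓕) {l : ℕ} {p : Plane → ℝ}
    (hp : p ∈ facePolySpace l F) : MemLp p 2 (arcLength.restrict F) := by
  obtain ⟨q, hq, rfl⟩ := hp
  exact ((hT.memLp_frontier (contDiff_of_mem_polySpace hq).continuous).mono_measure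
    (Measure.restrict_mono (h𝓕.subset F hF) le_rfl)).indicator (h𝓕.measurableSet hF)

theorem integral_faceProj_mul {F : Set Plane} (hF : F ∈ 𝓕) {l : ℕ} {f q : Plane → ℝ}
    (hf : MemLp f 2 (arcLength.restrict (frontier T))) (hq : q ∈ polySpace l) :
    ∫ x in F, (faceProj l F f : Plane → ℝ) x * q x ∂arcLength = ∫ x in F, f x * q x ∂arcLength := by
  have h := integral_l2Proj_mul (fun _ hp => hT.memLp_of_mem_facePolySpace h𝓕 hF hp)
    (hf.mono_measure (Measure.restrict_mono (h𝓕.subset F hF) le_rfl))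
    (⟨q, hq, rfl⟩ : F.indicator q ∈ facePolySpace l F)
  have hFm := h𝓕.measurableSet hF
  have e : ∀ g : Plane → ℝ, ∫ x in F, g x * F.indicator q x ∂arcLength =
      ∫ x in F, g x * q x ∂arcLength := fun g =>
    setIntegral_congr_fun hFm fun x hx => by simp only [indicator_of_mem hx]
  rw [e, e] at h
  exact h

/-- Projections of boundary functions are invisible against polynomial fluxes. -/
theorem sum_integral_faceProj_mul {l : ℕ} {f : Fin 2 → Plane → ℝ} {q : Fin 2 → Fin 2 → Plane → ℝ}
    (hf : ∀ i, MemLp (f i) 2 (arcLength.restrict (frontier T)))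
    (hq : ∀ i j, q i j ∈ polySpace l) :
    ∑ F : 𝓕, ∫ x in (F : Set Plane), ∑ i, (faceProj l F (f i) : Plane → ℝ) x *
        ∑ j, q i j x * outwardNormal T x j ∂arcLength =
      ∑ i, ∑ j, ∫ x in frontier T, f i x * q i j x * outwardNormal T x j ∂arcLength := by
  have hi : ∀ i j, IntegrableOn (fun x => f i x * q i j x * outwardNormal T x j) (frontier T)
      arcLength := fun i j =>
    hT.integrable_boundary (hf i) j (contDiff_of_mem_polySpace (hq i j)).continuous
  have key : ∀ F : 𝓕, ∫ x in (F : Set Plane), ∑ i, (faceProj l F (f i) : Plane → ℝ) x *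
        ∑ j, q i j x * outwardNormal T x j ∂arcLength =
      ∑ i, ∑ j, ∫ x in (F : Set Plane), f i x * q i j x * outwardNormal T x j ∂arcLength := by
    rintro ⟨F, hF⟩
    obtain ⟨n, hn⟩ := h𝓕.exists_normal hT.isPolygon hF
    have hFm := h𝓕.measurableSet hF
    -- The normal is constant on a face, so the flux through it is a polynomial of degree at most
    -- `l`.
    have hqn : ∀ i, (∑ j, n j • q i j) ∈ polySpace l := fun i =>
      Submodule.sum_mem _ fun j _ => Submodule.smul_mem _ _ (hq i j)
    have hmono : arcLength.restrict F ≤ arcLength.restrict (frontier T) :=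
      Measure.restrict_mono (h𝓕.subset F hF) le_rfl
    have e1 : ∫ x in F, ∑ i, (faceProj l F (f i) : Plane → ℝ) x *
        ∑ j, q i j x * outwardNormal T x j ∂arcLength =
        ∫ x in F, ∑ i, (faceProj l F (f i) : Plane → ℝ) x * (∑ j, n j • q i j) x ∂arcLength := by
      refine setIntegral_congr_fun hFm fun x hx => ?_
      simp only [hn x hx, Finset.sum_apply, Pi.smul_apply, smul_eq_mul, mul_comm]
    rw [e1, integral_finsetSum _ fun i _ => integrable_mul_of_memLp
      (hT.memLp_of_mem_facePolySpace h𝓕 hF (faceProj l F (f i)).2)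
      ((hT.memLp_frontier (contDiff_of_mem_polySpace (hqn i)).continuous).mono_measure hmono)]
    refine Finset.sum_congr rfl fun i _ => ?_
    rw [hT.integral_faceProj_mul h𝓕 hF (hf i) (hqn i),
      ← integral_finsetSum _ fun j _ => (hi i j).mono_set (h𝓕.subset F hF)]
    refine setIntegral_congr_fun hFm fun x hx => ?_
    simp only [hn x hx, Finset.sum_apply, Pi.smul_apply, smul_eq_mul, Finset.mul_sum]
    exact Finset.sum_congr rfl fun j _ => by ring
  rw [Finset.sum_congr rfl fun F _ => key F, Finset.sum_comm]
  refine Finset.sum_congr rfl fun i _ => ?_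
  rw [Finset.sum_comm]
  exact Finset.sum_congr rfl fun j _ => h𝓕.sum_integral_eq (hi i j)

/-- Integration by parts in the right-hand side of the reconstruction of an interpolate. -/
theorem rhs_interp_eq {k : ℕ} {v w : Plane → ℝ} (hv : MemSobolev 2 T v)
    (hw : w ∈ polySpace (k + 2)) (A : Tensor4) :
    -(∫ x in T, elemPart (interp k T 𝓕 v) x * divDivMoment A w x)
      - ∑ F : 𝓕, ∫ x in (F : Set Plane),
          ∑ i, gradPart (interp k T 𝓕 v) F i x *
            ∑ j, moment A w x i j * outwardNormal T x j ∂arcLength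
      + ∑ F : 𝓕, ∫ x in (F : Set Plane),
          facePart (interp k T 𝓕 v) F x *
            ∑ i, divMoment A w x i * outwardNormal T x i ∂arcLength =
      tensorForm A (volume.restrict T) (hess w) (weakHess T v) := by
  have hM := moment_mem_polySpace A hw
  have hD := divMoment_mem_polySpace A hw
  have hMs := fun i j => contDiff_of_mem_polySpace (hM i j)
  have hDs := fun i => contDiff_of_mem_polySpace (hD i)
  have hL : ∀ {f : Plane → ℝ}, ContDiff ℝ ∞ f → MemLp f 2 (volume.restrict T) := fun hf =>
    memLp_of_continuous_of_isBounded hT.isPolygon.isBounded hf.continuous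
  obtain ⟨t0, g0, -⟩ := hT.trace_spec hv.isH1
  have t1 := fun i => (hT.trace_spec (hv.isH1_weakGrad i)).1
  have g1 := fun i => (hT.trace_spec (hv.isH1_weakGrad i)).2.1
  have e1 : ∫ x in T, elemPart (interp k T 𝓕 v) x * divDivMoment A w x =
      ∫ x in T, v x * divDivMoment A w x :=
    hT.integral_elemProj_mul hv.1 (divDivMoment_mem_polySpace A hw)
  have e2 : ∑ F : 𝓕, ∫ x in (F : Set Plane), ∑ i, gradPart (interp k T 𝓕 v) F i x *
      ∑ j, moment A w x i j * outwardNormal T x j ∂arcLength =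
      ∑ i, ∑ j, ∫ x in T, (weakGrad T v i x * pd j (fun y => moment A w y i j) x +
        weakHess T v x i j * moment A w x i j) := by
    refine (hT.sum_integral_faceProj_mul h𝓕 t1 hM).trans ?_
    exact Finset.sum_congr rfl fun i _ => Finset.sum_congr rfl fun j _ =>
      (g1 i j _ (hMs i j)).symm
  have e3 : ∑ F : 𝓕, ∫ x in (F : Set Plane), facePart (interp k T 𝓕 v) F x *
      ∑ i, divMoment A w x i * outwardNormal T x i ∂arcLength =
      ∑ i, ∫ x in T, (v x * pd i (fun y => divMoment A w y i) x +
        weakGrad T v i x * divMoment A w x i) := by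
    -- The scalar term is treated as a vector with second component zero, so that the same lemma
    -- serves.
    have h1 := hT.sum_integral_faceProj_mul h𝓕 (l := k)
      (f := fun i => if i = 0 then trace T v else 0)
      (q := fun i j => if i = 0 then fun x => divMoment A w x j else 0)
      (by intro i; split_ifs; exacts [t0, MemLp.zero])
      (by intro i j; split_ifs; exacts [hD j, Submodule.zero_mem _])
    have h2 : ∀ F : 𝓕, ∫ x in (F : Set Plane), facePart (interp k T 𝓕 v) F x *
        ∑ i, divMoment A w x i * outwardNormal T x i ∂arcLength =
        ∫ x in (F : Set Plane), ∑ i : Fin 2,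
          (faceProj k F (if i = 0 then trace T v else 0) : Plane → ℝ) x *
          ∑ j, (if i = 0 then fun x => divMoment A w x j else 0) x * outwardNormal T x j
            ∂arcLength := by
      intro F
      refine integral_congr_ae (Eventually.of_forall fun x => ?_)
      simp [Fin.sum_univ_two (fun i : Fin 2 => (faceProj k F (if i = 0 then trace T v else 0) :
        Plane → ℝ) x * _), facePart, interp]
    rw [Finset.sum_congr rfl fun F _ => h2 F, h1, Fin.sum_univ_two]
    simp only [if_true, one_ne_zero, if_false, Pi.zero_apply, zero_mul, integral_zero,
      Finset.sum_const_zero, add_zero]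
    exact Finset.sum_congr rfl fun i _ => (g0 i _ (hDs i)).symm
  have i1 : ∀ i j, Integrable (fun x => weakGrad T v i x * pd j (fun y => moment A w y i j) x)
      (volume.restrict T) := fun i j => integrable_mul_of_memLp (hv.isH1_weakGrad i).memLp
    (hL (contDiff_pd (hMs i j) j))
  have i2 : ∀ i j, Integrable (fun x => weakHess T v x i j * moment A w x i j)
      (volume.restrict T) := fun i j => integrable_mul_of_memLp ((hv.isH1_weakGrad i).memLp_grad j)
    (hL (hMs i j))
  have i3 : ∀ i, Integrable (fun x => v x * pd i (fun y => divMoment A w y i) x)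
      (volume.restrict T) := fun i => integrable_mul_of_memLp hv.1 (hL (contDiff_pd (hDs i) i))
  have i4 : ∀ i, Integrable (fun x => weakGrad T v i x * divMoment A w x i)
      (volume.restrict T) := fun i => integrable_mul_of_memLp (hv.isH1_weakGrad i).memLp (hL (hDs i))
  have e4 : ∫ x in T, v x * divDivMoment A w x =
      ∑ i, ∫ x in T, v x * pd i (fun y => divMoment A w y i) x := by
    rw [← integral_finsetSum _ fun i _ => i3 i]
    simp only [divDivMoment, Finset.mul_sum]
  have e5 : ∀ i, ∫ x in T, weakGrad T v i x * divMoment A w x i =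
      ∑ j, ∫ x in T, weakGrad T v i x * pd j (fun y => moment A w y i j) x := by
    intro i
    rw [← integral_finsetSum _ fun j _ => i1 i j]
    simp only [divMoment, Finset.mul_sum]
  have e6 : tensorForm A (volume.restrict T) (hess w) (weakHess T v) =
      -∑ i, ∑ j, ∫ x in T, weakHess T v x i j * moment A w x i j := by
    rw [Finset.sum_congr rfl fun i _ => (integral_finsetSum _ fun j _ => i2 i j).symm,
      ← integral_finsetSum _ fun i _ => integrable_finsetSum _ fun j _ => i2 i j, ← integral_neg]
    refine integral_congr_ae (Eventually.of_forall fun x => ?_)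
    simp only [frob, moment, Matrix.neg_apply, mul_neg, Finset.sum_neg_distrib, neg_neg,
      mul_comm]
  -- The terms with `div div M_w` cancel, as do those that pair the weak gradient with `div M_w`;
  -- only the weak Hessian against `-M_w = A ∇²w` is left.
  rw [e1, e2, e3, e4, e6, Finset.sum_congr rfl fun i _ => integral_add (i3 i) (i4 i),
    Finset.sum_congr rfl fun i _ => Finset.sum_congr rfl fun j _ => integral_add (i1 i j) (i2 i j)]
  simp only [Finset.sum_add_distrib, e5]
  ring

end IsTriangulated

end

end HHO

namespace HHO

noncomputable section

open Filter Geometry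
open scoped Topology ENNReal

theorem energy_eq_tensorForm (A : Tensor4) (T : Set Plane) (p w : Plane → ℝ) :
    energy A T p w = tensorForm A (volume.restrict T) (hess p) (hess w) := rfl

theorem integral_frob_self {μ : Measure Plane} {M : Plane → Matrix (Fin 2) (Fin 2) ℝ}
    (hM : MemLpMatrix μ M) : ∫ x, frob (M x) (M x) ∂μ = ∑ i, ∑ j, ∫ x, M x i j ^ 2 ∂μ := by
  rw [Finset.sum_congr rfl fun i _ => (integral_finsetSum _ fun j _ => (hM i j).integrable_sq).symm,
    ← integral_finsetSum _ fun i _ => integrable_finsetSum _ fun j _ => (hM i j).integrable_sq]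
  simp only [frob, pow_two]

namespace IsTriangulated

variable {K : SimplicialComplex ℝ Plane} {T : Set Plane} {r : ℝ}
  {𝓕 : Finset (Set Plane)} {A : Tensor4} {α β : ℝ} {k : ℕ} {v : Plane → ℝ}

/-! ### The reconstruction of an interpolate -/

/-- The energy is degenerate, for instance on affine functions, but an element of its kernel has
vanishing Hessian almost everywhere on `T`, so the right-hand side vanishes on it too. -/
theorem exists_energy_eq (hT : IsTriangulated K T r) (hα : 0 < α) (hs : A.Symmetric)
    (hA : A.Elliptic α β) {l : ℕ} {N : Plane → Matrix (Fin 2) (Fin 2) ℝ}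
    (hN : MemLpMatrix (volume.restrict T) N) : ∃ p ∈ polySpace l, ∀ w ∈ polySpace l,
      energy A T p w = tensorForm A (volume.restrict T) (hess w) N := by
  have hbT := hT.isPolygon.isBounded
  have hc : ∀ p : polySpace l, ContDiff ℝ ∞ (p : Plane → ℝ) := fun p =>
    contDiff_of_mem_polySpace p.2
  have hh : ∀ p : polySpace l, MemLpMatrix (volume.restrict T) (hess p) := fun p =>
    memLpMatrix_hess hbT (hc p)
  have ha : ∀ p q : polySpace l, hess ((p + q : polySpace l) : Plane → ℝ) =
      fun x => hess p x + hess q x := fun p q => funext (hess_add (hc p) (hc q))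
  have hm : ∀ (c : ℝ) (p : polySpace l), hess ((c • p : polySpace l) : Plane → ℝ) =
      fun x => c • hess p x := fun c p => funext (hess_smul (hc p) c)
  have hadd : ∀ (p q : polySpace l) {N : Plane → Matrix (Fin 2) (Fin 2) ℝ},
      MemLpMatrix (volume.restrict T) N →
      tensorForm A (volume.restrict T) (hess ((p + q : polySpace l) : Plane → ℝ)) N =
        tensorForm A (volume.restrict T) (hess p) N + tensorForm A (volume.restrict T) (hess q) N :=
    fun p q N hN => by rw [ha, tensorForm_add_left (hh p) (hh q) hN]
  have hsmul : ∀ (c : ℝ) (p : polySpace l) (N : Plane → Matrix (Fin 2) (Fin 2) ℝ),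
      tensorForm A (volume.restrict T) (hess ((c • p : polySpace l) : Plane → ℝ)) N =
        c * tensorForm A (volume.restrict T) (hess p) N :=
    fun c p N => by rw [hm, tensorForm_smul_left]
  let B : polySpace l →ₗ[ℝ] polySpace l →ₗ[ℝ] ℝ := LinearMap.mk₂ ℝ
    (fun p q => energy A T p q)
    (fun p p' q => hadd p p' (hh q))
    (fun c p q => hsmul c p _)
    (fun p q q' => by
      simp only [energy_eq_tensorForm, tensorForm_comm hs (hess p)]
      exact hadd q q' (hh p))
    (fun c p q => by
      simp only [energy_eq_tensorForm, tensorForm_comm hs (hess p)]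
      exact hsmul c q _)
  let L : polySpace l →ₗ[ℝ] ℝ :=
    { toFun := fun q => tensorForm A (volume.restrict T) (hess q) N
      map_add' := fun p q => hadd p q hN
      map_smul' := fun c q => hsmul c q _ }
  have hBe : ∀ p q, B p q = energy A T p q := fun p q => rfl
  obtain ⟨p, hp⟩ := exists_eq_of_symmetric B (fun p q => tensorForm_comm hs _ _) L
    fun z hz => by
      have hz' : energy A T z z = 0 := by rw [← hBe, hz]; rfl
      exact tensorForm_eq_zero hα hA (hh z) (isSymm_hess (hc z)) hz' N
  refine ⟨p, p.2, fun w hw => ?_⟩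
  have h1 : B p ⟨w, hw⟩ = L ⟨w, hw⟩ := by rw [hp]
  exact h1

/-- A solution `p₀` of the variational problem is corrected by the affine projection of `v - p₀`,
which leaves the Hessian unchanged. Because `k ≥ 1`, replacing `v` by its projection of degree `k`
does not alter the affine moments. Existence gives content to the choice made in `reconstruction`.
-/
theorem exists_isReconstruction (hT : IsTriangulated K T r) (h𝓕 : IsBoundaryDecomposition T 𝓕)
    (hα : 0 < α) (hs : A.Symmetric) (hA : A.Elliptic α β)
    (hk : 1 ≤ k) (hv : MemSobolev 2 T v) :
    ∃ p : polySpace (k + 2), IsReconstruction A T (interp k T 𝓕 v) p := by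
  obtain ⟨p₀, hp₀m, hp₀⟩ := hT.exists_energy_eq hα hs hA (l := k + 2) (memLpMatrix_weakHess hv)
  have hLp : ∀ {l : ℕ} {p : Plane → ℝ}, p ∈ polySpace l → MemLp p 2 (volume.restrict T) :=
    fun hp => hT.memLp_of_mem_polySpace hp
  obtain ⟨q, hq⟩ := exists_l2Proj (fun _ hp => hLp hp) (hv.1.sub (hLp hp₀m))
    (V := polySpace 1)
  have hq' : (q : Plane → ℝ) ∈ polySpace (k + 2) := polySpace_mono (by omega) q.2
  refine ⟨⟨p₀ + q, Submodule.add_mem _ hp₀m hq'⟩, fun w hw => ?_, ?_⟩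
  · rw [hT.rhs_interp_eq h𝓕 hv hw A, ← hp₀ w hw]
    have h1 : hess (p₀ + (q : Plane → ℝ)) = hess p₀ := by
      ext x : 1
      rw [hess_add (contDiff_of_mem_polySpace hp₀m) (contDiff_of_mem_polySpace q.2),
        hess_eq_zero q.2, add_zero]
    simp only [energy_eq_tensorForm, h1]
  · refine l2Proj_congr fun z hz w hw => ?_
    have hwL := hLp hw
    have hwk : w ∈ polySpace k := polySpace_mono hk hw
    have h1 : ∫ x in T, elemPart (interp k T 𝓕 v) x * w x = ∫ x in T, v x * w x :=
      hT.integral_elemProj_mul hv.1 hwk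
    have h2 := hq w hw
    have i0 : Integrable (fun x => z x * w x) (volume.restrict T) :=
      integrable_mul_of_memLp (hLp hz) hwL
    have i1 : Integrable (fun x => (q : Plane → ℝ) x * w x) (volume.restrict T) :=
      integrable_mul_of_memLp (hLp q.2) hwL
    have i2 : Integrable (fun x => v x * w x) (volume.restrict T) :=
      integrable_mul_of_memLp hv.1 hwL
    have i3 : Integrable (fun x => p₀ x * w x) (volume.restrict T) :=
      integrable_mul_of_memLp (hLp hp₀m) hwL
    have i4 : Integrable (fun x => elemPart (interp k T 𝓕 v) x * w x) (volume.restrict T) :=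
      integrable_mul_of_memLp (hLp (elemProj k T v).2) hwL
    have i23 : Integrable (fun x => v x * w x - p₀ x * w x) (volume.restrict T) :=
      i2.sub i3
    have i13 : Integrable (fun x => p₀ x * w x + (q : Plane → ℝ) x * w x)
      (volume.restrict T) := i3.add i1
    simp only [Pi.sub_apply, sub_mul] at h2
    rw [integral_sub i1 i23, integral_sub i2 i3] at h2
    simp only [Pi.add_apply, sub_mul, add_mul]
    rw [integral_sub i0 i13, integral_sub i0 i4, integral_add i3 i1, h1]
    linarith

/-- The later estimates use only these two orthogonality relations and the degree of `p`. The second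
one needs `k ≥ 1`. -/
theorem reconstruction_interp_spec (hT : IsTriangulated K T r) (h𝓕 : IsBoundaryDecomposition T 𝓕)
    (hα : 0 < α) (hs : A.Symmetric) (hA : A.Elliptic α β)
    (hk : 1 ≤ k) (hv : MemSobolev 2 T v) {p : Plane → ℝ}
    (hp : p = (reconstruction A T (interp k T 𝓕 v) : Plane → ℝ)) :
    (∀ w ∈ polySpace (k + 2),
      tensorForm A (volume.restrict T) (fun x => weakHess T v x - hess p x) (hess w) = 0) ∧
    ∀ q ∈ polySpace 1, ∫ x in T, (v - p) x * q x = 0 := by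
  have hbT := hT.isPolygon.isBounded
  have hpm : p ∈ polySpace (k + 2) := hp ▸ (reconstruction A T (interp k T 𝓕 v)).2
  obtain ⟨h1, h2⟩ : IsReconstruction A T (interp k T 𝓕 v)
    (reconstruction A T (interp k T 𝓕 v)) :=
    Classical.epsilon_spec (hT.exists_isReconstruction h𝓕 hα hs hA hk hv)
  rw [← hp] at h2
  refine ⟨fun w hw => ?_, fun q hq => ?_⟩
  · have hwc := memLpMatrix_hess hbT (contDiff_of_mem_polySpace hw)
    have hpc := memLpMatrix_hess hbT (contDiff_of_mem_polySpace hpm)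
    have h3 := h1 w hw
    rw [hT.rhs_interp_eq h𝓕 hv hw A, energy_eq_tensorForm, ← hp, tensorForm_comm hs (hess w)] at h3
    have h4 := tensorForm_add_left (A := A) ((memLpMatrix_weakHess hv).sub hpc) hpc hwc
    simp only [sub_add_cancel] at h4
    change tensorForm A (volume.restrict T) (weakHess T v) (hess w) = _ at h4
    linarith
  · have hpL := hT.memLp_of_mem_polySpace hpm
    have hqL := hT.memLp_of_mem_polySpace hq
    have e1 := hT.integral_elemProj_mul hpL hq
    have e2 := hT.integral_elemProj_mul (f := elemPart (interp k T 𝓕 v))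
      (hT.memLp_of_mem_polySpace (elemProj k T v).2) hq
    have e3 : ∫ x in T, elemPart (interp k T 𝓕 v) x * q x = ∫ x in T, v x * q x :=
      hT.integral_elemProj_mul hv.1 (polySpace_mono hk hq)
    rw [h2] at e1
    simp only [Pi.sub_apply, sub_mul]
    rw [integral_sub (integrable_mul_of_memLp hv.1 hqL) (integrable_mul_of_memLp hpL hqL)]
    linarith

variable {θ : ℝ}

/-- Approximation of second derivatives by the reconstruction of the interpolate. -/
theorem sum_integral_weakHess_sub_sq_le (hθ : 0 < θ) (hT : IsTriangulated K T (θ * Metric.diam T))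
    (hα : 0 < α) (hs : A.Symmetric) (hA : A.Elliptic α β) (hv : MemSobolev (k + 3) T v)
    {p : Plane → ℝ} (hp : p ∈ polySpace (k + 2)) (horth : ∀ w ∈ polySpace (k + 2),
      tensorForm A (volume.restrict T) (fun x => weakHess T v x - hess p x) (hess w) = 0) :
    ∑ i, ∑ j, ∫ x in T, (weakHess T v x i j - hess p x i j) ^ 2 ≤
      4 * (β / α) * (2 * poincareConst θ * Metric.diam T ^ 2) ^ (k + 1) *
        sobolevSeminorm (k + 3) T v ^ 2 := by
  have hbT := hT.isPolygon.isBounded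
  have hv2 : MemSobolev 2 T v := hv.of_le (by omega)
  obtain ⟨w, hw, hwv⟩ := hT.exists_poly_approx hθ (m := k + 2) hv
  have hpc := contDiff_of_mem_polySpace hp
  have hwc := contDiff_of_mem_polySpace hw
  -- The admissible direction `p - w` turns the Hessian error of `p` into that of the approximant
  -- `w`.
  have hz : p + (-1 : ℝ) • w ∈ polySpace (k + 2) :=
    Submodule.add_mem _ hp (Submodule.smul_mem _ _ hw)
  have hzc := contDiff_of_mem_polySpace hz
  have hE := (memLpMatrix_weakHess hv2).sub (memLpMatrix_hess hbT hpc)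
  have hD := (memLpMatrix_weakHess hv2).sub (memLpMatrix_hess hbT hwc)
  have h1 := integral_frob_le_of_orthogonal hα hs hA hE (memLpMatrix_hess hbT hzc)
    (fun x => (isSymm_weakHess T v x).sub (isSymm_hess hpc x)) (isSymm_hess hzc) (horth _ hz)
  have h2 : ∀ x, weakHess T v x - hess p x + hess (p + (-1 : ℝ) • w) x =
      weakHess T v x - hess w x := by
    intro x
    rw [hess_add hpc (contDiff_of_mem_polySpace (Submodule.smul_mem _ (-1 : ℝ) hw)), hess_smul hwc]
    module
  simp only [h2] at h1
  rw [integral_frob_self hE, integral_frob_self hD] at h1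
  have h3 : ∀ i j, ∫ x in T, (weakHess T v x - hess w x) i j ^ 2 ≤
      (2 * poincareConst θ * Metric.diam T ^ 2) ^ (k + 1) * sobolevSeminorm (k + 3) T v ^ 2 := by
    intro i j
    -- Second derivatives are `k + 1` orders below `k + 3`, which gives the power of `h`; the factor
    -- 4 counts the entries of the Hessian.
    have h4 := hwv (k + 1) (Pi.single i 1 + Pi.single j 1)
      (by rw [sum_add_single]; simp; ring)
    rw [← pdMulti_pd hwc, pdMulti_single] at h4
    exact h4
  have h4 : ∑ i, ∑ j, ∫ x in T, (weakHess T v x - hess w x) i j ^ 2 ≤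
      4 * ((2 * poincareConst θ * Metric.diam T ^ 2) ^ (k + 1) *
        sobolevSeminorm (k + 3) T v ^ 2) := by
    simp only [Fin.sum_univ_two]
    linarith [h3 0 0, h3 0 1, h3 1 0, h3 1 1]
  have hβ : 0 ≤ β / α := div_nonneg (hA.nonneg hα) hα.le
  calc _ ≤ _ := h1
    _ ≤ _ := mul_le_mul_of_nonneg_left h4 hβ
    _ = _ := by ring

end IsTriangulated

end

end HHO

/-! ### Estimate of the stabilization and conclusion. -/

namespace HHO

noncomputable section

open Filter Geometry
open scoped Topology ENNReal

namespace IsTriangulated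

variable {K : SimplicialComplex ℝ Plane} {T : Set Plane} {r θ : ℝ}
  {𝓕 : Finset (Set Plane)} {A : Tensor4} {α β : ℝ} {k : ℕ} {v : Plane → ℝ}

/-! ### Bounds on the stabilization -/

/-- With `r = θ h` the area count leaves at most `1 / θ²` triangles, with three edges each. -/
theorem card_boundaryEdges_le_const (hθ : 0 < θ) (hT : IsTriangulated K T (θ * Metric.diam T)) :
    (hT.finite_boundaryEdges.toFinset.card : ℝ) ≤ 3 / θ ^ 2 := by
  have hh : 0 < Metric.diam T := pos_of_mul_pos_right hT.radius_pos hθ.le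
  have h1 : (hT.finite_boundaryEdges.toFinset.card : ℝ) ≤
      3 * hT.finite_elemTriangles.toFinset.card := by exact_mod_cast hT.card_boundaryEdges_le
  have h2 := hT.card_mul_sq_le
  rw [le_div_iff₀ (by positivity)]
  have h3 : (hT.finite_elemTriangles.toFinset.card : ℝ) * θ ^ 2 ≤ 1 := by
    by_contra! h
    nlinarith [mul_lt_mul_of_pos_right h (pow_pos hh 2)]
  nlinarith [sq_nonneg θ]

theorem sum_integral_faceProj_sub_sq_le (hT : IsTriangulated K T r)
    (h𝓕 : IsBoundaryDecomposition T 𝓕) {l : ℕ} {f p : Plane → ℝ}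
    (hf : MemLp f 2 (arcLength.restrict (frontier T))) (hp : Continuous p) :
    ∑ F : 𝓕, ∫ x in (F : Set Plane),
      (faceProj l F (p - (faceProj l F f : Plane → ℝ)) : Plane → ℝ) x ^ 2 ∂arcLength ≤
      ∫ x in frontier T, (f x - p x) ^ 2 ∂arcLength := by
  have hpL := hT.memLp_frontier hp
  have hi : IntegrableOn (fun x => (f x - p x) ^ 2) (frontier T) arcLength :=
    (hf.sub hpL).integrable_sq
  rw [← h𝓕.sum_integral_eq hi]
  refine Finset.sum_le_sum fun F _ => ?_
  have hmono : arcLength.restrict (F : Set Plane) ≤ arcLength.restrict (frontier T) :=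
    Measure.restrict_mono (h𝓕.subset F F.2) le_rfl
  exact integral_l2Proj_sub_sq_le (fun _ hq => hT.memLp_of_mem_facePolySpace h𝓕 F.2 hq)
    (hf.mono_measure hmono) (hpL.mono_measure hmono)

/-- The stabilization of an interpolate is bounded by the approximation errors of the
reconstruction. -/
theorem stab_interp_le (hT : IsTriangulated K T r) (h𝓕 : IsBoundaryDecomposition T 𝓕)
    (hα : 0 < α) (hA : A.Elliptic α β) (hv : MemSobolev 2 T v) {p : Plane → ℝ}
    (hp : p = (reconstruction A T (interp k T 𝓕 v) : Plane → ℝ)) :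
    stab A T (interp k T 𝓕 v) (interp k T 𝓕 v) ≤
      β / Metric.diam T ^ 4 * (∫ x in T, (v x - p x) ^ 2) +
      β / Metric.diam T * (∑ i, ∫ x in frontier T,
        (trace T (weakGrad T v i) x - pd i p x) ^ 2 ∂arcLength) +
      β / Metric.diam T ^ 3 * ∫ x in frontier T, (trace T v x - p x) ^ 2 ∂arcLength := by
  have hpm : p ∈ polySpace (k + 2) := hp ▸ (reconstruction A T (interp k T 𝓕 v)).2
  have hps := contDiff_of_mem_polySpace hpm
  have hAβ := hA.maxEigenvalue_le hα
  have hβ := hA.nonneg hα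
  have hh : 0 ≤ Metric.diam T := Metric.diam_nonneg
  have hX := integral_l2Proj_sub_sq_le (V := polySpace k)
    (fun _ hq => hT.memLp_of_mem_polySpace hq) hv.1 (hT.memLp_of_mem_polySpace hpm)
  have hY := fun i => hT.sum_integral_faceProj_sub_sq_le h𝓕 (l := k)
    (hT.trace_spec (hv.isH1_weakGrad i)).1 (contDiff_pd hps i).continuous
  have hZ := hT.sum_integral_faceProj_sub_sq_le h𝓕 (l := k) (hT.trace_spec hv.isH1).1 hps.continuous
  have e : ∀ F : 𝓕, ∫ x in (F : Set Plane), ∑ i,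
        (faceProj k F (pd i p - (faceProj k F (trace T (weakGrad T v i)) : Plane → ℝ)) :
          Plane → ℝ) x *
        (faceProj k F (pd i p - (faceProj k F (trace T (weakGrad T v i)) : Plane → ℝ)) :
          Plane → ℝ) x ∂arcLength = ∑ i, ∫ x in (F : Set Plane),
        (faceProj k F (pd i p - (faceProj k F (trace T (weakGrad T v i)) : Plane → ℝ)) :
          Plane → ℝ) x ^ 2 ∂arcLength := by
    intro F
    have hi : ∀ i, MemLp (faceProj k F (pd i p - (faceProj k F (trace T (weakGrad T v i)) :
        Plane → ℝ)) : Plane → ℝ) 2 (arcLength.restrict F) := fun i =>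
      hT.memLp_of_mem_facePolySpace h𝓕 F.2 (faceProj k F _).2
    rw [← integral_finsetSum _ fun i _ => (hi i).integrable_sq]
    simp only [pow_two]
  have hY' := Finset.sum_le_sum fun i (_ : i ∈ (Finset.univ : Finset (Fin 2))) => hY i
  rw [Finset.sum_comm, ← Finset.sum_congr rfl fun F _ => e F] at hY'
  have hY0 : 0 ≤ ∑ F : 𝓕, ∫ x in (F : Set Plane), ∑ i,
        (faceProj k F (pd i p - (faceProj k F (trace T (weakGrad T v i)) : Plane → ℝ)) :
          Plane → ℝ) x *
        (faceProj k F (pd i p - (faceProj k F (trace T (weakGrad T v i)) : Plane → ℝ)) :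
          Plane → ℝ) x ∂arcLength := Finset.sum_nonneg fun F _ => integral_nonneg fun x =>
    Finset.sum_nonneg fun i _ => mul_self_nonneg _
  have hX0 : 0 ≤ ∫ x in T, (elemProj k T (p - (elemProj k T v : Plane → ℝ)) : Plane → ℝ) x ^ 2 :=
    integral_sq_nonneg _
  have hZ0 : 0 ≤ ∑ F : 𝓕, ∫ x in (F : Set Plane),
      (faceProj k F (p - (faceProj k F (trace T v) : Plane → ℝ)) : Plane → ℝ) x ^ 2 ∂arcLength :=
    Finset.sum_nonneg fun F _ => integral_sq_nonneg _
  have hst : stab A T (interp k T 𝓕 v) (interp k T 𝓕 v) =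
      A.maxEigenvalue / Metric.diam T ^ 4 *
        (∫ x in T, (elemProj k T (p - (elemProj k T v : Plane → ℝ)) : Plane → ℝ) x ^ 2) +
      A.maxEigenvalue / Metric.diam T * (∑ F : 𝓕, ∫ x in (F : Set Plane), ∑ i,
        (faceProj k F (pd i p - (faceProj k F (trace T (weakGrad T v i)) : Plane → ℝ)) :
          Plane → ℝ) x *
        (faceProj k F (pd i p - (faceProj k F (trace T (weakGrad T v i)) : Plane → ℝ)) :
          Plane → ℝ) x ∂arcLength) +
      A.maxEigenvalue / Metric.diam T ^ 3 * ∑ F : 𝓕, ∫ x in (F : Set Plane),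
        (faceProj k F (p - (faceProj k F (trace T v) : Plane → ℝ)) : Plane → ℝ) x ^ 2 ∂arcLength := by
    rw [hp]
    simp only [pow_two]
    rfl
  rw [hst]
  -- The integrals are nonnegative, so the eigenvalue may be replaced by `β` whatever its sign.
  have hd : ∀ n, A.maxEigenvalue / Metric.diam T ^ n ≤ β / Metric.diam T ^ n := fun n =>
    div_le_div_of_nonneg_right hAβ (pow_nonneg hh n)
  have hd0 : ∀ n, 0 ≤ β / Metric.diam T ^ n := fun n => div_nonneg hβ (pow_nonneg hh n)
  have hd1 := hd 1
  have hd01 := hd0 1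
  rw [pow_one] at hd1 hd01
  exact add_le_add (add_le_add (mul_le_mul (hd 4) hX hX0 (hd0 4)) (mul_le_mul hd1 hY' hY0 hd01))
    (mul_le_mul (hd 3) hZ hZ0 (hd0 3))

end IsTriangulated

/-- The constant in the bound of the errors of the reconstruction on the boundary and in the
interior of an element. -/
def errorConst (θ : ℝ) : ℝ :=
  poincareConst θ ^ 2 + 6 / θ ^ 3 * (3 * poincareConst θ ^ 2 +
    8 * (2 * poincareConst θ + 128 * poincareConst θ ^ 2 / θ ^ 4) + 2)

theorem errorConst_nonneg {θ : ℝ} (hθ : 0 < θ) : 0 ≤ errorConst θ := by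
  have := poincareConst_pos θ
  unfold errorConst
  positivity

namespace IsTriangulated

variable {K : SimplicialComplex ℝ Plane} {T : Set Plane} {r θ : ℝ}
  {𝓕 : Finset (Set Plane)} {A : Tensor4} {α β : ℝ} {k : ℕ} {v : Plane → ℝ}

/-- Orthogonality of the error to affine functions controls it and its gradient on `T`, and the
trace inequality controls them on the boundary. The weights in the stabilization are those for which
all powers of `h` cancel. -/
theorem stab_interp_le_hess (hθ : 0 < θ) (hT : IsTriangulated K T (θ * Metric.diam T))
    (h𝓕 : IsBoundaryDecomposition T 𝓕) (hα : 0 < α) (hs : A.Symmetric) (hA : A.Elliptic α β)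
    (hk : 1 ≤ k) (hv : MemSobolev 2 T v) {p : Plane → ℝ}
    (hp : p = (reconstruction A T (interp k T 𝓕 v) : Plane → ℝ)) :
    stab A T (interp k T 𝓕 v) (interp k T 𝓕 v) ≤
      β * errorConst θ * ∑ i, ∑ j, ∫ x in T, (weakHess T v x i j - hess p x i j) ^ 2 := by
  have hpm : p ∈ polySpace (k + 2) := hp ▸ (reconstruction A T (interp k T 𝓕 v)).2
  have hps := contDiff_of_mem_polySpace hpm
  have hbT := hT.isPolygon.isBounded
  have hβ := hA.nonneg hα
  have hh : 0 < Metric.diam T := pos_of_mul_pos_right hT.radius_pos hθ.le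
  have hst := hT.stab_interp_le h𝓕 hα hA hv hp
  have h0 := hv.isH1.sub (isH1_of_smooth hbT hps)
  have h1 := fun i => (hv.isH1_weakGrad i).sub (isH1_of_smooth hbT (contDiff_pd hps i))
  obtain ⟨b0, b1⟩ := hT.integral_sq_le_of_orthogonal hθ h0 h1
    (hT.reconstruction_interp_spec h𝓕 hα hs hA hk hv hp).2
  have t0 := (hT.trace_spec hv.isH1).2.2 p hps
  have t1 := fun i => (hT.trace_spec (hv.isH1_weakGrad i)).2.2 (pd i p) (contDiff_pd hps i)
  have hN := hT.card_boundaryEdges_le_const hθ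
  have hdd : ∀ i j x, weakHess T v x i j - pd j (pd i p) x = weakHess T v x i j - hess p x i j := by
    intro i j x
    rw [pd_comm hps j i]; rfl
  simp only [Pi.sub_apply, hdd] at b0 b1
  simp only [hdd] at t1
  set C := poincareConst θ
  set h := Metric.diam T
  set N : ℝ := (hT.finite_boundaryEdges.toFinset.card : ℝ)
  set D := 2 * C + 128 * C ^ 2 / θ ^ 4 with hD
  have hC : 0 < C := poincareConst_pos θ
  have hD0 : 0 < D := by positivity
  set H := ∑ i, ∑ j, ∫ x in T, (weakHess T v x i j - hess p x i j) ^ 2 with hH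
  have hHi0 : ∀ i, 0 ≤ ∑ j, ∫ x in T, (weakHess T v x i j - hess p x i j) ^ 2 := fun i =>
    Finset.sum_nonneg fun j _ => integral_sq_nonneg _
  have hHi : ∀ i, ∑ j, ∫ x in T, (weakHess T v x i j - hess p x i j) ^ 2 ≤ H := fun i =>
    Finset.single_le_sum (f := fun i => ∑ j, ∫ x in T, (weakHess T v x i j - hess p x i j) ^ 2)
      (fun i _ => hHi0 i) (Finset.mem_univ i)
  have hH0 : 0 ≤ H := Finset.sum_nonneg fun i _ => hHi0 i
  -- At most `3 / θ²` edges, each with trace constant `2 / (θ h)`.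
  have hbd : ∀ {X Y : ℝ}, X ≤ N * (2 / (θ * h) * Y) → 0 ≤ Y → X ≤ 6 / (θ ^ 3 * h) * Y := by
    intro X Y hX hY
    calc X ≤ N * (2 / (θ * h) * Y) := hX
      _ ≤ 3 / θ ^ 2 * (2 / (θ * h) * Y) := mul_le_mul_of_nonneg_right hN (by positivity)
      _ = _ := by field_simp; ring
  have b1s : ∑ i, ∫ x in T, (weakGrad T v i x - pd i p x) ^ 2 ≤ 2 * (D * h ^ 2 * H) := by
    rw [Fin.sum_univ_two]; linarith [b1 0, b1 1]
  have t0' : ∫ x in frontier T, (trace T v x - p x) ^ 2 ∂arcLength ≤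
      6 / (θ ^ 3 * h) * ((3 * C ^ 2 + 2 * D) * h ^ 4 * H) := by
    refine (hbd t0 ?_).trans (mul_le_mul_of_nonneg_left ?_ (by positivity))
    · exact add_nonneg (mul_nonneg (by norm_num) (integral_sq_nonneg _)) (mul_nonneg (by positivity)
        (Finset.sum_nonneg fun i _ => integral_sq_nonneg _))
    · nlinarith [mul_le_mul_of_nonneg_left b1s (sq_nonneg h)]
  have t1' : ∀ i, ∫ x in frontier T, (trace T (weakGrad T v i) x - pd i p x) ^ 2 ∂arcLength ≤
      6 / (θ ^ 3 * h) * ((3 * D + 1) * h ^ 2 * H) := by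
    intro i
    refine (hbd (t1 i) ?_).trans (mul_le_mul_of_nonneg_left ?_ (by positivity))
    · exact add_nonneg (mul_nonneg (by norm_num) (integral_sq_nonneg _))
        (mul_nonneg (by positivity) (hHi0 i))
    · nlinarith [mul_le_mul_of_nonneg_left (hHi i) (sq_nonneg h), b1 i]
  have t1s : ∑ i, ∫ x in frontier T, (trace T (weakGrad T v i) x - pd i p x) ^ 2 ∂arcLength ≤
      2 * (6 / (θ ^ 3 * h) * ((3 * D + 1) * h ^ 2 * H)) := by
    rw [Fin.sum_univ_two]; linarith [t1' 0, t1' 1]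
  calc _ ≤ _ := hst
    _ ≤ β / h ^ 4 * (C ^ 2 * h ^ 4 * H) +
        β / h * (2 * (6 / (θ ^ 3 * h) * ((3 * D + 1) * h ^ 2 * H))) +
        β / h ^ 3 * (6 / (θ ^ 3 * h) * ((3 * C ^ 2 + 2 * D) * h ^ 4 * H)) :=
      add_le_add (add_le_add (mul_le_mul_of_nonneg_left b0 (by positivity))
        (mul_le_mul_of_nonneg_left t1s (by positivity)))
        (mul_le_mul_of_nonneg_left t0' (by positivity))
    -- The two boundary terms contribute `2 (3 D + 1)` and `3 C² + 2 D`.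
    _ = β * (C ^ 2 + 6 / θ ^ 3 * (3 * C ^ 2 + 8 * D + 2)) * H := by
      field_simp
      ring
    _ = _ := by rw [errorConst]

end IsTriangulated

/-- The constant in the consistency estimate of the stabilization. -/
def consistencyConst (k : ℕ) (θ α β : ℝ) : ℝ :=
  β * errorConst θ * (4 * (β / α) * (2 * poincareConst θ) ^ (k + 1))

theorem IsTriangulated.sqrt_stab_interp_le {K : SimplicialComplex ℝ Plane} {T : Set Plane} {θ : ℝ}
    {𝓕 : Finset (Set Plane)} {A : Tensor4} {α β : ℝ} {k : ℕ} {v : Plane → ℝ} (hθ : 0 < θ)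
    (hT : IsTriangulated K T (θ * Metric.diam T)) (h𝓕 : IsBoundaryDecomposition T 𝓕) (hα : 0 < α)
    (hs : A.Symmetric) (hA : A.Elliptic α β) (hk : 1 ≤ k) (hv : MemSobolev (k + 3) T v) :
    √(stab A T (interp k T 𝓕 v) (interp k T 𝓕 v)) ≤
      √(consistencyConst k θ α β) * Metric.diam T ^ (k + 1) * sobolevSeminorm (k + 3) T v := by
  have hv2 : MemSobolev 2 T v := hv.of_le (by omega)
  have hS : 0 ≤ sobolevSeminorm (k + 3) T v := Finset.sum_nonneg fun _ _ => Real.sqrt_nonneg _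
  have h1 := hT.stab_interp_le_hess hθ h𝓕 hα hs hA hk hv2 (k := k) rfl
  have h2 := hT.sum_integral_weakHess_sub_sq_le hθ hα hs hA hv
    (reconstruction A T (interp k T 𝓕 v)).2
    (hT.reconstruction_interp_spec h𝓕 hα hs hA hk hv2 rfl).1
  have hβ := hA.nonneg hα
  have hE := errorConst_nonneg hθ
  have h3 : stab A T (interp k T 𝓕 v) (interp k T 𝓕 v) ≤
      consistencyConst k θ α β * (Metric.diam T ^ (k + 1) * sobolevSeminorm (k + 3) T v) ^ 2 := by
    refine h1.trans ((mul_le_mul_of_nonneg_left h2 (mul_nonneg hβ hE)).trans (le_of_eq ?_))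
    rw [consistencyConst, mul_pow (2 * poincareConst θ)]
    ring
  rw [mul_assoc]
  refine (Real.sqrt_le_sqrt h3).trans (le_of_eq ?_)
  rw [Real.sqrt_mul' _ (sq_nonneg _),
    Real.sqrt_sq (mul_nonneg (pow_nonneg Metric.diam_nonneg _) hS)]

end

end HHO

/-- Consistency of the stabilization. The constant depends only on the polynomial degree `k`, the
mesh regularity parameter `ϱ`, and the ellipticity bounds `α`, `β` of the material tensor field. -/
theorem proposition3p2 (k : ℕ) (hk : 1 ≤ k) (ϱ α β : ℝ) (hϱ : 0 < ϱ) (hα : 0 < α) :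
    ∃ C : ℝ, 0 < C ∧
      ∀ (Ω : Set HHO.Plane), HHO.IsPolygon Ω →
      ∀ (P : Finset (Set HHO.Plane)), HHO.IsPolygonalPartition Ω P →
      ∀ (𝔸 : HHO.Plane → HHO.Tensor4), HHO.IsMaterialField P 𝔸 α β →
      ∀ (𝓜 : HHO.PolyMesh Ω), 𝓜.Compliant P →
      ∀ (K : Geometry.SimplicialComplex ℝ HHO.Plane),
        HHO.IsMatchingSubmesh 𝓜 K → HHO.IsRegular 𝓜 K ϱ →
      ∀ T ∈ 𝓜.elems,
      ∀ A_T : HHO.Tensor4, (∀ x ∈ T, 𝔸 x = A_T) →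
      ∀ v : HHO.Plane → ℝ, HHO.MemSobolev (k + 3) T v →
        √(HHO.stab A_T T (HHO.interp k T (𝓜.facesOf T) v) (HHO.interp k T (𝓜.facesOf T) v)) ≤
          C * Metric.diam T ^ (k + 1) * HHO.sobolevSeminorm (k + 3) T v := by
  have hθ : 0 < ϱ ^ 2 / 2 := by positivity
  -- Adding 1 makes the constant positive even if the square root vanishes.
  refine ⟨√(HHO.consistencyConst k (ϱ ^ 2 / 2) α β) + 1, by positivity, ?_⟩
  intro Ω hΩ P _ 𝔸 h𝔸 𝓜 h𝓜 K hK hreg T hT A_T hA v hv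
  obtain ⟨D, ⟨hDP, hTD⟩, -⟩ := h𝓜 T hT
  obtain ⟨B, hBs, hBe, hB⟩ := h𝔸 D hDP
  obtain ⟨x, hx⟩ := (𝓜.elems_partition.isPolygon T hT).isConnected.nonempty
  -- Both tensors are the value of the field at a point of the nonempty element.
  have hBA : B = A_T := (hB x (hTD hx)).symm.trans (hA x hx)
  subst hBA
  refine (HHO.IsTriangulated.sqrt_stab_interp_le hθ (𝓜.isTriangulated hΩ hϱ hK hreg hT)
    (𝓜.isBoundaryDecomposition hΩ hT) hα hBs hBe hk hv).trans ?_
  have hS : 0 ≤ HHO.sobolevSeminorm (k + 3) T v :=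
    Finset.sum_nonneg fun _ _ => Real.sqrt_nonneg _
  have hh : 0 ≤ Metric.diam T ^ (k + 1) := pow_nonneg Metric.diam_nonneg _
  exact mul_le_mul_of_nonneg_right (mul_le_mul_of_nonneg_right (le_add_of_nonneg_right zero_le_one)
    hh) hS
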